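/- **Setting.** Let $d\in\{2,3\}$, let $\Omega\subset\mathbb R^d$ be a bounded polytopal domain and $\Gamma=\bigcup_{i}\Gamma_i\subset\Omega$ a finite union of pairwise disjoint, planar, polygonal, simply connected, relatively open fractures, with unit normal $\mathbf n^+$ pointing out of side $+$. Let $\mathbf U_0$ be the space of $\mathbf v\in H^1(\Omega\setminus\overline\Gamma)^d$ with zero trace on $\partial\Omega$, with one-sided traces $\gamma_\pm\mathbf v$ on $\Gamma$, jump $[\![\mathbf v]\!]=\gamma_+\mathbf v-\gamma_-\mathbf v$, and assume Korn's inequality on $\mathbf U_0$: $\|\mathbf v\|_{H^1}\le c_K\|\epsilon(\mathbf v)\|_{L^2}$. $H^{-1/2}(\Gamma)$ denotes the dual of $\prod_i H^{1/2}(\Gamma_i)$. Indices $n,\tau$ denote the components along and orthogonal to $\mathbf n^+$; $x^+=\max(0,x)$, $x^-=(-x)^+$. *Data.* $T>0$; for each phase $\alpha\in\{\mathrm{nw},\mathrm w\}$ and rock type $\mathrm{rt}\in\{m,f,+,-\}$: mobilities $\eta^\alpha_{\rm rt}$ continuous, non-decreasing on $[0,1]$ and bounded there between positive constants, with $\eta^{\rm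 w}_\pm(1)=\eta^{\rm w}_f(1)$, $\eta^{\rm nw}_\pm(0)=\eta^{\rm nw}_f(0)$; saturations $S^{\rm nw}_{\rm rt}$ non-decreasing, Lipschitz, with values in $[0,1]$, $S^{\rm w}_{\rm rt}=1-S^{\rm nw}_{\rm rt}$, and $U_{\rm rt}(p)=\int_0^p q\,(S^{\rm nw}_{\rm rt})'(q)\,dq$; $d_0:\Gamma\to(0,\infty)$ continuous and bounded; $E>0$, $-1<\nu<1/2$, $F\ge0$, and $\sigma(\mathbf u)=\frac{E}{1+\nu}\big(\epsilon(\mathbf u)+\frac{\nu}{1-2\nu}(\operatorname{div}\mathbf u)\mathbb I\big)$; $0\le\bar\phi^0\in L^\infty(\Omega)$; $\bar p^\alpha_{0,m}\in L^\infty(\Omega)$, $\bar p^\alpha_{0,f}\in L^\infty(\Gamma)$; $\mathbf f\in L^2(\Omega)^d$, $h^\alpha_m\in L^2((0,T)\times\Omega)$, $h^\alpha_f\in L^2((0,T)\times\Gamma)$; $\Lambda_f\in L^\infty(\Gamma)$ bounded below by a positive constant; $\mathbb K_m\in L^\infty(\Omega)^{d\times d}$ symmetric and uniformly elliptic. Moreover: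 $b\in[0,1]$, $M\in(0,+\infty]$ ($1/M=0$ if $M=\infty$), and $\bar d_{\mathfrak a},\bar\phi_{\mathfrak a}>0$ for $\mathfrak a\in\{+,-\}$. *Discretization.* A time grid $0=t_0<\dots<t_N=T$; sequences $(w^k)_{0\le k\le N}$ are identified with functions of time equal to $w^{k}$ on $(t_{k-1},t_{k}]$ and to $w^0$ at $0$, with $\delta_t w=(w^{k}-w^{k-1})/(t_{k}-t_{k-1})$ on $(t_{k-1},t_{k}]$. A finite-dimensional pressure space $X=X_m\times X_f$ with linear gradients $\nabla^m:X_m\to L^\infty(\Omega)^d$, $\nabla^f:X_f\to L^\infty(\Gamma)^{d-1}$, linear jumps $[\![\cdot]\!]^{\mathfrak a}:X\to L^\infty(\Gamma)$, reconstructions $\Pi^m,\Pi^f$ and traces $\mathbb T^{\mathfrak a}$ that are piecewise constant with respect to fixed bases of $X_m$, $X_f$ (nonlinear functions act coordinatewise in these bases), and interpolators $I^m:L^\infty(\Omega)\to X_m$, $I^f:L^\infty(\Gamma)\to X_f$, $J^m:L^2(\Omega)\to X_m$. The quantity $\|v\|_X=\|\nabla^m v_m\|_{L^2}+\|d_0^{3/2}\nabla^f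 v_f\|_{L^2}+\sum_{\mathfrak a}\|[\![v]\!]^{\mathfrak a}\|_{L^2}$ is a norm. The displacement space $X_{\mathbf u}\subset\mathbf U_0$ is a finite-dimensional subspace; multipliers are constant vectors $\boldsymbol\mu_\sigma\in\mathbb R^d$ on the faces $\sigma$ of a finite partition of $\Gamma$ that is conforming with $(\Gamma_i)_i$. Set $[\![\mathbf u]\!]_{n,\mathcal F}|_\sigma=\frac1{|\sigma|}\int_\sigma[\![\mathbf u]\!]_n$ and $C(\lambda_n)=\{\boldsymbol\mu:\mu_{n,\sigma}\ge0,\ |\boldsymbol\mu_{\tau,\sigma}|\le F\lambda_{n,\sigma}\ \forall\sigma\}$. *Gradient scheme.* Find $p^\alpha\in X^{N+1}$, $\mathbf u\in X_{\mathbf u}^{N+1}$ and $\boldsymbol\lambda^k\in C(\lambda^k_n)$, $0\le k\le N$, such that, for all $\alpha$, all $\varphi\in X^{N+1}$, $\mathbf v\in X_{\mathbf u}^{N+1}$ and $\boldsymbol\mu^k\in C(\lambda^k_n)$, $1\le k\le N$, $$\begin{aligned}&\int_0^T\!\!\int_\Omega\big(\delta_t(\phi_{\mathcal D}\Pi^ms^\alpha_m)\Pi^m\varphi_m+\eta^\alpha_m(\Pi^ms^\alpha_m)\mathbb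 K_m\nabla^mp^\alpha_m\cdot\nabla^m\varphi_m\big)+\int_0^T\!\!\int_\Gamma\delta_t(d_{f}\Pi^fs^\alpha_f)\Pi^f\varphi_f\\&+\int_0^T\!\!\int_\Gamma\eta^\alpha_f(\Pi^fs^\alpha_f)\tfrac{d_{f}^3}{12}\nabla^fp^\alpha_f\cdot\nabla^f\varphi_f+\sum_{\mathfrak a}\int_0^T\!\!\int_\Gamma\big(Q^\alpha_{f,\mathfrak a}[\![\varphi]\!]^{\mathfrak a}+\bar d_{\mathfrak a}\bar\phi_{\mathfrak a}\,\delta_t(\mathbb T^{\mathfrak a}s^\alpha_{\mathfrak a})\,\mathbb T^{\mathfrak a}\varphi_m\big)\\&=\int_0^T\!\!\int_\Omega h^\alpha_m\Pi^m\varphi_m+\int_0^T\!\!\int_\Gamma h^\alpha_f\Pi^f\varphi_f,\end{aligned}$$ $$\int_0^T\!\!\int_\Omega\big(\sigma(\mathbf u):\epsilon(\mathbf v)-b\,\Pi^mp^E_m\operatorname{div}\mathbf v\big)+\int_0^T\!\!\int_\Gamma\boldsymbol\lambda\cdot[\![\mathbf v]\!]+\int_0^T\!\!\int_\Gamma\Pi^fp^E_f[\![\mathbf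 v]\!]_{n,\mathcal F}=\int_0^T\!\!\int_\Omega\mathbf f\cdot\mathbf v,$$ $$\int_0^T\!\!\int_\Gamma(\mu_n-\lambda_n)[\![\mathbf u]\!]_n+\int_0^T\!\!\int_\Gamma(\boldsymbol\mu_\tau-\boldsymbol\lambda_\tau)\cdot\delta_t[\![\mathbf u]\!]_\tau\le0,$$ where, for $\omega\in\{m,f\}$, $p_{c,\omega}=p^{\rm nw}_\omega-p^{\rm w}_\omega$, $s^\alpha_\omega=S^\alpha_\omega(p_{c,\omega})$, $s^\alpha_{\mathfrak a}=S^\alpha_{\mathfrak a}(p_{c,m})$, $p^E_\omega=\sum_\alpha p^\alpha_\omega s^\alpha_\omega-U_\omega(p_{c,\omega})$, $Q^\alpha_{f,\mathfrak a}=\Lambda_f\big[\eta^\alpha_{\mathfrak a}(\mathbb T^{\mathfrak a}s^\alpha_{\mathfrak a})([\![p^\alpha]\!]^{\mathfrak a})^+-\eta^\alpha_f(\Pi^fs^\alpha_f)([\![p^\alpha]\!]^{\mathfrak a})^-\big]$, $\phi_{\mathcal D}=\Pi^mJ^m\bar\phi^0+b\operatorname{div}(\mathbf u-\mathbf u^0)+\frac1M\Pi^m(p^E_m-p^{E,0}_m)$,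 $d_{f}=d_0-[\![\mathbf u]\!]_{n,\mathcal F}$. The initial values are $p^{\alpha,0}_\omega=I^\omega\bar p^\alpha_{0,\omega}$, and $(\mathbf u^0,\boldsymbol\lambda^0)$ solves the mechanical equation and inequality without the time integral, with the initial equivalent pressures and with $[\![\mathbf u]\!]_\tau$ in place of $\delta_t[\![\mathbf u]\!]_\tau$. **Theorem (energy estimates).** Assume that, for some $c^\star,c_\star>0$, the coercivity $\|\Pi^mv_m\|_{L^2}+\|\Pi^fv_f\|_{L^2}+\sum_{\mathfrak a}\|\mathbb T^{\mathfrak a}v_m\|_{L^2}\le c^\star\|v\|_X$ holds for all $v\in X$, and the inf-sup condition $$\inf_{\boldsymbol\mu\ne0}\ \sup_{\mathbf v\in X_{\mathbf u}\setminus\{0\}}\frac{\int_\Gamma\boldsymbol\mu\cdot[\![\mathbf v]\!]}{\|\epsilon(\mathbf v)\|_{L^2(\Omega)}\|\boldsymbol\mu\|_{H^{-1/2}(\Gamma)}}\ge c_\star$$ holds. Let $C_0$ be a bound for the discrete initial data, that is, for $\|\Pi^mJ^m\bar\phi^0\|_{L^2(\Omega)}$, $\|\Pi^\omega p^{\alpha,0}_\omega\|_{L^2}$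 ($\omega\in\{m,f\}$), $\frac1{\sqrt M}\|\Pi^mp^{E,0}_m\|_{L^2(\Omega)}$ and $\bar d_{\mathfrak a}\bar\phi_{\mathfrak a}\|U_{\mathfrak a}(\mathbb T^{\mathfrak a}p^0_{c,m})\|_{L^1(\Gamma)}$. If $(p^\alpha,\mathbf u,\boldsymbol\lambda)$ solves the gradient scheme and $\phi_{\mathcal D}\ge\phi_{\min}\ge0$ on $[0,T]\times\Omega$ for a constant $\phi_{\min}$, then, for all $\alpha$ and $\mathfrak a$, the quantities $$\|\nabla^mp^\alpha_m\|_{L^2((0,T)\times\Omega)},\quad\|d_{f}^{3/2}\nabla^fp^\alpha_f\|_{L^2((0,T)\times\Gamma)},\quad\|[\![p^\alpha]\!]^{\mathfrak a}\|_{L^2((0,T)\times\Gamma)},$$ $$\bar d_{\mathfrak a}\bar\phi_{\mathfrak a}\|U_{\mathfrak a}(\mathbb T^{\mathfrak a}p_{c,m})\|_{L^\infty(0,T;L^1(\Gamma))},\quad\phi_{\min}\|U_m(\Pi^mp_{c,m})\|_{L^\infty(0,T;L^1(\Omega))},\quad\|d_0U_f(\Pi^fp_{c,f})\|_{L^\infty(0,T;L^1(\Gamma))},$$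 $$\tfrac1{\sqrt M}\|\Pi^mp^E_m\|_{L^\infty(0,T;L^2(\Omega))},\quad\|\epsilon(\mathbf u)\|_{L^\infty(0,T;L^2(\Omega))},\quad\|d_{f}\|_{L^\infty(0,T;L^4(\Gamma))},\quad\|\boldsymbol\lambda\|_{L^2(0,T;H^{-1/2}(\Gamma))}$$ are all at most a constant $C\ge0$ that depends only on $\Omega$, $\Gamma$, the data listed under *Data* other than $b,M,\bar d_{\mathfrak a},\bar\phi_{\mathfrak a}$, on $c^\star$, $c_\star$ and on $C_0$. In particular $C$ depends neither on the discretization nor on $\phi_{\min}$, and on $b,M,\bar d_{\mathfrak a},\bar\phi_{\mathfrak a}$ only through the bound $C_0$ on the initial data. -/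

import Mathlib

open MeasureTheory Set
open scoped ENNReal RealInnerProductSpace ContDiff

noncomputable section

namespace PoroMech

/-- Vectors of `ℝᵈ` with the Euclidean norm. -/
abbrev Vec (d : ℕ) := EuclideanSpace ℝ (Fin d)

/-- `d × d` tensors with the Frobenius norm; the inner product is the double contraction. -/
abbrev Tensor (d : ℕ) := EuclideanSpace ℝ (Fin d × Fin d)

/-- Non-wetting and wetting phases. -/
inductive Phase
  | nw
  | w

/-- The two sides of the fractures. -/
inductive Side
  | plus
  | minus

/-- Rock types: matrix, fracture, and damaged layer on either side of the fractures. -/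
inductive Rock
  | mat
  | frac
  | dam (a : Side)

/-- `+1` on the side `+`, `-1` on the side `-`. -/
def Side.sign : Side → ℝ
  | .plus => 1
  | .minus => -1

/-! ### Geometry -/

/-- An open set whose closure is a finite union of (compact convex) polytopes. -/
def IsPolytopal {d : ℕ} (S : Set (Vec d)) : Prop :=
  ∃ P : Finset (Finset (Vec d)), S = interior (⋃ p ∈ P, convexHull ℝ (p : Set (Vec d)))

/-- A bounded polytopal domain `Ω ⊂ ℝᵈ` with a finite network of planar fractures.
The `i`-th fracture is the image of the polygonal set `shape i ⊂ ℝᵈ⁻¹` under an affine isometry;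
`normal i` is the unit normal `n⁺`, which points out of the side `+`. -/
structure FractureNetwork (d : ℕ) where
  Ω : Set (Vec d)
  Ω_polytopal : IsPolytopal Ω
  Ω_connected : IsConnected Ω
  numFrac : ℕ
  shape : Fin numFrac → Set (Vec (d - 1))
  shape_polytopal : ∀ i, IsPolytopal (shape i)
  shape_simplyConnected : ∀ i, IsSimplyConnected (shape i)
  frame : Fin numFrac → (Vec (d - 1) →ᵃⁱ[ℝ] Vec d)
  normal : Fin numFrac → Vec d
  normal_unit : ∀ i, ‖normal i‖ = 1
  normal_orth : ∀ i x y, ⟪frame i x - frame i y, normal i⟫ = 0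
  frac_subset : ∀ i, frame i '' shape i ⊆ Ω
  frac_disjoint : ∀ i j, i ≠ j → Disjoint (frame i '' shape i) (frame j '' shape j)

namespace FractureNetwork

variable {d : ℕ} (G : FractureNetwork d)

/-- The `i`-th fracture `Γ_i`. -/
def frac (i : Fin G.numFrac) : Set (Vec d) := G.frame i '' G.shape i

/-- The fracture network `Γ`. -/
def Γ : Set (Vec d) := ⋃ i, G.frac i

/-- Lebesgue measure on `Ω`. -/
def vol : Measure (Vec d) := volume.restrict G.Ω

/-- The `(d-1)`-dimensional surface measure on `Γ`. -/
def surf : Measure (Vec d) := (μHE[d - 1]).restrict G.Γ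

/-- The unit normal field `n⁺` on `Γ`. -/
def nrm (x : Vec d) : Vec d := ∑ i, (G.frac i).indicator (fun _ => G.normal i) x

/-- Normal component on `Γ` of a vector field. -/
def nComp (w : Vec d → Vec d) (x : Vec d) : ℝ := ⟪w x, G.nrm x⟫

/-- Tangential component on `Γ` of a vector field. -/
def tComp (w : Vec d → Vec d) (x : Vec d) : Vec d := w x - G.nComp w x • G.nrm x

/-- The open half-space on the side `a` of the hyperplane that contains `Γ_i`. -/
def halfSpace (i : Fin G.numFrac) (a : Side) : Set (Vec d) :=
  {y | a.sign * ⟪y - G.frame i 0, G.normal i⟫ < 0}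

/-- A vector field on `Ω ∖ Γ̄` in `L²`, together with candidates for its gradient
(the entry `(i, j)` is `∂_j v_i`) and for its traces on the two sides of `Γ`. -/
abbrev Disp :=
  Lp (Vec d) 2 G.vol × Lp (Tensor d) 2 G.vol × (Side → Lp (Vec d) 2 G.surf)

variable {G}

/-- The field itself. -/
def val (v : G.Disp) (x : Vec d) : Vec d := v.1 x

/-- Its gradient. -/
def grad (v : G.Disp) (x : Vec d) : Tensor d := v.2.1 x

/-- Its trace on the side `a` of `Γ`. -/
def tr (a : Side) (v : G.Disp) (x : Vec d) : Vec d := v.2.2 a x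

/-- The symmetric gradient. -/
def strain (v : G.Disp) (x : Vec d) : Tensor d :=
  WithLp.toLp 2 fun ij => (grad v x (ij.1, ij.2) + grad v x (ij.2, ij.1)) / 2

/-- The divergence. -/
def dvg (v : G.Disp) (x : Vec d) : ℝ := ∑ i, grad v x (i, i)

/-- The jump across `Γ`. -/
def jmp (v : G.Disp) (x : Vec d) : Vec d := tr .plus v x - tr .minus v x

/-- The partial derivative `∂_j φ`. -/
def pd (j : Fin d) (φ : Vec d → ℝ) (x : Vec d) : ℝ := fderiv ℝ φ x (EuclideanSpace.single j 1)

variable (G)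

/-- The space `U₀` of the vector fields in `H¹(Ω ∖ Γ̄)ᵈ` with zero trace on `∂Ω`, each listed with
its weak gradient and its traces on both sides of `Γ`, which it determines uniquely.

The first condition is the integration by parts formula with test functions that vanish near `Γ̄`
but not necessarily near `∂Ω`: for test functions supported in `Ω ∖ Γ̄` it defines the weak
gradient, and for the other ones it says that the boundary term on `∂Ω` vanishes.
The second one is Green's formula on the side `a` of `Γ_i`, with test functions whose support
touches the closure of that half-space only in `Γ_i` and in the part of `Ω ∖ Γ̄` inside it:
it defines the trace. -/
def U₀ : Set G.Disp :=
  {v | (∀ φ : Vec d → ℝ, ContDiff ℝ ∞ φ → HasCompactSupport φ →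
          Disjoint (tsupport φ) (closure G.Γ) →
          ∀ i j, ∫ x, val v x i * pd j φ x ∂G.vol = -∫ x, grad v x (i, j) * φ x ∂G.vol) ∧
       (∀ (k : Fin G.numFrac) (a : Side) (φ : Vec d → ℝ), ContDiff ℝ ∞ φ → HasCompactSupport φ →
          tsupport φ ∩ closure (G.halfSpace k a) ⊆
            G.frac k ∪ (G.halfSpace k a ∩ (G.Ω \ closure G.Γ)) →
          ∀ i j,
            ∫ x in G.halfSpace k a, (val v x i * pd j φ x + grad v x (i, j) * φ x) ∂G.vol =
              a.sign * G.normal k j * ∫ x in G.frac k, tr a v x i * φ x ∂G.surf)}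

/-- Korn's inequality on `U₀`: the `L²` norm of the symmetric gradient controls the `H¹` norm. -/
def Korn : Prop :=
  ∃ c : ℝ, ∀ v ∈ G.U₀,
    eLpNorm (val v) 2 G.vol + eLpNorm (grad v) 2 G.vol
      ≤ ENNReal.ofReal c * eLpNorm (strain v) 2 G.vol

/-- Square of the norm of `H^{1/2}(Γ)ᵈ = ∏ᵢ H^{1/2}(Γ_i)ᵈ`, with the Sobolev--Slobodeckij norm
on each fracture. -/
def halfNormSq (v : Vec d → Vec d) : ℝ≥0∞ :=
  ∫⁻ x, ‖v x‖ₑ ^ 2 ∂G.surf +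
    ∑ i, ∫⁻ x in G.frac i, ∫⁻ y in G.frac i, ‖v x - v y‖ₑ ^ 2 / edist x y ^ d ∂G.surf ∂G.surf

/-- Norm of `H^{-1/2}(Γ)ᵈ`, the dual of `H^{1/2}(Γ)ᵈ`, for an `L²` function `μ`. -/
def negHalfNorm (μ : Vec d → Vec d) : ℝ≥0∞ :=
  ⨆ (v : Vec d → Vec d) (_ : AEStronglyMeasurable v G.surf) (_ : G.halfNormSq v ≤ 1),
    ENNReal.ofReal (∫ x, ⟪μ x, v x⟫ ∂G.surf)

end FractureNetwork

open FractureNetwork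

variable {d : ℕ}

/-! ### Data of the model -/

/-- The data of the model other than the Biot coefficient, the Biot modulus, and the width and
porosity of the damaged layers. -/
structure ModelData (G : FractureNetwork d) where
  /-- final time -/
  T : ℝ
  T_pos : 0 < T
  /-- phase mobilities, as functions of the saturation of the phase -/
  mob : Phase → Rock → ℝ → ℝ
  mob_cont : ∀ α rt, ContinuousOn (mob α rt) (Icc 0 1)
  mob_mono : ∀ α rt, MonotoneOn (mob α rt) (Icc 0 1)
  mob_bdd : ∀ α rt, ∃ m M : ℝ, 0 < m ∧ ∀ s ∈ Icc (0 : ℝ) 1, m ≤ mob α rt s ∧ mob α rt s ≤ M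
  mob_w : ∀ a, mob .w (.dam a) 1 = mob .w .frac 1
  mob_nw : ∀ a, mob .nw (.dam a) 0 = mob .nw .frac 0
  /-- non-wetting phase saturations, as functions of the capillary pressure -/
  Snw : Rock → ℝ → ℝ
  Snw_mono : ∀ rt, Monotone (Snw rt)
  Snw_lip : ∀ rt, ∃ L, LipschitzWith L (Snw rt)
  Snw_range : ∀ rt q, Snw rt q ∈ Icc (0 : ℝ) 1
  /-- fracture aperture at contact state -/
  d₀ : Vec d → ℝ
  d₀_cont : ContinuousOn d₀ G.Γ
  d₀_pos : ∀ x ∈ G.Γ, 0 < d₀ x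
  d₀_bdd : ∃ B : ℝ, ∀ x ∈ G.Γ, d₀ x ≤ B
  /-- Young's modulus -/
  E : ℝ
  E_pos : 0 < E
  /-- Poisson's ratio -/
  ν : ℝ
  ν_gt : -1 < ν
  ν_lt : ν < 1 / 2
  /-- friction coefficient -/
  F : ℝ
  F_nonneg : 0 ≤ F
  /-- initial matrix porosity -/
  φ₀ : Lp ℝ 2 G.vol
  φ₀_bdd : MemLp φ₀ ⊤ G.vol
  φ₀_nonneg : ∀ᵐ x ∂G.vol, 0 ≤ φ₀ x
  /-- initial pressures in the matrix and in the fractures -/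
  pm₀ : Phase → Lp ℝ ⊤ G.vol
  pf₀ : Phase → Lp ℝ ⊤ G.surf
  /-- source terms -/
  f : Lp (Vec d) 2 G.vol
  hm : Phase → ℝ × Vec d → ℝ
  hm_memLp : ∀ α, MemLp (hm α) 2 ((volume.restrict (Ioo 0 T)).prod G.vol)
  hf : Phase → ℝ × Vec d → ℝ
  hf_memLp : ∀ α, MemLp (hf α) 2 ((volume.restrict (Ioo 0 T)).prod G.surf)
  /-- normal fracture transmissibility -/
  Λ : Vec d → ℝ
  Λ_memLp : MemLp Λ ⊤ G.surf
  Λ_lower : ∃ c : ℝ, 0 < c ∧ ∀ᵐ x ∂G.surf, c ≤ Λ x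
  /-- matrix permeability tensor -/
  K : Vec d → (Vec d →L[ℝ] Vec d)
  K_memLp : MemLp K ⊤ G.vol
  K_symm : ∀ᵐ x ∂G.vol, ∀ ξ ζ, ⟪K x ξ, ζ⟫ = ⟪ξ, K x ζ⟫
  K_elliptic : ∃ c : ℝ, 0 < c ∧ ∀ᵐ x ∂G.vol, ∀ ξ, c * ‖ξ‖ ^ 2 ≤ ⟪K x ξ, ξ⟫

/-- The Biot coefficient, the Biot modulus (possibly infinite), and the width and the porosity of
the damaged layers. -/
structure BiotData where
  b : ℝ
  b_mem : b ∈ Icc (0 : ℝ) 1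
  M : ℝ≥0∞
  M_pos : 0 < M
  dDam : Side → ℝ
  dDam_pos : ∀ a, 0 < dDam a
  φDam : Side → ℝ
  φDam_pos : ∀ a, 0 < φDam a

/-- `1/M`, which is `0` for `M = ∞`. -/
def BiotData.invM (B : BiotData) : ℝ := (B.M⁻¹).toReal

namespace ModelData

variable {G : FractureNetwork d} (D : ModelData G)

/-- Saturation functions of the two phases. -/
def sat : Phase → Rock → ℝ → ℝ
  | .nw, rt, q => D.Snw rt q
  | .w, rt, q => 1 - D.Snw rt q

/-- Capillary energy density. -/
def U (rt : Rock) (p : ℝ) : ℝ := ∫ q in (0 : ℝ)..p, q * deriv (D.Snw rt) q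

/-- The linear elastic stress tensor. -/
def stress (v : G.Disp) (x : Vec d) : Tensor d :=
  (D.E / (1 + D.ν)) • (strain v x +
    (D.ν / (1 - 2 * D.ν) * dvg v x) • WithLp.toLp 2 fun ij => if ij.1 = ij.2 then (1 : ℝ) else 0)

end ModelData

/-! ### Discretizations -/

/-- The piecewise constant function with value `v i` on `cell i` (and `0` outside the cells). -/
def pwConst {n : ℕ} {E : Type} [AddCommMonoid E] (cell : Fin n → Set (Vec d)) (v : Fin n → E)
    (x : Vec d) : E := ∑ i, (cell i).indicator (fun _ => v i) x

/-- Gradient discretization of the flow. The spaces of discrete unknowns are identified with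
`ℝ^{nm}` and `ℝ^{nf}` through the bases in which the function and trace reconstructions are
piecewise constant. -/
structure FlowGD (G : FractureNetwork d) (d₀ : Vec d → ℝ) where
  nm : ℕ
  nf : ℕ
  /-- cells of the piecewise constant reconstructions -/
  cellM : Fin nm → Set (Vec d)
  cellM_meas : ∀ i, MeasurableSet (cellM i)
  cellM_subset : ∀ i, cellM i ⊆ G.Ω
  cellM_disjoint : Pairwise fun i j => Disjoint (cellM i) (cellM j)
  cellF : Fin nf → Set (Vec d)
  cellF_meas : ∀ i, MeasurableSet (cellF i)
  cellF_subset : ∀ i, cellF i ⊆ G.Γ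
  cellF_disjoint : Pairwise fun i j => Disjoint (cellF i) (cellF j)
  cellT : Side → Fin nm → Set (Vec d)
  cellT_meas : ∀ a i, MeasurableSet (cellT a i)
  cellT_subset : ∀ a i, cellT a i ⊆ G.Γ
  cellT_disjoint : ∀ a, Pairwise fun i j => Disjoint (cellT a i) (cellT a j)
  /-- discrete gradients -/
  gradM : (Fin nm → ℝ) →ₗ[ℝ] Lp (Vec d) ⊤ G.vol
  gradF : (Fin nf → ℝ) →ₗ[ℝ] Lp (Vec (d - 1)) ⊤ G.surf
  /-- jump reconstructions -/
  jump : Side → ((Fin nm → ℝ) × (Fin nf → ℝ)) →ₗ[ℝ] Lp ℝ ⊤ G.surf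
  /-- the natural seminorm is a norm -/
  norm_def : ∀ v : (Fin nm → ℝ) × (Fin nf → ℝ),
    eLpNorm (gradM v.1) 2 G.vol
      + eLpNorm (fun x => d₀ x ^ (3 / 2 : ℝ) • gradF v.2 x) 2 G.surf
      + (eLpNorm (jump .plus v) 2 G.surf + eLpNorm (jump .minus v) 2 G.surf) = 0 → v = 0
  /-- interpolators of the initial conditions -/
  interpM : Lp ℝ ⊤ G.vol → (Fin nm → ℝ)
  interpF : Lp ℝ ⊤ G.surf → (Fin nf → ℝ)
  interpφ : Lp ℝ 2 G.vol → (Fin nm → ℝ)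

namespace FlowGD

variable {G : FractureNetwork d} {d₀ : Vec d → ℝ} (P : FlowGD G d₀)

/-- The space of discrete pressures. -/
abbrev X := (Fin P.nm → ℝ) × (Fin P.nf → ℝ)

/-- Function reconstruction in the matrix. -/
def recM (v : Fin P.nm → ℝ) : Vec d → ℝ := pwConst P.cellM v

/-- Function reconstruction in the fractures. -/
def recF (v : Fin P.nf → ℝ) : Vec d → ℝ := pwConst P.cellF v

/-- Trace reconstruction on the side `a` of the fractures. -/
def recT (a : Side) (v : Fin P.nm → ℝ) : Vec d → ℝ := pwConst (P.cellT a) v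

/-- The discrete norm. -/
def normX (v : P.X) : ℝ≥0∞ :=
  eLpNorm (P.gradM v.1) 2 G.vol
    + eLpNorm (fun x => d₀ x ^ (3 / 2 : ℝ) • P.gradF v.2 x) 2 G.surf
    + (eLpNorm (P.jump .plus v) 2 G.surf + eLpNorm (P.jump .minus v) 2 G.surf)

/-- Coercivity with constant `c`. -/
def Coercive (c : ℝ) : Prop :=
  ∀ v : P.X,
    eLpNorm (P.recM v.1) 2 G.vol + eLpNorm (P.recF v.2) 2 G.surf
      + (eLpNorm (P.recT .plus v.1) 2 G.surf + eLpNorm (P.recT .minus v.1) 2 G.surf)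
      ≤ ENNReal.ofReal c * P.normX v

end FlowGD

/-- Discretization of the contact mechanics: a finite-dimensional subspace of `U₀` for the
displacement, and a partition of `Γ` (up to a null set), conforming with the planar fractures,
for the piecewise constant multipliers. -/
structure MechGD (G : FractureNetwork d) where
  X : Submodule ℝ G.Disp
  X_finite : FiniteDimensional ℝ X
  X_subset : (X : Set G.Disp) ⊆ G.U₀
  nF : ℕ
  face : Fin nF → Set (Vec d)
  owner : Fin nF → Fin G.numFrac
  face_meas : ∀ σ, MeasurableSet (face σ)
  face_subset : ∀ σ, face σ ⊆ G.frac (owner σ)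
  face_pos : ∀ σ, 0 < G.surf (face σ)
  face_disjoint : Pairwise fun σ σ' => Disjoint (face σ) (face σ')
  face_cover : G.surf (G.Γ \ ⋃ σ, face σ) = 0

namespace MechGD

variable {G : FractureNetwork d} (Q : MechGD G)

/-- The space of discrete multipliers. -/
abbrev Mult := Fin Q.nF → Vec d

/-- A discrete multiplier as a piecewise constant function on `Γ`. -/
def mfun (μ : Q.Mult) : Vec d → Vec d := pwConst Q.face μ

/-- Normal component of a multiplier on a face. -/
def mn (μ : Q.Mult) (σ : Fin Q.nF) : ℝ := ⟪μ σ, G.normal (Q.owner σ)⟫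

/-- Tangential component of a multiplier on a face. -/
def mt (μ : Q.Mult) (σ : Fin Q.nF) : Vec d := μ σ - Q.mn μ σ • G.normal (Q.owner σ)

/-- The discrete dual cone `C(λ_n)` for the friction coefficient `F`. -/
def cone (F : ℝ) (lam : Q.Mult) : Set Q.Mult :=
  {μ | ∀ σ, 0 ≤ Q.mn μ σ ∧ ‖Q.mt μ σ‖ ≤ F * Q.mn lam σ}

/-- Average displacement on the side `a` of a face. -/
def faceAvg (a : Side) (v : G.Disp) (σ : Fin Q.nF) : Vec d :=
  ⨍ x in Q.face σ, tr a v x ∂G.surf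

/-- Normal component of the average displacement jump on a face. -/
def jumpN (v : G.Disp) (σ : Fin Q.nF) : ℝ :=
  ⟪Q.faceAvg .plus v σ - Q.faceAvg .minus v σ, G.normal (Q.owner σ)⟫

/-- The global normal jump reconstruction. -/
def jumpNF (v : G.Disp) : Vec d → ℝ := pwConst Q.face (Q.jumpN v)

/-- The discrete inf-sup condition with constant `c`. -/
def InfSup (c : ℝ) : Prop :=
  (c : EReal) ≤ ⨅ μ : {μ : Q.Mult // μ ≠ 0}, ⨆ v : {v : Q.X // v ≠ 0},
    (((∫ x, ⟪Q.mfun μ.1 x, jmp (v.1 : G.Disp) x⟫ ∂G.surf) /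
      ((eLpNorm (strain (v.1 : G.Disp)) 2 G.vol).toReal *
        (G.negHalfNorm (Q.mfun μ.1)).toReal) : ℝ) : EReal)

end MechGD

/-- A discretization `0 = t_0 < ⋯ < t_N = T` of `[0, T]` (the values `t k` with `k > N` play no
role). -/
structure TimeGrid (T : ℝ) where
  N : ℕ
  t : ℕ → ℝ
  t_zero : t 0 = 0
  t_last : t N = T
  t_lt : ∀ k < N, t k < t (k + 1)

namespace TimeGrid

variable {T : ℝ} (τ : TimeGrid T)

/-- The index `k` with `s ∈ (t_{k-1}, t_k]`, and `0` for `s = 0`. -/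
def idx (s : ℝ) : ℕ := sInf {k | s ≤ τ.t k}

/-- The piecewise constant function of time with value `w k` on `(t_{k-1}, t_k]` and `w 0` at `0`
(of the sequence `w`, only the terms of index at most `N` are used on `[0, T]`). -/
def ext {E : Type*} (w : ℕ → E) (s : ℝ) : E := w (τ.idx s)

/-- Discrete time derivative: `(w k - w (k-1)) / (t_k - t_{k-1})` on `(t_{k-1}, t_k]`. -/
def δ {E : Type*} [AddCommGroup E] [Module ℝ E] (w : ℕ → E) (s : ℝ) : E :=
  (τ.t (τ.idx s) - τ.t (τ.idx s - 1))⁻¹ • (w (τ.idx s) - w (τ.idx s - 1))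

end TimeGrid

/-! ### The gradient scheme -/

section Scheme

variable {G : FractureNetwork d} (D : ModelData G) (B : BiotData)
  (P : FlowGD G D.d₀) (Q : MechGD G) (τ : TimeGrid D.T)

/-- Discrete matrix capillary pressure. -/
def pcM (p : Phase → P.X) : Fin P.nm → ℝ := fun i => (p .nw).1 i - (p .w).1 i

/-- Discrete fracture capillary pressure. -/
def pcF (p : Phase → P.X) : Fin P.nf → ℝ := fun i => (p .nw).2 i - (p .w).2 i

/-- Discrete matrix saturations `S^α_rt(p_{c,m})`, for the rock types `m` and `±`. -/
def satM (α : Phase) (rt : Rock) (p : Phase → P.X) : Fin P.nm → ℝ :=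
  fun i => D.sat α rt (pcM D P p i)

/-- Discrete fracture saturations. -/
def satF (α : Phase) (p : Phase → P.X) : Fin P.nf → ℝ :=
  fun i => D.sat α .frac (pcF D P p i)

/-- Discrete matrix equivalent pressure. -/
def pEM (p : Phase → P.X) : Fin P.nm → ℝ := fun i =>
  (p .nw).1 i * satM D P .nw .mat p i + (p .w).1 i * satM D P .w .mat p i
    - D.U .mat (pcM D P p i)

/-- Discrete fracture equivalent pressure. -/
def pEF (p : Phase → P.X) : Fin P.nf → ℝ := fun i =>
  (p .nw).2 i * satF D P .nw p i + (p .w).2 i * satF D P .w p i - D.U .frac (pcF D P p i)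

/-- Discrete porosity at time `t_k`. -/
def porosity (p : ℕ → Phase → P.X) (u : ℕ → Q.X) (k : ℕ) (x : Vec d) : ℝ :=
  P.recM (P.interpφ D.φ₀) x + B.b * dvg (u k - u 0 : G.Disp) x
    + B.invM * P.recM (pEM D P (p k) - pEM D P (p 0)) x

/-- Discrete fracture aperture for the displacement `v`. -/
def aperture (v : G.Disp) (x : Vec d) : ℝ := D.d₀ x - Q.jumpNF v x

/-- Matrix--fracture flux on the side `a`. -/
def mfFlux (α : Phase) (a : Side) (p : Phase → P.X) (x : Vec d) : ℝ :=
  D.Λ x * (D.mob α (.dam a) (P.recT a (satM D P α (.dam a) p) x) * max 0 (P.jump a (p α) x)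
    - D.mob α .frac (P.recF (satF D P α p) x) * max 0 (-P.jump a (p α) x))

/-- The matrix--fracture flux and damaged layer terms on the side `a` in the flow equation, at
time `s`, tested with `ψ`. -/
def sideTerm (p : ℕ → Phase → P.X) (α : Phase) (a : Side) (ψ : P.X) (s : ℝ) : ℝ :=
  ∫ x, (mfFlux D P α a (τ.ext p s) x * P.jump a ψ x
    + B.dDam a * B.φDam a * τ.δ (fun k => P.recT a (satM D P α (.dam a) (p k))) s x
        * P.recT a ψ.1 x) ∂G.surf

/-- The flow equation of the phase `α`. -/
def FlowEq (p : ℕ → Phase → P.X) (u : ℕ → Q.X) (α : Phase) : Prop :=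
  ∀ φ : ℕ → P.X,
    ∫ s in Ioc 0 D.T,
      ((∫ x, (τ.δ (fun k x => porosity D B P Q p u k x * P.recM (satM D P α .mat (p k)) x) s x
              * P.recM (τ.ext φ s).1 x
            + D.mob α .mat (P.recM (satM D P α .mat (τ.ext p s)) x)
              * ⟪D.K x (P.gradM (τ.ext p s α).1 x), P.gradM (τ.ext φ s).1 x⟫) ∂G.vol)
        + (∫ x, τ.δ (fun k x => aperture D Q (u k) x * P.recF (satF D P α (p k)) x) s x
              * P.recF (τ.ext φ s).2 x ∂G.surf)
        + (∫ x, D.mob α .frac (P.recF (satF D P α (τ.ext p s)) x)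
              * (aperture D Q (τ.ext u s).1 x ^ 3 / 12)
              * ⟪P.gradF (τ.ext p s α).2 x, P.gradF (τ.ext φ s).2 x⟫ ∂G.surf)
        + (sideTerm D B P τ p α .plus (τ.ext φ s) s + sideTerm D B P τ p α .minus (τ.ext φ s) s))
    = ∫ s in Ioc 0 D.T,
        ((∫ x, D.hm α (s, x) * P.recM (τ.ext φ s).1 x ∂G.vol)
          + ∫ x, D.hf α (s, x) * P.recF (τ.ext φ s).2 x ∂G.surf)

/-- Left-hand side of the mechanical equation at a given time, tested with `v`. -/
def mechForm (p : Phase → P.X) (u : G.Disp) (lam : Q.Mult) (v : G.Disp) : ℝ :=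
  (∫ x, (⟪D.stress u x, strain v x⟫ - B.b * P.recM (pEM D P p) x * dvg v x) ∂G.vol)
    + (∫ x, ⟪Q.mfun lam x, jmp v x⟫ ∂G.surf)
    + ∫ x, P.recF (pEF D P p) x * Q.jumpNF v x ∂G.surf

/-- The mechanical equation. -/
def MechEq (p : ℕ → Phase → P.X) (u : ℕ → Q.X) (lam : ℕ → Q.Mult) : Prop :=
  ∀ v : ℕ → Q.X,
    ∫ s in Ioc 0 D.T, mechForm D B P Q (τ.ext p s) (τ.ext u s).1 (τ.ext lam s) (τ.ext v s).1
      = ∫ s in Ioc 0 D.T, ∫ x, ⟪D.f x, val (τ.ext v s).1 x⟫ ∂G.vol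

/-- The variational inequality of frictional contact. -/
def ContactIneq (u : ℕ → Q.X) (lam : ℕ → Q.Mult) : Prop :=
  ∀ μ : ℕ → Q.Mult, (∀ k, 1 ≤ k → k ≤ τ.N → μ k ∈ Q.cone D.F (lam k)) →
    (∫ s in Ioc 0 D.T, ∫ x, G.nComp (Q.mfun (τ.ext μ s - τ.ext lam s)) x
        * G.nComp (jmp (τ.ext u s).1) x ∂G.surf)
      + (∫ s in Ioc 0 D.T, ∫ x, ⟪G.tComp (Q.mfun (τ.ext μ s - τ.ext lam s)) x,
          G.tComp (jmp (τ.δ u s).1) x⟫ ∂G.surf) ≤ 0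

/-- The stationary frictional contact problem satisfied by the initial displacement and
multiplier, with the equivalent pressures of the initial pressures `p`. -/
def InitialMech (p : Phase → P.X) (u : Q.X) (lam : Q.Mult) : Prop :=
  (∀ v : Q.X, mechForm D B P Q p u lam v = ∫ x, ⟪D.f x, val (v : G.Disp) x⟫ ∂G.vol) ∧
  ∀ μ ∈ Q.cone D.F lam,
    (∫ x, G.nComp (Q.mfun (μ - lam)) x * G.nComp (jmp (u : G.Disp)) x ∂G.surf)
      + (∫ x, ⟪G.tComp (Q.mfun (μ - lam)) x, G.tComp (jmp (u : G.Disp)) x⟫ ∂G.surf) ≤ 0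

/-- Solutions `(p, u, λ)` of the gradient scheme; sequences are indexed by the time steps, and
their terms of index greater than `N` play no role. -/
structure IsSolution (p : ℕ → Phase → P.X) (u : ℕ → Q.X) (lam : ℕ → Q.Mult) : Prop where
  lam_mem : ∀ k ≤ τ.N, lam k ∈ Q.cone D.F (lam k)
  flow : ∀ α, FlowEq D B P Q τ p u α
  mech : MechEq D B P Q τ p u lam
  contact : ContactIneq D Q τ u lam
  init_pM : ∀ α, (p 0 α).1 = P.interpM (D.pm₀ α)
  init_pF : ∀ α, (p 0 α).2 = P.interpF (D.pf₀ α)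
  init_mech : InitialMech D B P Q (p 0) (u 0) (lam 0)

/-- The discrete initial data are bounded by `C₀`: interpolated porosity and pressures, and the
parts of the initial energy in the equivalent pressure and in the damaged layers. Here `p` is the
initial discrete pressure. -/
def InitialBound (C₀ : ℝ) (p : Phase → P.X) : Prop :=
  eLpNorm (P.recM (P.interpφ D.φ₀)) 2 G.vol ≤ ENNReal.ofReal C₀ ∧
  (∀ α, eLpNorm (P.recM (p α).1) 2 G.vol ≤ ENNReal.ofReal C₀) ∧
  (∀ α, eLpNorm (P.recF (p α).2) 2 G.surf ≤ ENNReal.ofReal C₀) ∧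
  ENNReal.ofReal (√B.invM) * eLpNorm (P.recM (pEM D P p)) 2 G.vol ≤ ENNReal.ofReal C₀ ∧
  ∀ a, ENNReal.ofReal (B.dDam a * B.φDam a)
    * eLpNorm (fun x => D.U (.dam a) (P.recT a (pcM D P p) x)) 1 G.surf ≤ ENNReal.ofReal C₀

end Scheme

end PoroMech

end

open PoroMech PoroMech.FractureNetwork

noncomputable section

namespace PoroMech

open Filter Topology NNReal

/-! ### Sobolev inequality on bounded convex sets -/

section Haar

variable {E F : Type*} [NormedAddCommGroup E] [NormedSpace ℝ E] [MeasurableSpace E]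
  [BorelSpace E] [NormedAddCommGroup F] [NormedSpace ℝ F] [MeasurableSpace F] [BorelSpace F]

/-! The estimate is a discrete energy balance, which is short, on top of a trace inequality for
`U₀`, which takes the first half of the proof.

Energy. Over one time step the equation of each phase is tested with its own pressure and the
mechanical equation with the displacement increment. Since U(p) - U(q) ≤ p (S(p) - S(q)), there is a
discrete chain rule, `accumulation_lower_bound`: ∑_α p^α δ(φ s^α) ≥ δ(φ U(p_c)) + p^E δφ.
Substituting δφ = b div δu + δp^E / M in the matrix and δd_f = -δ⟦u⟧_n in the fractures
(`storeM_step`, `storeF_step`) produces exactly the coupling terms of the mechanical equation, and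
they cancel in `energy_step`. What remains is the increment of the capillary energies, of
|p^E|²/(2M) and of the elastic energy, the work of the contact forces, and the dissipation.

Suitable multipliers in the contact inequality (`contact_signs`) give ⟦u⟧_n ≤ 0 on each face, hence
d_f ≥ d₀, and a nonnegative contact work. The dissipation dominates the squared norm of the
pressures (`exists_dissPhase_le`); by d_f ≥ d₀ and coercivity it absorbs the sources. The body force
does not depend on time, so its work is part of the energy and is absorbed by the elastic energy. No
Gronwall argument is needed, and b, M and the layer parameters enter only through b ≤ 1 and the
initial energy. The initial displacement is bounded by testing the stationary contact problem with
itself, and the multipliers follow from the mechanical equation and the inf-sup condition.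

Traces. The aperture and the coupling terms require the strain to control the traces on Γ in L⁴.
Elements of `U₀` have traces defined only by Green's formula, so the inequality is proved directly.
The planes of the fractures cut a large ball into convex cells that avoid the closure of Γ. Thanks
to the zero trace on ∂Ω, the extension by zero is weakly differentiable on each cell, even where the
cell leaves Ω. Gagliardo's inequality for fourth powers, applied to mollifications on shrunken
cells, bounds the L⁴ norm on slices parallel to a fracture (`slice_weak`). Green's formula with thin
cutoffs bounds the trace by averages over such slices (`enorm_tr_le`), and Fatou's lemma passes to
the limit (`lintegral_tr_piece_le`). Korn's inequality then replaces the H¹ norm by the strain. -/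

theorem exists_map_affine_eq_smul [FiniteDimensional ℝ F] (μ : Measure E) [μ.IsAddHaarMeasure] (ν : Measure F)
    [ν.IsAddHaarMeasure] (L : E ≃L[ℝ] F) (c : F) :
    ∃ κ : ℝ≥0, κ ≠ 0 ∧ Measure.map (fun x => c + L x) μ = κ • ν := by
  have h1 : (μ.map L).IsAddHaarMeasure := L.isAddHaarMeasure_map μ
  refine ⟨Measure.addHaarScalarFactor (μ.map L) ν,
    (Measure.addHaarScalarFactor_pos_of_isAddHaarMeasure _ _).ne', ?_⟩
  rw [show (fun x => c + L x) = (fun y => c + y) ∘ L from rfl,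
    ← Measure.map_map (measurable_const_add c) L.continuous.measurable]
  rw [map_add_left_eq_self]
  exact Measure.isAddLeftInvariant_eq_smul _ _

theorem lintegral_comp_affine {μ : Measure E} {ν : Measure F} {L : E ≃L[ℝ] F} {c : F} {κ : ℝ≥0}
    (h : Measure.map (fun x => c + L x) μ = κ • ν) (f : F → ℝ≥0∞) :
    ∫⁻ x, f (c + L x) ∂μ = κ * ∫⁻ y, f y ∂ν := by
  have he : MeasurableEmbedding (fun x => c + L x) :=
    (measurableEmbedding_addLeft c).comp L.toHomeomorph.measurableEmbedding
  rw [← he.lintegral_map, h, lintegral_smul_measure]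
  rfl

end Haar

/-- The fundamental theorem of calculus compares h(a) with each h(t); averaging over t gives the
claim. -/
theorem enorm_le_lintegral_add_deriv {h : ℝ → ℝ} (hh : ContDiff ℝ 1 h) (a l : ℝ) :
    ENNReal.ofReal l * ‖h a‖ₑ ≤ (∫⁻ t in Ioc a (a + l), ‖h t‖ₑ) +
      ENNReal.ofReal l * ∫⁻ t in Ioc a (a + l), ‖deriv h t‖ₑ := by
  have key : ∀ t ∈ Ioc a (a + l),
      ‖h a‖ₑ ≤ ‖h t‖ₑ + ∫⁻ s in Ioc a (a + l), ‖deriv h s‖ₑ := by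
    intro t ht
    have hI : ∫ s in a..t, deriv h s = h t - h a := by
      apply intervalIntegral.integral_deriv_eq_sub
      · intro x _; exact (hh.differentiable one_ne_zero).differentiableAt
      · exact (hh.continuous_deriv le_rfl).intervalIntegrable _ _
    have h2 : ‖h t - h a‖ₑ ≤ ∫⁻ s in Ioc a (a + l), ‖deriv h s‖ₑ := by
      rw [← hI, intervalIntegral.integral_of_le ht.1.le]
      exact (enorm_integral_le_lintegral_enorm _).trans
        (lintegral_mono_set (Ioc_subset_Ioc_right ht.2))
    calc ‖h a‖ₑ = ‖h t - (h t - h a)‖ₑ := by congr 1; ring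
      _ ≤ ‖h t‖ₑ + ‖h t - h a‖ₑ := enorm_sub_le
      _ ≤ _ := by gcongr
  calc ENNReal.ofReal l * ‖h a‖ₑ = ∫⁻ _ in Ioc a (a + l), ‖h a‖ₑ := by
        simp [mul_comm]
    _ ≤ ∫⁻ t in Ioc a (a + l), (‖h t‖ₑ + ∫⁻ s in Ioc a (a + l), ‖deriv h s‖ₑ) :=
        setLIntegral_mono' measurableSet_Ioc key
    _ = _ := by
        rw [lintegral_add_right _ measurable_const]
        simp [mul_comm]

variable {d : ℕ}

theorem contDiff_comp_line {u : Vec d → ℝ} (hu : ContDiff ℝ 1 u) (x e : Vec d) :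
    ContDiff ℝ 1 (fun t : ℝ => u (x + t • e)) := by
  fun_prop

theorem deriv_comp_line {u : Vec d → ℝ} (hu : ContDiff ℝ 1 u) (x e : Vec d) (t : ℝ) :
    deriv (fun t : ℝ => u (x + t • e)) t = fderiv ℝ u (x + t • e) e := by
  have h1 : HasDerivAt (fun t : ℝ => x + t • e) e t := by
    simpa using ((hasDerivAt_id t).smul_const e).const_add x
  exact ((hu.differentiable one_ne_zero _).hasFDerivAt.comp_hasDerivAt t h1).deriv

theorem enorm_le_lintegral_segment {u : Vec d → ℝ} (hu : ContDiff ℝ 1 u) (x e : Vec d) (a l : ℝ) :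
    ENNReal.ofReal l * ‖u (x + a • e)‖ₑ ≤ (∫⁻ t in Ioc a (a + l), ‖u (x + t • e)‖ₑ) +
      ENNReal.ofReal l * ‖e‖ₑ * ∫⁻ t in Ioc a (a + l), ‖fderiv ℝ u (x + t • e)‖ₑ := by
  refine (enorm_le_lintegral_add_deriv (contDiff_comp_line hu x e) a l).trans ?_
  rw [mul_assoc, ← lintegral_const_mul' _ _ enorm_ne_top]
  gcongr with t
  rw [deriv_comp_line hu, mul_comm]
  exact ContinuousLinearMap.le_opENorm _ _

/-- Gagliardo's inequality on the points of a convex set from which one can move along every vector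
of a basis without leaving the set. -/
theorem gagliardo (hd : 2 ≤ d) (e : Fin d → Vec d) (he : LinearIndependent ℝ e) :
    ∃ K : ℝ≥0, ∀ Z : Set (Vec d), IsOpen Z → Convex ℝ Z → ∀ u : Vec d → ℝ, ContDiff ℝ 1 u →
      ∫⁻ x in {x ∈ Z | ∀ l, x + e l ∈ Z}, ‖u x‖ₑ ^ ((d : ℝ) / (d - 1)) ≤
        K * (∫⁻ x in Z, (‖u x‖ₑ + ‖fderiv ℝ u x‖ₑ)) ^ ((d : ℝ) / (d - 1)) := by
  have hd1 : (1 : ℝ) < d := by exact_mod_cast hd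
  have hd0 : 0 < (d : ℝ) - 1 := by linarith
  set p : ℝ := (d : ℝ) / (d - 1) with hp
  have hp0 : 0 ≤ p := by positivity
  have hcard : Fintype.card (Fin d) = Module.finrank ℝ (Vec d) := by simp
  have : Nonempty (Fin d) := ⟨⟨0, by omega⟩⟩
  let b := basisOfLinearIndependentOfCardEqFinrank he hcard
  let L : (Fin d → ℝ) ≃L[ℝ] Vec d := b.equivFun.symm.toContinuousLinearEquiv
  have hL : ∀ y, L y = ∑ l, y l • e l := by
    intro y
    simp [L, b, Module.Basis.equivFun_symm_apply]
  obtain ⟨κ, hκ0, hκ⟩ := exists_map_affine_eq_smul (volume : Measure (Fin d → ℝ))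
    (volume : Measure (Vec d)) L 0
  let M : ℝ≥0 := 1 + ∑ l, ‖e l‖₊
  have hM : ∀ l, ‖e l‖ₑ ≤ M := by
    intro l
    have : ‖e l‖₊ ≤ M := (Finset.single_le_sum (f := fun l => ‖e l‖₊) (fun _ _ => zero_le)
      (Finset.mem_univ l)).trans (le_add_of_nonneg_left zero_le_one)
    exact_mod_cast this
  have hM1 : (1 : ℝ≥0∞) ≤ M := by
    have : (1 : ℝ≥0) ≤ M := le_add_of_nonneg_right zero_le
    exact_mod_cast this
  refine ⟨κ⁻¹ * (κ * M) ^ p, fun Z hZo hZc u hu => ?_⟩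
  -- The cutoff turns integrals over segments inside Z into integrals over whole lines, as the
  -- grid-lines inequality requires.
  let G : Vec d → ℝ≥0∞ := Z.indicator fun x => ‖u x‖ₑ + ‖fderiv ℝ u x‖ₑ
  have hucont := hu.continuous
  have hu'cont := hu.continuous_fderiv one_ne_zero
  have hG : Measurable G := by
    apply Measurable.indicator _ hZo.measurableSet
    exact (hucont.enorm.add hu'cont.enorm).measurable
  have hS : MeasurableSet {x ∈ Z | ∀ l, x + e l ∈ Z} := by
    apply hZo.measurableSet.inter
    have : {x | ∀ l, x + e l ∈ Z} = ⋂ l, (fun x => x + e l) ⁻¹' Z := by ext; simp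
    change MeasurableSet {x | ∀ l, x + e l ∈ Z}
    rw [this]
    exact MeasurableSet.iInter fun l => (hZo.preimage (continuous_add_const (e l))).measurableSet
  have hpt : ∀ x ∈ {x ∈ Z | ∀ l, x + e l ∈ Z}, ∀ l,
      ‖u x‖ₑ ≤ M * ∫⁻ t : ℝ, G (x + t • e l) := by
    intro x hx l
    have h1 := enorm_le_lintegral_segment hu x (e l) 0 1
    simp only [ENNReal.ofReal_one, one_mul, zero_smul, add_zero, zero_add] at h1
    refine h1.trans ?_
    have hmem : ∀ t ∈ Ioc (0 : ℝ) 1, x + t • e l ∈ Z := fun t ht =>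
      hZc.add_smul_mem hx.1 (hx.2 l) ⟨ht.1.le, ht.2⟩
    calc (∫⁻ t in Ioc (0 : ℝ) 1, ‖u (x + t • e l)‖ₑ)
          + ‖e l‖ₑ * ∫⁻ t in Ioc (0 : ℝ) 1, ‖fderiv ℝ u (x + t • e l)‖ₑ
        ≤ M * (∫⁻ t in Ioc (0 : ℝ) 1, ‖u (x + t • e l)‖ₑ)
          + M * ∫⁻ t in Ioc (0 : ℝ) 1, ‖fderiv ℝ u (x + t • e l)‖ₑ := by
          gcongr
          · exact le_mul_of_one_le_left zero_le hM1
          · exact hM l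
      _ = M * ∫⁻ t in Ioc (0 : ℝ) 1, (‖u (x + t • e l)‖ₑ + ‖fderiv ℝ u (x + t • e l)‖ₑ) := by
          rw [← mul_add, lintegral_add_left]
          exact (hucont.comp (by fun_prop)).enorm.measurable
      _ = M * ∫⁻ t in Ioc (0 : ℝ) 1, G (x + t • e l) := by
          congr 1
          apply setLIntegral_congr_fun measurableSet_Ioc
          intro t ht
          simp only [G, indicator_of_mem (hmem t ht)]
      _ ≤ _ := by gcongr; exact Measure.restrict_le_self
  -- The grid-lines inequality in the coordinates of the basis e; p is the conjugate exponent of the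
  -- number d of coordinates.
  have hgrid := lintegral_prod_lintegral_pow_le (ι := Fin d) (fun _ => (volume : Measure ℝ))
    (p := p) (by
      rw [Fintype.card_fin, Real.holderConjugate_iff]
      refine ⟨hd1, ?_⟩
      rw [hp]; field_simp; ring) (f := fun y => G (L y)) (hG.comp L.continuous.measurable)
  rw [Fintype.card_fin] at hgrid
  have hupd : ∀ (y : Fin d → ℝ) (l : Fin d),
      ∫⁻ t, G (L (Function.update y l t)) = ∫⁻ t : ℝ, G (L y + t • e l) := by
    intro y l
    rw [← lintegral_add_left_eq_self (fun t => G (L (Function.update y l t))) (y l)]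
    congr 1; ext t; congr 1
    rw [hL, hL, ← Finset.add_sum_erase _ _ (Finset.mem_univ l),
      ← Finset.add_sum_erase (a := l) Finset.univ (fun l => y l • e l) (Finset.mem_univ l)]
    simp only [Function.update_self, add_smul]
    rw [add_right_comm]
    congr 1
    congr 1
    apply Finset.sum_congr rfl
    intro i hi
    rw [Function.update_of_ne (Finset.ne_of_mem_erase hi)]
  have hchange : ∀ H : Vec d → ℝ≥0∞, ∫⁻ y, H (L y) = κ * ∫⁻ x, H x := by
    intro H
    simpa using lintegral_comp_affine hκ H
  have hfin : (κ : ℝ≥0∞) * ∫⁻ x, ∏ l, (∫⁻ t : ℝ, G (x + t • e l)) ^ ((1 : ℝ) / (d - 1)) ≤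
      (κ * ∫⁻ x, G x) ^ p := by
    rw [← hchange, ← hchange]
    simp only [hupd] at hgrid
    exact hgrid
  have hκ' : (κ : ℝ≥0∞) ≠ 0 := by exact_mod_cast hκ0
  have hGint : ∫⁻ x, G x = ∫⁻ x in Z, (‖u x‖ₑ + ‖fderiv ℝ u x‖ₑ) :=
    lintegral_indicator hZo.measurableSet _
  calc ∫⁻ x in {x ∈ Z | ∀ l, x + e l ∈ Z}, ‖u x‖ₑ ^ p
      ≤ ∫⁻ x in {x ∈ Z | ∀ l, x + e l ∈ Z},
          M ^ p * ∏ l, (∫⁻ t : ℝ, G (x + t • e l)) ^ ((1 : ℝ) / (d - 1)) := by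
        apply setLIntegral_mono' hS
        intro x hx
        -- The exponent d/(d-1) is shared among the d directions, so that each factor can be bounded
        -- along its own line.
        have hsplit : ∀ a : ℝ≥0∞, a ^ p = ∏ _l : Fin d, a ^ ((1 : ℝ) / (d - 1)) := by
          intro a
          rw [Finset.prod_const, Finset.card_univ, Fintype.card_fin, ← ENNReal.rpow_mul_natCast]
          congr 1; rw [hp]; ring
        rw [hsplit, hsplit, ← Finset.prod_mul_distrib]
        apply Finset.prod_le_prod' 
        intro l _
        rw [← ENNReal.mul_rpow_of_nonneg _ _ (by positivity)]
        exact ENNReal.rpow_le_rpow (hpt x hx l) (by positivity)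
    _ ≤ ∫⁻ x, M ^ p * ∏ l, (∫⁻ t : ℝ, G (x + t • e l)) ^ ((1 : ℝ) / (d - 1)) :=
        setLIntegral_le_lintegral _ _
    _ = M ^ p * ∫⁻ x, ∏ l, (∫⁻ t : ℝ, G (x + t • e l)) ^ ((1 : ℝ) / (d - 1)) :=
        lintegral_const_mul' _ _ (ENNReal.rpow_ne_top_of_nonneg hp0 ENNReal.coe_ne_top)
    _ ≤ M ^ p * (κ⁻¹ * (κ * ∫⁻ x, G x) ^ p) := by
        gcongr
        rw [ENNReal.coe_inv hκ0, ← ENNReal.mul_le_iff_le_inv hκ' ENNReal.coe_ne_top]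
        exact hfin
    _ = _ := by
        rw [hGint, ENNReal.mul_rpow_of_nonneg _ _ hp0]
        rw [ENNReal.coe_mul, ENNReal.coe_rpow_of_nonneg _ hp0, ENNReal.coe_mul,
          ENNReal.mul_rpow_of_nonneg _ _ hp0]
        ring

/-- A nonempty open set spans the space, so a basis can be extracted from it. -/
theorem exists_linearIndependent_mem_of_isOpen {U : Set (Vec d)} (hU : IsOpen U)
    (hne : U.Nonempty) : ∃ e : Fin d → Vec d, LinearIndependent ℝ e ∧ ∀ l, e l ∈ U := by
  obtain ⟨b, hbU, hspan, hb⟩ := exists_linearIndependent ℝ U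
  have htop : Submodule.span ℝ U = ⊤ := by
    apply Submodule.eq_top_of_nonempty_interior'
    exact hne.mono ((interior_maximal Submodule.subset_span hU))
  let B : Module.Basis b ℝ (Vec d) := Module.Basis.mk hb (by simp [hspan, htop])
  have : Fintype b := FiniteDimensional.fintypeBasisIndex B
  have hc : Fintype.card b = d := by
    rw [← Module.finrank_eq_card_basis B]; simp
  let σ : Fin d ≃ b := (Fintype.equivFinOfCardEq hc).symm
  exact ⟨fun l => (σ l : Vec d), hb.comp _ σ.injective, fun l => hbU (σ l).2⟩

/-- Near a point x of the large ball, choose a basis close to y₀ - x: translating any nearby y ∈ Z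
by a basis vector lands in the ball around y₀, hence in Z. By compactness finitely many bases
suffice, and they depend only on y₀, r and R. The uniformity in Z matters because the inequality is
later applied to a sequence of shrunken cells. -/
theorem gagliardo_convex (hd : 2 ≤ d) (y₀ : Vec d) {r : ℝ} (hr : 0 < r) (R : ℝ) :
    ∃ K : ℝ≥0, ∀ Z : Set (Vec d), IsOpen Z → Convex ℝ Z → Metric.ball y₀ r ⊆ Z →
      Z ⊆ Metric.ball 0 R → ∀ u : Vec d → ℝ, ContDiff ℝ 1 u →
      ∫⁻ x in Z, ‖u x‖ₑ ^ ((d : ℝ) / (d - 1)) ≤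
        K * (∫⁻ x in Z, (‖u x‖ₑ + ‖fderiv ℝ u x‖ₑ)) ^ ((d : ℝ) / (d - 1)) := by
  have hbase : ∀ x : Vec d, ∃ e : Fin d → Vec d, LinearIndependent ℝ e ∧
      ∀ l, e l ∈ Metric.ball (y₀ - x) (r / 2) := fun x =>
    exists_linearIndependent_mem_of_isOpen Metric.isOpen_ball ⟨_, Metric.mem_ball_self (by positivity)⟩
  choose e he hemem using hbase
  choose K hK using fun x => gagliardo hd (e x) (he x)
  obtain ⟨s, -, hs⟩ := (isCompact_closedBall (0 : Vec d) R).elim_nhds_subcover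
    (fun x => Metric.ball x (r / 2)) (fun x _ => Metric.ball_mem_nhds x (by positivity))
  refine ⟨∑ x ∈ s, K x, fun Z hZo hZc hZr hZR u hu => ?_⟩
  have hcov : Z ⊆ ⋃ x ∈ s, {y ∈ Z | ∀ l, y + e x l ∈ Z} := by
    intro y hy
    obtain ⟨x, hx, hyx⟩ := mem_iUnion₂.1 (hs (Metric.ball_subset_closedBall (hZR hy)))
    refine mem_iUnion₂.2 ⟨x, hx, hy, fun l => hZr ?_⟩
    have h1 := hemem x l
    rw [Metric.mem_ball, dist_eq_norm] at h1 hyx ⊢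
    calc ‖y + e x l - y₀‖ = ‖(y - x) + (e x l - (y₀ - x))‖ := by congr 1; abel
      _ ≤ ‖y - x‖ + ‖e x l - (y₀ - x)‖ := norm_add_le _ _
      _ < r := by linarith
  calc ∫⁻ x in Z, ‖u x‖ₑ ^ ((d : ℝ) / (d - 1))
      ≤ ∫⁻ y in ⋃ x ∈ s, {y ∈ Z | ∀ l, y + e x l ∈ Z}, ‖u y‖ₑ ^ ((d : ℝ) / (d - 1)) :=
        lintegral_mono_set hcov
    _ ≤ ∑ x ∈ s, ∫⁻ y in {y ∈ Z | ∀ l, y + e x l ∈ Z}, ‖u y‖ₑ ^ ((d : ℝ) / (d - 1)) := by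
        rw [← Finset.sum_coe_sort]
        have := lintegral_iUnion_le (μ := volume)
          (fun x : s => {y ∈ Z | ∀ l, y + e x l ∈ Z}) (fun y => ‖u y‖ₑ ^ ((d : ℝ) / (d - 1)))
        rw [tsum_fintype] at this
        simpa only [iUnion_subtype] using this
    _ ≤ ∑ x ∈ s, K x * (∫⁻ x in Z, (‖u x‖ₑ + ‖fderiv ℝ u x‖ₑ)) ^ ((d : ℝ) / (d - 1)) :=
        Finset.sum_le_sum fun x _ => hK x Z hZo hZc u hu
    _ = _ := by rw [← Finset.sum_mul]; push_cast; rfl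

/-- Gagliardo's inequality for f⁴. For d = 3 its exponent 3/2 produces the sixth power directly; for
d = 2 it produces the eighth power, which is lowered to the sixth on a bounded set. Both dimensions
then share the same right-hand side. -/
theorem lintegral_pow_six_le_of_convex (hd : d = 2 ∨ d = 3) (y₀ : Vec d) {r : ℝ} (hr : 0 < r)
    (R : ℝ) : ∃ K : ℝ≥0, ∀ Z : Set (Vec d), IsOpen Z → Convex ℝ Z → Metric.ball y₀ r ⊆ Z →
      Z ⊆ Metric.ball 0 R → ∀ f : Vec d → ℝ, ContDiff ℝ 1 f →
      ∫⁻ x in Z, ‖f x‖ₑ ^ 6 ≤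
        K * (∫⁻ x in Z, (‖f x‖ₑ ^ 4 + ‖f x‖ₑ ^ 3 * ‖fderiv ℝ f x‖ₑ)) ^ (3 / 2 : ℝ) := by
  obtain ⟨K, hK⟩ := gagliardo_convex (by omega : 2 ≤ d) y₀ hr R
  have hpow : ∀ Z : Set (Vec d), IsOpen Z → Convex ℝ Z → Metric.ball y₀ r ⊆ Z →
      Z ⊆ Metric.ball 0 R → ∀ f : Vec d → ℝ, ContDiff ℝ 1 f →
      ∫⁻ x in Z, (‖f x‖ₑ ^ 4) ^ ((d : ℝ) / (d - 1)) ≤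
        K * (4 * ∫⁻ x in Z, (‖f x‖ₑ ^ 4 + ‖f x‖ₑ ^ 3 * ‖fderiv ℝ f x‖ₑ)) ^ ((d : ℝ) / (d - 1)) := by
    intro Z h1 h2 h3 h4 f hf
    have hd1 : (1 : ℝ) < d := by rcases hd with rfl | rfl <;> norm_num
    have h := hK Z h1 h2 h3 h4 (fun x => f x ^ 4) (hf.pow 4)
    simp only [enorm_pow] at h
    refine h.trans ?_
    have : 0 ≤ (d : ℝ) / (d - 1) := div_nonneg (by linarith) (by linarith)
    gcongr
    rw [← lintegral_const_mul' _ _ (by simp)]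
    gcongr with x
    have hderiv : fderiv ℝ (fun x => f x ^ 4) x = (4 * f x ^ 3) • fderiv ℝ f x := by
      have := ((hf.differentiable one_ne_zero x).hasFDerivAt.pow 4).fderiv
      rw [this]; norm_num
    rw [hderiv, enorm_smul, enorm_mul, enorm_pow, mul_add]
    have h4 : ‖(4 : ℝ)‖ₑ = 4 := by
      rw [Real.enorm_eq_ofReal (by norm_num)]; norm_num
    rw [h4, mul_assoc]
    gcongr
    exact le_mul_of_one_le_left zero_le (by norm_num)
  rcases hd with rfl | rfl
  · let V : ℝ≥0∞ := volume (Metric.ball (0 : Vec 2) R)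
    have hV : V ≠ ⊤ := measure_ball_lt_top.ne
    refine ⟨(V ^ (1 / 4 : ℝ)).toNNReal * (K * 16) ^ (3 / 4 : ℝ), fun Z h1 h2 h3 h4 f hf => ?_⟩
    have h := hpow Z h1 h2 h3 h4 f hf
    norm_num at h
    set N := ∫⁻ x in Z, (‖f x‖ₑ ^ 4 + ‖f x‖ₑ ^ 3 * ‖fderiv ℝ f x‖ₑ) with hN
    -- Hölder against the constant 1 with exponents 4/3 and 4: the power 4/3 of |f|⁶ is |f|⁸.
    have hH := ENNReal.lintegral_mul_le_Lp_mul_Lq (volume.restrict Z)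
      (p := 4 / 3) (q := 4) (by rw [Real.holderConjugate_iff]; norm_num)
      (f := fun x => ‖f x‖ₑ ^ 6) (g := fun _ => 1)
      (hf.continuous.enorm.measurable.pow_const 6).aemeasurable aemeasurable_const
    have e1 : ∀ x, (‖f x‖ₑ ^ 6) ^ (4 / 3 : ℝ) = (‖f x‖ₑ ^ 4) ^ (2 : ℕ) := by
      intro x
      rw [← pow_mul, ← ENNReal.rpow_natCast_mul, ← ENNReal.rpow_natCast]
      norm_num
    simp only [Pi.mul_apply, mul_one, ENNReal.one_rpow, e1, lintegral_one,
      Measure.restrict_apply_univ] at hH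
    refine hH.trans ?_
    calc (∫⁻ x in Z, (‖f x‖ₑ ^ 4) ^ 2) ^ (1 / (4 / 3) : ℝ) * volume Z ^ (1 / 4 : ℝ)
        ≤ (K * (4 * N) ^ 2) ^ (1 / (4 / 3) : ℝ) * V ^ (1 / 4 : ℝ) := by
          gcongr
          exact measure_mono h4
      _ = _ := by
          rw [ENNReal.coe_mul, ENNReal.coe_toNNReal (by finiteness)]
          rw [ENNReal.coe_rpow_of_nonneg _ (by norm_num : (0 : ℝ) ≤ 3 / 4)]
          rw [mul_pow, ← mul_assoc, ENNReal.mul_rpow_of_nonneg _ (N ^ 2) (by norm_num)]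
          rw [← ENNReal.rpow_natCast N, ← ENNReal.rpow_mul]
          push_cast
          norm_num
          ring
  · refine ⟨K * 4 ^ (3 / 2 : ℝ), fun Z h1 h2 h3 h4 f hf => ?_⟩
    have h := hpow Z h1 h2 h3 h4 f hf
    norm_num at h
    have e1 : ∀ x, (‖f x‖ₑ ^ 4) ^ (3 / 2 : ℝ) = ‖f x‖ₑ ^ 6 := by
      intro x
      rw [← ENNReal.rpow_natCast_mul, ← ENNReal.rpow_natCast]
      norm_num
    simp only [e1] at h
    refine h.trans (le_of_eq ?_)
    rw [ENNReal.mul_rpow_of_nonneg _ _ (by norm_num), ENNReal.coe_mul,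
      ENNReal.coe_rpow_of_nonneg _ (by norm_num), mul_assoc]
    norm_num

theorem setLIntegral_ne_top_of_continuous {Z : Set (Vec d)} {R : ℝ}
    (hZ : Z ⊆ Metric.ball 0 R) {g : Vec d → ℝ≥0} (hg : Continuous g) :
    ∫⁻ x in Z, g x ≠ ⊤ := by
  obtain ⟨M, hM⟩ : ∃ M : ℝ≥0, ∀ x ∈ Metric.closedBall (0 : Vec d) R, g x ≤ M := by
    rcases (Metric.closedBall (0 : Vec d) R).eq_empty_or_nonempty with h | h
    · exact ⟨0, by simp [h]⟩
    · obtain ⟨x, -, hx⟩ := (isCompact_closedBall (0 : Vec d) R).exists_isMaxOn h hg.continuousOn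
      exact ⟨g x, fun y hy => hx hy⟩
  refine ne_top_of_le_ne_top ?_ (lintegral_mono_set (hZ.trans Metric.ball_subset_closedBall))
  refine ne_top_of_le_ne_top ?_ (setLIntegral_mono' measurableSet_closedBall
    fun x hx => ENNReal.coe_le_coe.2 (hM x hx))
  simp only [lintegral_const, Measure.restrict_apply_univ]
  have := (measure_closedBall_lt_top (x := (0 : Vec d)) (r := R) (μ := volume)).ne
  finiteness

/-- Write the integrand as |f|³ (|f| + |∇f|). Cauchy–Schwarz and the bound on ∫|f|⁶ estimate the
integral N by a multiple of N^{3/4} times the H¹ norm, and N^{3/4} is divided out. -/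
theorem sobolev_convex (hd : d = 2 ∨ d = 3) (y₀ : Vec d) {r : ℝ} (hr : 0 < r) (R : ℝ) :
    ∃ K : ℝ≥0, ∀ Z : Set (Vec d), IsOpen Z → Convex ℝ Z → Metric.ball y₀ r ⊆ Z →
      Z ⊆ Metric.ball 0 R → ∀ f : Vec d → ℝ, ContDiff ℝ 1 f →
      ∫⁻ x in Z, (‖f x‖ₑ ^ 4 + ‖f x‖ₑ ^ 3 * ‖fderiv ℝ f x‖ₑ) ≤
        K * (∫⁻ x in Z, (‖f x‖ₑ ^ 2 + ‖fderiv ℝ f x‖ₑ ^ 2)) ^ 2 := by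
  obtain ⟨K, hK⟩ := lintegral_pow_six_le_of_convex hd y₀ hr R
  refine ⟨(K * 2) ^ 2, fun Z h1 h2 h3 h4 f hf => ?_⟩
  have h := hK Z h1 h2 h3 h4 f hf
  have hc := hf.continuous.enorm
  have hc' := (hf.continuous_fderiv one_ne_zero).enorm
  set N := ∫⁻ x in Z, (‖f x‖ₑ ^ 4 + ‖f x‖ₑ ^ 3 * ‖fderiv ℝ f x‖ₑ) with hN
  set A := ∫⁻ x in Z, (‖f x‖ₑ ^ 2 + ‖fderiv ℝ f x‖ₑ ^ 2) with hA
  have hNtop : N ≠ ⊤ := by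
    have := setLIntegral_ne_top_of_continuous h4
      (g := fun x => ‖f x‖₊ ^ 4 + ‖f x‖₊ ^ 3 * ‖fderiv ℝ f x‖₊) (by
        have := hf.continuous_fderiv one_ne_zero
        have := hf.continuous
        fun_prop)
    push_cast at this
    exact this
  -- Dividing by N^{3/4} needs N to be finite, which holds because f is C¹ on the whole space and Z
  -- is bounded, and nonzero.
  by_cases hN0 : N = 0
  · simp [hN0]
  have hH := ENNReal.lintegral_mul_le_Lp_mul_Lq (volume.restrict Z)
    (p := 2) (q := 2) (by rw [Real.holderConjugate_iff]; norm_num)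
    (f := fun x => ‖f x‖ₑ ^ 3) (g := fun x => ‖f x‖ₑ + ‖fderiv ℝ f x‖ₑ)
    (hc.measurable.pow_const 3).aemeasurable (hc.add hc').aemeasurable
  have e1 : ∀ x, (‖f x‖ₑ ^ 3) ^ (2 : ℝ) = ‖f x‖ₑ ^ 6 := by
    intro x
    rw [← ENNReal.rpow_natCast_mul, ← ENNReal.rpow_natCast]
    norm_num
  have e2 : ∀ a b : ℝ≥0∞, (a + b) ^ (2 : ℝ) ≤ 2 * (a ^ 2 + b ^ 2) := by
    intro a b
    have := ENNReal.rpow_add_le_mul_rpow_add_rpow a b (p := 2) (by norm_num)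
    norm_num at this ⊢
    exact this
  simp only [Pi.mul_apply, e1] at hH
  have hNA : N ≤ (K * N ^ (3 / 2 : ℝ)) ^ (1 / 2 : ℝ) * (2 * A) ^ (1 / 2 : ℝ) := by
    calc N = ∫⁻ x in Z, ‖f x‖ₑ ^ 3 * (‖f x‖ₑ + ‖fderiv ℝ f x‖ₑ) := by
          rw [hN]; congr 1; ext x; ring
      _ ≤ _ := hH
      _ ≤ _ := by
          gcongr
          rw [← lintegral_const_mul' _ _ (by simp)]
          gcongr with x
          exact e2 _ _
  have h34 : N ^ (3 / 4 : ℝ) ≠ 0 := by simp [ENNReal.rpow_eq_zero_iff, hN0, hNtop]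
  have h34' : N ^ (3 / 4 : ℝ) ≠ ⊤ := by finiteness
  have h14 : N ^ (1 / 4 : ℝ) ≤ (K * 2 * A) ^ (1 / 2 : ℝ) := by
    rw [← ENNReal.mul_le_mul_iff_right h34 h34', ← ENNReal.rpow_add _ _ hN0 hNtop]
    norm_num
    refine hNA.trans (le_of_eq ?_)
    rw [mul_assoc (K : ℝ≥0∞), ENNReal.mul_rpow_of_nonneg _ _ (by norm_num),
      ENNReal.mul_rpow_of_nonneg (K : ℝ≥0∞) (2 * A) (by norm_num), ← ENNReal.rpow_mul]
    norm_num
    ring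
  have := ENNReal.rpow_le_rpow h14 (by norm_num : (0 : ℝ) ≤ 4)
  rw [← ENNReal.rpow_mul, ← ENNReal.rpow_mul] at this
  norm_num at this
  rw [mul_pow] at this
  push_cast
  exact this

end PoroMech

end

noncomputable section

namespace PoroMech

open Filter Topology NNReal

variable {d : ℕ}

/-! ### Slices of weakly differentiable functions on convex sets -/

/-- Jensen's inequality for the power n, obtained from Hölder's inequality against the constant 1.
-/
theorem lintegral_pow_le_of_isProbabilityMeasure {α : Type*} [MeasurableSpace α] (ν : Measure α)
    [IsProbabilityMeasure ν] {F : α → ℝ≥0∞} (hF : AEMeasurable F ν) {n : ℕ} (hn : 2 ≤ n) :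
    (∫⁻ x, F x ∂ν) ^ n ≤ ∫⁻ x, F x ^ n ∂ν := by
  have hn1 : (1 : ℝ) < n := by exact_mod_cast hn
  have h := ENNReal.lintegral_mul_le_Lp_mul_Lq ν (Real.HolderConjugate.conjExponent hn1)
    hF (aemeasurable_const (b := (1 : ℝ≥0∞)))
  simp only [Pi.mul_apply, mul_one, ENNReal.one_rpow, lintegral_one, measure_univ,
    ENNReal.rpow_natCast] at h
  have h2 := pow_le_pow_left₀ zero_le h n
  rwa [← ENNReal.rpow_natCast (_ ^ _), ← ENNReal.rpow_mul, one_div,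
    inv_mul_cancel₀ (by positivity), ENNReal.rpow_one] at h2

section Chart

variable (A : Vec (d - 1) →ᵃⁱ[ℝ] Vec d) (e : Vec d)

/-- The chart of `ℝᵈ` given by the frame `A` of a hyperplane and a transversal vector `e`. -/
def chart (q : Vec (d - 1) × ℝ) : Vec d := A q.1 + q.2 • e

variable {A e} {n : Vec d} (hd : 1 ≤ d) (hA : ∀ x y, ⟪A x - A y, n⟫ = 0) (he : ⟪e, n⟫ ≠ 0)

include hd hA he

/-- The vector e is transversal to the plane of A, so the linear part is injective between spaces of
dimension (d-1)+1 and d. -/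
theorem exists_chart_eq : ∃ L : (Vec (d - 1) × ℝ) ≃L[ℝ] Vec d, chart A e = fun q => A 0 + L q := by
  let f : (Vec (d - 1) × ℝ) →ₗ[ℝ] Vec d :=
    A.linear ∘ₗ LinearMap.fst ℝ _ _ + (LinearMap.toSpanSingleton ℝ _ e) ∘ₗ LinearMap.snd ℝ _ _
  have hf : ∀ q, A q.1 + q.2 • e = A 0 + f q := by
    intro q
    have : A q.1 = A.linear (q.1 - 0) + A 0 := by
      have := A.toAffineMap.linearMap_vsub q.1 0
      simp only [vsub_eq_sub] at this
      rw [this]; simp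
    rw [this]
    simp [f]; abel
  have hinj : Function.Injective f := by
    rw [injective_iff_map_eq_zero]
    rintro ⟨z, t⟩ h
    have h1 := hf (z, t)
    rw [h] at h1
    have h2 : t • e = -(A z - A 0) := by
      simp only [add_zero] at h1
      rw [← h1]; simp
    have ht : t = 0 := by
      have : ⟪t • e, n⟫ = 0 := by rw [h2, inner_neg_left, hA, neg_zero]
      rw [real_inner_smul_left] at this
      exact (mul_eq_zero.1 this).resolve_right he
    subst ht
    have : A z = A 0 := by
      rw [zero_smul] at h2
      exact sub_eq_zero.1 (neg_eq_zero.1 h2.symm)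
    rw [A.injective this]; rfl
  let L := LinearMap.linearEquivOfInjective f hinj (by simp; omega)
  exact ⟨L.toContinuousLinearEquiv, funext fun q => hf q⟩

theorem exists_map_chart : ∃ κ : ℝ≥0, κ ≠ 0 ∧
    Measure.map (chart A e) (volume : Measure (Vec (d - 1) × ℝ)) = κ • volume := by
  obtain ⟨L, hL⟩ := exists_chart_eq hd hA he
  have : (volume : Measure (Vec (d - 1) × ℝ)).IsAddHaarMeasure :=
    Measure.prod.instIsAddHaarMeasure volume volume
  rw [hL]
  exact exists_map_affine_eq_smul _ _ L _

theorem isHomeomorph_chart : IsHomeomorph (chart A e) := by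
  obtain ⟨L, hL⟩ := exists_chart_eq hd hA he
  rw [hL]
  exact (Homeomorph.addLeft (A 0)).isHomeomorph.comp L.toHomeomorph.isHomeomorph

/-- An L¹ trace inequality on interior slices: each value is bounded by the average of u along a
segment in direction e plus the variation along it, and Fubini in the chart integrates these
segments over the slice. The constant depends neither on t nor on Z. -/
theorem slice_le : ∃ K : ℝ≥0, ∀ Z : Set (Vec d), IsOpen Z → Convex ℝ Z →
    ∀ u : Vec d → ℝ, ContDiff ℝ 1 u → ∀ t ∈ Ioo (0 : ℝ) (1 / 2),
      ∫⁻ z in {z | chart A e (z, t) ∈ Z ∧ chart A e (z, 1) ∈ Z}, ‖u (chart A e (z, t))‖ₑ ≤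
        K * ∫⁻ x in Z, (‖u x‖ₑ + ‖fderiv ℝ u x‖ₑ) := by
  obtain ⟨κ, hκ0, hκ⟩ := exists_map_chart hd hA he
  have hemb : MeasurableEmbedding (chart A e) :=
    (isHomeomorph_chart hd hA he).homeomorph.measurableEmbedding
  refine ⟨2 * (1 + ‖e‖₊) * κ, fun Z hZo hZc u hu t ht => ?_⟩
  let G : Vec d → ℝ≥0∞ := Z.indicator fun x => ‖u x‖ₑ + ‖fderiv ℝ u x‖ₑ
  have hucont := hu.continuous
  have hu'cont := hu.continuous_fderiv one_ne_zero
  have hG : Measurable G := by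
    apply Measurable.indicator _ hZo.measurableSet
    exact (hucont.enorm.add hu'cont.enorm).measurable
  have hchart : Continuous (chart A e) := (isHomeomorph_chart hd hA he).continuous
  have hmeas : MeasurableSet {z | chart A e (z, t) ∈ Z ∧ chart A e (z, 1) ∈ Z} :=
    ((hZo.preimage (hchart.comp (Continuous.prodMk_left t))).inter
      (hZo.preimage (hchart.comp (Continuous.prodMk_left 1)))).measurableSet
  have hpt : ∀ z ∈ {z | chart A e (z, t) ∈ Z ∧ chart A e (z, 1) ∈ Z},
      ‖u (chart A e (z, t))‖ₑ ≤ 2 * (1 + ‖e‖ₑ) * ∫⁻ s : ℝ, G (chart A e (z, s)) := by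
    intro z hz
    have h1 := enorm_le_lintegral_segment hu (A z) e t (1 / 2)
    -- As t < 1/2, this segment ends below height 1, so it lies between two points of the convex set
    -- Z. Its length 1/2 is the origin of the factor 2.
    have hmem : ∀ s ∈ Ioc t (t + 1 / 2), A z + s • e ∈ Z := by
      intro s hs
      have hs1 : s ≤ 1 := by linarith [hs.2, ht.2]
      have h1t : 0 < 1 - t := by linarith [ht.2]
      have : A z + s • e = (A z + t • e) + ((s - t) / (1 - t)) • ((1 - t) • e) := by
        rw [smul_smul, div_mul_cancel₀ _ h1t.ne', add_assoc, ← add_smul]; congr 2; ring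
      rw [this]
      refine hZc.add_smul_mem hz.1 ?_ ⟨by apply div_nonneg <;> linarith [hs.1], ?_⟩
      · convert hz.2 using 1
        simp only [chart]
        rw [add_assoc, ← add_smul]; congr 2; ring
      · rw [div_le_one h1t]; linarith
    have hle : (∫⁻ s in Ioc t (t + 1 / 2), ‖u (A z + s • e)‖ₑ) +
        ENNReal.ofReal (1 / 2) * ‖e‖ₑ * ∫⁻ s in Ioc t (t + 1 / 2), ‖fderiv ℝ u (A z + s • e)‖ₑ
        ≤ (1 + ‖e‖ₑ) * ∫⁻ s : ℝ, G (chart A e (z, s)) := by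
      calc _ ≤ (1 + ‖e‖ₑ) * (∫⁻ s in Ioc t (t + 1 / 2), ‖u (A z + s • e)‖ₑ) +
            (1 + ‖e‖ₑ) * ∫⁻ s in Ioc t (t + 1 / 2), ‖fderiv ℝ u (A z + s • e)‖ₑ := by
            gcongr
            · exact le_mul_of_one_le_left zero_le le_self_add
            · refine (mul_le_of_le_one_left zero_le ?_).trans le_add_self
              rw [ENNReal.ofReal_le_one]; norm_num
        _ = (1 + ‖e‖ₑ) * ∫⁻ s in Ioc t (t + 1 / 2),
            (‖u (A z + s • e)‖ₑ + ‖fderiv ℝ u (A z + s • e)‖ₑ) := by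
            rw [← mul_add, lintegral_add_left]
            exact (hucont.comp (by fun_prop)).enorm.measurable
        _ = (1 + ‖e‖ₑ) * ∫⁻ s in Ioc t (t + 1 / 2), G (chart A e (z, s)) := by
            congr 1
            apply setLIntegral_congr_fun measurableSet_Ioc
            intro s hs
            simp only [G, chart, indicator_of_mem (hmem s hs)]
        _ ≤ _ := by gcongr; exact Measure.restrict_le_self
    have h2 : ‖u (A z + t • e)‖ₑ = 2 * (ENNReal.ofReal (1 / 2) * ‖u (A z + t • e)‖ₑ) := by
      have : (2 : ℝ≥0∞) * ENNReal.ofReal (1 / 2) = 1 := by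
        rw [← ENNReal.ofReal_ofNat, ← ENNReal.ofReal_mul (by norm_num)]
        norm_num
      rw [← mul_assoc, this, one_mul]
    change ‖u (A z + t • e)‖ₑ ≤ _
    rw [h2, mul_assoc]
    exact mul_le_mul_right (h1.trans hle) _
  calc _ ≤ ∫⁻ z in {z | chart A e (z, t) ∈ Z ∧ chart A e (z, 1) ∈ Z},
        2 * (1 + ‖e‖ₑ) * ∫⁻ s : ℝ, G (chart A e (z, s)) := setLIntegral_mono' hmeas hpt
    _ ≤ ∫⁻ z, 2 * (1 + ‖e‖ₑ) * ∫⁻ s : ℝ, G (chart A e (z, s)) := setLIntegral_le_lintegral _ _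
    _ = 2 * (1 + ‖e‖ₑ) * ∫⁻ z, ∫⁻ s : ℝ, G (chart A e (z, s)) :=
        lintegral_const_mul' _ _ (by finiteness)
    _ = 2 * (1 + ‖e‖ₑ) * ∫⁻ q, G (chart A e q) := by
        rw [Measure.volume_eq_prod, lintegral_prod]
        exact (hG.comp hchart.measurable).aemeasurable
    _ = 2 * (1 + ‖e‖ₑ) * (κ * ∫⁻ x, G x) := by
        rw [← hemb.lintegral_map, hκ, lintegral_smul_measure]; rfl
    _ = _ := by
        rw [lintegral_indicator hZo.measurableSet]
        push_cast
        rw [enorm_eq_nnnorm]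
        ring

end Chart

theorem enorm_add_enorm_fderiv_pow_four_le {f : Vec d → ℝ} (hf : ContDiff ℝ 1 f) (x : Vec d) :
    ‖f x‖ₑ ^ 4 + ‖fderiv ℝ (fun x => f x ^ 4) x‖ₑ ≤
      4 * (‖f x‖ₑ ^ 4 + ‖f x‖ₑ ^ 3 * ‖fderiv ℝ f x‖ₑ) := by
  have hderiv : fderiv ℝ (fun x => f x ^ 4) x = (4 * f x ^ 3) • fderiv ℝ f x := by
    have := ((hf.differentiable one_ne_zero x).hasFDerivAt.pow 4).fderiv
    rw [this]; norm_num
  rw [hderiv, enorm_smul, enorm_mul, enorm_pow, mul_add]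
  have h4 : ‖(4 : ℝ)‖ₑ = 4 := by
    rw [Real.enorm_eq_ofReal (by norm_num)]; norm_num
  rw [h4, mul_assoc]
  gcongr
  exact le_mul_of_one_le_left zero_le (by norm_num)

/-- `g` is the weak gradient of `w` on `Z`. -/
def HasWeakGradOn (w : Vec d → ℝ) (g : Vec d → Vec d) (Z : Set (Vec d)) : Prop :=
  ∀ φ : Vec d → ℝ, ContDiff ℝ ∞ φ → HasCompactSupport φ → tsupport φ ⊆ Z →
    ∀ j, ∫ x, w x * pd j φ x = -∫ x, g x j * φ x

/-- The image of `Z` under the homothety with center `y₀` and ratio `1 - l`. -/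
def shrink (y₀ : Vec d) (l : ℝ) (Z : Set (Vec d)) : Set (Vec d) :=
  AffineMap.homothety y₀ (1 - l)⁻¹ ⁻¹' Z

section Shrink

variable {y₀ : Vec d} {l r R : ℝ} {Z : Set (Vec d)}

theorem isOpen_shrink (hZ : IsOpen Z) : IsOpen (shrink y₀ l Z) :=
  hZ.preimage (AffineMap.homothety_continuous _ _)

theorem convex_shrink (hZ : Convex ℝ Z) : Convex ℝ (shrink y₀ l Z) :=
  hZ.affine_preimage _

theorem eq_of_homothety (hl : l < 1) (x : Vec d) :
    x = (1 - l) • (AffineMap.homothety y₀ (1 - l)⁻¹ x) + l • y₀ := by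
  have : 1 - l ≠ 0 := by linarith
  rw [AffineMap.homothety_apply, vsub_eq_sub, vadd_eq_add, smul_add, smul_smul,
    mul_inv_cancel₀ this, one_smul, sub_smul, one_smul]
  abel

/-- A point of the shrunken set is (1-l)z + l y₀ with z ∈ Z; moving y₀ inside its ball moves the
point by up to l r without leaving Z. This is the room for mollification. -/
theorem ball_subset_of_mem_shrink (hZ : Convex ℝ Z) (hr : Metric.ball y₀ r ⊆ Z) (hl0 : 0 < l)
    (hl : l < 1) {x : Vec d} (hx : x ∈ shrink y₀ l Z) : Metric.ball x (l * r) ⊆ Z := by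
  intro y hy
  have h1 : y₀ + l⁻¹ • (y - x) ∈ Z := by
    apply hr
    rw [Metric.mem_ball, dist_eq_norm, add_sub_cancel_left, norm_smul, norm_inv, Real.norm_eq_abs,
      abs_of_pos hl0, inv_mul_lt_iff₀ hl0, ← dist_eq_norm]
    exact hy
  have h2 := hZ hx h1 (by linarith : 0 ≤ 1 - l) hl0.le (by ring)
  convert h2 using 1
  rw [smul_add, smul_smul, mul_inv_cancel₀ hl0.ne', one_smul, ← add_assoc, ← eq_of_homothety hl x]
  abel

theorem shrink_subset (hZ : Convex ℝ Z) (hr : Metric.ball y₀ r ⊆ Z) (hr0 : 0 < r) (hl0 : 0 < l)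
    (hl : l < 1) : shrink y₀ l Z ⊆ Z := fun _ hx =>
  ball_subset_of_mem_shrink hZ hr hl0 hl hx (Metric.mem_ball_self (by positivity))

/-- All shrunken sets keep a ball of fixed radius, so the constant of `sobolev_convex` does not
depend on l. -/
theorem ball_subset_shrink (hr : Metric.ball y₀ r ⊆ Z) (hl : l ≤ 1 / 2) :
    Metric.ball y₀ (r / 2) ⊆ shrink y₀ l Z := by
  intro x hx
  apply hr
  have h1 : 0 < 1 - l := by linarith
  rw [Metric.mem_ball, dist_eq_norm] at hx ⊢
  rw [AffineMap.homothety_apply, vsub_eq_sub, vadd_eq_add, add_sub_cancel_right, norm_smul,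
    norm_inv, Real.norm_eq_abs, abs_of_pos h1, inv_mul_lt_iff₀ h1]
  nlinarith [norm_nonneg (x - y₀)]

theorem eventually_mem_shrink (hZ : IsOpen Z) {ι : Type*} {f : Filter ι} {l : ι → ℝ}
    (hl : Tendsto l f (𝓝 0)) {x : Vec d} (hx : x ∈ Z) : ∀ᶠ i in f, x ∈ shrink y₀ (l i) Z := by
  have h : Tendsto (fun i => (1 - l i)⁻¹ • (x - y₀) + y₀) f
      (𝓝 ((1 - 0 : ℝ)⁻¹ • (x - y₀) + y₀)) :=
    (((tendsto_const_nhds.sub hl).inv₀ (by norm_num)).smul_const _).add_const _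
  simp only [sub_zero, inv_one, one_smul, sub_add_cancel] at h
  exact h.eventually (hZ.mem_nhds hx)

end Shrink

open ContinuousLinearMap Convolution

/-- The mollifier is a probability density: Jensen's inequality in the convolution variable, then
Tonelli and translation invariance. -/
theorem lintegral_convolution_sq_le {E : Type*} [NormedAddCommGroup E] [NormedSpace ℝ E]
    [MeasurableSpace E] [BorelSpace E]
    (ρ : ContDiffBump (0 : Vec d)) {h : Vec d → E} (hh : Measurable h) :
    ∫⁻ x, ‖(ρ.normed volume ⋆[lsmul ℝ ℝ, volume] h) x‖ₑ ^ 2 ≤ ∫⁻ x, ‖h x‖ₑ ^ 2 := by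
  let ν : Measure (Vec d) := volume.withDensity fun t => ENNReal.ofReal (ρ.normed volume t)
  have hρm : Measurable fun t => ENNReal.ofReal (ρ.normed volume t) :=
    (ρ.continuous_normed).measurable.ennreal_ofReal
  have : IsProbabilityMeasure ν := ⟨by
    rw [withDensity_apply _ MeasurableSet.univ, Measure.restrict_univ,
      ← ofReal_integral_eq_lintegral_ofReal ρ.integrable_normed
        (ae_of_all _ fun x => ρ.nonneg_normed x), ρ.integral_normed, ENNReal.ofReal_one]⟩
  have hpt : ∀ x, ‖(ρ.normed volume ⋆[lsmul ℝ ℝ, volume] h) x‖ₑ ≤ ∫⁻ t, ‖h (x - t)‖ₑ ∂ν := by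
    intro x
    rw [lintegral_withDensity_eq_lintegral_mul _ hρm (by fun_prop)]
    refine (enorm_integral_le_lintegral_enorm _).trans (lintegral_mono fun t => ?_)
    simp only [lsmul_apply, enorm_smul, Pi.mul_apply]
    rw [Real.enorm_eq_ofReal (ρ.nonneg_normed t)]
  calc _ ≤ ∫⁻ x, ∫⁻ t, ‖h (x - t)‖ₑ ^ 2 ∂ν := by
        apply lintegral_mono fun x => ?_
        exact (pow_le_pow_left₀ zero_le (hpt x) 2).trans
          (lintegral_pow_le_of_isProbabilityMeasure ν (by fun_prop) le_rfl)
    _ = ∫⁻ t, ∫⁻ x, ‖h (x - t)‖ₑ ^ 2 ∂volume ∂ν := by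
        apply lintegral_lintegral_swap
        fun_prop
    _ = ∫⁻ t, ∫⁻ x, ‖h x‖ₑ ^ 2 ∂volume ∂ν := by
        congr 1; ext t
        exact lintegral_sub_right_eq_self (fun x => ‖h x‖ₑ ^ 2) t
    _ = _ := by simp

theorem fderiv_eq_sum_pd (φ : Vec d → ℝ) (x v : Vec d) :
    fderiv ℝ φ x v = ∑ j, v j * pd j φ x := by
  conv_lhs => rw [← (EuclideanSpace.basisFun (Fin d) ℝ).sum_repr v]
  simp [pd]

/-- The translate y ↦ ρ(x - y) is an admissible test function as soon as its support lies in Z, and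
the weak formulation then says that the gradient of ρ * w at x is (ρ * g)(x). -/
theorem enorm_fderiv_convolution_le {w : Vec d → ℝ} {g : Vec d → Vec d} {Z : Set (Vec d)}
    (hw : MemLp w 2 volume) (hg : MemLp g 2 volume) (h : HasWeakGradOn w g Z)
    (ρ : ContDiffBump (0 : Vec d)) {x : Vec d} (hx : Metric.closedBall x ρ.rOut ⊆ Z) :
    ‖fderiv ℝ (ρ.normed volume ⋆[lsmul ℝ ℝ, volume] w) x‖ₑ ≤
      ‖(ρ.normed volume ⋆[lsmul ℝ ℝ, volume] g) x‖ₑ := by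
  have hρ : ContDiff ℝ ∞ (ρ.normed volume) := ρ.contDiff_normed
  have hwl : LocallyIntegrable w volume := hw.locallyIntegrable (by norm_num)
  have hgl : LocallyIntegrable g volume := hg.locallyIntegrable (by norm_num)
  have h1 := (HasCompactSupport.hasFDerivAt_convolution_left (lsmul ℝ ℝ)
    (ρ.hasCompactSupport_normed) (hρ.of_le (by simp)) hwl x).fderiv
  rw [h1]
  let φ : Vec d → ℝ := fun y => ρ.normed volume (x - y)
  have hφ : ContDiff ℝ ∞ φ := hρ.comp (contDiff_const.sub contDiff_id)
  have hφc : HasCompactSupport φ := by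
    exact (ρ.hasCompactSupport_normed).comp_homeomorph (Homeomorph.subLeft x)
  have hφs : tsupport φ ⊆ Z := by
    refine subset_trans ?_ hx
    apply closure_minimal _ Metric.isClosed_closedBall
    intro y hy
    have : x - y ∈ Function.support (ρ.normed volume) := hy
    rw [ρ.support_normed_eq, Metric.mem_ball, dist_zero_right] at this
    rw [Metric.mem_closedBall, dist_comm, dist_eq_norm]
    exact this.le
  have hφd : ∀ y v, fderiv ℝ φ y v = -fderiv ℝ (ρ.normed volume) (x - y) v := by
    intro y v
    have h2 : HasFDerivAt (fun y : Vec d => x - y) (-ContinuousLinearMap.id ℝ (Vec d)) y :=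
      (hasFDerivAt_id y).const_sub x
    have h3 := ((hρ.differentiable (by simp)) (x - y)).hasFDerivAt.comp y h2
    change fderiv ℝ ((ρ.normed volume) ∘ fun y : Vec d => x - y) y v = _
    rw [h3.fderiv]; simp
  have hφ'cont : ∀ v, Continuous fun y => fderiv ℝ φ y v := fun v =>
    (hφ.continuous_fderiv (by simp)).clm_apply continuous_const
  have hφ'c : ∀ v, HasCompactSupport fun y => fderiv ℝ φ y v := fun v =>
    hφc.fderiv_apply ℝ v
  have hgj : ∀ j, LocallyIntegrable (fun y => g y j) volume := fun j =>
    MemLp.locallyIntegrable ((EuclideanSpace.proj (𝕜 := ℝ) j).comp_memLp' hg) (by norm_num)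
  have hconvg : Integrable (fun t => φ t • g t) volume :=
    hgl.integrable_smul_left_of_hasCompactSupport hφ.continuous hφc
  have key : ∀ v, (fderiv ℝ (ρ.normed volume) ⋆[(lsmul ℝ ℝ).precompL (Vec d), volume] w) x v =
      ⟪(ρ.normed volume ⋆[lsmul ℝ ℝ, volume] g) x, v⟫ := by
    intro v
    have hex : ConvolutionExistsAt (fderiv ℝ (ρ.normed volume)) w x
        ((lsmul ℝ ℝ).precompL (Vec d)) volume :=
      (HasCompactSupport.convolutionExists_left _ ((ρ.hasCompactSupport_normed).fderiv ℝ)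
        (hρ.continuous_fderiv (by simp)) hwl) x
    rw [convolution_eq_swap, convolution_eq_swap,
      ContinuousLinearMap.integral_apply hex.integrable_swap, real_inner_comm]
    simp only [lsmul_apply]
    rw [← integral_inner hconvg v]
    have e1 : ∀ t, ((lsmul ℝ ℝ).precompL (Vec d) (fderiv ℝ (ρ.normed volume) (x - t)) (w t)) v =
        -∑ j, v j * (w t * pd j φ t) := by
      intro t
      rw [precompL_apply, ContinuousLinearMap.lsmul_apply, smul_eq_mul,
        ← neg_eq_iff_eq_neg.2 (hφd t v).symm.symm, fderiv_eq_sum_pd, neg_mul, Finset.sum_mul]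
      congr 1
      apply Finset.sum_congr rfl; intro j _; ring
    have e2 : ∀ t, ⟪v, φ t • g t⟫ = ∑ j, v j * (g t j * φ t) := by
      intro t
      rw [real_inner_smul_right, PiLp.inner_apply, Finset.mul_sum]
      apply Finset.sum_congr rfl; intro j _
      simp only [RCLike.inner_apply, conj_trivial]; ring
    simp only [e1, e2]
    have i1 : ∀ j, Integrable (fun t => w t * pd j φ t) volume := by
      intro j
      have := hwl.integrable_smul_left_of_hasCompactSupport
        (hφ'cont (EuclideanSpace.single j 1)) (hφ'c (EuclideanSpace.single j 1))
      simpa only [smul_eq_mul, mul_comm, pd] using this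
    have i2 : ∀ j, Integrable (fun t => g t j * φ t) volume := by
      intro j
      have := (hgj j).integrable_smul_left_of_hasCompactSupport hφ.continuous hφc
      simpa only [smul_eq_mul, mul_comm] using this
    rw [integral_neg, integral_finsetSum _ fun j _ => (i1 j).const_mul _,
      integral_finsetSum _ fun j _ => (i2 j).const_mul _, ← Finset.sum_neg_distrib]
    apply Finset.sum_congr rfl
    intro j _
    rw [integral_const_mul, integral_const_mul, h φ hφ hφc hφs j]
    ring
  have hL : (fderiv ℝ (ρ.normed volume) ⋆[(lsmul ℝ ℝ).precompL (Vec d), volume] w) x =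
      innerSL ℝ ((ρ.normed volume ⋆[lsmul ℝ ℝ, volume] g) x) := by
    ext1 v; rw [key]; rfl
  rw [hL]
  exact (enorm_eq_iff_norm_eq.2 (innerSL_apply_norm ℝ _)).le

/-- On almost every slice of a convex set, parallel to a hyperplane, a weakly differentiable
function is bounded in `L⁴` by its `H¹` norm. -/
theorem slice_weak (hd : d = 2 ∨ d = 3) {A : Vec (d - 1) →ᵃⁱ[ℝ] Vec d} {e n : Vec d}
    (hA : ∀ x y, ⟪A x - A y, n⟫ = 0) (he : ⟪e, n⟫ ≠ 0) {y₀ : Vec d} {r R : ℝ} (hr : 0 < r)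
    {Z : Set (Vec d)} (hZo : IsOpen Z) (hZc : Convex ℝ Z) (hZr : Metric.ball y₀ r ⊆ Z)
    (hZR : Z ⊆ Metric.ball 0 R) :
    ∃ K : ℝ≥0, ∀ (w : Vec d → ℝ) (g : Vec d → Vec d), Measurable w → Measurable g →
      MemLp w 2 volume → MemLp g 2 volume → HasWeakGradOn w g Z →
      ∀ᵐ t : ℝ, t ∈ Ioo (0 : ℝ) (1 / 2) →
        ∫⁻ z in {z | chart A e (z, t) ∈ Z ∧ chart A e (z, 1) ∈ Z}, ‖w (chart A e (z, t))‖ₑ ^ 4 ≤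
          K * ((∫⁻ x, ‖w x‖ₑ ^ 2) + ∫⁻ x, ‖g x‖ₑ ^ 2) ^ 2 := by
  have hd1 : 1 ≤ d := by omega
  obtain ⟨K₁, hK₁⟩ := slice_le hd1 hA he
  obtain ⟨K₂, hK₂⟩ := sobolev_convex hd y₀ (half_pos hr) R
  obtain ⟨κ, hκ0, hκ⟩ := exists_map_chart hd1 hA he
  have hchart : Continuous (chart A e) := (isHomeomorph_chart hd1 hA he).continuous
  refine ⟨K₁ * 4 * K₂, fun w g hwm hgm hw hg hwg => ?_⟩
  -- Shrinking ratios that tend to 0 and never exceed 1/2, as `ball_subset_shrink` requires.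
  let l : ℕ → ℝ := fun i => 1 / ((i : ℝ) + 2)
  have hl0 : ∀ i, 0 < l i := fun i => by positivity
  have hl1 : ∀ i, l i ≤ 1 / 2 := fun i => by
    apply one_div_le_one_div_of_le (by norm_num)
    have : (0 : ℝ) ≤ i := by positivity
    linarith
  have hlt : Tendsto l atTop (𝓝 0) :=
    tendsto_const_nhds.div_atTop (tendsto_natCast_atTop_atTop.atTop_add tendsto_const_nhds)
  -- The outer radius is below the margin l r of the shrunken set, and the ratio of the two radii is
  -- fixed, which gives almost everywhere convergence of the mollifications.
  let ρ : ℕ → ContDiffBump (0 : Vec d) := fun i =>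
    ⟨l i * r / 4, l i * r / 2, by have := hl0 i; positivity, by
      have := mul_pos (hl0 i) hr; linarith⟩
  let W : ℕ → Vec d → ℝ := fun i => (ρ i).normed volume ⋆[lsmul ℝ ℝ, volume] w
  have hwl : LocallyIntegrable w volume := hw.locallyIntegrable (by norm_num)
  have hWsmooth : ∀ i, ContDiff ℝ 1 (W i) := fun i =>
    (ρ i).hasCompactSupport_normed.contDiff_convolution_left _
      (by exact_mod_cast (ρ i).contDiff_normed (n := 1)) hwl
  have hWae : ∀ᵐ x, Tendsto (fun i => W i x) atTop (𝓝 (w x)) := by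
    apply ContDiffBump.ae_convolution_tendsto_right_of_locallyIntegrable (K := 2) _ _ hwl
    · have : Tendsto (fun i => l i * r / 2) atTop (𝓝 (0 * r / 2)) := (hlt.mul_const r).div_const 2
      simpa using this
    · refine Eventually.of_forall fun i => ?_
      change l i * r / 2 ≤ 2 * (l i * r / 4)
      linarith
  have hQ : Measure.QuasiMeasurePreserving (chart A e) volume volume :=
    ⟨hchart.measurable, by rw [hκ]; exact Measure.smul_absolutelyContinuous⟩
  -- Fubini in the chart: convergence almost everywhere in space gives convergence almost everywhere
  -- on almost every slice.
  have hWae2 : ∀ᵐ t : ℝ, ∀ᵐ z : Vec (d - 1),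
      Tendsto (fun i => W i (chart A e (z, t))) atTop (𝓝 (w (chart A e (z, t)))) := by
    have h1 := hQ.ae hWae
    have h2 := (Measure.measurePreserving_swap
      (μ := (volume : Measure ℝ)) (ν := (volume : Measure (Vec (d - 1))))).quasiMeasurePreserving.ae
        (p := fun q => Tendsto (fun i => W i (chart A e q)) atTop (𝓝 (w (chart A e q)))) h1
    exact Measure.ae_ae_of_ae_prod h2
  have hbound : ∀ i, ∀ t ∈ Ioo (0 : ℝ) (1 / 2),
      ∫⁻ z in {z | chart A e (z, t) ∈ shrink y₀ (l i) Z ∧ chart A e (z, 1) ∈ shrink y₀ (l i) Z},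
        ‖W i (chart A e (z, t))‖ₑ ^ 4 ≤
        K₁ * 4 * K₂ * ((∫⁻ x, ‖w x‖ₑ ^ 2) + ∫⁻ x, ‖g x‖ₑ ^ 2) ^ 2 := by
    intro i t ht
    set Z' := shrink y₀ (l i) Z
    have hl1' : l i < 1 := by linarith [hl1 i]
    have o1 : IsOpen Z' := isOpen_shrink hZo
    have o2 : Convex ℝ Z' := convex_shrink hZc
    have o3 : Z' ⊆ Z := shrink_subset hZc hZr hr (hl0 i) hl1'
    -- The slice inequality for the fourth power; the gradient of that power is what
    -- `sobolev_convex` controls.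
    have h1 := hK₁ Z' o1 o2 (fun x => W i x ^ 4) ((hWsmooth i).pow 4) t ht
    simp only [enorm_pow] at h1
    have h2 := hK₂ Z' o1 o2 (ball_subset_shrink hZr (hl1 i)) (o3.trans hZR) (W i) (hWsmooth i)
    have h3 : ∫⁻ x in Z', (‖W i x‖ₑ ^ 2 + ‖fderiv ℝ (W i) x‖ₑ ^ 2) ≤
        (∫⁻ x, ‖w x‖ₑ ^ 2) + ∫⁻ x, ‖g x‖ₑ ^ 2 := by
      rw [lintegral_add_left ((hWsmooth i).continuous.enorm.measurable.pow_const 2)]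
      refine add_le_add ?_ ?_
      · exact (setLIntegral_le_lintegral _ _).trans (lintegral_convolution_sq_le (ρ i) hwm)
      · refine (setLIntegral_mono' o1.measurableSet fun x hx => ?_).trans
          ((setLIntegral_le_lintegral _ _).trans (lintegral_convolution_sq_le (ρ i) hgm))
        gcongr
        apply enorm_fderiv_convolution_le hw hg hwg
        refine subset_trans ?_ (ball_subset_of_mem_shrink hZc hZr (hl0 i) hl1' hx)
        apply Metric.closedBall_subset_ball
        change l i * r / 2 < l i * r
        linarith [mul_pos (hl0 i) hr]
    have h4 : ∫⁻ x in Z', (‖W i x‖ₑ ^ 4 + ‖fderiv ℝ (fun x => W i x ^ 4) x‖ₑ) ≤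
        4 * (K₂ * ((∫⁻ x, ‖w x‖ₑ ^ 2) + ∫⁻ x, ‖g x‖ₑ ^ 2) ^ 2) := by
      calc ∫⁻ x in Z', (‖W i x‖ₑ ^ 4 + ‖fderiv ℝ (fun x => W i x ^ 4) x‖ₑ)
          ≤ ∫⁻ x in Z', 4 * (‖W i x‖ₑ ^ 4 + ‖W i x‖ₑ ^ 3 * ‖fderiv ℝ (W i) x‖ₑ) := by
            gcongr with x
            exact enorm_add_enorm_fderiv_pow_four_le (hWsmooth i) x
        _ = 4 * ∫⁻ x in Z', (‖W i x‖ₑ ^ 4 + ‖W i x‖ₑ ^ 3 * ‖fderiv ℝ (W i) x‖ₑ) :=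
            lintegral_const_mul' _ _ (by simp)
        _ ≤ _ := by
            gcongr
            exact h2.trans (by gcongr)
    refine h1.trans ((mul_le_mul_right h4 _).trans (le_of_eq ?_))
    ring
  have hopen : ∀ s, Measurable fun z : Vec (d - 1) => chart A e (z, s) := fun s =>
    hchart.measurable.comp (measurable_id.prodMk measurable_const)
  filter_upwards [hWae2] with t hWt ht
  have hS : MeasurableSet {z | chart A e (z, t) ∈ Z ∧ chart A e (z, 1) ∈ Z} :=
    ((hopen t) hZo.measurableSet).inter ((hopen 1) hZo.measurableSet)
  rw [← lintegral_indicator hS]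
  have hmeas : ∀ i, MeasurableSet {z | chart A e (z, t) ∈ shrink y₀ (l i) Z ∧
      chart A e (z, 1) ∈ shrink y₀ (l i) Z} := fun i =>
    ((hopen t) (isOpen_shrink hZo).measurableSet).inter
      ((hopen 1) (isOpen_shrink hZo).measurableSet)
  -- Fatou's lemma: the two points of Z attached to z belong to all shrunken sets from some index
  -- on, so the indicators do not affect the limit.
  calc _ ≤ ∫⁻ z, liminf (fun i => {z | chart A e (z, t) ∈ shrink y₀ (l i) Z ∧
        chart A e (z, 1) ∈ shrink y₀ (l i) Z}.indicator
          (fun z => ‖W i (chart A e (z, t))‖ₑ ^ 4) z) atTop := by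
        apply lintegral_mono_ae
        filter_upwards [hWt] with z hz
        by_cases hzZ : chart A e (z, t) ∈ Z ∧ chart A e (z, 1) ∈ Z
        · rw [indicator_of_mem (by exact hzZ)]
          have hz2 : Tendsto (fun i => ‖W i (chart A e (z, t))‖ₑ ^ 4) atTop
              (𝓝 (‖w (chart A e (z, t))‖ₑ ^ 4)) :=
            ((ENNReal.continuous_pow 4).tendsto _).comp ((continuous_enorm.tendsto _).comp hz)
          refine (Tendsto.liminf_eq (hz2.congr' ?_)).ge
          filter_upwards [eventually_mem_shrink hZo hlt hzZ.1,
            eventually_mem_shrink hZo hlt hzZ.2] with i h1 h2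
          rw [indicator_of_mem]
          exact ⟨h1, h2⟩
        · rw [indicator_of_notMem (by exact hzZ)]
          exact zero_le
    _ ≤ liminf (fun i => ∫⁻ z, {z | chart A e (z, t) ∈ shrink y₀ (l i) Z ∧
        chart A e (z, 1) ∈ shrink y₀ (l i) Z}.indicator
          (fun z => ‖W i (chart A e (z, t))‖ₑ ^ 4) z) atTop := by
        apply lintegral_liminf_le
        intro i
        refine Measurable.indicator ?_ (hmeas i)
        exact (((hWsmooth i).continuous.measurable.comp (hopen t)).enorm.pow_const 4)
    _ ≤ _ := by
        apply liminf_le_of_le (by isBoundedDefault)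
        intro b hb
        obtain ⟨i, hi⟩ := hb.exists
        rw [lintegral_indicator (hmeas i)] at hi
        push_cast
        exact hi.trans (hbound i t ht)

end PoroMech

end

noncomputable section

namespace PoroMech

open Filter Topology NNReal

variable {d : ℕ}

/-! ### Geometry of fracture networks -/

theorem IsPolytopal.isOpen {S : Set (Vec d)} (h : IsPolytopal S) : IsOpen S := by
  obtain ⟨P, rfl⟩ := h
  exact isOpen_interior

theorem IsPolytopal.isBounded {S : Set (Vec d)} (h : IsPolytopal S) : Bornology.IsBounded S := by
  obtain ⟨P, rfl⟩ := h
  refine Bornology.IsBounded.subset ?_ interior_subset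
  refine (P.finite_toSet.isCompact_biUnion fun p _ => ?_).isBounded
  exact p.finite_toSet.isCompact_convexHull ℝ

namespace FractureNetwork

variable (G : FractureNetwork d)

theorem isOpen_Ω : IsOpen G.Ω := G.Ω_polytopal.isOpen

theorem exists_Ω_subset_ball : ∃ R : ℝ, G.Ω ⊆ Metric.ball 0 R :=
  (G.Ω_polytopal.isBounded).subset_ball 0

instance : IsFiniteMeasure G.vol :=
  ⟨by rw [vol, Measure.restrict_apply_univ]; exact G.Ω_polytopal.isBounded.measure_lt_top⟩

theorem measurableEmbedding_frame (k : Fin G.numFrac) : MeasurableEmbedding (G.frame k) :=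
  (G.frame k).isometry.isClosedEmbedding.measurableEmbedding

theorem measurableSet_frac (k : Fin G.numFrac) : MeasurableSet (G.frac k) :=
  (G.measurableEmbedding_frame k).measurableSet_image.2 (G.shape_polytopal k).isOpen.measurableSet

theorem measurableSet_Γ : MeasurableSet G.Γ := MeasurableSet.iUnion G.measurableSet_frac

theorem frac_subset_Γ (k : Fin G.numFrac) : G.frac k ⊆ G.Γ := subset_iUnion _ k

/-- Isometries preserve the normalised Hausdorff measure, which is Lebesgue measure on ℝᵈ⁻¹. -/
theorem surf_restrict_frac (k : Fin G.numFrac) :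
    G.surf.restrict (G.frac k) = (volume.restrict (G.shape k)).map (G.frame k) := by
  have h1 := (G.frame k).isometry.map_euclideanHausdorffMeasure (d := d - 1)
  rw [EuclideanSpace.euclideanHausdorffMeasure_eq_volume] at h1
  have hsub : G.frac k ⊆ range (G.frame k) := image_subset_range _ _
  rw [surf, Measure.restrict_restrict (G.measurableSet_frac k),
    inter_eq_self_of_subset_left (G.frac_subset_Γ k), ← inter_eq_self_of_subset_left hsub,
    ← Measure.restrict_restrict (G.measurableSet_frac k), ← h1,
    (G.measurableEmbedding_frame k).restrict_map, frac,
    preimage_image_eq _ (G.frame k).injective]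

theorem surf_eq_sum : G.surf = Measure.sum fun k => G.surf.restrict (G.frac k) := by
  rw [← Measure.restrict_iUnion (s := G.frac) (fun i j h => G.frac_disjoint i j h) G.measurableSet_frac]
  rw [surf, Measure.restrict_restrict (MeasurableSet.iUnion G.measurableSet_frac)]
  rw [show (⋃ i, G.frac i) = G.Γ from rfl, inter_self]

instance : IsFiniteMeasure G.surf := by
  rw [surf_eq_sum]
  have : ∀ k, IsFiniteMeasure (G.surf.restrict (G.frac k)) := by
    intro k
    rw [surf_restrict_frac]
    have : IsFiniteMeasure (volume.restrict (G.shape k)) :=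
      ⟨by rw [Measure.restrict_apply_univ]; exact (G.shape_polytopal k).isBounded.measure_lt_top⟩
    infer_instance
  exact ⟨by
    rw [Measure.sum_apply _ MeasurableSet.univ, tsum_fintype]
    exact ENNReal.sum_lt_top.2 fun k _ => measure_lt_top _ _⟩

theorem lintegral_surf (f : Vec d → ℝ≥0∞) :
    ∫⁻ x, f x ∂G.surf = ∑ k, ∫⁻ z in G.shape k, f (G.frame k z) := by
  conv_lhs => rw [surf_eq_sum]
  rw [lintegral_sum_measure, tsum_fintype]
  refine Finset.sum_congr rfl fun k _ => ?_
  rw [surf_restrict_frac, (G.measurableEmbedding_frame k).lintegral_map]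

/-- The signed distance to the hyperplane of the `j`-th fracture. -/
def planeDist (j : Fin G.numFrac) (y : Vec d) : ℝ := ⟪y - G.frame j 0, G.normal j⟫

theorem continuous_planeDist (j : Fin G.numFrac) : Continuous (G.planeDist j) := by
  unfold planeDist; fun_prop

theorem planeDist_frac {j : Fin G.numFrac} {x : Vec d} (hx : x ∈ G.frac j) : G.planeDist j x = 0 := by
  obtain ⟨z, -, rfl⟩ := hx
  exact G.normal_orth j z 0

/-- The union of the finitely many fracture planes is closed and contains Γ. It is therefore enough
to stay off these planes in order to avoid the closure of Γ. -/
theorem exists_planeDist_eq_zero {x : Vec d} (hx : x ∈ closure G.Γ) : ∃ j, G.planeDist j x = 0 := by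
  have hcl : IsClosed (⋃ j, {y | G.planeDist j y = 0}) :=
    isClosed_iUnion_of_finite fun j => isClosed_eq (G.continuous_planeDist j) continuous_const
  have : closure G.Γ ⊆ ⋃ j, {y | G.planeDist j y = 0} :=
    closure_minimal (iUnion_mono fun j x hx => G.planeDist_frac hx) hcl
  simpa using this hx

theorem planeDist_chart (j k : Fin G.numFrac) (e : Vec d) (q : Vec (d - 1) × ℝ) :
    G.planeDist j (chart (G.frame k) e q) = G.planeDist j (G.frame k q.1) + q.2 * ⟪e, G.normal j⟫ := by
  simp only [planeDist, chart]
  rw [← real_inner_smul_left, ← inner_add_left]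
  congr 1; abel

/-- The points of the `k`-th fracture plane that lie on the plane of another fracture. -/
def excPts (k : Fin G.numFrac) : Set (Vec (d - 1)) :=
  {z | ∃ j, G.planeDist j (G.frame k z) = 0 ∧ ∃ z', G.planeDist j (G.frame k z') ≠ 0}

theorem excPts_eq (k : Fin G.numFrac) : G.excPts k =
    ⋃ j, ⋃ (_ : ∃ z', G.planeDist j (G.frame k z') ≠ 0), {z | G.planeDist j (G.frame k z) = 0} := by
  ext z; simp only [excPts, mem_iUnion, mem_ofPred_eq]
  constructor
  · rintro ⟨j, h1, h2⟩; exact ⟨j, h2, h1⟩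
  · rintro ⟨j, h2, h1⟩; exact ⟨j, h1, h2⟩

theorem measurableSet_excPts (k : Fin G.numFrac) : MeasurableSet (G.excPts k) := by
  rw [excPts_eq]
  refine MeasurableSet.iUnion fun j => MeasurableSet.iUnion fun _ => ?_
  exact (isClosed_eq ((G.continuous_planeDist j).comp (G.frame k).continuous)
    continuous_const).measurableSet

/-- A plane that does not contain the k-th one cuts it in a proper affine subspace. -/
theorem volume_excPts (k : Fin G.numFrac) : volume (G.excPts k) = 0 := by
  rw [excPts_eq]
  refine measure_iUnion_null fun j => measure_iUnion_null fun ⟨z', hz'⟩ => ?_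
  let s : AffineSubspace ℝ (Vec (d - 1)) :=
    (AffineSubspace.mk' (G.frame j 0) (ℝ ∙ G.normal j)ᗮ).comap (G.frame k).toAffineMap
  have hs : ∀ z, z ∈ s ↔ G.planeDist j (G.frame k z) = 0 := by
    intro z
    rw [AffineSubspace.mem_comap, AffineSubspace.mem_mk', vsub_eq_sub,
      Submodule.mem_orthogonal_singleton_iff_inner_left]
    rfl
  have : {z | G.planeDist j (G.frame k z) = 0} = s := by ext z; exact (hs z).symm
  rw [this]
  apply Measure.addHaar_affineSubspace
  intro h
  exact hz' ((hs z').1 (h ▸ AffineSubspace.mem_top ℝ _ _))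

theorem one_le_dim (k : Fin G.numFrac) : 1 ≤ d := by
  rcases Nat.eq_zero_or_pos d with rfl | h
  · have := G.normal_unit k
    rw [Subsingleton.elim (G.normal k) 0, norm_zero] at this
    norm_num at this
  · exact h

/-- Otherwise the j-th plane would contain the k-th one and also be invariant in direction e, hence
contain the whole range of the chart, which is ℝᵈ. -/
theorem inner_normal_ne_zero_of_planeDist_eq_zero {j k : Fin G.numFrac} {e : Vec d}
    (he : ⟪e, G.normal k⟫ ≠ 0) (h : ∀ z, G.planeDist j (G.frame k z) = 0) : ⟪e, G.normal j⟫ ≠ 0 := by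
  intro h0
  obtain ⟨q, hq⟩ := (isHomeomorph_chart (G.one_le_dim k) (G.normal_orth k) he).surjective
    (G.frame j 0 + G.normal j)
  have h1 := G.planeDist_chart j k e q
  rw [hq, h, h0, mul_zero, add_zero] at h1
  simp only [planeDist, add_sub_cancel_left, real_inner_self_eq_norm_sq, G.normal_unit] at h1
  norm_num at h1

/-- Near a fracture point that lies on no other fracture plane, the points next to the fracture are
in `Ω ∖ Γ̄`. -/
theorem eventually_chart_mem {k : Fin G.numFrac} {e : Vec d} (he : ⟪e, G.normal k⟫ ≠ 0)
    {z₀ : Vec (d - 1)} (hz : z₀ ∈ G.shape k) (hz' : z₀ ∉ G.excPts k) :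
    ∀ᶠ q in 𝓝 (z₀, (0 : ℝ)), q.1 ∈ G.shape k ∧
      (q.2 ≠ 0 → chart (G.frame k) e q ∈ G.Ω \ closure G.Γ) := by
  have hcont : Continuous (chart (G.frame k) e) :=
    (isHomeomorph_chart (G.one_le_dim k) (G.normal_orth k) he).continuous
  have h0 : chart (G.frame k) e (z₀, 0) = G.frame k z₀ := by simp [chart]
  have h1 : ∀ᶠ q in 𝓝 (z₀, (0 : ℝ)), q.1 ∈ G.shape k :=
    continuous_fst.continuousAt.eventually ((G.shape_polytopal k).isOpen.mem_nhds hz)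
  have h2 : ∀ᶠ q in 𝓝 (z₀, (0 : ℝ)), chart (G.frame k) e q ∈ G.Ω := by
    apply hcont.continuousAt.eventually
    rw [h0]
    exact G.isOpen_Ω.mem_nhds (G.frac_subset k (mem_image_of_mem _ hz))
  have h3 : ∀ᶠ q in 𝓝 (z₀, (0 : ℝ)), ∀ j, q.2 ≠ 0 → G.planeDist j (chart (G.frame k) e q) ≠ 0 := by
    rw [eventually_all]
    intro j
    -- A plane through a non-exceptional point contains the entire k-th plane and is left at once in
    -- direction e; any other plane stays at positive distance nearby.
    by_cases hj : G.planeDist j (G.frame k z₀) = 0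
    · have hj' : ∀ z, G.planeDist j (G.frame k z) = 0 := by
        intro z; by_contra hne; exact hz' ⟨j, hj, z, hne⟩
      refine Eventually.of_forall fun q hq => ?_
      rw [planeDist_chart, hj', zero_add]
      exact mul_ne_zero hq (G.inner_normal_ne_zero_of_planeDist_eq_zero he hj')
    · have : ∀ᶠ q in 𝓝 (z₀, (0 : ℝ)), G.planeDist j (chart (G.frame k) e q) ≠ 0 := by
        apply ((G.continuous_planeDist j).comp hcont).continuousAt.eventually_ne
        rw [Function.comp_apply, h0]; exact hj
      exact this.mono fun q hq _ => hq
  filter_upwards [h1, h2, h3] with q h1 h2 h3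
  refine ⟨h1, fun hq => ⟨h2, fun hΓ => ?_⟩⟩
  obtain ⟨j, hj⟩ := G.exists_planeDist_eq_zero hΓ
  exact h3 j hq hj

theorem Side.sign_ne_zero (a : Side) : a.sign ≠ 0 := by cases a <;> simp [Side.sign]

theorem chart_mem_halfSpace_iff {k : Fin G.numFrac} {a : Side} {e : Vec d}
    (he : a.sign * ⟪e, G.normal k⟫ < 0) (q : Vec (d - 1) × ℝ) :
    chart (G.frame k) e q ∈ G.halfSpace k a ↔ 0 < q.2 := by
  change a.sign * G.planeDist k (chart (G.frame k) e q) < 0 ↔ _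
  have : G.planeDist k (G.frame k q.1) = 0 := G.normal_orth k q.1 0
  rw [planeDist_chart, this, zero_add, mul_left_comm]
  constructor
  · intro h; by_contra h'; push Not at h'
    nlinarith
  · intro h; exact mul_neg_of_pos_of_neg h he

theorem isOpen_halfSpace (k : Fin G.numFrac) (a : Side) : IsOpen (G.halfSpace k a) :=
  isOpen_lt ((G.continuous_planeDist k).const_smul a.sign) continuous_const

theorem convex_halfSpace (k : Fin G.numFrac) (a : Side) : Convex ℝ (G.halfSpace k a) := by
  intro x hx y hy s t hs ht hst
  have h : G.planeDist k (s • x + t • y) = s * G.planeDist k x + t * G.planeDist k y := by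
    simp only [planeDist]
    rw [← real_inner_smul_left, ← real_inner_smul_left, ← inner_add_left]
    congr 1
    have : G.frame k 0 = s • G.frame k 0 + t • G.frame k 0 := by rw [← add_smul, hst, one_smul]
    rw [smul_sub, smul_sub]
    nth_rewrite 1 [this]
    abel
  change a.sign * G.planeDist k _ < 0
  change a.sign * G.planeDist k x < 0 at hx
  change a.sign * G.planeDist k y < 0 at hy
  rw [h]
  rcases hs.eq_or_lt with rfl | hs
  · have : t = 1 := by linarith
    subst this; linarith
  · nlinarith [mul_pos hs (neg_pos.2 hx)]

theorem closure_halfSpace_subset (k : Fin G.numFrac) (a : Side) :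
    closure (G.halfSpace k a) ⊆ {y | a.sign * G.planeDist k y ≤ 0} :=
  closure_minimal (fun y h => le_of_lt (show a.sign * G.planeDist k y < 0 from h))
    (isClosed_le ((G.continuous_planeDist k).const_smul a.sign) continuous_const)

end FractureNetwork

end PoroMech

end

noncomputable section

namespace PoroMech

open Filter Topology NNReal

variable {d : ℕ}

/-! ### The trace inequality -/

namespace FractureNetwork

variable (G : FractureNetwork d)

/-- A component of a displacement field, extended by `0` outside `Ω`. -/
def extVal (v : G.Disp) (i : Fin d) : Vec d → ℝ := G.Ω.indicator fun x => val v x i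

/-- The gradient of a component of a displacement field, extended by `0` outside `Ω`. -/
def extGrad (v : G.Disp) (i : Fin d) : Vec d → Vec d :=
  G.Ω.indicator fun x => WithLp.toLp 2 fun j => grad v x (i, j)

variable {G}

theorem measurable_val (v : G.Disp) : Measurable (val v) :=
  (Lp.stronglyMeasurable v.1).measurable

theorem measurable_grad (v : G.Disp) : Measurable (grad v) :=
  (Lp.stronglyMeasurable v.2.1).measurable

theorem measurable_tr (a : Side) (v : G.Disp) : Measurable (tr a v) :=
  (Lp.stronglyMeasurable (v.2.2 a)).measurable

theorem memLp_val (v : G.Disp) : MemLp (val v) 2 G.vol := Lp.memLp v.1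

theorem memLp_grad (v : G.Disp) : MemLp (grad v) 2 G.vol := Lp.memLp v.2.1

theorem memLp_tr (a : Side) (v : G.Disp) : MemLp (tr a v) 2 G.surf := Lp.memLp (v.2.2 a)

theorem measurable_extVal (v : G.Disp) (i : Fin d) : Measurable (G.extVal v i) := by
  apply Measurable.indicator _ G.isOpen_Ω.measurableSet
  exact (EuclideanSpace.proj (𝕜 := ℝ) i).continuous.measurable.comp (measurable_val v)

theorem measurable_gradRow (v : G.Disp) (i : Fin d) :
    Measurable fun x => (WithLp.toLp 2 fun j => grad v x (i, j) : Vec d) := by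
  have h : Continuous fun t : Tensor d => (WithLp.toLp 2 fun j => t (i, j) : Vec d) := by fun_prop
  exact h.measurable.comp (measurable_grad v)

theorem measurable_extGrad (v : G.Disp) (i : Fin d) : Measurable (G.extGrad v i) :=
  (measurable_gradRow v i).indicator G.isOpen_Ω.measurableSet

theorem norm_row_le (t : Tensor d) (i : Fin d) :
    ‖(WithLp.toLp 2 fun j => t (i, j) : Vec d)‖ ≤ ‖t‖ := by
  rw [EuclideanSpace.norm_eq, EuclideanSpace.norm_eq]
  apply Real.sqrt_le_sqrt
  rw [Fintype.sum_prod_type]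
  exact Finset.single_le_sum (f := fun i => ∑ j, ‖t (i, j)‖ ^ 2)
    (fun _ _ => Finset.sum_nonneg fun _ _ => by positivity) (Finset.mem_univ i)

theorem memLp_extVal (v : G.Disp) (i : Fin d) : MemLp (G.extVal v i) 2 volume := by
  rw [extVal, memLp_indicator_iff_restrict G.isOpen_Ω.measurableSet]
  exact (memLp_val v).mono
    ((EuclideanSpace.proj (𝕜 := ℝ) i).continuous.measurable.comp
      (measurable_val v)).aestronglyMeasurable
    (ae_of_all _ fun x => PiLp.norm_apply_le _ i)

theorem memLp_extGrad (v : G.Disp) (i : Fin d) : MemLp (G.extGrad v i) 2 volume := by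
  rw [extGrad, memLp_indicator_iff_restrict G.isOpen_Ω.measurableSet]
  exact (memLp_grad v).mono (measurable_gradRow v i).aestronglyMeasurable
    (ae_of_all _ fun x => norm_row_le _ i)

theorem integrable_extVal (v : G.Disp) (i : Fin d) : Integrable (G.extVal v i) := by
  rw [extVal, integrable_indicator_iff G.isOpen_Ω.measurableSet]
  have h := (memLp_indicator_iff_restrict G.isOpen_Ω.measurableSet).1 (memLp_extVal v i)
  have : IsFiniteMeasure (volume.restrict G.Ω) := inferInstanceAs (IsFiniteMeasure G.vol)
  exact h.integrable (by norm_num)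

theorem integrable_extGrad (v : G.Disp) (i : Fin d) : Integrable (G.extGrad v i) := by
  rw [extGrad, integrable_indicator_iff G.isOpen_Ω.measurableSet]
  have h := (memLp_indicator_iff_restrict G.isOpen_Ω.measurableSet).1 (memLp_extGrad v i)
  have : IsFiniteMeasure (volume.restrict G.Ω) := inferInstanceAs (IsFiniteMeasure G.vol)
  exact h.integrable (by norm_num)

/-- The test functions in the first condition of `U₀` need not vanish near ∂Ω, so the extension by
zero creates no singular part there. Hence Z has to avoid the closure of Γ but need not lie in Ω. -/
theorem hasWeakGradOn_ext {v : G.Disp} (hv : v ∈ G.U₀) (i : Fin d) {Z : Set (Vec d)}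
    (hZ : Disjoint Z (closure G.Γ)) : HasWeakGradOn (G.extVal v i) (G.extGrad v i) Z := by
  intro φ h1 h2 h3 j
  have h := hv.1 φ h1 h2 (hZ.mono_left h3) i j
  rw [vol, ← integral_indicator G.isOpen_Ω.measurableSet,
    ← integral_indicator G.isOpen_Ω.measurableSet] at h
  have e1 : (fun x => G.extVal v i x * pd j φ x) =
      G.Ω.indicator fun x => val v x i * pd j φ x := by
    ext x; by_cases hx : x ∈ G.Ω <;> simp [extVal, hx]
  have e2 : (fun x => G.extGrad v i x j * φ x) =
      G.Ω.indicator fun x => grad v x (i, j) * φ x := by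
    ext x; by_cases hx : x ∈ G.Ω <;> simp [extGrad, hx]
  rw [e1, e2]
  exact h

/-- Green's formula in a chart. -/
theorem green_chart {v : G.Disp} (hv : v ∈ G.U₀) {k : Fin G.numFrac} {a : Side} {e : Vec d}
    (he : a.sign * ⟪e, G.normal k⟫ < 0) {κ : ℝ≥0}
    (hκ : Measure.map (chart (G.frame k) e) volume = κ • volume) (i : Fin d)
    {ψ : Vec (d - 1) → ℝ} {χ : ℝ → ℝ} (hψ : ContDiff ℝ ∞ ψ) (hψc : HasCompactSupport ψ)
    (hχ : ContDiff ℝ ∞ χ) (hχc : HasCompactSupport χ)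
    (hadm : ∀ q ∈ tsupport ψ ×ˢ tsupport χ, q.1 ∈ G.shape k ∧
      (q.2 ≠ 0 → chart (G.frame k) e q ∈ G.Ω \ closure G.Γ)) :
    ∫ q : Vec (d - 1) × ℝ, (Ioi (0 : ℝ)).indicator (fun t =>
        G.extVal v i (chart (G.frame k) e (q.1, t)) * (ψ q.1 * deriv χ t)
        + ⟪G.extGrad v i (chart (G.frame k) e (q.1, t)), e⟫ * (ψ q.1 * χ t)) q.2 =
      κ * (a.sign * ⟪e, G.normal k⟫ *
        ∫ z in G.shape k, tr a v (G.frame k z) i * (ψ z * χ 0)) := by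
  have hen : ⟪e, G.normal k⟫ ≠ 0 := fun h => by rw [h, mul_zero] at he; exact lt_irrefl _ he
  have hd1 := G.one_le_dim k
  have hhom := isHomeomorph_chart hd1 (G.normal_orth k) hen
  obtain ⟨L, hL⟩ := exists_chart_eq hd1 (G.normal_orth k) hen
  set Ψ := chart (G.frame k) e with hΨ
  let inv : Vec d → Vec (d - 1) × ℝ := fun x => L.symm (x - G.frame k 0)
  have hinv : ∀ q, inv (Ψ q) = q := by
    intro q; simp [inv, hL]
  have hinv' : ∀ x, Ψ (inv x) = x := by
    intro x; simp [inv, hL]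
  let Φ : Vec d → ℝ := fun x => ψ (inv x).1 * χ (inv x).2
  have hΦΨ : ∀ q, Φ (Ψ q) = ψ q.1 * χ q.2 := by intro q; simp only [Φ, hinv]
  have hinvs : ContDiff ℝ ∞ inv := L.symm.contDiff.comp (contDiff_id.sub contDiff_const)
  have hΦ : ContDiff ℝ ∞ Φ :=
    (hψ.comp (contDiff_fst.comp hinvs)).mul (hχ.comp (contDiff_snd.comp hinvs))
  have hcomp : IsCompact (Ψ '' (tsupport ψ ×ˢ tsupport χ)) :=
    (hψc.isCompact.prod hχc.isCompact).image hhom.continuous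
  have hsupp : tsupport Φ ⊆ Ψ '' (tsupport ψ ×ˢ tsupport χ) := by
    apply closure_minimal _ hcomp.isClosed
    intro x hx
    have hx' : ψ (inv x).1 * χ (inv x).2 ≠ 0 := hx
    exact ⟨inv x, ⟨subset_tsupport _ (left_ne_zero_of_mul hx'),
      subset_tsupport _ (right_ne_zero_of_mul hx')⟩, hinv' x⟩
  have hΦc : HasCompactSupport Φ := hcomp.of_isClosed_subset (isClosed_tsupport _) hsupp
  -- In the closed half-space the transversal coordinate is nonnegative: where it vanishes the point
  -- is on the fracture, elsewhere `hadm` applies.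
  have hadm' : tsupport Φ ∩ closure (G.halfSpace k a) ⊆
      G.frac k ∪ (G.halfSpace k a ∩ (G.Ω \ closure G.Γ)) := by
    rintro x ⟨hx1, hx2⟩
    obtain ⟨q, hq, rfl⟩ := hsupp hx1
    obtain ⟨hq1, hq2⟩ := hadm q hq
    have h3 : a.sign * G.planeDist k (Ψ q) ≤ 0 := G.closure_halfSpace_subset k a hx2
    have h4 : G.planeDist k (G.frame k q.1) = 0 := G.normal_orth k q.1 0
    rw [hΨ, planeDist_chart, h4, zero_add, mul_left_comm] at h3
    have h5 : 0 ≤ q.2 := by by_contra h'; push Not at h'; nlinarith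
    rcases h5.eq_or_lt with h5 | h5
    · left
      refine ⟨q.1, hq1, ?_⟩
      simp [hΨ, chart, ← h5]
    · right
      exact ⟨(G.chart_mem_halfSpace_iff he q).2 h5, hq2 h5.ne'⟩
  have hderiv : ∀ q, fderiv ℝ Φ (Ψ q) e = ψ q.1 * deriv χ q.2 := by
    intro q
    have h1 : HasDerivAt (fun s : ℝ => Ψ (q.1, s)) e q.2 := by
      simpa [hΨ, chart] using ((hasDerivAt_id q.2).smul_const e).const_add (G.frame k q.1)
    have h2 : HasDerivAt (fun s : ℝ => Φ (Ψ (q.1, s))) (fderiv ℝ Φ (Ψ q) e) q.2 :=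
      HasFDerivAt.comp_hasDerivAt (l := Φ) (f := fun s : ℝ => Ψ (q.1, s)) q.2
        (hΦ.differentiable (by simp) (Ψ q)).hasFDerivAt h1
    have h3 : HasDerivAt (fun s : ℝ => Φ (Ψ (q.1, s))) (ψ q.1 * deriv χ q.2) q.2 := by
      simp only [hΦΨ]
      exact (hχ.differentiable (by simp) q.2).hasDerivAt.const_mul _
    exact h2.unique h3
  have hgreen : ∫ x in G.halfSpace k a, (val v x i * fderiv ℝ Φ x e +
      ⟪(WithLp.toLp 2 fun j => grad v x (i, j) : Vec d), e⟫ * Φ x) ∂G.vol =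
      a.sign * ⟪e, G.normal k⟫ * ∫ x in G.frac k, tr a v x i * Φ x ∂G.surf := by
    have h := hv.2 k a Φ hΦ hΦc hadm' i
    have hvi : Integrable (fun x => val v x i) G.vol :=
      ((EuclideanSpace.proj (𝕜 := ℝ) i).comp_memLp' (memLp_val v)).integrable (by norm_num)
    have hgi : ∀ j, Integrable (fun x => grad v x (i, j)) G.vol := fun j =>
      ((EuclideanSpace.proj (𝕜 := ℝ) (i, j)).comp_memLp' (memLp_grad v)).integrable (by norm_num)
    have hint : ∀ j, Integrable (fun x => val v x i * pd j Φ x + grad v x (i, j) * Φ x)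
        (G.vol.restrict (G.halfSpace k a)) := by
      intro j
      have c1 : Continuous (pd j Φ) :=
        (hΦ.continuous_fderiv (by simp)).clm_apply continuous_const
      have c2 : HasCompactSupport (pd j Φ) := hΦc.fderiv_apply ℝ _
      obtain ⟨C1, hC1⟩ := c2.exists_bound_of_continuous c1
      obtain ⟨C2, hC2⟩ := hΦc.exists_bound_of_continuous hΦ.continuous
      exact ((hvi.mul_bdd c1.aestronglyMeasurable (ae_of_all _ hC1)).add
        ((hgi j).mul_bdd hΦ.continuous.aestronglyMeasurable (ae_of_all _ hC2))).integrableOn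
    -- Green's formula in direction e is the combination, with coefficients e j, of the formulas for
    -- the partial derivatives.
    have hsum : ∀ x, val v x i * fderiv ℝ Φ x e +
        ⟪(WithLp.toLp 2 fun j => grad v x (i, j) : Vec d), e⟫ * Φ x =
        ∑ j, e j * (val v x i * pd j Φ x + grad v x (i, j) * Φ x) := by
      intro x
      rw [fderiv_eq_sum_pd, PiLp.inner_apply, Finset.mul_sum, Finset.sum_mul,
        ← Finset.sum_add_distrib]
      refine Finset.sum_congr rfl fun j _ => ?_
      simp only [RCLike.inner_apply, conj_trivial]; ring
    simp only [hsum]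
    rw [integral_finsetSum _ fun j _ => (hint j).const_mul _]
    simp only [integral_const_mul, h]
    rw [PiLp.inner_apply, Finset.mul_sum, Finset.sum_mul]
    refine Finset.sum_congr rfl fun j _ => ?_
    simp only [RCLike.inner_apply, conj_trivial]; ring
  have hR : ∫ x in G.frac k, tr a v x i * Φ x ∂G.surf =
      ∫ z in G.shape k, tr a v (G.frame k z) i * (ψ z * χ 0) := by
    rw [surf_restrict_frac, (G.measurableEmbedding_frame k).integral_map]
    refine integral_congr_ae (ae_of_all _ fun z => ?_)
    have : G.frame k z = Ψ (z, 0) := by simp [hΨ, chart]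
    simp only
    rw [this, hΦΨ]
  rw [← hR, ← hgreen, vol, Measure.restrict_restrict (G.isOpen_halfSpace k a).measurableSet,
    ← integral_indicator ((G.isOpen_halfSpace k a).inter G.isOpen_Ω).measurableSet]
  have hemb : MeasurableEmbedding Ψ := hhom.homeomorph.measurableEmbedding
  have hchange : ∀ F : Vec d → ℝ, ∫ q, F (Ψ q) = κ * ∫ x, F x := by
    intro F
    rw [← hemb.integral_map, hκ, integral_smul_nnreal_measure]; rfl
  rw [← hchange]
  refine integral_congr_ae (ae_of_all _ fun q => ?_)
  simp only
  by_cases hq : 0 < q.2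
  · rw [indicator_of_mem (by exact hq)]
    by_cases hΩ : Ψ q ∈ G.Ω
    · have hmem : Ψ q ∈ G.halfSpace k a ∩ G.Ω := ⟨(G.chart_mem_halfSpace_iff he q).2 hq, hΩ⟩
      rw [indicator_of_mem hmem, hderiv, hΦΨ]
      simp only [extVal, extGrad, indicator_of_mem hΩ]
    · rw [indicator_of_notMem (fun h => hΩ h.2)]
      simp only [extVal, extGrad, indicator_of_notMem hΩ]
      simp
  · rw [indicator_of_notMem (by exact hq), indicator_of_notMem]
    exact fun h => hq ((G.chart_mem_halfSpace_iff he q).1 h.1)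

end FractureNetwork

end PoroMech

end

/-! ### Traces as limits of transversal averages -/

noncomputable section

namespace PoroMech

open Filter Topology NNReal

variable {d : ℕ}

namespace FractureNetwork

variable {G : FractureNetwork d}

theorem integrable_tr_frame (a : Side) (v : G.Disp) (k : Fin G.numFrac) (i : Fin d) :
    IntegrableOn (fun z => tr a v (G.frame k z) i) (G.shape k) := by
  have h : Integrable (fun x => tr a v x i) G.surf :=
    ((EuclideanSpace.proj (𝕜 := ℝ) i).comp_memLp' (memLp_tr a v)).integrable (by norm_num)
  have h2 : Integrable (fun x => tr a v x i) (G.surf.restrict (G.frac k)) := h.integrableOn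
  rw [surf_restrict_frac, (G.measurableEmbedding_frame k).integrable_map_iff] at h2
  exact h2

/-- Near the fracture, the trace is bounded by averages over short transversal segments. -/
theorem enorm_tr_le {k : Fin G.numFrac} {a : Side} {e : Vec d}
    (he : a.sign * ⟪e, G.normal k⟫ < 0) :
    ∃ C : ℝ≥0, ∀ v ∈ G.U₀, ∀ i, ∀ᵐ z, z ∈ G.shape k \ G.excPts k →
      ∀ᶠ m : ℕ in atTop, ‖tr a v (G.frame k z) i‖ₑ ≤
        C * (m * (∫⁻ t in Ioc 0 (1 / (m : ℝ)), ‖G.extVal v i (chart (G.frame k) e (z, t))‖ₑ) +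
          ∫⁻ t in Ioc 0 (1 / (m : ℝ)), ‖G.extGrad v i (chart (G.frame k) e (z, t))‖ₑ) := by
  have hen : ⟪e, G.normal k⟫ ≠ 0 := fun h => by rw [h, mul_zero] at he; exact lt_irrefl _ he
  have hd1 := G.one_le_dim k
  have hhom := isHomeomorph_chart hd1 (G.normal_orth k) hen
  have hemb : MeasurableEmbedding (chart (G.frame k) e) := hhom.homeomorph.measurableEmbedding
  obtain ⟨κ, hκ0, hκ⟩ := exists_map_chart hd1 (G.normal_orth k) hen
  let χ : ContDiffBump (0 : ℝ) := ⟨1 / 2, 1, by norm_num, by norm_num⟩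
  have hχ : ContDiff ℝ ∞ χ := χ.contDiff
  obtain ⟨C₁, hC₁⟩ := (χ.hasCompactSupport.deriv).exists_bound_of_continuous
    (hχ.continuous_deriv (by simp))
  set c : ℝ := κ * (a.sign * ⟪e, G.normal k⟫) with hc
  have hc0 : c ≠ 0 := mul_ne_zero (by exact_mod_cast hκ0) he.ne
  let M : ℝ≥0 := C₁.toNNReal + ‖e‖₊
  refine ⟨‖c‖₊⁻¹ * M, fun v hv i => ?_⟩
  -- Cutoffs equal to 1 on the fracture and 0 beyond height 1/m; their slope of order m gives the
  -- factor m in front of the integral of the values.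
  let χm : ℕ → ℝ → ℝ := fun m t => χ (m * t)
  have hχm : ∀ m, ContDiff ℝ ∞ (χm m) := fun m => hχ.comp (contDiff_const.mul contDiff_id)
  have hχm' : ∀ m t, deriv (χm m) t = m * deriv χ (m * t) := by
    intro m t
    have h1 : HasDerivAt (fun t : ℝ => (m : ℝ) * t) m t := by
      simpa using (hasDerivAt_id t).const_mul (m : ℝ)
    have h2 := ((hχ.differentiable (by simp)) (m * t)).hasDerivAt.comp t h1
    rw [mul_comm]
    exact h2.deriv
  have hsupp : ∀ m : ℕ, 1 ≤ m → ∀ t, 1 / (m : ℝ) < |t| → χm m t = 0 ∧ deriv (χm m) t = 0 := by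
    intro m hm t ht
    have hm0 : (0 : ℝ) < m := by exact_mod_cast hm
    have h1 : (1 : ℝ) < |m * t| := by
      rw [abs_mul, abs_of_pos hm0]; rw [div_lt_iff₀ hm0] at ht; linarith
    have h2 : (m * t : ℝ) ∉ tsupport χ := by
      rw [χ.tsupport_eq, Metric.mem_closedBall, dist_zero_right, Real.norm_eq_abs]
      exact not_le.2 h1
    refine ⟨image_eq_zero_of_notMem_tsupport (f := χ) h2, ?_⟩
    rw [hχm', image_eq_zero_of_notMem_tsupport (fun h => h2 (tsupport_deriv_subset h)), mul_zero]
  have htsupp : ∀ m : ℕ, 1 ≤ m → tsupport (χm m) ⊆ Icc (-(1 / (m : ℝ))) (1 / m) := by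
    intro m hm
    apply closure_minimal _ isClosed_Icc
    intro t ht
    rw [mem_Icc, ← abs_le]
    by_contra h
    exact ht (hsupp m hm t (not_le.1 h)).1
  have hχmc : ∀ m : ℕ, 1 ≤ m → HasCompactSupport (χm m) := fun m hm =>
    isCompact_Icc.of_isClosed_subset (isClosed_tsupport _) (htsupp m hm)
  have hχm0 : ∀ m, χm m 0 = 1 := fun m => by
    simp only [χm, mul_zero]
    exact χ.one_of_mem_closedBall (by simp [χ])
  let J : ℕ → Vec (d - 1) × ℝ → ℝ := fun m q =>
    G.extVal v i (chart (G.frame k) e q) * (Ioi (0 : ℝ)).indicator (deriv (χm m)) q.2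
      + ⟪G.extGrad v i (chart (G.frame k) e q), e⟫ * (Ioi (0 : ℝ)).indicator (χm m) q.2
  have hJint : ∀ m : ℕ, 1 ≤ m → Integrable (J m) := by
    intro m hm
    have w1 : Integrable fun q => G.extVal v i (chart (G.frame k) e q) := by
      have : Integrable (G.extVal v i) (Measure.map (chart (G.frame k) e) volume) := by
        rw [hκ]; exact (integrable_extVal v i).smul_measure (by simp)
      exact (hemb.integrable_map_iff).1 this
    have w2 : Integrable fun q => ⟪G.extGrad v i (chart (G.frame k) e q), e⟫ := by
      have : Integrable (G.extGrad v i) (Measure.map (chart (G.frame k) e) volume) := by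
        rw [hκ]; exact (integrable_extGrad v i).smul_measure (by simp)
      exact ((hemb.integrable_map_iff).1 this).inner_const e
    have c1 := (hχm m).continuous_deriv (by simp)
    have c2 := (hχm m).continuous
    obtain ⟨B1, hB1⟩ := (hχmc m hm).deriv.exists_bound_of_continuous c1
    obtain ⟨B2, hB2⟩ := (hχmc m hm).exists_bound_of_continuous c2
    refine (w1.mul_bdd (c := B1) ?_ (ae_of_all _ fun q => ?_)).add
      (w2.mul_bdd (c := B2) ?_ (ae_of_all _ fun q => ?_))
    · exact ((c1.measurable.indicator measurableSet_Ioi).comp measurable_snd).aestronglyMeasurable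
    · exact (norm_indicator_le_norm_self _ _).trans (hB1 _)
    · exact ((c2.measurable.indicator measurableSet_Ioi).comp measurable_snd).aestronglyMeasurable
    · exact (norm_indicator_le_norm_self _ _).trans (hB2 _)
  -- The defect in the identity between the trace and the transversal integral of J m. It vanishes
  -- locally because Green's formula makes its integral against every admissible ψ vanish.
  let T : ℕ → Vec (d - 1) → ℝ := fun m z =>
    c * (G.shape k).indicator (fun z => tr a v (G.frame k z) i) z - ∫ t, J m (z, t)
  have hshape : MeasurableSet (G.shape k) := (G.shape_polytopal k).isOpen.measurableSet
  have hTint : ∀ m : ℕ, 1 ≤ m → Integrable (T m) := fun m hm =>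
    (((integrable_tr_frame a v k i).integrable_indicator hshape).const_mul c).sub
      (hJint m hm).integral_prod_left
  -- Green's formula is available only if the supports of ψ and χm stay in a neighbourhood of z₀
  -- free of other fractures, so the threshold on m depends on z₀.
  have hlocal : ∀ z₀ ∈ G.shape k \ G.excPts k, ∃ δ > 0, ∀ᵐ z, z ∈ Metric.ball z₀ δ →
      ∀ᶠ m : ℕ in atTop, T m z = 0 := by
    intro z₀ hz₀
    obtain ⟨δ, hδ, hball⟩ := Metric.eventually_nhds_iff_ball.1
      (G.eventually_chart_mem hen hz₀.1 hz₀.2)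
    refine ⟨δ, hδ, ?_⟩
    obtain ⟨m₀, hm₀⟩ := exists_nat_gt (1 / δ)
    have hm₀0 : (0 : ℝ) < m₀ := lt_trans (by positivity) hm₀
    have hall : ∀ m : ℕ, m₀ ≤ m → ∀ᵐ z, z ∈ Metric.ball z₀ δ → T m z = 0 := by
      intro m hm
      have hm' : (m₀ : ℝ) ≤ m := by exact_mod_cast hm
      have hm1 : 1 ≤ m := by
        have : (0 : ℝ) < m := by linarith
        exact_mod_cast this
      have hmδ : 1 / (m : ℝ) < δ := by
        rw [div_lt_iff₀ (by linarith)]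
        rw [div_lt_iff₀ hδ] at hm₀
        nlinarith
      apply Metric.isOpen_ball.ae_eq_zero_of_integral_contDiff_smul_eq_zero
        ((hTint m hm1).locallyIntegrable.locallyIntegrableOn _)
      intro ψ hψ hψc hψs
      have hadm : ∀ q ∈ tsupport ψ ×ˢ tsupport (χm m), q.1 ∈ G.shape k ∧
          (q.2 ≠ 0 → chart (G.frame k) e q ∈ G.Ω \ closure G.Γ) := by
        rintro ⟨z, t⟩ ⟨hz, ht⟩
        apply hball
        rw [← ball_prod_same]
        refine ⟨hψs hz, ?_⟩
        rw [Metric.mem_ball, dist_zero_right, Real.norm_eq_abs]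
        exact (abs_le.2 (htsupp m hm1 ht)).trans_lt hmδ
      have hg := green_chart hv he hκ i hψ hψc (hχm m) (hχmc m hm1) hadm
      obtain ⟨Bψ, hBψ⟩ := hψc.exists_bound_of_continuous hψ.continuous
      have hL : ∫ q : Vec (d - 1) × ℝ, (Ioi (0 : ℝ)).indicator (fun t =>
          G.extVal v i (chart (G.frame k) e (q.1, t)) * (ψ q.1 * deriv (χm m) t)
          + ⟪G.extGrad v i (chart (G.frame k) e (q.1, t)), e⟫ * (ψ q.1 * χm m t)) q.2 =
          ∫ z, ψ z * ∫ t, J m (z, t) := by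
        have h1 : ∀ q : Vec (d - 1) × ℝ, (Ioi (0 : ℝ)).indicator (fun t =>
          G.extVal v i (chart (G.frame k) e (q.1, t)) * (ψ q.1 * deriv (χm m) t)
          + ⟪G.extGrad v i (chart (G.frame k) e (q.1, t)), e⟫ * (ψ q.1 * χm m t)) q.2 =
          ψ q.1 * J m q := by
          intro q
          by_cases hq : q.2 ∈ Ioi (0 : ℝ)
          · simp only [J, indicator_of_mem hq]; ring
          · simp only [J, indicator_of_notMem hq]; ring
        simp only [h1]
        rw [Measure.volume_eq_prod, integral_prod]
        · simp only [integral_const_mul]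
        · exact (hJint m hm1).bdd_mul (c := Bψ)
            (hψ.continuous.comp continuous_fst).aestronglyMeasurable (ae_of_all _ fun q => hBψ _)
      rw [hL, hχm0] at hg
      simp only [T, smul_eq_mul, mul_sub]
      have i1 : Integrable fun z => ψ z * (c * (G.shape k).indicator
          (fun z => tr a v (G.frame k z) i) z) :=
        (((integrable_tr_frame a v k i).integrable_indicator hshape).const_mul c).bdd_mul (c := Bψ)
          hψ.continuous.aestronglyMeasurable (ae_of_all _ hBψ)
      have i2 : Integrable fun z => ψ z * ∫ t, J m (z, t) :=
        (hJint m hm1).integral_prod_left.bdd_mul (c := Bψ)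
          hψ.continuous.aestronglyMeasurable (ae_of_all _ hBψ)
      rw [integral_sub i1 i2, hg, sub_eq_zero, ← integral_indicator hshape, ← mul_assoc, ← hc,
        ← integral_const_mul]
      refine integral_congr_ae (ae_of_all _ fun z => ?_)
      by_cases hz : z ∈ G.shape k
      · simp only [indicator_of_mem hz]; ring
      · simp only [indicator_of_notMem hz]; ring
    have hall' : ∀ᵐ z, ∀ m : ℕ, m₀ ≤ m → z ∈ Metric.ball z₀ δ → T m z = 0 := by
      refine ae_all_iff.2 fun m => ?_
      by_cases hm : m₀ ≤ m
      · filter_upwards [hall m hm] with z hz _ using hz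
      · exact ae_of_all _ fun z h => absurd h hm
    filter_upwards [hall'] with z hz hzb
    exact eventually_atTop.2 ⟨m₀, fun m hm => hz m hm hzb⟩
  -- A set that is null near each of its points is null.
  have hglobal : ∀ᵐ z, z ∈ G.shape k \ G.excPts k → ∀ᶠ m : ℕ in atTop, T m z = 0 := by
    rw [ae_iff]
    apply measure_null_of_locally_null
    intro z₀ hz₀
    simp only [Classical.not_imp, mem_ofPred_eq] at hz₀
    obtain ⟨δ, hδ, hb⟩ := hlocal z₀ hz₀.1
    refine ⟨_, inter_mem_nhdsWithin _ (Metric.ball_mem_nhds z₀ hδ), ?_⟩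
    rw [ae_iff] at hb
    refine measure_mono_null ?_ hb
    rintro z ⟨hz1, hz2⟩
    simp only [Classical.not_imp, mem_ofPred_eq] at hz1 ⊢
    exact ⟨hz2, hz1.2⟩
  filter_upwards [hglobal] with z hz hzs
  filter_upwards [hz hzs, eventually_ge_atTop 1] with m hT hm1
  have hm0 : (0 : ℝ) < m := by exact_mod_cast hm1
  simp only [T, indicator_of_mem hzs.1] at hT
  have hle : ‖c‖ₑ * ‖tr a v (G.frame k z) i‖ₑ ≤ M *
      (m * (∫⁻ t in Ioc 0 (1 / (m : ℝ)), ‖G.extVal v i (chart (G.frame k) e (z, t))‖ₑ) +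
          ∫⁻ t in Ioc 0 (1 / (m : ℝ)), ‖G.extGrad v i (chart (G.frame k) e (z, t))‖ₑ) := by
    rw [← enorm_mul, sub_eq_zero.1 hT]
    refine (enorm_integral_le_lintegral_enorm _).trans ?_
    have hmeas : Measurable fun t : ℝ => chart (G.frame k) e (z, t) :=
      hemb.measurable.comp measurable_prodMk_left
    have m1 : Measurable fun t : ℝ => ‖G.extVal v i (chart (G.frame k) e (z, t))‖ₑ :=
      ((measurable_extVal v i).comp hmeas).enorm
    have hpt : ∀ t, ‖J m (z, t)‖ₑ ≤ (Ioc 0 (1 / (m : ℝ))).indicator (fun t => M *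
        (m * ‖G.extVal v i (chart (G.frame k) e (z, t))‖ₑ +
          ‖G.extGrad v i (chart (G.frame k) e (z, t))‖ₑ)) t := by
      intro t
      by_cases ht : t ∈ Ioc 0 (1 / (m : ℝ))
      · rw [indicator_of_mem ht]
        have ht0 : t ∈ Ioi (0 : ℝ) := ht.1
        simp only [J, indicator_of_mem ht0]
        have b1 : ‖deriv (χm m) t‖ₑ ≤ M * m := by
          rw [hχm', mul_comm, enorm_mul]
          have h1 : ‖deriv χ (m * t)‖ₑ ≤ M := by
            rw [enorm_eq_nnnorm]
            have : ‖deriv χ (m * t)‖₊ ≤ C₁.toNNReal := by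
              rw [← NNReal.coe_le_coe, coe_nnnorm]
              exact (hC₁ _).trans (Real.le_coe_toNNReal _)
            exact_mod_cast this.trans le_self_add
          have h2 : ‖(m : ℝ)‖ₑ = m := by
            rw [Real.enorm_eq_ofReal hm0.le, ENNReal.ofReal_natCast]
          rw [h2]
          gcongr
        have b2 : ‖χm m t‖ₑ ≤ 1 := by
          rw [Real.enorm_eq_ofReal (χ.nonneg), ENNReal.ofReal_le_one]
          exact χ.le_one
        have b3 : ‖⟪G.extGrad v i (chart (G.frame k) e (z, t)), e⟫‖ₑ ≤
            M * ‖G.extGrad v i (chart (G.frame k) e (z, t))‖ₑ := by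
          have h1 : ‖⟪G.extGrad v i (chart (G.frame k) e (z, t)), e⟫‖₊ ≤
              ‖G.extGrad v i (chart (G.frame k) e (z, t))‖₊ * ‖e‖₊ := nnnorm_inner_le_nnnorm _ _
          have h2 : ‖e‖₊ ≤ M := le_add_self
          rw [mul_comm]
          simp only [enorm_eq_nnnorm]
          exact_mod_cast h1.trans (mul_le_mul_right h2 _)
        calc _ ≤ ‖G.extVal v i (chart (G.frame k) e (z, t))‖ₑ * ‖deriv (χm m) t‖ₑ +
              ‖⟪G.extGrad v i (chart (G.frame k) e (z, t)), e⟫‖ₑ * ‖χm m t‖ₑ := by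
              refine (enorm_add_le _ _).trans ?_
              rw [enorm_mul, enorm_mul]
          _ ≤ ‖G.extVal v i (chart (G.frame k) e (z, t))‖ₑ * (M * m) +
              (M * ‖G.extGrad v i (chart (G.frame k) e (z, t))‖ₑ) * 1 := by
              gcongr
          _ = _ := by ring
      · rw [indicator_of_notMem ht]
        have : J m (z, t) = 0 := by
          by_cases ht0 : t ∈ Ioi (0 : ℝ)
          · have : 1 / (m : ℝ) < |t| := by
              rw [abs_of_pos ht0]; by_contra h; exact ht ⟨ht0, not_lt.1 h⟩
            simp only [J, indicator_of_mem ht0, (hsupp m hm1 t this).1, (hsupp m hm1 t this).2]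
            ring
          · simp only [J, indicator_of_notMem ht0]; ring
        rw [this, enorm_zero]
    refine (lintegral_mono hpt).trans (le_of_eq ?_)
    rw [lintegral_indicator measurableSet_Ioc, lintegral_const_mul' _ _ ENNReal.coe_ne_top,
      lintegral_add_left (m1.const_mul _), lintegral_const_mul' _ _ (by simp)]
  have hce : ‖c‖ₑ ≠ 0 := by simpa using hc0
  rw [ENNReal.coe_mul, ENNReal.coe_inv (by simpa using hc0), mul_assoc, ← enorm_eq_nnnorm,
    ← ENNReal.mul_le_iff_le_inv hce enorm_ne_top]
  exact hle

end FractureNetwork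

end PoroMech

end

/-! ### L⁴ bound for the trace on one fracture -/

noncomputable section

namespace PoroMech

open Filter Topology NNReal

variable {d : ℕ}

theorem eLpNorm_natCast_pow {α E : Type*} [MeasurableSpace α] [NormedAddCommGroup E] (f : α → E)
    (μ : Measure α) {n : ℕ} (hn : n ≠ 0) : eLpNorm f n μ ^ n = ∫⁻ x, ‖f x‖ₑ ^ n ∂μ := by
  have := eLpNorm_nnreal_pow_eq_lintegral (f := f) (μ := μ) (p := n) (by exact_mod_cast hn)
  simpa only [NNReal.coe_natCast, ENNReal.rpow_natCast, ENNReal.coe_natCast] using this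

namespace FractureNetwork

variable {G : FractureNetwork d}

theorem lintegral_extVal_sq_le (v : G.Disp) (i : Fin d) :
    ∫⁻ x, ‖G.extVal v i x‖ₑ ^ 2 ≤ ∫⁻ x, ‖val v x‖ₑ ^ 2 ∂G.vol := by
  have : (fun x => ‖G.extVal v i x‖ₑ ^ 2) = G.Ω.indicator fun x => ‖val v x i‖ₑ ^ 2 := by
    ext x; by_cases hx : x ∈ G.Ω <;> simp [extVal, hx]
  rw [this, lintegral_indicator G.isOpen_Ω.measurableSet]
  apply lintegral_mono fun x => ?_
  gcongr
  rw [enorm_le_iff_norm_le]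
  exact PiLp.norm_apply_le _ i

theorem lintegral_extGrad_sq_le (v : G.Disp) (i : Fin d) :
    ∫⁻ x, ‖G.extGrad v i x‖ₑ ^ 2 ≤ ∫⁻ x, ‖grad v x‖ₑ ^ 2 ∂G.vol := by
  have : (fun x => ‖G.extGrad v i x‖ₑ ^ 2) = G.Ω.indicator fun x =>
      ‖(WithLp.toLp 2 fun j => grad v x (i, j) : Vec d)‖ₑ ^ 2 := by
    ext x; by_cases hx : x ∈ G.Ω <;> simp [extGrad, hx]
  rw [this, lintegral_indicator G.isOpen_Ω.measurableSet]
  apply lintegral_mono fun x => ?_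
  gcongr
  rw [enorm_le_iff_norm_le]
  exact norm_row_le _ i

/-- For pieces from which direction e leads into a convex cell Z. By `enorm_tr_le` the trace is
bounded by the average of the function over heights in (0, 1/m] plus a gradient integral that tends
to 0 for almost every z. Jensen's inequality moves the fourth power inside the average, Fatou's
lemma moves the limit outside the integral over S, and after exchanging the integrals each slice is
bounded by `slice_weak`. -/
theorem lintegral_tr_piece_le (hd : d = 2 ∨ d = 3) {k : Fin G.numFrac} {a : Side} {e : Vec d}
    (he : a.sign * ⟪e, G.normal k⟫ < 0) {y₀ : Vec d} {r R : ℝ} (hr : 0 < r)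
    {Z : Set (Vec d)} (hZo : IsOpen Z) (hZc : Convex ℝ Z) (hZr : Metric.ball y₀ r ⊆ Z)
    (hZR : Z ⊆ Metric.ball 0 R) (hZΓ : Disjoint Z (closure G.Γ)) {S : Set (Vec (d - 1))}
    (hSm : MeasurableSet S) (hS : S ⊆ G.shape k \ G.excPts k)
    (hSZ : ∀ z ∈ S, ∀ t ∈ Ioc (0 : ℝ) 1, chart (G.frame k) e (z, t) ∈ Z) :
    ∃ K : ℝ≥0, ∀ v ∈ G.U₀, ∀ i, ∫⁻ z in S, ‖tr a v (G.frame k z) i‖ₑ ^ 4 ≤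
      K * ((∫⁻ x, ‖val v x‖ₑ ^ 2 ∂G.vol) + ∫⁻ x, ‖grad v x‖ₑ ^ 2 ∂G.vol) ^ 2 := by
  have hen : ⟪e, G.normal k⟫ ≠ 0 := fun h => by rw [h, mul_zero] at he; exact lt_irrefl _ he
  have hd1 := G.one_le_dim k
  have hhom := isHomeomorph_chart hd1 (G.normal_orth k) hen
  have hemb : MeasurableEmbedding (chart (G.frame k) e) := hhom.homeomorph.measurableEmbedding
  obtain ⟨κ, hκ0, hκ⟩ := exists_map_chart hd1 (G.normal_orth k) hen
  obtain ⟨C, hC⟩ := enorm_tr_le (G := G) he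
  obtain ⟨K, hK⟩ := slice_weak hd (G.normal_orth k) hen hr hZo hZc hZr hZR
  refine ⟨C ^ 4 * K, fun v hv i => ?_⟩
  set Q := ((∫⁻ x, ‖val v x‖ₑ ^ 2 ∂G.vol) + ∫⁻ x, ‖grad v x‖ₑ ^ 2 ∂G.vol) with hQ
  let w : Vec (d - 1) × ℝ → ℝ := fun q => G.extVal v i (chart (G.frame k) e q)
  have hw : Measurable w := (measurable_extVal v i).comp hemb.measurable
  let I : ℕ → Set ℝ := fun m => Ioc 0 (1 / (m : ℝ))
  have hIvol : ∀ m, volume (I m) = ENNReal.ofReal (1 / m) := fun m => by simp [I]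
  have hslice : ∀ᵐ t : ℝ, t ∈ Ioo (0 : ℝ) (1 / 2) →
      ∫⁻ z in S, ‖w (z, t)‖ₑ ^ 4 ≤ K * Q ^ 2 := by
    filter_upwards [hK (G.extVal v i) (G.extGrad v i) (measurable_extVal v i)
      (measurable_extGrad v i) (memLp_extVal v i) (memLp_extGrad v i)
      (hasWeakGradOn_ext hv i hZΓ)] with t h ht
    refine (lintegral_mono_set fun z hz => ?_).trans ((h ht).trans ?_)
    · exact ⟨hSZ z hz t ⟨ht.1, by linarith [ht.2]⟩, hSZ z hz 1 (by simp)⟩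
    · exact mul_le_mul_right (pow_le_pow_left' (add_le_add (lintegral_extVal_sq_le v i)
        (lintegral_extGrad_sq_le v i)) 2) _
  have hgfin : ∀ᵐ z, ∫⁻ t, ‖G.extGrad v i (chart (G.frame k) e (z, t))‖ₑ ≠ ⊤ := by
    have : Integrable (G.extGrad v i) (Measure.map (chart (G.frame k) e) volume) := by
      rw [hκ]; exact (integrable_extGrad v i).smul_measure (by simp)
    filter_upwards [((hemb.integrable_map_iff).1 this).prod_right_ae] with z hz
    exact hz.2.ne
  have hIt : Tendsto (fun m => volume (I m)) atTop (𝓝 0) := by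
    simp only [hIvol]
    have : Tendsto (fun m : ℕ => ENNReal.ofReal (1 / m)) atTop (𝓝 (ENNReal.ofReal 0)) :=
      ENNReal.tendsto_ofReal tendsto_one_div_atTop_nhds_zero_nat
    simpa using this
  -- Subtracting the gradient integral before taking the fourth power makes it disappear in the
  -- limit, without a constant from expanding the power.
  have hpt : ∀ᵐ z, z ∈ S → ‖tr a v (G.frame k z) i‖ₑ ^ 4 ≤
      liminf (fun m : ℕ => C ^ 4 * (m * ∫⁻ t in I m, ‖w (z, t)‖ₑ ^ 4)) atTop := by
    filter_upwards [hC v hv i, hgfin] with z hz hg hzS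
    have hgt := tendsto_setLIntegral_zero hg hIt
    have h1 : Tendsto (fun m : ℕ => (‖tr a v (G.frame k z) i‖ₑ -
        C * ∫⁻ t in I m, ‖G.extGrad v i (chart (G.frame k) e (z, t))‖ₑ) ^ 4) atTop
        (𝓝 (‖tr a v (G.frame k z) i‖ₑ ^ 4)) := by
      have h2 : Tendsto (fun m : ℕ => (‖tr a v (G.frame k z) i‖ₑ -
        C * ∫⁻ t in I m, ‖G.extGrad v i (chart (G.frame k) e (z, t))‖ₑ)) atTop
        (𝓝 (‖tr a v (G.frame k z) i‖ₑ - C * 0)) :=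
        ENNReal.Tendsto.sub tendsto_const_nhds
          (ENNReal.Tendsto.const_mul hgt (Or.inr ENNReal.coe_ne_top)) (Or.inl enorm_ne_top)
      rw [mul_zero, tsub_zero] at h2
      exact ((ENNReal.continuous_pow 4).tendsto _).comp h2
    rw [← h1.liminf_eq]
    refine liminf_le_liminf ?_ (by isBoundedDefault) (by isBoundedDefault)
    filter_upwards [hz (hS hzS), eventually_ge_atTop 1] with m hm hm1
    have hm0 : (0 : ℝ) < m := by exact_mod_cast hm1
    have hmm : (m : ℝ≥0∞) * ENNReal.ofReal (1 / m) = 1 := by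
      rw [← ENNReal.ofReal_natCast, ← ENNReal.ofReal_mul hm0.le, mul_one_div_cancel hm0.ne',
        ENNReal.ofReal_one]
    -- Normalised Lebesgue measure on (0, 1/m], for Jensen's inequality.
    let ν : Measure ℝ := (m : ℝ≥0∞) • volume.restrict (I m)
    have : IsProbabilityMeasure ν := ⟨by
      simp only [ν, Measure.smul_apply, Measure.restrict_apply_univ, hIvol, smul_eq_mul, hmm]⟩
    have hν := lintegral_pow_le_of_isProbabilityMeasure ν
      (F := fun t => ‖w (z, t)‖ₑ) (hw.comp measurable_prodMk_left).enorm.aemeasurable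
      (by norm_num : 2 ≤ 4)
    simp only [ν, lintegral_smul_measure, smul_eq_mul] at hν
    calc _ ≤ (C * (m * ∫⁻ t in I m, ‖w (z, t)‖ₑ)) ^ 4 := by
          gcongr
          rw [tsub_le_iff_right, ← mul_add]
          exact hm
      _ = C ^ 4 * (m * ∫⁻ t in I m, ‖w (z, t)‖ₑ) ^ 4 := mul_pow _ _ _
      _ ≤ _ := by gcongr
  have hmeas : ∀ m : ℕ, Measurable fun z => ∫⁻ t in I m, ‖w (z, t)‖ₑ ^ 4 := fun m =>
    (hw.enorm.pow_const 4).lintegral_prod_right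
  calc _ ≤ ∫⁻ z in S, liminf (fun m : ℕ => C ^ 4 * (m * ∫⁻ t in I m, ‖w (z, t)‖ₑ ^ 4)) atTop :=
        setLIntegral_mono_ae' hSm hpt
    _ ≤ liminf (fun m : ℕ => ∫⁻ z in S, C ^ 4 * (m * ∫⁻ t in I m, ‖w (z, t)‖ₑ ^ 4)) atTop :=
        lintegral_liminf_le fun m => ((hmeas m).const_mul _).const_mul _
    _ ≤ _ := by
        apply liminf_le_of_le (by isBoundedDefault)
        intro b hb
        -- From m = 3 on, all heights involved lie in (0, 1/2), where the slice bound holds.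
        obtain ⟨m, hm, hm3⟩ := (hb.and (eventually_ge_atTop 3)).exists
        refine hm.trans ?_
        have hm0 : (0 : ℝ) < m := by exact_mod_cast (by omega : 0 < m)
        have hmm : (m : ℝ≥0∞) * ENNReal.ofReal (1 / m) = 1 := by
          rw [← ENNReal.ofReal_natCast, ← ENNReal.ofReal_mul hm0.le, mul_one_div_cancel hm0.ne',
            ENNReal.ofReal_one]
        have hsub : I m ⊆ Ioo (0 : ℝ) (1 / 2) := fun t ht => ⟨ht.1, by
          refine ht.2.trans_lt (one_div_lt_one_div_of_lt (by norm_num) ?_)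
          have : (3 : ℝ) ≤ m := by exact_mod_cast hm3
          linarith⟩
        rw [lintegral_const_mul _ ((hmeas m).const_mul _), lintegral_const_mul _ (hmeas m),
          lintegral_lintegral_swap (hw.enorm.pow_const 4).aemeasurable]
        calc (C : ℝ≥0∞) ^ 4 * (m * ∫⁻ t in I m, ∫⁻ z in S, ‖w (z, t)‖ₑ ^ 4)
            ≤ C ^ 4 * (m * ∫⁻ t in I m, K * Q ^ 2) := by
              refine mul_le_mul_right (mul_le_mul_right
                (setLIntegral_mono_ae' measurableSet_Ioc ?_) _) _
              filter_upwards [hslice] with t ht htI using ht (hsub htI)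
          _ = _ := by
              rw [lintegral_const, Measure.restrict_apply_univ, hIvol,
                mul_left_comm (m : ℝ≥0∞), hmm]
              push_cast; ring

theorem exists_side_sign_mul_neg {x : ℝ} (hx : x ≠ 0) : ∃ s : Side, s.sign * x < 0 := by
  rcases hx.lt_or_gt with h | h
  · exact ⟨.plus, by simpa [Side.sign] using h⟩
  · exact ⟨.minus, by simpa [Side.sign] using h⟩

theorem Side.eq_of_sign_mul_neg {s s' : Side} {x : ℝ} (h : s.sign * x < 0)
    (h' : s'.sign * x < 0) : s = s' := by
  cases s <;> cases s' <;> simp only [Side.sign] at h h' <;> first | rfl | linarith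

variable (G) in
/-- A cell of the arrangement of the fracture planes, inside a ball. -/
def cell (R : ℝ) (σ : Fin G.numFrac → Side) : Set (Vec d) :=
  Metric.ball 0 R ∩ ⋂ j, G.halfSpace j (σ j)

theorem isOpen_cell (R : ℝ) (σ : Fin G.numFrac → Side) : IsOpen (G.cell R σ) :=
  Metric.isOpen_ball.inter (isOpen_iInter_of_finite fun j => G.isOpen_halfSpace j (σ j))

theorem convex_cell (R : ℝ) (σ : Fin G.numFrac → Side) : Convex ℝ (G.cell R σ) :=
  (convex_ball 0 R).inter (convex_iInter fun j => G.convex_halfSpace j (σ j))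

theorem disjoint_cell (R : ℝ) (σ : Fin G.numFrac → Side) :
    Disjoint (G.cell R σ) (closure G.Γ) := by
  rw [Set.disjoint_left]
  intro x hx hx'
  obtain ⟨j, hj⟩ := G.exists_planeDist_eq_zero hx'
  have h1 : (σ j).sign * G.planeDist j x < 0 := mem_iInter.1 hx.2 j
  rw [hj, mul_zero] at h1
  exact lt_irrefl _ h1

/-- Leaving a non-exceptional fracture point along the normal towards side a, one is strictly on one
side of every plane for all short times, hence inside a single cell. -/
theorem exists_mem_closure_cell {R : ℝ} (hR : G.Ω ⊆ Metric.ball 0 R) {k : Fin G.numFrac}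
    (a : Side) {z : Vec (d - 1)} (hz : z ∈ G.shape k \ G.excPts k) :
    ∃ σ : Fin G.numFrac → Side, σ k = a ∧ G.frame k z ∈ closure (G.cell R σ) := by
  let e : Vec d := -a.sign • G.normal k
  have hek : ⟪e, G.normal k⟫ = -a.sign := by
    rw [real_inner_smul_left, real_inner_self_eq_norm_sq, G.normal_unit]; ring
  have hen : ⟪e, G.normal k⟫ ≠ 0 := by rw [hek]; exact neg_ne_zero.2 (Side.sign_ne_zero a)
  -- Its sign tells on which side of plane j the departing segment lies: the signed distance
  -- decides, or, for a plane through the point, the component of e along its normal.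
  let x : Fin G.numFrac → ℝ := fun j =>
    if G.planeDist j (G.frame k z) = 0 then ⟪e, G.normal j⟫ else G.planeDist j (G.frame k z)
  have hx : ∀ j, x j ≠ 0 := by
    intro j
    by_cases hj : G.planeDist j (G.frame k z) = 0
    · simp only [x, hj, if_true]
      apply G.inner_normal_ne_zero_of_planeDist_eq_zero hen
      intro z'; by_contra hne; exact hz.2 ⟨j, hj, z', hne⟩
    · simp only [x, hj, if_false]
      exact hj
  choose σ hσ using fun j => exists_side_sign_mul_neg (hx j)
  have hk : G.planeDist k (G.frame k z) = 0 := G.normal_orth k z 0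
  refine ⟨σ, Side.eq_of_sign_mul_neg (hσ k) ?_, ?_⟩
  · simp only [x, hk, if_true, hek]
    nlinarith [sq_pos_of_ne_zero (Side.sign_ne_zero a)]
  have hcont : Continuous fun s : ℝ => chart (G.frame k) e (z, s) := by
    simp only [chart]; fun_prop
  have h0 : chart (G.frame k) e (z, 0) = G.frame k z := by simp [chart]
  have ht : Tendsto (fun s : ℝ => chart (G.frame k) e (z, s)) (𝓝[>] 0) (𝓝 (G.frame k z)) := by
    rw [← h0]; exact (hcont.tendsto 0).mono_left nhdsWithin_le_nhds
  apply mem_closure_of_tendsto ht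
  have hball : ∀ᶠ s in 𝓝[>] (0 : ℝ), chart (G.frame k) e (z, s) ∈ Metric.ball (0 : Vec d) R :=
    ht.eventually (Metric.isOpen_ball.mem_nhds (hR (G.frac_subset k (mem_image_of_mem _ hz.1))))
  have hhalf : ∀ᶠ s in 𝓝[>] (0 : ℝ), ∀ j, (σ j).sign * G.planeDist j
      (chart (G.frame k) e (z, s)) < 0 := by
    rw [eventually_all]
    intro j
    have hσj := hσ j
    by_cases hj : G.planeDist j (G.frame k z) = 0
    · simp only [x, hj, if_true] at hσj
      filter_upwards [self_mem_nhdsWithin] with s hs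
      rw [planeDist_chart, hj, zero_add, mul_left_comm]
      exact mul_neg_of_pos_of_neg hs hσj
    · simp only [x, hj, if_false] at hσj
      have : Tendsto (fun s => (σ j).sign * G.planeDist j (chart (G.frame k) e (z, s)))
          (𝓝[>] 0) (𝓝 ((σ j).sign * G.planeDist j (G.frame k z))) :=
        (((G.continuous_planeDist j).tendsto _).comp ht).const_mul _
      exact this.eventually_lt_const hσj
  filter_upwards [hball, hhalf] with s h1 h2
  exact ⟨h1, mem_iInter.2 h2⟩

/-- Up to exceptional points the fracture is covered by the closures of the finitely many cells on
side a. Within one cell, fix a ball around y₀ and split the fracture into pieces of the size of this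
ball: on each piece one fixed vector e translates all points into the ball, and convexity keeps the
connecting segments in the cell. -/
theorem lintegral_tr_shape_le (hd : d = 2 ∨ d = 3) (k : Fin G.numFrac) (a : Side) :
    ∃ K : ℝ≥0, ∀ v ∈ G.U₀, ∀ i, ∫⁻ z in G.shape k, ‖tr a v (G.frame k z) i‖ₑ ^ 4 ≤
      K * ((∫⁻ x, ‖val v x‖ₑ ^ 2 ∂G.vol) + ∫⁻ x, ‖grad v x‖ₑ ^ 2 ∂G.vol) ^ 2 := by
  obtain ⟨R, hR⟩ := G.exists_Ω_subset_ball
  have hshape : MeasurableSet (G.shape k) := (G.shape_polytopal k).isOpen.measurableSet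
  let S : (Fin G.numFrac → Side) → Set (Vec (d - 1)) := fun σ =>
    {z | z ∈ G.shape k \ G.excPts k ∧ G.frame k z ∈ closure (G.cell R σ)}
  have hSm : ∀ σ, MeasurableSet (S σ) := fun σ =>
    (hshape.diff (G.measurableSet_excPts k)).inter
      ((G.frame k).continuous.measurable isClosed_closure.measurableSet)
  have hcell : ∀ σ : Fin G.numFrac → Side, ∃ K : ℝ≥0, σ k = a → ∀ v ∈ G.U₀, ∀ i,
      ∫⁻ z in S σ, ‖tr a v (G.frame k z) i‖ₑ ^ 4 ≤
      K * ((∫⁻ x, ‖val v x‖ₑ ^ 2 ∂G.vol) + ∫⁻ x, ‖grad v x‖ₑ ^ 2 ∂G.vol) ^ 2 := by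
    intro σ
    by_cases hσ : σ k = a
    swap
    · exact ⟨0, fun h => absurd h hσ⟩
    rcases (G.cell R σ).eq_empty_or_nonempty with hemp | ⟨y₀, hy₀⟩
    · refine ⟨0, fun _ v _ i => ?_⟩
      have : S σ = ∅ := by
        ext z; simp [S, hemp]
      rw [this]; simp
    obtain ⟨r, hr, hball⟩ := Metric.isOpen_iff.1 (isOpen_cell R σ) y₀ hy₀
    -- The covering radius equals the radius of the ball inside the cell. The centers are taken on
    -- the fracture plane, so that y₀ minus a center points to side a.
    obtain ⟨s, hs1, hs2⟩ := ((isCompact_closedBall (0 : Vec d) R).inter_right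
      (G.frame k).isometry.isClosedEmbedding.isClosed_range).elim_nhds_subcover
      (fun x => Metric.ball x r) (fun x _ => Metric.ball_mem_nhds x hr)
    let S' : Vec d → Set (Vec (d - 1)) := fun x => S σ ∩ (G.frame k) ⁻¹' (Metric.ball x r)
    have hpiece : ∀ x : s, ∃ K : ℝ≥0, ∀ v ∈ G.U₀, ∀ i,
        ∫⁻ z in S' x, ‖tr a v (G.frame k z) i‖ₑ ^ 4 ≤
        K * ((∫⁻ x, ‖val v x‖ₑ ^ 2 ∂G.vol) + ∫⁻ x, ‖grad v x‖ₑ ^ 2 ∂G.vol) ^ 2 := by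
      rintro ⟨x, hx⟩
      obtain ⟨z₁, rfl⟩ := (hs1 x hx).2
      have he : a.sign * ⟪y₀ - G.frame k z₁, G.normal k⟫ < 0 := by
        have h1 : (σ k).sign * G.planeDist k y₀ < 0 := mem_iInter.1 hy₀.2 k
        have h2 := G.normal_orth k z₁ 0
        rw [hσ] at h1
        have : y₀ - G.frame k z₁ = (y₀ - G.frame k 0) - (G.frame k z₁ - G.frame k 0) := by abel
        rw [this, inner_sub_left, h2, sub_zero]
        exact h1
      refine lintegral_tr_piece_le hd he hr (isOpen_cell R σ) (convex_cell R σ) hball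
        inter_subset_left (disjoint_cell R σ)
        ((hSm σ).inter ((G.frame k).continuous.measurable measurableSet_ball))
        (fun z hz => hz.1.1) ?_
      intro z hz t ht
      have h1 : G.frame k z + (y₀ - G.frame k z₁) ∈ G.cell R σ := by
        apply hball
        have := hz.2
        rw [mem_preimage, Metric.mem_ball, dist_eq_norm] at this
        rw [Metric.mem_ball, dist_eq_norm]
        convert this using 2
        abel
      rcases ht.2.eq_or_lt with rfl | ht1
      · simpa [chart] using h1
      have h2 := (convex_cell R σ).openSegment_closure_interior_subset_interior hz.1.2
        ((isOpen_cell R σ).interior_eq.symm ▸ h1)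
      rw [(isOpen_cell R σ).interior_eq] at h2
      apply h2
      refine ⟨1 - t, t, by linarith, ht.1, by ring, ?_⟩
      simp only [chart, sub_smul, smul_add, one_smul, smul_sub]
      abel
    choose K hK using hpiece
    refine ⟨∑ x, K x, fun _ v hv i => ?_⟩
    have hcov : S σ ⊆ ⋃ x : s, S' x := by
      intro z hz
      have h1 : G.frame k z ∈ Metric.closedBall (0 : Vec d) R ∩ range (G.frame k) :=
        ⟨Metric.ball_subset_closedBall (hR (G.frac_subset k (mem_image_of_mem _ hz.1.1))),
          mem_range_self z⟩
      obtain ⟨x, hx, hxz⟩ := mem_iUnion₂.1 (hs2 h1)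
      exact mem_iUnion.2 ⟨⟨x, hx⟩, hz, hxz⟩
    calc _ ≤ ∫⁻ z in ⋃ x : s, S' x, ‖tr a v (G.frame k z) i‖ₑ ^ 4 := lintegral_mono_set hcov
      _ ≤ ∑ x : s, ∫⁻ z in S' x, ‖tr a v (G.frame k z) i‖ₑ ^ 4 := by
          rw [← tsum_fintype (L := .unconditional _)]
          exact lintegral_iUnion_le _ _
      _ ≤ ∑ x : s, _ := Finset.sum_le_sum fun x _ => hK x v hv i
      _ = _ := by rw [← Finset.sum_mul]; push_cast; rfl
  choose K hK using hcell
  have : Finite Side := Finite.of_injective (β := Bool) (fun s => match s with | .plus => true | .minus => false)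
    (by rintro (_ | _) (_ | _) <;> simp)
  have : Fintype (Fin G.numFrac → Side) := Fintype.ofFinite _
  refine ⟨∑ σ, K σ, fun v hv i => ?_⟩
  have hcov : (G.shape k \ G.excPts k : Set _) ⊆ ⋃ σ : {σ : Fin G.numFrac → Side // σ k = a}, S σ := by
    intro z hz
    obtain ⟨σ, h1, h2⟩ := exists_mem_closure_cell hR a hz
    exact mem_iUnion.2 ⟨⟨σ, h1⟩, hz, h2⟩
  have hae : (G.shape k \ G.excPts k : Set _) =ᵐ[volume] G.shape k :=
    sdiff_null_ae_eq_self (G.volume_excPts k)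
  classical
  calc _ = ∫⁻ z in G.shape k \ G.excPts k, ‖tr a v (G.frame k z) i‖ₑ ^ 4 :=
        (setLIntegral_congr hae).symm
    _ ≤ ∫⁻ z in ⋃ σ : {σ : Fin G.numFrac → Side // σ k = a}, S σ, ‖tr a v (G.frame k z) i‖ₑ ^ 4 :=
        lintegral_mono_set hcov
    _ ≤ ∑ σ : {σ : Fin G.numFrac → Side // σ k = a}, ∫⁻ z in S σ, ‖tr a v (G.frame k z) i‖ₑ ^ 4 := by
        rw [← tsum_fintype (L := .unconditional _)]
        exact lintegral_iUnion_le _ _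
    _ ≤ ∑ σ : {σ : Fin G.numFrac → Side // σ k = a}, K σ *
        ((∫⁻ x, ‖val v x‖ₑ ^ 2 ∂G.vol) + ∫⁻ x, ‖grad v x‖ₑ ^ 2 ∂G.vol) ^ 2 :=
        Finset.sum_le_sum fun σ _ => hK σ σ.2 v hv i
    _ ≤ _ := by
        rw [← Finset.sum_mul]
        refine mul_le_mul_left ?_ _
        rw [ENNReal.ofNNReal_finsetSum,
          ← Fintype.sum_subtype_add_sum_subtype (fun σ => σ k = a) fun σ => (K σ : ℝ≥0∞)]
        exact le_self_add

end FractureNetwork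

end PoroMech

end

/-! ### Trace inequality on the network, combined with Korn's inequality -/

noncomputable section

namespace PoroMech

open Filter Topology NNReal

variable {d : ℕ}

namespace FractureNetwork

variable {G : FractureNetwork d}

theorem enorm_pow_four_le_sum (y : Vec d) :
    ‖y‖ₑ ^ 4 ≤ (d : ℝ≥0∞) ^ 3 * ∑ i, ‖y i‖ₑ ^ 4 := by
  have h1 : ‖y‖ ^ 2 = ∑ i, ‖y i‖ ^ 2 := EuclideanSpace.norm_sq_eq y
  have h2 : ‖y‖ ^ 4 ≤ (d : ℝ) * ∑ i, ‖y i‖ ^ 4 := by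
    have := sq_sum_le_card_mul_sum_sq (s := (Finset.univ : Finset (Fin d))) (f := fun i => ‖y i‖ ^ 2)
    rw [← h1] at this
    simp only [Finset.card_univ, Fintype.card_fin] at this
    calc ‖y‖ ^ 4 = (‖y‖ ^ 2) ^ 2 := by ring
      _ ≤ _ := this
      _ = _ := by simp only [← pow_mul]
  have h3 : (d : ℝ) * ∑ i, ‖y i‖ ^ 4 ≤ (d : ℝ) ^ 3 * ∑ i, ‖y i‖ ^ 4 := by
    apply mul_le_mul_of_nonneg_right _ (by positivity)
    rcases Nat.eq_zero_or_pos d with h | h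
    · simp [h]
    · exact_mod_cast Nat.le_self_pow (by norm_num) d
  have h4 := ENNReal.ofReal_le_ofReal (h2.trans h3)
  rw [ENNReal.ofReal_pow (norm_nonneg _), ENNReal.ofReal_mul (by positivity),
    ENNReal.ofReal_pow (by positivity), ENNReal.ofReal_natCast,
    ENNReal.ofReal_sum_of_nonneg (fun _ _ => by positivity)] at h4
  simpa only [ENNReal.ofReal_pow (norm_nonneg _), ofReal_norm] using h4

theorem exists_eLpNorm_tr_le (hd : d = 2 ∨ d = 3) (G : FractureNetwork d) (a : Side) :
    ∃ K : ℝ≥0, ∀ v ∈ G.U₀, eLpNorm (tr a v) 4 G.surf ≤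
      K * (eLpNorm (val v) 2 G.vol + eLpNorm (grad v) 2 G.vol) := by
  choose K hK using fun k => lintegral_tr_shape_le (G := G) hd k a
  let C : ℝ≥0 := d ^ 3 * ∑ k, d * K k
  -- As C ≤ (C + 1)⁴, no fourth root of the constant has to be taken.
  refine ⟨C + 1, fun v hv => ?_⟩
  set A := eLpNorm (val v) 2 G.vol
  set B := eLpNorm (grad v) 2 G.vol
  have hA : ∫⁻ x, ‖val v x‖ₑ ^ 2 ∂G.vol = A ^ 2 :=
    (eLpNorm_natCast_pow (val v) G.vol (n := 2) (by norm_num)).symm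
  have hB : ∫⁻ x, ‖grad v x‖ₑ ^ 2 ∂G.vol = B ^ 2 :=
    (eLpNorm_natCast_pow (grad v) G.vol (n := 2) (by norm_num)).symm
  have h4 : eLpNorm (tr a v) 4 G.surf ^ 4 = ∫⁻ x, ‖tr a v x‖ₑ ^ 4 ∂G.surf :=
    eLpNorm_natCast_pow (tr a v) G.surf (n := 4) (by norm_num)
  have hmi : ∀ i, Measurable fun x => ‖tr a v x i‖ₑ ^ 4 := fun i =>
    ((EuclideanSpace.proj i : Vec d →L[ℝ] ℝ).continuous.measurable.comp
      (measurable_tr a v)).enorm.pow_const 4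
  have hk : ∀ k, ∫⁻ z in G.shape k, ∑ i, ‖tr a v (G.frame k z) i‖ₑ ^ 4 ≤
      ((d * K k : ℝ≥0) : ℝ≥0∞) * (A ^ 2 + B ^ 2) ^ 2 := by
    intro k
    have hmi' : ∀ i, Measurable fun z => ‖tr a v (G.frame k z) i‖ₑ ^ 4 := fun i =>
      (hmi i).comp (G.frame k).continuous.measurable
    rw [lintegral_finsetSum _ fun i _ => hmi' i]
    calc _ ≤ ∑ i : Fin d, (K k : ℝ≥0∞) * (A ^ 2 + B ^ 2) ^ 2 :=
          Finset.sum_le_sum fun i _ => by rw [← hA, ← hB]; exact hK k v hv i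
      _ = _ := by rw [Finset.sum_const, Finset.card_univ, Fintype.card_fin, nsmul_eq_mul]
                  push_cast; ring
  have hmain : eLpNorm (tr a v) 4 G.surf ^ 4 ≤ ((C + 1 : ℝ≥0) * (A + B)) ^ 4 := by
    rw [h4]
    calc ∫⁻ x, ‖tr a v x‖ₑ ^ 4 ∂G.surf
        ≤ ∫⁻ x, (d : ℝ≥0∞) ^ 3 * ∑ i, ‖tr a v x i‖ₑ ^ 4 ∂G.surf :=
          lintegral_mono fun x => enorm_pow_four_le_sum _
      _ = (d : ℝ≥0∞) ^ 3 * ∑ k, ∫⁻ z in G.shape k, ∑ i, ‖tr a v (G.frame k z) i‖ₑ ^ 4 := by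
          rw [lintegral_const_mul _ (Finset.measurable_fun_sum _ fun i _ => hmi i), lintegral_surf]
      _ ≤ (d : ℝ≥0∞) ^ 3 * ∑ k, ((d * K k : ℝ≥0) : ℝ≥0∞) * (A ^ 2 + B ^ 2) ^ 2 :=
          mul_le_mul_right (Finset.sum_le_sum fun k _ => hk k) _
      _ = (C : ℝ≥0∞) * (A ^ 2 + B ^ 2) ^ 2 := by
          rw [← Finset.sum_mul, ← mul_assoc]; simp only [C]; push_cast; rfl
      _ ≤ ((C + 1 : ℝ≥0) : ℝ≥0∞) ^ 4 * ((A + B) ^ 2) ^ 2 := by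
          have h1 : (C : ℝ≥0∞) ≤ ((C + 1 : ℝ≥0) : ℝ≥0∞) ^ 4 := by
            have : C ≤ (C + 1) ^ 4 := (le_add_of_nonneg_right zero_le_one).trans
              (le_self_pow₀ (by simp) (by norm_num))
            exact_mod_cast this
          have h2 : A ^ 2 + B ^ 2 ≤ (A + B) ^ 2 := by
            rw [add_sq, add_right_comm]; exact le_self_add
          exact mul_le_mul' h1 (pow_le_pow_left' h2 2)
      _ = _ := by ring
  exact (ENNReal.pow_le_pow_left_iff (by norm_num)).1 hmain

/-- Under Korn's inequality, the strain controls the field, its gradient and its traces. -/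
theorem Korn.exists_bound (hd : d = 2 ∨ d = 3) (hG : G.Korn) :
    ∃ c : ℝ≥0, ∀ v ∈ G.U₀,
      eLpNorm (val v) 2 G.vol ≤ c * eLpNorm (strain v) 2 G.vol ∧
      eLpNorm (grad v) 2 G.vol ≤ c * eLpNorm (strain v) 2 G.vol ∧
      ∀ a, eLpNorm (tr a v) 4 G.surf ≤ c * eLpNorm (strain v) 2 G.vol := by
  obtain ⟨c, hc⟩ := hG
  choose K hK using fun a => exists_eLpNorm_tr_le hd G a
  refine ⟨(1 + K .plus + K .minus) * c.toNNReal, fun v hv => ?_⟩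
  have h := hc v hv
  set A := eLpNorm (val v) 2 G.vol
  set B := eLpNorm (grad v) 2 G.vol
  have hmono : ∀ t : ℝ≥0, t ≤ 1 + K .plus + K .minus → (t : ℝ≥0∞) * (A + B) ≤
      (((1 + K .plus + K .minus) * c.toNNReal : ℝ≥0) : ℝ≥0∞) * eLpNorm (strain v) 2 G.vol := by
    intro t ht
    rw [ENNReal.coe_mul, mul_assoc]
    exact mul_le_mul' (by exact_mod_cast ht) h
  have h1 := hmono 1 (by rw [add_assoc]; exact le_self_add)
  rw [ENNReal.coe_one, one_mul] at h1
  refine ⟨le_self_add.trans h1, le_add_self.trans h1, fun a => (hK a v hv).trans (hmono _ ?_)⟩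
  cases a
  · exact le_add_self.trans le_self_add
  · exact le_add_self

end FractureNetwork

end PoroMech

end

/-! ### L² norms and piecewise constant functions -/

noncomputable section

namespace PoroMech

open Filter Topology NNReal

section LTwo

variable {α E F : Type*} [MeasurableSpace α] {μ : Measure α}
  [NormedAddCommGroup E] [NormedAddCommGroup F] {f g : α → E} {p q r : ℝ≥0∞}

/-- The `L²` norm as a real number. -/
def l2norm (f : α → E) (μ : Measure α) : ℝ := (eLpNorm f 2 μ).toReal

theorem l2norm_nonneg (f : α → E) (μ : Measure α) : 0 ≤ l2norm f μ := ENNReal.toReal_nonneg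

theorem eLpNorm_two_eq_ofReal (hf : MemLp f 2 μ) : eLpNorm f 2 μ = ENNReal.ofReal (l2norm f μ) :=
  (ENNReal.ofReal_toReal hf.2.ne).symm

theorem lintegral_enorm_sq_eq_ofReal (hf : MemLp f 2 μ) :
    ∫⁻ x, ‖f x‖ₑ ^ 2 ∂μ = ENNReal.ofReal (l2norm f μ ^ 2) := by
  rw [ENNReal.ofReal_pow (l2norm_nonneg f μ), ← eLpNorm_two_eq_ofReal hf]
  exact (eLpNorm_natCast_pow f μ (n := 2) (by norm_num)).symm

theorem sq_l2norm (hf : MemLp f 2 μ) : l2norm f μ ^ 2 = ∫ x, ‖f x‖ ^ 2 ∂μ := by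
  have h := lintegral_enorm_sq_eq_ofReal hf
  have hm : AEStronglyMeasurable (fun x => ‖f x‖ ^ 2) μ := hf.1.norm.pow 2
  rw [integral_eq_lintegral_of_nonneg_ae (Eventually.of_forall fun x => by positivity)
    hm]
  simp only [ENNReal.ofReal_pow (norm_nonneg _), ofReal_norm, h]
  rw [ENNReal.toReal_ofReal (by positivity)]

theorem integrable_norm_sq (hf : MemLp f 2 μ) : Integrable (fun x => ‖f x‖ ^ 2) μ :=
  hf.norm.integrable_sq

theorem l2norm_add_le (hf : MemLp f 2 μ) (hg : MemLp g 2 μ) :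
    l2norm (fun x => f x + g x) μ ≤ l2norm f μ + l2norm g μ := by
  unfold l2norm
  rw [← ENNReal.toReal_add hf.2.ne hg.2.ne]
  exact ENNReal.toReal_mono (ENNReal.add_ne_top.2 ⟨hf.2.ne, hg.2.ne⟩)
    (eLpNorm_add_le hf.1 hg.1 (by norm_num))

theorem l2norm_le_of_ae {g : α → F} (hg : MemLp g 2 μ) {c : ℝ} (hc : 0 ≤ c)
    (h : ∀ᵐ x ∂μ, ‖f x‖ ≤ c * ‖g x‖) : l2norm f μ ≤ c * l2norm g μ := by
  have h1 := eLpNorm_le_mul_eLpNorm_of_ae_le_mul h 2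
  unfold l2norm
  have := ENNReal.toReal_mono (ENNReal.mul_ne_top ENNReal.ofReal_ne_top hg.2.ne) h1
  rwa [ENNReal.toReal_mul, ENNReal.toReal_ofReal hc] at this

theorem l2norm_norm (f : α → E) : l2norm (fun x => ‖f x‖) μ = l2norm f μ := by
  unfold l2norm; rw [eLpNorm_norm]

theorem l2norm_le_of_eLpNorm_le {c : ℝ} (hc : 0 ≤ c) (h : eLpNorm f 2 μ ≤ ENNReal.ofReal c) :
    l2norm f μ ≤ c := by
  have := ENNReal.toReal_mono ENNReal.ofReal_ne_top h
  rwa [ENNReal.toReal_ofReal hc] at this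

theorem memLp_mul {f g : α → ℝ} [ENNReal.HolderTriple p q r] (hf : MemLp f p μ)
    (hg : MemLp g q μ) : MemLp (fun x => f x * g x) r μ :=
  MemLp.mul (r := r) hg hf

theorem memLp_inner [InnerProductSpace ℝ E] [ENNReal.HolderTriple p q r] (hf : MemLp f p μ)
    (hg : MemLp g q μ) : MemLp (fun x => ⟪f x, g x⟫) r μ := by
  refine (memLp_mul (r := r) hf.norm hg.norm).mono (hf.1.inner hg.1) (Eventually.of_forall fun x => ?_)
  rw [norm_mul, norm_norm, norm_norm]
  exact norm_inner_le_norm _ _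

theorem memLp_clm_apply [NormedSpace ℝ E] [NormedSpace ℝ F] [ENNReal.HolderTriple p q r]
    {K : α → E →L[ℝ] F} (hK : MemLp K p μ) (hf : MemLp f q μ) : MemLp (fun x => K x (f x)) r μ := by
  refine (memLp_mul (r := r) hK.norm hf.norm).mono
    (isBoundedBilinearMap_apply.continuous.comp_aestronglyMeasurable (hK.1.prodMk hf.1))
    (Eventually.of_forall fun x => ?_)
  rw [norm_mul, norm_norm, norm_norm]
  exact (K x).le_opNorm _

theorem integrable_mul_of_memLp {f g : α → ℝ} (hf : MemLp f 2 μ) (hg : MemLp g 2 μ) :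
    Integrable (fun x => f x * g x) μ :=
  memLp_one_iff_integrable.1 (memLp_mul hf hg)

theorem integrable_inner_of_memLp [InnerProductSpace ℝ E] (hf : MemLp f 2 μ) (hg : MemLp g 2 μ) :
    Integrable (fun x => ⟪f x, g x⟫) μ :=
  memLp_one_iff_integrable.1 (memLp_inner hf hg)

theorem abs_integral_inner_le [InnerProductSpace ℝ E] (hf : MemLp f 2 μ) (hg : MemLp g 2 μ) :
    |∫ x, ⟪f x, g x⟫ ∂μ| ≤ l2norm f μ * l2norm g μ := by
  have h1 : ∫ x, ⟪f x, g x⟫ ∂μ = ⟪hf.toLp f, hg.toLp g⟫ := by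
    rw [L2.inner_def]
    apply integral_congr_ae
    filter_upwards [hf.coeFn_toLp, hg.coeFn_toLp] with x h1 h2
    rw [h1, h2]
  rw [h1]
  refine (abs_real_inner_le_norm _ _).trans_eq ?_
  rw [Lp.norm_toLp, Lp.norm_toLp]; rfl

theorem abs_integral_mul_le {f g : α → ℝ} (hf : MemLp f 2 μ) (hg : MemLp g 2 μ) :
    |∫ x, f x * g x ∂μ| ≤ l2norm f μ * l2norm g μ := by
  have := abs_integral_inner_le hg hf
  rw [mul_comm (l2norm f μ)]
  simpa using this

end LTwo

section PwConst

variable {d : ℕ} {n : ℕ} {E E' : Type} [AddCommMonoid E] [AddCommMonoid E']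
  {cell : Fin n → Set (Vec d)}

theorem pwConst_apply_of_mem (hc : Pairwise fun i j => Disjoint (cell i) (cell j)) (v : Fin n → E)
    {i : Fin n} {x : Vec d} (hx : x ∈ cell i) : pwConst cell v x = v i := by
  unfold pwConst
  rw [Finset.sum_eq_single i, indicator_of_mem hx]
  · intro j _ hj
    exact indicator_of_notMem (fun h => Set.disjoint_left.1 (hc hj) h hx) _
  · simp

theorem pwConst_apply_of_forall_notMem (v : Fin n → E) {x : Vec d} (hx : ∀ i, x ∉ cell i) :
    pwConst cell v x = 0 :=
  Finset.sum_eq_zero fun i _ => indicator_of_notMem (hx i) _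

variable (cell) in
theorem pwConst_zero (x : Vec d) : pwConst cell (0 : Fin n → E) x = 0 := by
  simp [pwConst]

/-- At each point, all piecewise constant functions are evaluated at the same cell. -/
theorem pwConst_cases (hc : Pairwise fun i j => Disjoint (cell i) (cell j)) (x : Vec d) :
    (∃ i, x ∈ cell i ∧ ∀ (E : Type) [AddCommMonoid E] (v : Fin n → E), pwConst cell v x = v i) ∨
      ((∀ i, x ∉ cell i) ∧
        ∀ (E : Type) [AddCommMonoid E] (v : Fin n → E), pwConst cell v x = 0) := by
  by_cases h : ∃ i, x ∈ cell i
  · obtain ⟨i, hi⟩ := h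
    exact Or.inl ⟨i, hi, fun E _ v => pwConst_apply_of_mem hc v hi⟩
  · push Not at h
    exact Or.inr ⟨h, fun E _ v => pwConst_apply_of_forall_notMem v h⟩

theorem measurable_pwConst [MeasurableSpace E] [MeasurableAdd₂ E]
    (hm : ∀ i, MeasurableSet (cell i)) (v : Fin n → E) : Measurable (pwConst cell v) :=
  Finset.measurable_fun_sum _ fun i _ => measurable_const.indicator (hm i)

/-- Outside the cells the reconstruction is 0, where f need not vanish; the shift by f 0 makes the
composition piecewise constant again. -/
theorem measurable_comp_pwConst (hc : Pairwise fun i j => Disjoint (cell i) (cell j))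
    (hm : ∀ i, MeasurableSet (cell i)) (v : Fin n → E) (f : E → ℝ) :
    Measurable fun x => f (pwConst cell v x) := by
  have : (fun x => f (pwConst cell v x)) =
      fun x => f 0 + pwConst cell (fun i => f (v i) - f 0) x := by
    ext x
    rcases pwConst_cases hc x with ⟨i, -, h⟩ | ⟨-, h⟩ <;> simp [h]
  rw [this]
  exact (measurable_pwConst hm _).const_add _

theorem exists_norm_pwConst_le {E : Type} [NormedAddCommGroup E]
    (hc : Pairwise fun i j => Disjoint (cell i) (cell j)) (v : Fin n → E) :
    ∃ C, ∀ x, ‖pwConst cell v x‖ ≤ C := by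
  refine ⟨∑ i, ‖v i‖, fun x => ?_⟩
  rcases pwConst_cases hc x with ⟨i, -, h⟩ | ⟨-, h⟩
  · rw [h]; exact Finset.single_le_sum (f := fun i => ‖v i‖) (fun _ _ => norm_nonneg _) (Finset.mem_univ i)
  · rw [h, norm_zero]; exact Finset.sum_nonneg fun _ _ => norm_nonneg _

theorem memLp_pwConst {μ : Measure (Vec d)} {E : Type} [NormedAddCommGroup E] [MeasurableSpace E]
    [BorelSpace E] [SecondCountableTopology E]
    (hc : Pairwise fun i j => Disjoint (cell i) (cell j))
    (hm : ∀ i, MeasurableSet (cell i)) (v : Fin n → E) : MemLp (pwConst cell v) ⊤ μ := by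
  obtain ⟨C, hC⟩ := exists_norm_pwConst_le hc v
  exact memLp_top_of_bound (measurable_pwConst hm v).aestronglyMeasurable C (Eventually.of_forall hC)

theorem memLp_comp_pwConst {μ : Measure (Vec d)}
    (hc : Pairwise fun i j => Disjoint (cell i) (cell j))
    (hm : ∀ i, MeasurableSet (cell i)) (v : Fin n → E) (f : E → ℝ) :
    MemLp (fun x => f (pwConst cell v x)) ⊤ μ := by
  refine memLp_top_of_bound (measurable_comp_pwConst hc hm v f).aestronglyMeasurable
    (|f 0| + ∑ i, |f (v i)|) (Eventually.of_forall fun x => ?_)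
  rcases pwConst_cases hc x with ⟨i, -, h⟩ | ⟨-, h⟩
  · rw [h, Real.norm_eq_abs]
    exact (Finset.single_le_sum (f := fun i => |f (v i)|) (fun _ _ => abs_nonneg _)
      (Finset.mem_univ i)).trans (le_add_of_nonneg_left (abs_nonneg _))
  · rw [h, Real.norm_eq_abs]
    exact le_add_of_nonneg_right (Finset.sum_nonneg fun _ _ => abs_nonneg _)

end PwConst

/-! ### Saturations and capillary energy -/

namespace ModelData

variable {d : ℕ} {G : FractureNetwork d} (D : ModelData G)

/-- Lipschitz functions are absolutely continuous, so the fundamental theorem of calculus holds with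
the almost everywhere derivative. -/
theorem integral_deriv_Snw (rt : Rock) (a b : ℝ) :
    IntervalIntegrable (deriv (D.Snw rt)) volume a b ∧
      ∫ q in a..b, deriv (D.Snw rt) q = D.Snw rt b - D.Snw rt a := by
  obtain ⟨L, hL⟩ := D.Snw_lip rt
  have := (hL.lipschitzOnWith (s := uIcc a b)).absolutelyContinuousOnInterval
  exact ⟨this.intervalIntegrable_deriv, this.integral_deriv_eq_sub⟩

theorem intervalIntegrable_mul_deriv_Snw (rt : Rock) (a b : ℝ) :
    IntervalIntegrable (fun q => q * deriv (D.Snw rt) q) volume a b :=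
  (D.integral_deriv_Snw rt a b).1.continuousOn_mul continuousOn_id

theorem U_sub_U_eq (rt : Rock) (a b : ℝ) :
    D.U rt b - D.U rt a = ∫ q in a..b, q * deriv (D.Snw rt) q := by
  unfold U
  exact intervalIntegral.integral_interval_sub_left (D.intervalIntegrable_mul_deriv_Snw rt 0 b)
    (D.intervalIntegrable_mul_deriv_Snw rt 0 a)

theorem U_sub_U_bounds (rt : Rock) {a b : ℝ} (hab : a ≤ b) :
    a * (D.Snw rt b - D.Snw rt a) ≤ D.U rt b - D.U rt a ∧
      D.U rt b - D.U rt a ≤ b * (D.Snw rt b - D.Snw rt a) := by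
  obtain ⟨hi, he⟩ := D.integral_deriv_Snw rt a b
  have h0 : ∀ q, 0 ≤ deriv (D.Snw rt) q := fun q => (D.Snw_mono rt).deriv_nonneg
  rw [D.U_sub_U_eq, ← he, ← intervalIntegral.integral_const_mul,
    ← intervalIntegral.integral_const_mul]
  have hm := D.intervalIntegrable_mul_deriv_Snw rt a b
  exact ⟨intervalIntegral.integral_mono_on hab (hi.const_mul a) hm fun q hq =>
      mul_le_mul_of_nonneg_right hq.1 (h0 q),
    intervalIntegral.integral_mono_on hab hm (hi.const_mul b) fun q hq =>
      mul_le_mul_of_nonneg_right hq.2 (h0 q)⟩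

/-- In the integral of q S'(q) the weight S' is nonnegative and q lies between the end points. This
replaces the chain rule dU = p dS in discrete time, for both directions of the change. -/
theorem U_sub_U_le (rt : Rock) (p q : ℝ) :
    D.U rt p - D.U rt q ≤ p * (D.Snw rt p - D.Snw rt q) := by
  rcases le_total q p with h | h
  · exact (D.U_sub_U_bounds rt h).2
  · have := (D.U_sub_U_bounds rt h).1
    linarith

theorem U_zero (rt : Rock) : D.U rt 0 = 0 := intervalIntegral.integral_same

theorem U_nonneg (rt : Rock) (p : ℝ) : 0 ≤ D.U rt p := by
  have := D.U_sub_U_le rt 0 p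
  rw [U_zero] at this; linarith

theorem U_le_abs (rt : Rock) (p : ℝ) : D.U rt p ≤ |p| := by
  have h := D.U_sub_U_le rt p 0
  rw [U_zero, sub_zero] at h
  refine h.trans ((le_abs_self _).trans ?_)
  rw [abs_mul]
  have h1 := D.Snw_range rt p
  have h2 := D.Snw_range rt 0
  have : |D.Snw rt p - D.Snw rt 0| ≤ 1 := abs_le.2 ⟨by linarith [h1.1, h2.2], by linarith [h1.2, h2.1]⟩
  nlinarith [abs_nonneg p]

theorem sat_mem (α : Phase) (rt : Rock) (q : ℝ) : D.sat α rt q ∈ Icc (0 : ℝ) 1 := by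
  have := D.Snw_range rt q
  cases α
  · exact this
  · exact ⟨by simp only [sat]; linarith [this.2], by simp only [sat]; linarith [this.1]⟩

theorem exists_mob_lower : ∃ m : ℝ, 0 < m ∧ ∀ α rt, ∀ s ∈ Icc (0 : ℝ) 1, m ≤ D.mob α rt s := by
  choose m M hm h using D.mob_bdd
  let r : Rock → ℝ := fun rt => min (m .nw rt) (m .w rt)
  refine ⟨min (min (r .mat) (r .frac)) (min (r (.dam .plus)) (r (.dam .minus))), ?_, ?_⟩
  · simp only [r, lt_min_iff]
    exact ⟨⟨⟨hm _ _, hm _ _⟩, hm _ _, hm _ _⟩, ⟨hm _ _, hm _ _⟩, hm _ _, hm _ _⟩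
  · intro α rt s hs
    refine le_trans ?_ (h α rt s hs).1
    have hr : r rt ≤ m α rt := by cases α <;> simp [r]
    refine le_trans ?_ hr
    rcases rt with _ | _ | (_ | _) <;> simp

/-- The equivalent pressure is controlled by the phase pressures. -/
theorem abs_equivalent_pressure_le (rt : Rock) (p q : ℝ) :
    |p * D.sat .nw rt (p - q) + q * D.sat .w rt (p - q) - D.U rt (p - q)| ≤ 2 * (|p| + |q|) := by
  have h1 := D.sat_mem .nw rt (p - q)
  have h2 := D.sat_mem .w rt (p - q)
  have hp : |p * D.sat .nw rt (p - q)| ≤ |p| := by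
    rw [abs_mul, abs_of_nonneg h1.1]; exact mul_le_of_le_one_right (abs_nonneg _) h1.2
  have hq : |q * D.sat .w rt (p - q)| ≤ |q| := by
    rw [abs_mul, abs_of_nonneg h2.1]; exact mul_le_of_le_one_right (abs_nonneg _) h2.2
  have hU : |D.U rt (p - q)| ≤ |p| + |q| := by
    rw [abs_of_nonneg (D.U_nonneg _ _)]
    exact (D.U_le_abs _ _).trans (abs_sub _ _)
  calc _ ≤ |p * D.sat .nw rt (p - q) + q * D.sat .w rt (p - q)| + |D.U rt (p - q)| := abs_sub _ _
    _ ≤ (|p * D.sat .nw rt (p - q)| + |q * D.sat .w rt (p - q)|) + |D.U rt (p - q)| := by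
        gcongr; exact abs_add_le _ _
    _ ≤ _ := by linarith

/-- Lower bound for the variation of the accumulation terms, for an extensive factor that
changes from `φ'` to `φ`. -/
theorem accumulation_lower_bound (rt : Rock) {φ' : ℝ} (hφ' : 0 ≤ φ') (φ p q p' q' : ℝ) :
    φ * D.U rt (p - q) - φ' * D.U rt (p' - q')
      + (φ - φ') * (p * D.sat .nw rt (p - q) + q * D.sat .w rt (p - q) - D.U rt (p - q)) ≤
    (φ * D.sat .nw rt (p - q) - φ' * D.sat .nw rt (p' - q')) * p
      + (φ * D.sat .w rt (p - q) - φ' * D.sat .w rt (p' - q')) * q := by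
  -- The two sides of the claim differ exactly by φ' times the defect in `U_sub_U_le`; hence only
  -- the old factor φ' must be nonnegative, and φ is arbitrary.
  have := mul_le_mul_of_nonneg_left (D.U_sub_U_le rt (p - q) (p' - q')) hφ'
  simp only [sat]
  linarith

end ModelData

end PoroMech

end

/-! ### Time grid -/

noncomputable section

namespace PoroMech

open Filter Topology NNReal

namespace TimeGrid

variable {T : ℝ} (τ : TimeGrid T)

theorem t_mono {j k : ℕ} (hjk : j ≤ k) (hk : k ≤ τ.N) : τ.t j ≤ τ.t k := by
  induction k, hjk using Nat.le_induction with
  | base => exact le_rfl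
  | succ k _ ih => exact (ih (by omega)).trans (τ.t_lt k (by omega)).le

theorem idx_eq {k : ℕ} (hk : k < τ.N) {s : ℝ} (hs : s ∈ Ioc (τ.t k) (τ.t (k + 1))) :
    τ.idx s = k + 1 := by
  apply le_antisymm
  · exact Nat.sInf_le hs.2
  · refine le_csInf ⟨k + 1, hs.2⟩ fun j hj => ?_
    by_contra h
    exact absurd (hj.trans (τ.t_mono (by omega : j ≤ k) hk.le)) (not_le.2 hs.1)

theorem exists_mem_Ioc {s : ℝ} (hs : s ∈ Ioc 0 T) :
    ∃ k < τ.N, s ∈ Ioc (τ.t k) (τ.t (k + 1)) := by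
  have hN : τ.N ∈ {k | s ≤ τ.t k} := by show s ≤ τ.t τ.N; rw [τ.t_last]; exact hs.2
  have hmem : s ≤ τ.t (τ.idx s) := Nat.sInf_mem (⟨_, hN⟩ : {k | s ≤ τ.t k}.Nonempty)
  have hle : τ.idx s ≤ τ.N := Nat.sInf_le hN
  have h0 : τ.idx s ≠ 0 := by
    intro h
    rw [h, τ.t_zero] at hmem
    exact absurd hs.1 (not_lt.2 hmem)
  obtain ⟨k, hk⟩ := Nat.exists_eq_succ_of_ne_zero h0
  refine ⟨k, by omega, ?_, by rwa [hk] at hmem⟩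
  by_contra h
  have : τ.idx s ≤ k := Nat.sInf_le (show s ≤ τ.t k from not_lt.1 h)
  omega

theorem idx_mem {s : ℝ} (hs : s ∈ Ioc 0 T) : 1 ≤ τ.idx s ∧ τ.idx s ≤ τ.N := by
  obtain ⟨k, hk, hsk⟩ := τ.exists_mem_Ioc hs
  rw [τ.idx_eq hk hsk]
  omega

theorem Ioc_subset {k : ℕ} (hk : k < τ.N) : Ioc (τ.t k) (τ.t (k + 1)) ⊆ Ioc 0 T := by
  exact Ioc_subset_Ioc (τ.t_zero.symm.le.trans (τ.t_mono (Nat.zero_le k) hk.le))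
    ((τ.t_mono hk le_rfl).trans τ.t_last.le)

/-- Localises the equations in time: a test sequence concentrated at the index k + 1 makes all other
intervals drop out. -/
theorem setIntegral_eq_of_idx {k : ℕ} (hk : k < τ.N) {F : ℝ → ℝ}
    (hF : ∀ s, τ.idx s ≠ k + 1 → F s = 0) :
    ∫ s in Ioc 0 T, F s = ∫ s in Ioc (τ.t k) (τ.t (k + 1)), F s := by
  refine setIntegral_eq_of_subset_of_forall_sdiff_eq_zero measurableSet_Ioc (τ.Ioc_subset hk) ?_
  intro s hs
  apply hF
  intro h
  obtain ⟨j, hj, hsj⟩ := τ.exists_mem_Ioc hs.1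
  have := τ.idx_eq hj hsj
  obtain rfl : j = k := by omega
  exact hs.2 hsj

theorem setIntegral_step {k : ℕ} (hk : k < τ.N) (L : ℕ → ℝ) (hL : ∀ j, j ≠ k + 1 → L j = 0) :
    ∫ s in Ioc 0 T, L (τ.idx s) = (τ.t (k + 1) - τ.t k) * L (k + 1) := by
  rw [τ.setIntegral_eq_of_idx hk fun s hs => hL _ hs,
    setIntegral_congr_fun (g := fun _ => L (k + 1)) measurableSet_Ioc
      fun s hs => by simp only [τ.idx_eq hk hs]]
  rw [setIntegral_const, measureReal_def, Real.volume_Ioc, smul_eq_mul,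
    ENNReal.toReal_ofReal (sub_nonneg.2 (τ.t_lt k hk).le)]

theorem lintegral_eq_sum (F : ℝ → ℝ≥0∞) :
    ∫⁻ s in Ioc 0 T, F s = ∑ k ∈ Finset.range τ.N, ∫⁻ s in Ioc (τ.t k) (τ.t (k + 1)), F s := by
  have : ∀ n ≤ τ.N, ∫⁻ s in Ioc 0 (τ.t n), F s =
      ∑ k ∈ Finset.range n, ∫⁻ s in Ioc (τ.t k) (τ.t (k + 1)), F s := by
    intro n
    induction n with
    | zero => simp [τ.t_zero]
    | succ n ih =>
      intro hn
      have h0 : 0 ≤ τ.t n := by rw [← τ.t_zero]; exact τ.t_mono (Nat.zero_le n) (by omega)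
      rw [Finset.sum_range_succ, ← ih (by omega), ← Ioc_union_Ioc_eq_Ioc h0 (τ.t_lt n hn).le,
        lintegral_union measurableSet_Ioc]
      rw [Set.disjoint_left]
      exact fun s h1 h2 => absurd h1.2 (not_le.2 h2.1)
  rw [← this τ.N le_rfl, τ.t_last]

theorem lintegral_idx (Φ : ℕ → ℝ≥0∞) : ∫⁻ s in Ioc 0 T, Φ (τ.idx s) =
    ∑ k ∈ Finset.range τ.N, ENNReal.ofReal (τ.t (k + 1) - τ.t k) * Φ (k + 1) := by
  rw [lintegral_eq_sum τ]
  refine Finset.sum_congr rfl fun k hk => ?_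
  rw [setLIntegral_congr_fun (g := fun _ => Φ (k + 1)) measurableSet_Ioc
    fun s hs => by simp only [τ.idx_eq (Finset.mem_range.1 hk) hs], setLIntegral_const,
    Real.volume_Ioc, mul_comm]

end TimeGrid

variable {d : ℕ} {G : FractureNetwork d}

namespace FractureNetwork

theorem nrm_of_mem_frac {k : Fin G.numFrac} {x : Vec d} (hx : x ∈ G.frac k) :
    G.nrm x = G.normal k := by
  unfold nrm
  rw [Finset.sum_eq_single k, indicator_of_mem hx]
  · intro j _ hj
    exact indicator_of_notMem (fun h => Set.disjoint_left.1 (G.frac_disjoint j k hj) h hx) _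
  · simp

theorem memLp_jmp (v : G.Disp) : MemLp (jmp v) 2 G.surf := (memLp_tr .plus v).sub (memLp_tr .minus v)

theorem tr_sub (a : Side) (v w : G.Disp) : tr a (v - w) =ᵐ[G.surf] fun x => tr a v x - tr a w x :=
  Lp.coeFn_sub _ _

theorem tr_smul (a : Side) (c : ℝ) (v : G.Disp) : tr a (c • v) =ᵐ[G.surf] fun x => c • tr a v x :=
  Lp.coeFn_smul _ _

end FractureNetwork

/-! ### Face averages and the contact inequality -/

namespace MechGD

variable (Q : MechGD G)

/-- The measure of a face. -/
def area (σ : Fin Q.nF) : ℝ := G.surf.real (Q.face σ)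

/-- The average displacement jump on a face. -/
def avgJump (v : G.Disp) (σ : Fin Q.nF) : Vec d := Q.faceAvg .plus v σ - Q.faceAvg .minus v σ

theorem area_pos (σ : Fin Q.nF) : 0 < Q.area σ :=
  ENNReal.toReal_pos (Q.face_pos σ).ne' (measure_ne_top _ _)

theorem ae_mem_face : ∀ᵐ x ∂G.surf, x ∈ ⋃ σ, Q.face σ := by
  have h1 : ∀ᵐ x ∂G.surf, x ∈ G.Γ := ae_restrict_mem G.measurableSet_Γ
  have h2 : ∀ᵐ x ∂G.surf, x ∉ G.Γ \ ⋃ σ, Q.face σ := measure_eq_zero_iff_ae_notMem.1 Q.face_cover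
  filter_upwards [h1, h2] with x hx1 hx2
  by_contra h; exact hx2 ⟨hx1, h⟩

theorem integral_eq_sum_faces {g : Vec d → ℝ} (hg : Integrable g G.surf) :
    ∫ x, g x ∂G.surf = ∑ σ, ∫ x in Q.face σ, g x ∂G.surf := by
  rw [← integral_iUnion_fintype Q.face_meas Q.face_disjoint fun σ => hg.integrableOn,
    Measure.restrict_eq_self_of_ae_mem Q.ae_mem_face]

theorem lintegral_eq_sum_faces (g : Vec d → ℝ≥0∞) :
    ∫⁻ x, g x ∂G.surf = ∑ σ, ∫⁻ x in Q.face σ, g x ∂G.surf := by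
  rw [← tsum_fintype (L := .unconditional _), ← lintegral_iUnion Q.face_meas Q.face_disjoint,
    Measure.restrict_eq_self_of_ae_mem Q.ae_mem_face]

theorem faceAvg_sub (a : Side) (v w : G.Disp) (σ : Fin Q.nF) :
    Q.faceAvg a (v - w) σ = Q.faceAvg a v σ - Q.faceAvg a w σ := by
  unfold faceAvg
  have hi : ∀ v : G.Disp, Integrable (tr a v) (G.surf.restrict (Q.face σ)) := fun v =>
    ((memLp_tr a v).integrable (by norm_num)).restrict
  rw [setAverage_eq, setAverage_eq, setAverage_eq, ← smul_sub, ← integral_sub (hi v) (hi w)]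
  congr 1
  exact integral_congr_ae (ae_restrict_of_ae (tr_sub a v w))

theorem faceAvg_smul (a : Side) (c : ℝ) (v : G.Disp) (σ : Fin Q.nF) :
    Q.faceAvg a (c • v) σ = c • Q.faceAvg a v σ := by
  unfold faceAvg
  rw [setAverage_eq, setAverage_eq, smul_comm c, ← integral_smul c]
  congr 1
  exact integral_congr_ae (ae_restrict_of_ae (tr_smul a c v))

theorem avgJump_sub (v w : G.Disp) (σ : Fin Q.nF) :
    Q.avgJump (v - w) σ = Q.avgJump v σ - Q.avgJump w σ := by
  unfold avgJump
  rw [faceAvg_sub, faceAvg_sub]; abel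

theorem avgJump_smul (c : ℝ) (v : G.Disp) (σ : Fin Q.nF) :
    Q.avgJump (c • v) σ = c • Q.avgJump v σ := by
  unfold avgJump
  rw [faceAvg_smul, faceAvg_smul, smul_sub]

theorem avgJump_eq (v : G.Disp) (σ : Fin Q.nF) :
    Q.avgJump v σ = ⨍ x in Q.face σ, jmp v x ∂G.surf := by
  have hi : ∀ a, Integrable (tr a v) (G.surf.restrict (Q.face σ)) := fun a =>
    ((memLp_tr a v).integrable (by norm_num)).restrict
  unfold avgJump faceAvg
  rw [setAverage_eq, setAverage_eq, setAverage_eq, ← smul_sub, ← integral_sub (hi _) (hi _)]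
  rfl

theorem jumpN_sub (v w : G.Disp) (σ : Fin Q.nF) :
    Q.jumpN (v - w) σ = Q.jumpN v σ - Q.jumpN w σ := by
  have := Q.avgJump_sub v w σ
  unfold avgJump at this
  unfold jumpN
  rw [this, inner_sub_left]

theorem setIntegral_face_inner (c : Vec d) (v : G.Disp) (σ : Fin Q.nF) :
    ∫ x in Q.face σ, ⟪c, jmp v x⟫ ∂G.surf = Q.area σ * ⟪c, Q.avgJump v σ⟫ := by
  rw [integral_inner ((memLp_jmp v).integrable (by norm_num)).restrict, avgJump_eq, setAverage_eq,
    real_inner_smul_right, ← mul_assoc, area, mul_inv_cancel₀, one_mul]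
  exact (Q.area_pos σ).ne'

/-- Piecewise constant vectors see only the face averages of the jump, which turns the contact
inequality into a finite sum. -/
theorem integral_eq_sum_area {g : Vec d → ℝ} (hg : Integrable g G.surf) (c : Q.Mult) (v : G.Disp)
    (h : ∀ σ, ∀ x ∈ Q.face σ, g x = ⟪c σ, jmp v x⟫) :
    ∫ x, g x ∂G.surf = ∑ σ, Q.area σ * ⟪c σ, Q.avgJump v σ⟫ := by
  rw [Q.integral_eq_sum_faces hg]
  refine Finset.sum_congr rfl fun σ _ => ?_
  rw [← setIntegral_face_inner]
  exact setIntegral_congr_fun (Q.face_meas σ) (h σ)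

theorem mfun_of_mem (μ : Q.Mult) {σ : Fin Q.nF} {x : Vec d} (hx : x ∈ Q.face σ) :
    Q.mfun μ x = μ σ := pwConst_apply_of_mem Q.face_disjoint μ hx

theorem memLp_mfun (μ : Q.Mult) : MemLp (Q.mfun μ) ⊤ G.surf :=
  memLp_pwConst Q.face_disjoint Q.face_meas μ

theorem memLp_jumpNF (v : G.Disp) : MemLp (Q.jumpNF v) ⊤ G.surf :=
  memLp_pwConst Q.face_disjoint Q.face_meas _

theorem integrable_mfun_inner (μ : Q.Mult) (v : G.Disp) :
    Integrable (fun x => ⟪Q.mfun μ x, jmp v x⟫) G.surf :=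
  integrable_inner_of_memLp ((Q.memLp_mfun μ).mono_exponent le_top) (memLp_jmp v)

theorem integral_mfun_inner (μ : Q.Mult) (v : G.Disp) :
    ∫ x, ⟪Q.mfun μ x, jmp v x⟫ ∂G.surf = ∑ σ, Q.area σ * ⟪μ σ, Q.avgJump v σ⟫ :=
  Q.integral_eq_sum_area (Q.integrable_mfun_inner μ v) μ v
    fun σ x hx => by rw [Q.mfun_of_mem μ hx]

theorem nrm_of_mem {σ : Fin Q.nF} {x : Vec d} (hx : x ∈ Q.face σ) :
    G.nrm x = G.normal (Q.owner σ) := nrm_of_mem_frac (Q.face_subset σ hx)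

theorem nComp_mul_eq (μ : Q.Mult) (v : G.Disp) {σ : Fin Q.nF} {x : Vec d} (hx : x ∈ Q.face σ) :
    G.nComp (Q.mfun μ) x * G.nComp (jmp v) x =
      ⟪Q.mn μ σ • G.normal (Q.owner σ), jmp v x⟫ := by
  unfold nComp mn
  rw [Q.mfun_of_mem μ hx, Q.nrm_of_mem hx, real_inner_smul_left, real_inner_comm (jmp v x)]

theorem inner_mt_normal (μ : Q.Mult) (σ : Fin Q.nF) : ⟪Q.mt μ σ, G.normal (Q.owner σ)⟫ = 0 := by
  unfold mt
  rw [inner_sub_left, real_inner_smul_left, real_inner_self_eq_norm_sq, G.normal_unit, mn]; ring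

theorem tComp_inner_eq (μ : Q.Mult) (v : G.Disp) {σ : Fin Q.nF} {x : Vec d} (hx : x ∈ Q.face σ) :
    ⟪G.tComp (Q.mfun μ) x, G.tComp (jmp v) x⟫ = ⟪Q.mt μ σ, jmp v x⟫ := by
  have : G.tComp (Q.mfun μ) x = Q.mt μ σ := by
    unfold tComp nComp mt mn
    rw [Q.mfun_of_mem μ hx, Q.nrm_of_mem hx]
  rw [this]
  unfold tComp
  rw [inner_sub_right, real_inner_smul_right, Q.nrm_of_mem hx, inner_mt_normal, mul_zero, sub_zero]

theorem integral_nComp_mul (μ : Q.Mult) (v : G.Disp) :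
    ∫ x, G.nComp (Q.mfun μ) x * G.nComp (jmp v) x ∂G.surf =
      ∑ σ, Q.area σ * (Q.mn μ σ * Q.jumpN v σ) := by
  let c : Q.Mult := fun σ => Q.mn μ σ • G.normal (Q.owner σ)
  have h : ∀ σ, ∀ x ∈ Q.face σ, G.nComp (Q.mfun μ) x * G.nComp (jmp v) x = ⟪c σ, jmp v x⟫ :=
    fun σ x hx => Q.nComp_mul_eq μ v hx
  rw [Q.integral_eq_sum_area (c := c) (v := v) _ h]
  · refine Finset.sum_congr rfl fun σ _ => ?_
    simp only [c, real_inner_smul_left, jumpN, avgJump, real_inner_comm]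
  · refine (Q.integrable_mfun_inner c v).congr ?_
    filter_upwards [Q.ae_mem_face] with x hx
    obtain ⟨σ, hσ⟩ := mem_iUnion.1 hx
    rw [h σ x hσ, Q.mfun_of_mem c hσ]

theorem integral_tComp_inner (μ : Q.Mult) (v : G.Disp) :
    ∫ x, ⟪G.tComp (Q.mfun μ) x, G.tComp (jmp v) x⟫ ∂G.surf =
      ∑ σ, Q.area σ * ⟪Q.mt μ σ, Q.avgJump v σ⟫ := by
  have h : ∀ σ, ∀ x ∈ Q.face σ, ⟪G.tComp (Q.mfun μ) x, G.tComp (jmp v) x⟫ =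
    ⟪Q.mt μ σ, jmp v x⟫ := fun σ x hx => Q.tComp_inner_eq μ v hx
  rw [Q.integral_eq_sum_area (c := Q.mt μ) (v := v) _ h]
  refine (Q.integrable_mfun_inner (Q.mt μ) v).congr ?_
  filter_upwards [Q.ae_mem_face] with x hx
  obtain ⟨σ, hσ⟩ := mem_iUnion.1 hx
  rw [h σ x hσ, Q.mfun_of_mem _ hσ]

theorem inner_avgJump_eq (μ : Q.Mult) (v : G.Disp) (σ : Fin Q.nF) :
    ⟪μ σ, Q.avgJump v σ⟫ = Q.mn μ σ * Q.jumpN v σ + ⟪Q.mt μ σ, Q.avgJump v σ⟫ := by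
  unfold mt
  rw [inner_sub_left, real_inner_smul_left, jumpN, avgJump, real_inner_comm (G.normal _)]; ring

theorem mn_sub (μ ν : Q.Mult) (σ : Fin Q.nF) : Q.mn (μ - ν) σ = Q.mn μ σ - Q.mn ν σ :=
  inner_sub_left _ _ _

theorem mt_sub (μ ν : Q.Mult) (σ : Fin Q.nF) : Q.mt (μ - ν) σ = Q.mt μ σ - Q.mt ν σ := by
  unfold mt
  rw [mn_sub, Pi.sub_apply, sub_smul]; abel

/-- Consequences of the discrete contact inequality, with an arbitrary tangential slip `g`. -/
theorem contact_signs {F : ℝ} (hF : 0 ≤ F) {lam : Q.Mult} (hlam : lam ∈ Q.cone F lam)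
    (v : G.Disp) (g : Q.Mult)
    (h : ∀ μ ∈ Q.cone F lam, (∑ σ, Q.area σ * (Q.mn (μ - lam) σ * Q.jumpN v σ))
      + ∑ σ, Q.area σ * ⟪Q.mt (μ - lam) σ, g σ⟫ ≤ 0) :
    (∀ σ, Q.jumpN v σ ≤ 0) ∧ 0 ≤ ∑ σ, Q.area σ * (Q.mn lam σ * Q.jumpN v σ) ∧
      0 ≤ ∑ σ, Q.area σ * ⟪Q.mt lam σ, g σ⟫ := by
  have hnn : ∀ σ, ⟪G.normal (Q.owner σ), G.normal (Q.owner σ)⟫ = 1 := fun σ => by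
    rw [real_inner_self_eq_norm_sq, G.normal_unit, one_pow]
  refine ⟨fun σ => ?_, ?_, ?_⟩
  -- Increasing λ by the unit normal on a single face stays in the cone and isolates the normal jump
  -- on that face.
  · let ν : Q.Mult := Pi.single σ (G.normal (Q.owner σ))
    have hmn : ∀ σ', Q.mn ν σ' = if σ' = σ then 1 else 0 := by
      intro σ'
      by_cases hs : σ' = σ
      · subst hs; simp [mn, ν, G.normal_unit]
      · simp [mn, ν, hs]
    have hmt : ∀ σ', Q.mt ν σ' = 0 := by
      intro σ'
      unfold mt
      rw [hmn]
      by_cases hs : σ' = σ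
      · subst hs; simp [ν]
      · simp [ν, hs]
    have hmem : ν + lam ∈ Q.cone F lam := by
      intro σ'
      have h1 : Q.mn (ν + lam) σ' = Q.mn ν σ' + Q.mn lam σ' := inner_add_left _ _ _
      have h2 : Q.mt (ν + lam) σ' = Q.mt lam σ' := by
        have := Q.mt_sub (ν + lam) lam σ'
        rw [add_sub_cancel_right, hmt] at this
        exact (sub_eq_zero.1 this.symm)
      rw [h1, h2, hmn]
      refine ⟨add_nonneg (by split_ifs <;> norm_num) (hlam σ').1, (hlam σ').2⟩
    have := h _ hmem
    rw [add_sub_cancel_right] at this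
    simp only [hmn, hmt, inner_zero_left, mul_zero, Finset.sum_const_zero, add_zero, ite_mul,
      one_mul, zero_mul, mul_ite, Finset.sum_ite_eq', Finset.mem_univ, if_true] at this
    exact nonpos_of_mul_nonpos_right this (Q.area_pos σ)
  -- Removing the normal part and keeping the tangential one isolates the normal work; the cone of λ
  -- bounds tangential parts by λ_n, not by the normal part of the test multiplier.
  · let ν : Q.Mult := Q.mt lam
    have hmn : ∀ σ, Q.mn ν σ = 0 := fun σ => Q.inner_mt_normal lam σ
    have hmt : ∀ σ, Q.mt ν σ = Q.mt lam σ := fun σ => by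
      rw [mt, hmn, zero_smul, sub_zero]
    have := h ν fun σ => by rw [hmn, hmt]; exact ⟨le_rfl, (hlam σ).2⟩
    simp only [mn_sub, mt_sub, hmn, hmt, sub_self, inner_zero_left, mul_zero,
      Finset.sum_const_zero, add_zero, zero_sub, neg_mul, mul_neg, Finset.sum_neg_distrib] at this
    linarith
  -- Removing the tangential part instead isolates the friction work.
  · let ν : Q.Mult := fun σ => Q.mn lam σ • G.normal (Q.owner σ)
    have hmn : ∀ σ, Q.mn ν σ = Q.mn lam σ := fun σ => by
      simp only [mn, ν, real_inner_smul_left, hnn, mul_one]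
    have hmt : ∀ σ, Q.mt ν σ = 0 := fun σ => by
      rw [mt, hmn, sub_self]
    have := h ν fun σ => by
      rw [hmn, hmt, norm_zero]; exact ⟨(hlam σ).1, mul_nonneg hF (hlam σ).1⟩
    simp only [mn_sub, mt_sub, hmn, hmt, sub_self, zero_mul, mul_zero,
      Finset.sum_const_zero, zero_add, zero_sub, inner_neg_left, mul_neg,
      Finset.sum_neg_distrib] at this
    linarith

theorem enorm_avgJump_pow_le (v : G.Disp) (σ : Fin Q.nF) :
    G.surf (Q.face σ) * ‖Q.avgJump v σ‖ₑ ^ 4 ≤ ∫⁻ x in Q.face σ, ‖jmp v x‖ₑ ^ 4 ∂G.surf := by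
  have h0 := (Q.face_pos σ).ne'
  have ht : G.surf (Q.face σ) ≠ ⊤ := measure_ne_top _ _
  let ν : Measure (Vec d) := (G.surf (Q.face σ))⁻¹ • G.surf.restrict (Q.face σ)
  have : IsProbabilityMeasure ν := ⟨by
    simp only [ν, Measure.smul_apply, Measure.restrict_apply_univ, smul_eq_mul]
    exact ENNReal.inv_mul_cancel h0 ht⟩
  have hm : Measurable (jmp v) := (measurable_tr .plus v).sub (measurable_tr .minus v)
  have h1 : ‖Q.avgJump v σ‖ₑ ^ 4 ≤ ∫⁻ x, ‖jmp v x‖ₑ ^ 4 ∂ν := by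
    rw [avgJump_eq, setAverage_eq']
    exact (pow_le_pow_left' (enorm_integral_le_lintegral_enorm _) 4).trans
      (lintegral_pow_le_of_isProbabilityMeasure ν hm.enorm.aemeasurable (by norm_num))
  calc _ ≤ G.surf (Q.face σ) * ∫⁻ x, ‖jmp v x‖ₑ ^ 4 ∂ν := mul_le_mul_right h1 _
    _ = _ := by
      rw [lintegral_smul_measure, smul_eq_mul, ← mul_assoc, ENNReal.mul_inv_cancel h0 ht, one_mul]

theorem abs_jumpN_le (v : G.Disp) (σ : Fin Q.nF) : |Q.jumpN v σ| ≤ ‖Q.avgJump v σ‖ := by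
  have := abs_real_inner_le_norm (Q.avgJump v σ) (G.normal (Q.owner σ))
  rwa [G.normal_unit, mul_one] at this

/-- Jensen's inequality on each face (`enorm_avgJump_pow_le`); the partition does not enter the
constant. -/
theorem eLpNorm_jumpNF_le (v : G.Disp) : eLpNorm (Q.jumpNF v) 4 G.surf ≤ eLpNorm (jmp v) 4 G.surf := by
  have h : eLpNorm (Q.jumpNF v) 4 G.surf ^ 4 ≤ eLpNorm (jmp v) 4 G.surf ^ 4 := by
    rw [show (4 : ℝ≥0∞) = ((4 : ℕ) : ℝ≥0∞) by norm_num, eLpNorm_natCast_pow _ _ (by norm_num),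
      eLpNorm_natCast_pow _ _ (by norm_num), Q.lintegral_eq_sum_faces, Q.lintegral_eq_sum_faces]
    refine Finset.sum_le_sum fun σ _ => le_trans ?_ (Q.enorm_avgJump_pow_le v σ)
    rw [setLIntegral_congr_fun (g := fun _ => ‖Q.jumpN v σ‖ₑ ^ 4) (Q.face_meas σ)
      fun x hx => by simp only [jumpNF, pwConst_apply_of_mem Q.face_disjoint _ hx],
      setLIntegral_const, mul_comm]
    refine mul_le_mul_right (pow_le_pow_left' ?_ 4) _
    rw [enorm_le_iff_norm_le]
    exact Q.abs_jumpN_le v σ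
  exact (ENNReal.pow_le_pow_left_iff (by norm_num)).1 h

end MechGD

end PoroMech

end

/-! ### Strain bounds and the elastic energy -/

noncomputable section

namespace PoroMech

open Filter Topology NNReal

variable {d : ℕ} {G : FractureNetwork d}

namespace FractureNetwork

theorem grad_sub (v w : G.Disp) : grad (v - w) =ᵐ[G.vol] fun x => grad v x - grad w x :=
  Lp.coeFn_sub _ _

theorem val_sub (v w : G.Disp) : val (v - w) =ᵐ[G.vol] fun x => val v x - val w x :=
  Lp.coeFn_sub _ _

theorem strain_sub (v w : G.Disp) : strain (v - w) =ᵐ[G.vol] fun x => strain v x - strain w x := by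
  filter_upwards [grad_sub v w] with x hx
  ext ij
  simp only [strain, hx, PiLp.sub_apply]
  ring

theorem dvg_sub (v w : G.Disp) : dvg (v - w) =ᵐ[G.vol] fun x => dvg v x - dvg w x := by
  filter_upwards [grad_sub v w] with x hx
  simp only [dvg, hx, PiLp.sub_apply, Finset.sum_sub_distrib]

theorem dvg_eq_sum_strain (v : G.Disp) (x : Vec d) : dvg v x = ∑ i, strain v x (i, i) :=
  Finset.sum_congr rfl fun i _ => by simp only [strain]; ring

theorem sq_dvg_le (v : G.Disp) (x : Vec d) : dvg v x ^ 2 ≤ d * ‖strain v x‖ ^ 2 := by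
  rw [dvg_eq_sum_strain]
  have h := sq_sum_le_card_mul_sum_sq (s := (Finset.univ : Finset (Fin d)))
    (f := fun i => strain v x (i, i))
  rw [Finset.card_univ, Fintype.card_fin] at h
  refine h.trans (mul_le_mul_of_nonneg_left ?_ (Nat.cast_nonneg d))
  rw [EuclideanSpace.norm_sq_eq, Fintype.sum_prod_type]
  refine Finset.sum_le_sum fun i _ => ?_
  refine le_trans (Real.norm_eq_abs _ ▸ (sq_abs _).symm.le) (Finset.single_le_sum (f := fun j => ‖strain v x (i, j)‖ ^ 2)
    (fun _ _ => by positivity) (Finset.mem_univ i))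

theorem norm_strain_le (v : G.Disp) (x : Vec d) : ‖strain v x‖ ≤ (d + 1) * ‖grad v x‖ := by
  have h : ‖strain v x‖ ^ 2 ≤ ((d + 1) * ‖grad v x‖) ^ 2 := by
    rw [EuclideanSpace.norm_sq_eq]
    calc ∑ ij, ‖strain v x ij‖ ^ 2 ≤ ∑ _ij : Fin d × Fin d, ‖grad v x‖ ^ 2 := by
          refine Finset.sum_le_sum fun ij _ => pow_le_pow_left₀ (norm_nonneg _) ?_ 2
          have h1 := PiLp.norm_apply_le (grad v x) (ij.1, ij.2)
          have h2 := PiLp.norm_apply_le (grad v x) (ij.2, ij.1)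
          simp only [Real.norm_eq_abs] at h1 h2
          simp only [strain, Real.norm_eq_abs]
          rw [abs_div, abs_of_pos (two_pos : (0 : ℝ) < 2)]
          have := abs_add_le (grad v x (ij.1, ij.2)) (grad v x (ij.2, ij.1))
          linarith
      _ = (d : ℝ) ^ 2 * ‖grad v x‖ ^ 2 := by
          rw [Finset.sum_const, Finset.card_univ, Fintype.card_prod, Fintype.card_fin, nsmul_eq_mul]
          push_cast; ring
      _ ≤ (d + 1 : ℝ) ^ 2 * ‖grad v x‖ ^ 2 := by gcongr; linarith
      _ = _ := by ring
  exact le_of_sq_le_sq h (by positivity)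

theorem measurable_strain (v : G.Disp) : Measurable (strain v) := by
  have hm := measurable_grad v
  have hc : ∀ ij : Fin d × Fin d, Measurable fun x => grad v x ij := fun ij =>
    (EuclideanSpace.proj ij : Tensor d →L[ℝ] ℝ).continuous.measurable.comp hm
  refine (WithLp.measurable_toLp 2 _).comp (measurable_pi_lambda _ fun ij => ?_)
  exact ((hc _).add (hc _)).div_const 2

theorem memLp_strain (v : G.Disp) : MemLp (strain v) 2 G.vol :=
  (memLp_grad v).of_le_mul (measurable_strain v).aestronglyMeasurable
    (Eventually.of_forall fun x => norm_strain_le v x)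

theorem abs_dvg_le (v : G.Disp) (x : Vec d) : |dvg v x| ≤ d * ‖strain v x‖ := by
  rw [dvg_eq_sum_strain]
  refine (Finset.abs_sum_le_sum_abs _ _).trans ?_
  calc ∑ i, |strain v x (i, i)| ≤ ∑ _i : Fin d, ‖strain v x‖ :=
        Finset.sum_le_sum fun i _ => PiLp.norm_apply_le (strain v x) (i, i)
    _ = _ := by rw [Finset.sum_const, Finset.card_univ, Fintype.card_fin, nsmul_eq_mul]

theorem memLp_dvg (v : G.Disp) : MemLp (dvg v) 2 G.vol := by
  refine (memLp_strain v).of_le_mul (c := d) (Measurable.aestronglyMeasurable ?_)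
    (Eventually.of_forall fun x => abs_dvg_le v x)
  exact Finset.measurable_fun_sum _ fun i _ =>
    (EuclideanSpace.proj (i, i) : Tensor d →L[ℝ] ℝ).continuous.measurable.comp (measurable_grad v)

/-- Under Korn's inequality, the strain controls the displacement, its divergence and its jump. -/
theorem Korn.exists_l2norm_bound (hd : d = 2 ∨ d = 3) (hG : G.Korn) :
    ∃ c : ℝ, 0 ≤ c ∧ ∀ v ∈ G.U₀,
      l2norm (val v) G.vol ≤ c * l2norm (strain v) G.vol ∧
      l2norm (dvg v) G.vol ≤ c * l2norm (strain v) G.vol ∧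
      ∀ Q : MechGD G, l2norm (Q.jumpNF v) G.surf ≤ c * l2norm (strain v) G.vol ∧
        eLpNorm (Q.jumpNF v) 4 G.surf ≤ ENNReal.ofReal (c * l2norm (strain v) G.vol) := by
  obtain ⟨c, hc⟩ := hG.exists_bound hd
  -- The factor |Γ|^{1/4} of the embedding of L⁴(Γ) into L²(Γ).
  let m : ℝ≥0 := (G.surf univ ^ (1 / (2 : ℝ≥0∞).toReal - 1 / (4 : ℝ≥0∞).toReal)).toNNReal
  have hm : G.surf univ ^ (1 / (2 : ℝ≥0∞).toReal - 1 / (4 : ℝ≥0∞).toReal) = m := by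
    refine (ENNReal.coe_toNNReal (ENNReal.rpow_ne_top_of_nonneg ?_ (measure_ne_top _ _))).symm
    norm_num
  refine ⟨c + d + 2 * c * (1 + m), by positivity, fun v hv => ?_⟩
  obtain ⟨h1, -, h3⟩ := hc v hv
  have hS := l2norm_nonneg (strain v) G.vol
  have hc0 : (0 : ℝ) ≤ c := c.2
  have hm0 : (0 : ℝ) ≤ m := m.2
  have hd0 : (0 : ℝ) ≤ d := Nat.cast_nonneg d
  have hcm : (0 : ℝ) ≤ c * m := by positivity
  refine ⟨?_, ?_, fun Q => ?_⟩
  · have : l2norm (val v) G.vol ≤ c * l2norm (strain v) G.vol := by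
      have := ENNReal.toReal_mono (ENNReal.mul_ne_top ENNReal.coe_ne_top (memLp_strain v).2.ne) h1
      rwa [ENNReal.toReal_mul] at this
    refine this.trans (mul_le_mul_of_nonneg_right (by linarith) hS)
  · refine (l2norm_le_of_ae (memLp_strain v) hd0 (Eventually.of_forall (abs_dvg_le v))).trans
      (mul_le_mul_of_nonneg_right (by linarith) hS)
  · have h4 : eLpNorm (Q.jumpNF v) 4 G.surf ≤ ENNReal.ofReal (2 * c * l2norm (strain v) G.vol) := by
      refine (Q.eLpNorm_jumpNF_le v).trans ?_
      refine (eLpNorm_sub_le (measurable_tr .plus v).aestronglyMeasurable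
        (measurable_tr .minus v).aestronglyMeasurable (by norm_num)).trans ?_
      refine (add_le_add (h3 .plus) (h3 .minus)).trans_eq ?_
      rw [eLpNorm_two_eq_ofReal (memLp_strain v), ← two_mul, mul_assoc,
        ENNReal.ofReal_mul (by norm_num), ENNReal.ofReal_mul hc0, ENNReal.ofReal_coe_nnreal,
        ENNReal.ofReal_ofNat]
    refine ⟨?_, h4.trans (ENNReal.ofReal_le_ofReal (mul_le_mul_of_nonneg_right (by linarith) hS))⟩
    have h2 : eLpNorm (Q.jumpNF v) 2 G.surf ≤
        ENNReal.ofReal (2 * c * l2norm (strain v) G.vol * m) := by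
      refine (eLpNorm_le_eLpNorm_mul_rpow_measure_univ
        (show (2 : ℝ≥0∞) ≤ 4 by norm_num)
        (Q.memLp_jumpNF v).1).trans ?_
      rw [hm, ENNReal.ofReal_mul (by positivity), ENNReal.ofReal_coe_nnreal]
      exact mul_le_mul_left h4 _
    refine (l2norm_le_of_eLpNorm_le (by positivity) h2).trans ?_
    have : 2 * c * l2norm (strain v) G.vol * m = 2 * c * m * l2norm (strain v) G.vol := by ring
    rw [this]
    exact mul_le_mul_of_nonneg_right (by linarith) hS

end FractureNetwork

namespace ModelData

variable (D : ModelData G)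

/-- The elastic energy product of two displacements. -/
def elastic (u v : G.Disp) : ℝ := ∫ x, ⟪D.stress u x, strain v x⟫ ∂G.vol

theorem stress_inner (u v : G.Disp) (x : Vec d) : ⟪D.stress u x, strain v x⟫ =
    D.E / (1 + D.ν) * (⟪strain u x, strain v x⟫ + D.ν / (1 - 2 * D.ν) * dvg u x * dvg v x) := by
  have : ⟪(WithLp.toLp 2 fun ij => if ij.1 = ij.2 then (1 : ℝ) else 0 : Tensor d), strain v x⟫ =
      dvg v x := by
    rw [dvg_eq_sum_strain, PiLp.inner_apply, Fintype.sum_prod_type]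
    refine Finset.sum_congr rfl fun i _ => ?_
    simp
  rw [stress, real_inner_smul_left, inner_add_left, real_inner_smul_left, this]

theorem integrable_stress_inner (u v : G.Disp) :
    Integrable (fun x => ⟪D.stress u x, strain v x⟫) G.vol := by
  simp only [stress_inner, mul_assoc]
  exact ((integrable_inner_of_memLp (memLp_strain u) (memLp_strain v)).add
    ((integrable_mul_of_memLp (memLp_dvg u) (memLp_dvg v)).const_mul _)).const_mul _

/-- The coercivity constant of the elastic energy. -/
def elasticLower : ℝ := D.E / (1 + D.ν) * min 1 ((1 + D.ν) / (1 - 2 * D.ν))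

theorem elasticLower_pos : 0 < D.elasticLower := by
  have h1 := D.E_pos; have h2 := D.ν_gt; have h3 := D.ν_lt
  have h4 : 0 < 1 + D.ν := by linarith
  have h5 : 0 < 1 - 2 * D.ν := by linarith
  unfold elasticLower
  positivity

/-- For ν ≥ 0 the divergence term is dropped. For ν < 0 it is estimated by (div u)² ≤ 3 |ε(u)|², and
1 + 3ν/(1-2ν) = (1+ν)/(1-2ν) is still positive; this is where d ≤ 3 is used. -/
theorem stress_inner_self_ge (hd : d ≤ 3) (u : G.Disp) (x : Vec d) :
    D.elasticLower * ‖strain u x‖ ^ 2 ≤ ⟪D.stress u x, strain u x⟫ := by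
  have h1 := D.E_pos; have h2 := D.ν_gt; have h3 := D.ν_lt
  have h4 : 0 < 1 + D.ν := by linarith
  have h5 : 0 < 1 - 2 * D.ν := by linarith
  rw [stress_inner, elasticLower, mul_assoc, real_inner_self_eq_norm_sq, mul_assoc _ (dvg u x),
    ← sq]
  refine mul_le_mul_of_nonneg_left ?_ (by positivity)
  have h6 := sq_dvg_le u x
  have h7 : (d : ℝ) ≤ 3 := by exact_mod_cast hd
  have hS : 0 ≤ ‖strain u x‖ ^ 2 := by positivity
  rcases le_total 0 D.ν with h | h
  · have : 0 ≤ D.ν / (1 - 2 * D.ν) * dvg u x ^ 2 := by positivity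
    have := mul_le_mul_of_nonneg_right (min_le_left 1 ((1 + D.ν) / (1 - 2 * D.ν))) hS
    linarith
  · have h8 : D.ν / (1 - 2 * D.ν) ≤ 0 := div_nonpos_of_nonpos_of_nonneg h h5.le
    have h9 : dvg u x ^ 2 ≤ 3 * ‖strain u x‖ ^ 2 := h6.trans (mul_le_mul_of_nonneg_right h7 hS)
    have h10 := mul_le_mul_of_nonpos_left h9 h8
    have h11 := mul_le_mul_of_nonneg_right (min_le_right 1 ((1 + D.ν) / (1 - 2 * D.ν))) hS
    have h12 : (1 + D.ν) / (1 - 2 * D.ν) = 1 + 3 * (D.ν / (1 - 2 * D.ν)) := by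
      rw [div_eq_iff h5.ne', add_mul, mul_assoc, div_mul_cancel₀ _ h5.ne']; ring
    have h13 : (1 + D.ν) / (1 - 2 * D.ν) * ‖strain u x‖ ^ 2 =
        ‖strain u x‖ ^ 2 + D.ν / (1 - 2 * D.ν) * (3 * ‖strain u x‖ ^ 2) := by rw [h12]; ring
    linarith

theorem elastic_self_ge (hd : d ≤ 3) (u : G.Disp) :
    D.elasticLower * l2norm (strain u) G.vol ^ 2 ≤ D.elastic u u := by
  rw [sq_l2norm (memLp_strain u), ← integral_const_mul]
  exact integral_mono ((integrable_norm_sq (memLp_strain u)).const_mul _)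
    (D.integrable_stress_inner u u) fun x => D.stress_inner_self_ge hd u x

/-- The identity a(a-b) = (a² - b² + (a-b)²)/2 for the symmetric elastic form, whose value on u - w
is nonnegative by coercivity. -/
theorem elastic_sub_ge (hd : d ≤ 3) (u w : G.Disp) :
    1 / 2 * D.elastic u u - 1 / 2 * D.elastic w w ≤ D.elastic u (u - w) := by
  unfold elastic
  rw [← integral_const_mul, ← integral_const_mul,
    ← integral_sub ((D.integrable_stress_inner u u).const_mul _)
      ((D.integrable_stress_inner w w).const_mul _)]
  refine integral_mono_ae (((D.integrable_stress_inner u u).const_mul _).sub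
      ((D.integrable_stress_inner w w).const_mul _)) (D.integrable_stress_inner u (u - w)) ?_
  filter_upwards [strain_sub u w, dvg_sub u w] with x h1 h2
  have h3 := D.stress_inner_self_ge hd (u - w) x
  have h4 : 0 ≤ D.elasticLower * ‖strain (u - w) x‖ ^ 2 :=
    mul_nonneg D.elasticLower_pos.le (by positivity)
  simp only [stress_inner, h1, h2, inner_sub_left, inner_sub_right,
    real_inner_comm (strain u x) (strain w x)] at h3 h4 ⊢
  nlinarith

/-- An upper bound for the elastic energy product. -/
theorem exists_elastic_le : ∃ c : ℝ, 0 ≤ c ∧ ∀ u v : G.Disp,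
    |D.elastic u v| ≤ c * (l2norm (strain u) G.vol * l2norm (strain v) G.vol) := by
  refine ⟨|D.E / (1 + D.ν)| * (1 + |D.ν / (1 - 2 * D.ν)| * (d * d)), by positivity, fun u v => ?_⟩
  have hi := integrable_inner_of_memLp (memLp_strain u) (memLp_strain v)
  have hd := integrable_mul_of_memLp (memLp_dvg u) (memLp_dvg v)
  have h1 : D.elastic u v = D.E / (1 + D.ν) * ((∫ x, ⟪strain u x, strain v x⟫ ∂G.vol) +
      D.ν / (1 - 2 * D.ν) * ∫ x, dvg u x * dvg v x ∂G.vol) := by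
    unfold elastic
    simp only [stress_inner, mul_assoc]
    rw [integral_const_mul, integral_add hi (hd.const_mul _), integral_const_mul]
  have h2 := abs_integral_inner_le (memLp_strain u) (memLp_strain v)
  have h3 := abs_integral_mul_le (memLp_dvg u) (memLp_dvg v)
  have h4 : ∀ w : G.Disp, l2norm (dvg w) G.vol ≤ d * l2norm (strain w) G.vol := fun w =>
    l2norm_le_of_ae (memLp_strain w) (Nat.cast_nonneg d) (Eventually.of_forall (abs_dvg_le w))
  have h5 := mul_le_mul (h4 u) (h4 v) (l2norm_nonneg _ _)
    (mul_nonneg (Nat.cast_nonneg d) (l2norm_nonneg _ _))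
  rw [h1, abs_mul, mul_assoc]
  refine mul_le_mul_of_nonneg_left ?_ (abs_nonneg _)
  refine (abs_add_le _ _).trans ?_
  rw [abs_mul, add_mul, one_mul, mul_assoc]
  refine add_le_add h2 (mul_le_mul_of_nonneg_left ?_ (abs_nonneg _))
  linarith

end ModelData

end PoroMech

end

/-! ### The scheme at a single time step -/

noncomputable section

namespace PoroMech

open Filter Topology NNReal

variable {d : ℕ} {G : FractureNetwork d}

/-- The difference quotient over the `j`-th time step. -/
def TimeGrid.quot {T : ℝ} (τ : TimeGrid T) {E : Type*} [AddCommGroup E] [Module ℝ E] (w : ℕ → E)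
    (j : ℕ) : E :=
  (τ.t j - τ.t (j - 1))⁻¹ • (w j - w (j - 1))

theorem TimeGrid.step_pos {T : ℝ} (τ : TimeGrid T) {k : ℕ} (hk : k < τ.N) :
    0 < τ.t (k + 1) - τ.t k := sub_pos.2 (τ.t_lt k hk)

section Scheme

variable (D : ModelData G) (B : BiotData) (P : FlowGD G D.d₀) (Q : MechGD G) (τ : TimeGrid D.T)
  (p : ℕ → Phase → P.X) (u : ℕ → Q.X) (lam : ℕ → Q.Mult)

/-- The left-hand side of the flow equation at the `j`-th time step. -/
def flowForm (α : Phase) (ψ : P.X) (j : ℕ) : ℝ :=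
  (∫ x, (τ.quot (fun k x => porosity D B P Q p u k x * P.recM (satM D P α .mat (p k)) x) j x
          * P.recM ψ.1 x
        + D.mob α .mat (P.recM (satM D P α .mat (p j)) x)
          * ⟪D.K x (P.gradM (p j α).1 x), P.gradM ψ.1 x⟫) ∂G.vol)
    + (∫ x, τ.quot (fun k x => aperture D Q (u k) x * P.recF (satF D P α (p k)) x) j x
          * P.recF ψ.2 x ∂G.surf)
    + (∫ x, D.mob α .frac (P.recF (satF D P α (p j)) x)
          * (aperture D Q (u j).1 x ^ 3 / 12)
          * ⟪P.gradF (p j α).2 x, P.gradF ψ.2 x⟫ ∂G.surf)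
    + ((∫ x, (mfFlux D P α .plus (p j) x * P.jump .plus ψ x
          + B.dDam .plus * B.φDam .plus
            * τ.quot (fun k => P.recT .plus (satM D P α (.dam .plus) (p k))) j x
            * P.recT .plus ψ.1 x) ∂G.surf)
      + ∫ x, (mfFlux D P α .minus (p j) x * P.jump .minus ψ x
          + B.dDam .minus * B.φDam .minus
            * τ.quot (fun k => P.recT .minus (satM D P α (.dam .minus) (p k))) j x
            * P.recT .minus ψ.1 x) ∂G.surf)

variable {D B P Q τ p u lam}

theorem FlowGD.recM_zero (x : Vec d) : P.recM 0 x = 0 := pwConst_zero _ x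
theorem FlowGD.recF_zero (x : Vec d) : P.recF 0 x = 0 := pwConst_zero _ x
theorem FlowGD.recT_zero (a : Side) (x : Vec d) : P.recT a 0 x = 0 := pwConst_zero _ x

theorem flowForm_zero (α : Phase) (j : ℕ) : flowForm D B P Q τ p u α 0 j = 0 := by
  have hgM : ⇑(P.gradM 0) =ᵐ[G.vol] 0 := by rw [map_zero]; exact Lp.coeFn_zero _ _ _
  have hgF : ⇑(P.gradF 0) =ᵐ[G.surf] 0 := by rw [map_zero]; exact Lp.coeFn_zero _ _ _
  have hj : ∀ a, ⇑(P.jump a 0) =ᵐ[G.surf] 0 := fun a => by rw [map_zero]; exact Lp.coeFn_zero _ _ _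
  unfold flowForm
  simp only [Prod.fst_zero, Prod.snd_zero, FlowGD.recM_zero, FlowGD.recF_zero, FlowGD.recT_zero,
    mul_zero, add_zero, zero_add, integral_zero]
  rw [integral_eq_zero_of_ae, integral_eq_zero_of_ae, integral_eq_zero_of_ae,
    integral_eq_zero_of_ae]
  · norm_num
  · filter_upwards [hj .minus] with x hx
    simp only [hx, Pi.zero_apply, mul_zero]
  · filter_upwards [hj .plus] with x hx
    simp only [hx, Pi.zero_apply, mul_zero]
  · filter_upwards [hgF] with x hx
    simp only [hx, Pi.zero_apply, mul_zero, inner_zero_right]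
  · filter_upwards [hgM] with x hx
    simp only [hx, Pi.zero_apply, mul_zero, inner_zero_right]

/-- The test sequence takes the value ψ at the index k + 1 and vanishes elsewhere. The sources
depend on time inside the step, so their integral cannot be simplified further. -/
theorem FlowEq.step {α : Phase} (h : FlowEq D B P Q τ p u α) {k : ℕ} (hk : k < τ.N) (ψ : P.X) :
    (τ.t (k + 1) - τ.t k) * flowForm D B P Q τ p u α ψ (k + 1) =
      ∫ s in Ioc (τ.t k) (τ.t (k + 1)), ((∫ x, D.hm α (s, x) * P.recM ψ.1 x ∂G.vol)
          + ∫ x, D.hf α (s, x) * P.recF ψ.2 x ∂G.surf) := by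
  let φ : ℕ → P.X := fun j => if j = k + 1 then ψ else 0
  have hφ : ∀ j, j ≠ k + 1 → φ j = 0 := fun j hj => if_neg hj
  have hφk : φ (k + 1) = ψ := if_pos rfl
  have h1 := h φ
  have h2 : ∫ s in Ioc 0 D.T, flowForm D B P Q τ p u α (φ (τ.idx s)) (τ.idx s) =
    ∫ s in Ioc 0 D.T, ((∫ x, D.hm α (s, x) * P.recM (φ (τ.idx s)).1 x ∂G.vol)
          + ∫ x, D.hf α (s, x) * P.recF (φ (τ.idx s)).2 x ∂G.surf) := h1
  rw [τ.setIntegral_step hk (fun j => flowForm D B P Q τ p u α (φ j) j)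
    (fun j hj => by rw [hφ j hj, flowForm_zero]), hφk] at h2
  rw [h2, τ.setIntegral_eq_of_idx hk]
  · refine setIntegral_congr_fun measurableSet_Ioc fun s hs => ?_
    simp only [τ.idx_eq hk hs, hφk]
  · intro s hs
    simp [hφ _ hs, FlowGD.recM_zero, FlowGD.recF_zero]

theorem mechForm_zero (q : Phase → P.X) (v : G.Disp) (μ : Q.Mult) :
    mechForm D B P Q q v μ 0 = 0 := by
  have h0 : grad (0 : G.Disp) =ᵐ[G.vol] 0 := Lp.coeFn_zero _ _ _
  have ht : ∀ a, tr a (0 : G.Disp) =ᵐ[G.surf] 0 := fun a => Lp.coeFn_zero _ _ _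
  have hN : Q.jumpN (0 : G.Disp) = 0 := by
    ext σ
    have := Q.jumpN_sub 0 0 σ
    rwa [sub_self, sub_self] at this
  have hjN : ∀ x, Q.jumpNF (0 : G.Disp) x = 0 := fun x => by
    unfold MechGD.jumpNF; rw [hN]; exact pwConst_zero _ x
  unfold mechForm
  simp only [hjN, mul_zero, integral_zero, add_zero]
  rw [integral_eq_zero_of_ae, integral_eq_zero_of_ae, add_zero]
  · filter_upwards [ht .plus, ht .minus] with x h1 h2
    simp [jmp, h1, h2]
  · filter_upwards [h0] with x h1
    have h2 : strain (0 : G.Disp) x = 0 := by ext ij; simp [strain, h1]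
    simp [h2, dvg, h1]

theorem MechEq.step (h : MechEq D B P Q τ p u lam) {k : ℕ} (hk : k < τ.N) (v : Q.X) :
    mechForm D B P Q (p (k + 1)) (u (k + 1)).1 (lam (k + 1)) v =
      ∫ x, ⟪D.f x, val (v : G.Disp) x⟫ ∂G.vol := by
  let φ : ℕ → Q.X := fun j => if j = k + 1 then v else 0
  have hφ : ∀ j, j ≠ k + 1 → φ j = 0 := fun j hj => if_neg hj
  have hφk : φ (k + 1) = v := if_pos rfl
  let L : ℕ → ℝ := fun j => mechForm D B P Q (p j) (u j).1 (lam j) (φ j).1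
  let R : ℕ → ℝ := fun j => ∫ x, ⟪D.f x, val (φ j).1 x⟫ ∂G.vol
  have h2 : ∫ s in Ioc 0 D.T, L (τ.idx s) = ∫ s in Ioc 0 D.T, R (τ.idx s) := h φ
  have h0 : val (0 : G.Disp) =ᵐ[G.vol] 0 := Lp.coeFn_zero _ _ _
  rw [τ.setIntegral_step hk L (fun j hj => by
      simp only [L, hφ j hj]; exact mechForm_zero _ _ _),
    τ.setIntegral_step hk R (fun j hj => by
      simp only [R, hφ j hj]
      refine integral_eq_zero_of_ae ?_
      filter_upwards [h0] with x hx
      show ⟪D.f x, val (0 : G.Disp) x⟫ = 0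
      rw [hx]; exact inner_zero_right _)] at h2
  simp only [L, R, hφk] at h2
  exact mul_left_cancel₀ (τ.step_pos hk).ne' h2

theorem MechGD.mfun_zero (x : Vec d) : Q.mfun 0 x = 0 := pwConst_zero _ x

/-- Away from the index k + 1 the test multiplier is λ itself, which is admissible and contributes
zero. The step length survives only in the tangential term, through the difference quotient. -/
theorem ContactIneq.step (h : ContactIneq D Q τ u lam) {k : ℕ}
    (hlam : ∀ k ≤ τ.N, lam k ∈ Q.cone D.F (lam k)) (hk : k < τ.N) {μ : Q.Mult}
    (hμ : μ ∈ Q.cone D.F (lam (k + 1))) :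
    (∑ σ, Q.area σ * (Q.mn (μ - lam (k + 1)) σ * Q.jumpN (u (k + 1)).1 σ)) +
      ∑ σ, Q.area σ * ⟪Q.mt (μ - lam (k + 1)) σ,
        Q.avgJump (u (k + 1) - u k : G.Disp) σ⟫ * (τ.t (k + 1) - τ.t k)⁻¹ ≤ 0 := by
  let φ : ℕ → Q.Mult := fun j => if j = k + 1 then μ else lam j
  have hφ : ∀ j, j ≠ k + 1 → φ j = lam j := fun j hj => if_neg hj
  have hφk : φ (k + 1) = μ := if_pos rfl
  have hmem : ∀ j, 1 ≤ j → j ≤ τ.N → φ j ∈ Q.cone D.F (lam j) := by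
    intro j _ hj
    by_cases hjk : j = k + 1
    · subst hjk; rw [hφk]; exact hμ
    · rw [hφ j hjk]; exact hlam j hj
  let L : ℕ → ℝ := fun j =>
    ∫ x, G.nComp (Q.mfun (φ j - lam j)) x * G.nComp (jmp (u j).1) x ∂G.surf
  let R : ℕ → ℝ := fun j =>
    ∫ x, ⟪G.tComp (Q.mfun (φ j - lam j)) x, G.tComp (jmp (τ.quot u j).1) x⟫ ∂G.surf
  have h2 : (∫ s in Ioc 0 D.T, L (τ.idx s)) + (∫ s in Ioc 0 D.T, R (τ.idx s)) ≤ 0 := h φ hmem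
  have hn0 : ∀ x, G.nComp (Q.mfun 0) x = 0 := fun x => by
    unfold nComp; rw [MechGD.mfun_zero]; exact inner_zero_left _
  have ht0 : ∀ x, G.tComp (Q.mfun 0) x = 0 := fun x => by
    unfold tComp; rw [hn0, MechGD.mfun_zero, zero_smul, sub_zero]
  rw [τ.setIntegral_step hk L (fun j hj => by
      simp only [L, hφ j hj, sub_self, hn0, zero_mul, integral_zero]),
    τ.setIntegral_step hk R (fun j hj => by
      simp only [R, hφ j hj, sub_self, ht0, inner_zero_left, integral_zero]), ← mul_add] at h2
  have h3 := nonpos_of_mul_nonpos_right h2 (τ.step_pos hk)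
  simp only [L, R, hφk] at h3
  rw [Q.integral_nComp_mul, Q.integral_tComp_inner] at h3
  refine le_trans (le_of_eq ?_) h3
  congr 1
  refine Finset.sum_congr rfl fun σ _ => ?_
  have : ((τ.quot u (k + 1) : Q.X) : G.Disp) =
    (τ.t (k + 1) - τ.t k)⁻¹ • (u (k + 1) - u k : G.Disp) := rfl
  rw [this, Q.avgJump_smul, real_inner_smul_right]
  ring

variable (h : IsSolution D B P Q τ p u lam)
include h

namespace IsSolution

/-- In the stationary problem the slip is the initial jump itself, so `contact_signs` gives the sign
of the whole contact work. -/
theorem initial_contact : (∀ σ, Q.jumpN (u 0).1 σ ≤ 0) ∧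
    0 ≤ ∫ x, ⟪Q.mfun (lam 0) x, jmp (u 0 : G.Disp) x⟫ ∂G.surf := by
  obtain ⟨h1, h2, h3⟩ := Q.contact_signs D.F_nonneg (h.lam_mem 0 (Nat.zero_le _)) (u 0 : G.Disp)
    (Q.avgJump (u 0)) (fun μ hμ => by
      rw [← Q.integral_nComp_mul, ← Q.integral_tComp_inner]
      exact h.init_mech.2 μ hμ)
  refine ⟨h1, ?_⟩
  rw [Q.integral_mfun_inner, Finset.sum_congr rfl fun σ _ => by rw [Q.inner_avgJump_eq, mul_add],
    Finset.sum_add_distrib]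
  exact add_nonneg h2 h3

theorem contact_step {k : ℕ} (hk : k < τ.N) : (∀ σ, Q.jumpN (u (k + 1)).1 σ ≤ 0) ∧
    0 ≤ ∑ σ, Q.area σ * (Q.mn (lam (k + 1)) σ * Q.jumpN (u (k + 1)).1 σ) ∧
      0 ≤ ∑ σ, Q.area σ * ⟪Q.mt (lam (k + 1)) σ, Q.avgJump (u (k + 1) - u k : G.Disp) σ⟫ := by
  obtain ⟨h1, h2, h3⟩ := Q.contact_signs D.F_nonneg (h.lam_mem (k + 1) hk) (u (k + 1) : G.Disp)
    (fun σ => (τ.t (k + 1) - τ.t k)⁻¹ • Q.avgJump (u (k + 1) - u k : G.Disp) σ) (fun μ hμ => by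
      refine le_trans (le_of_eq ?_) (h.contact.step h.lam_mem hk hμ)
      congr 1
      refine Finset.sum_congr rfl fun σ _ => ?_
      rw [real_inner_smul_right]; ring)
  refine ⟨h1, h2, ?_⟩
  have : ∑ σ, Q.area σ * ⟪Q.mt (lam (k + 1)) σ,
      (τ.t (k + 1) - τ.t k)⁻¹ • Q.avgJump (u (k + 1) - u k : G.Disp) σ⟫ = (τ.t (k + 1) - τ.t k)⁻¹ *
      ∑ σ, Q.area σ * ⟪Q.mt (lam (k + 1)) σ, Q.avgJump (u (k + 1) - u k : G.Disp) σ⟫ := by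
    rw [Finset.mul_sum]
    refine Finset.sum_congr rfl fun σ _ => ?_
    rw [real_inner_smul_right]; ring
  rw [this] at h3
  exact nonneg_of_mul_nonneg_right h3 (inv_pos.2 (τ.step_pos hk))

theorem jumpN_nonpos {k : ℕ} (hk : k ≤ τ.N) (σ : Fin Q.nF) : Q.jumpN (u k).1 σ ≤ 0 := by
  cases k with
  | zero => exact h.initial_contact.1 σ
  | succ k => exact (h.contact_step hk).1 σ

theorem jumpNF_nonpos {k : ℕ} (hk : k ≤ τ.N) (x : Vec d) : Q.jumpNF (u k).1 x ≤ 0 := by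
  unfold MechGD.jumpNF
  rcases pwConst_cases Q.face_disjoint x with ⟨σ, -, hσ⟩ | ⟨-, h0⟩
  · rw [hσ]; exact h.jumpN_nonpos hk σ
  · rw [h0]

/-- Non-penetration: the contact conditions can only open the fractures. This allows the
dissipation, weighted by the aperture, to be compared with the discrete norm, weighted by d₀. -/
theorem d₀_le_aperture {k : ℕ} (hk : k ≤ τ.N) (x : Vec d) :
    D.d₀ x ≤ aperture D Q (u k).1 x := by
  have := h.jumpNF_nonpos hk x
  unfold aperture; linarith

/-- The friction part is nonnegative by the contact inequality. In the normal part, subtracting the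
old jump only helps, because it is nonpositive and λ_n ≥ 0. For the first step this uses the initial
contact problem. -/
theorem contact_work_nonneg {k : ℕ} (hk : k < τ.N) :
    0 ≤ ∫ x, ⟪Q.mfun (lam (k + 1)) x, jmp (u (k + 1) - u k : G.Disp) x⟫ ∂G.surf := by
  obtain ⟨-, h2, h3⟩ := h.contact_step hk
  rw [Q.integral_mfun_inner, Finset.sum_congr rfl fun σ _ => by rw [Q.inner_avgJump_eq, mul_add],
    Finset.sum_add_distrib]
  refine add_nonneg (h2.trans (Finset.sum_le_sum fun σ _ => ?_)) h3
  refine mul_le_mul_of_nonneg_left ?_ (Q.area_pos σ).le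
  refine mul_le_mul_of_nonneg_left ?_ (h.lam_mem (k + 1) hk σ).1
  rw [Q.jumpN_sub]
  linarith [h.jumpN_nonpos hk.le σ]

end IsSolution

end Scheme

end PoroMech

end

/-! ### Splitting the flow equation into accumulation and flux terms -/

noncomputable section

namespace PoroMech

open Filter Topology NNReal

variable {d : ℕ} {G : FractureNetwork d}

namespace FlowGD

variable {d₀ : Vec d → ℝ} {P : FlowGD G d₀}

theorem memLp_recM (v : Fin P.nm → ℝ) {r : ℝ≥0∞} : MemLp (P.recM v) r G.vol :=
  (memLp_pwConst P.cellM_disjoint P.cellM_meas v).mono_exponent le_top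

theorem memLp_recF (v : Fin P.nf → ℝ) {r : ℝ≥0∞} : MemLp (P.recF v) r G.surf :=
  (memLp_pwConst P.cellF_disjoint P.cellF_meas v).mono_exponent le_top

theorem memLp_recT (a : Side) (v : Fin P.nm → ℝ) {r : ℝ≥0∞} :
    MemLp (P.recT a v) r G.surf :=
  (memLp_pwConst (P.cellT_disjoint a) (P.cellT_meas a) v).mono_exponent le_top

theorem memLp_comp_recM (f : ℝ → ℝ) (v : Fin P.nm → ℝ) {r : ℝ≥0∞} :
    MemLp (fun x => f (P.recM v x)) r G.vol :=
  (memLp_comp_pwConst P.cellM_disjoint P.cellM_meas v f).mono_exponent le_top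

theorem memLp_comp_recF (f : ℝ → ℝ) (v : Fin P.nf → ℝ) {r : ℝ≥0∞} :
    MemLp (fun x => f (P.recF v x)) r G.surf :=
  (memLp_comp_pwConst P.cellF_disjoint P.cellF_meas v f).mono_exponent le_top

theorem memLp_comp_recT (f : ℝ → ℝ) (a : Side) (v : Fin P.nm → ℝ) {r : ℝ≥0∞} :
    MemLp (fun x => f (P.recT a v x)) r G.surf :=
  (memLp_comp_pwConst (P.cellT_disjoint a) (P.cellT_meas a) v f).mono_exponent le_top

end FlowGD

section Scheme

variable (D : ModelData G) (B : BiotData) (P : FlowGD G D.d₀) (Q : MechGD G) (τ : TimeGrid D.T)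
  (p : ℕ → Phase → P.X) (u : ℕ → Q.X)

variable {D} in
theorem ModelData.memLp_d₀ : MemLp D.d₀ ⊤ G.surf := by
  obtain ⟨C, hC⟩ := D.d₀_bdd
  refine memLp_top_of_bound (D.d₀_cont.aestronglyMeasurable G.measurableSet_Γ) C ?_
  filter_upwards [ae_restrict_mem G.measurableSet_Γ] with x hx
  rw [Real.norm_eq_abs, abs_of_pos (D.d₀_pos x hx)]
  exact hC x hx

theorem memLp_aperture (v : G.Disp) {r : ℝ≥0∞} : MemLp (aperture D Q v) r G.surf :=
  (D.memLp_d₀.sub (Q.memLp_jumpNF v)).mono_exponent le_top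

theorem memLp_porosity (k : ℕ) : MemLp (porosity D B P Q p u k) 2 G.vol :=
  ((FlowGD.memLp_recM _).add ((memLp_dvg _).const_mul _)).add ((FlowGD.memLp_recM _).const_mul _)

theorem memLp_mfFlux (α : Phase) (a : Side) (q : Phase → P.X) :
    MemLp (mfFlux D P α a q) ⊤ G.surf := by
  have hj : MemLp (P.jump a (q α)) ⊤ G.surf := Lp.memLp _
  have h1 : MemLp (fun x => max 0 (P.jump a (q α) x)) ⊤ G.surf := by
    simp only [max_comm (0 : ℝ)]; exact hj.pos_part
  have h2 : MemLp (fun x => max 0 (-P.jump a (q α) x)) ⊤ G.surf := by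
    simp only [max_comm (0 : ℝ)]; exact hj.neg_part
  have h3 : MemLp (fun x => D.mob α (.dam a) (P.recT a (satM D P α (.dam a) q) x)
      * max 0 (P.jump a (q α) x)) ⊤ G.surf := memLp_mul (FlowGD.memLp_comp_recT _ _ _ (r := ⊤)) h1
  have h4 : MemLp (fun x => D.mob α .frac (P.recF (satF D P α q) x)
      * max 0 (-P.jump a (q α) x)) ⊤ G.surf := memLp_mul (FlowGD.memLp_comp_recF _ _ (r := ⊤)) h2
  exact memLp_mul D.Λ_memLp (h3.sub h4)

/-- Accumulation in the matrix over a time step, tested with `ψ`. -/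
def accM (α : Phase) (ψ : P.X) (k : ℕ) : ℝ :=
  ∫ x, (porosity D B P Q p u (k + 1) x * P.recM (satM D P α .mat (p (k + 1))) x
    - porosity D B P Q p u k x * P.recM (satM D P α .mat (p k)) x) * P.recM ψ.1 x ∂G.vol

/-- Accumulation in the fractures over a time step, tested with `ψ`. -/
def accF (α : Phase) (ψ : P.X) (k : ℕ) : ℝ :=
  ∫ x, (aperture D Q (u (k + 1)) x * P.recF (satF D P α (p (k + 1))) x
    - aperture D Q (u k) x * P.recF (satF D P α (p k)) x) * P.recF ψ.2 x ∂G.surf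

/-- Accumulation in a damaged layer over a time step, tested with `ψ`. -/
def accT (α : Phase) (a : Side) (ψ : P.X) (k : ℕ) : ℝ :=
  ∫ x, (P.recT a (satM D P α (.dam a) (p (k + 1))) x
    - P.recT a (satM D P α (.dam a) (p k)) x) * P.recT a ψ.1 x ∂G.surf

/-- Darcy term in the matrix. -/
def diffM (α : Phase) (q : Phase → P.X) (ψ : P.X) : ℝ :=
  ∫ x, D.mob α .mat (P.recM (satM D P α .mat q) x)
    * ⟪D.K x (P.gradM (q α).1 x), P.gradM ψ.1 x⟫ ∂G.vol

/-- Poiseuille term in the fractures. -/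
def diffF (α : Phase) (q : Phase → P.X) (v : G.Disp) (ψ : P.X) : ℝ :=
  ∫ x, D.mob α .frac (P.recF (satF D P α q) x) * (aperture D Q v x ^ 3 / 12)
    * ⟪P.gradF (q α).2 x, P.gradF ψ.2 x⟫ ∂G.surf

/-- Matrix--fracture exchange term. -/
def exch (α : Phase) (a : Side) (q : Phase → P.X) (ψ : P.X) : ℝ :=
  ∫ x, mfFlux D P α a q x * P.jump a ψ x ∂G.surf

theorem integrable_diffM (α : Phase) (q : Phase → P.X) (ψ : P.X) :
    Integrable (fun x => D.mob α .mat (P.recM (satM D P α .mat q) x)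
      * ⟪D.K x (P.gradM (q α).1 x), P.gradM ψ.1 x⟫) G.vol := by
  have h1 : MemLp (fun x => D.K x (P.gradM (q α).1 x)) ⊤ G.vol :=
    memLp_clm_apply D.K_memLp (Lp.memLp (P.gradM (q α).1))
  have h2 : MemLp (fun x => ⟪D.K x (P.gradM (q α).1 x), P.gradM ψ.1 x⟫) ⊤ G.vol :=
    memLp_inner h1 (Lp.memLp (P.gradM ψ.1))
  exact integrable_mul_of_memLp (FlowGD.memLp_comp_recM _ _) (h2.mono_exponent le_top)

theorem memLp_aperture_pow (v : G.Disp) : MemLp (fun x => aperture D Q v x ^ 3) ⊤ G.surf := by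
  have h := memLp_aperture D Q v (r := ⊤)
  have h2 : MemLp (fun x => aperture D Q v x * (aperture D Q v x * aperture D Q v x)) ⊤ G.surf :=
    memLp_mul h (memLp_mul h h (r := ⊤))
  simpa only [pow_succ, pow_zero, one_mul, mul_assoc] using h2

theorem integrable_diffF (α : Phase) (q : Phase → P.X) (v : G.Disp) (ψ : P.X) :
    Integrable (fun x => D.mob α .frac (P.recF (satF D P α q) x) * (aperture D Q v x ^ 3 / 12)
      * ⟪P.gradF (q α).2 x, P.gradF ψ.2 x⟫) G.surf := by
  have h1 : MemLp (fun x => ⟪P.gradF (q α).2 x, P.gradF ψ.2 x⟫) ⊤ G.surf :=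
    memLp_inner (Lp.memLp (P.gradF (q α).2)) (Lp.memLp (P.gradF ψ.2))
  have h2 : MemLp (fun x => aperture D Q v x ^ 3 / 12) ⊤ G.surf := by
    simpa only [div_eq_mul_inv] using (memLp_aperture_pow D Q v).mul_const _
  have h3 : MemLp (fun x => D.mob α .frac (P.recF (satF D P α q) x) * (aperture D Q v x ^ 3 / 12))
      ⊤ G.surf := memLp_mul (FlowGD.memLp_comp_recF _ _ (r := ⊤)) h2
  exact integrable_mul_of_memLp (h3.mono_exponent le_top) (h1.mono_exponent le_top)

theorem integrable_exch (α : Phase) (a : Side) (q : Phase → P.X) (ψ : P.X) :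
    Integrable (fun x => mfFlux D P α a q x * P.jump a ψ x) G.surf :=
  integrable_mul_of_memLp ((memLp_mfFlux D P α a q).mono_exponent le_top)
    ((Lp.memLp (P.jump a ψ)).mono_exponent le_top)

theorem integrable_accM (α : Phase) (ψ : P.X) (k : ℕ) :
    Integrable (fun x => (porosity D B P Q p u (k + 1) x * P.recM (satM D P α .mat (p (k + 1))) x
    - porosity D B P Q p u k x * P.recM (satM D P α .mat (p k)) x) * P.recM ψ.1 x) G.vol := by
  have h : ∀ j, MemLp (fun x => porosity D B P Q p u j x * P.recM (satM D P α .mat (p j)) x) 2 G.vol :=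
    fun j => memLp_mul (memLp_porosity D B P Q p u j) (FlowGD.memLp_recM _ (r := ⊤))
  exact integrable_mul_of_memLp ((h (k + 1)).sub (h k)) (FlowGD.memLp_recM _)

theorem integrable_accF (α : Phase) (ψ : P.X) (k : ℕ) :
    Integrable (fun x => (aperture D Q (u (k + 1)) x * P.recF (satF D P α (p (k + 1))) x
    - aperture D Q (u k) x * P.recF (satF D P α (p k)) x) * P.recF ψ.2 x) G.surf := by
  have h : ∀ j, MemLp (fun x => aperture D Q (u j) x * P.recF (satF D P α (p j)) x) 2 G.surf :=
    fun j => memLp_mul (memLp_aperture D Q (u j) (r := 2)) (FlowGD.memLp_recF _ (r := ⊤))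
  exact integrable_mul_of_memLp ((h (k + 1)).sub (h k)) (FlowGD.memLp_recF _)

theorem integrable_accT (α : Phase) (a : Side) (ψ : P.X) (k : ℕ) :
    Integrable (fun x => (P.recT a (satM D P α (.dam a) (p (k + 1))) x
    - P.recT a (satM D P α (.dam a) (p k)) x) * P.recT a ψ.1 x) G.surf :=
  integrable_mul_of_memLp ((FlowGD.memLp_recT _ _).sub (FlowGD.memLp_recT _ _))
    (FlowGD.memLp_recT _ _)

/-- Multiplication by the step length removes the difference quotients, leaving plain increments
next to fluxes weighted by the step length. -/
theorem flowForm_eq (α : Phase) (ψ : P.X) {k : ℕ} (hk : k < τ.N) :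
    (τ.t (k + 1) - τ.t k) * flowForm D B P Q τ p u α ψ (k + 1) =
      accM D B P Q p u α ψ k + accF D P Q p u α ψ k
        + (B.dDam .plus * B.φDam .plus * accT D P p α .plus ψ k
          + B.dDam .minus * B.φDam .minus * accT D P p α .minus ψ k)
        + (τ.t (k + 1) - τ.t k) * (diffM D P α (p (k + 1)) ψ
          + diffF D P Q α (p (k + 1)) (u (k + 1)) ψ
          + (exch D P α .plus (p (k + 1)) ψ + exch D P α .minus (p (k + 1)) ψ)) := by
  set c := τ.t (k + 1) - τ.t k with hc
  have hc0 : c ≠ 0 := (τ.step_pos hk).ne'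
  have h1 : ∫ x, (τ.quot (fun k x => porosity D B P Q p u k x * P.recM (satM D P α .mat (p k)) x)
        (k + 1) x * P.recM ψ.1 x
        + D.mob α .mat (P.recM (satM D P α .mat (p (k + 1))) x)
          * ⟪D.K x (P.gradM (p (k + 1) α).1 x), P.gradM ψ.1 x⟫) ∂G.vol =
      c⁻¹ * accM D B P Q p u α ψ k + diffM D P α (p (k + 1)) ψ := by
    rw [accM, diffM, ← integral_const_mul, ← integral_add
      ((integrable_accM D B P Q p u α ψ k).const_mul _) (integrable_diffM D P α (p (k + 1)) ψ)]
    refine integral_congr_ae (Eventually.of_forall fun x => ?_)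
    simp only [TimeGrid.quot, Nat.add_sub_cancel, Pi.smul_apply, Pi.sub_apply, smul_eq_mul,
      mul_assoc, hc]
  have h2 : ∫ x, τ.quot (fun k x => aperture D Q (u k) x * P.recF (satF D P α (p k)) x) (k + 1) x
          * P.recF ψ.2 x ∂G.surf = c⁻¹ * accF D P Q p u α ψ k := by
    rw [accF, ← integral_const_mul]
    refine integral_congr_ae (Eventually.of_forall fun x => ?_)
    simp only [TimeGrid.quot, Nat.add_sub_cancel, Pi.smul_apply, Pi.sub_apply, smul_eq_mul,
      mul_assoc, hc]
  have h3 : ∀ a, ∫ x, (mfFlux D P α a (p (k + 1)) x * P.jump a ψ x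
          + B.dDam a * B.φDam a
            * τ.quot (fun k => P.recT a (satM D P α (.dam a) (p k))) (k + 1) x
            * P.recT a ψ.1 x) ∂G.surf =
      exch D P α a (p (k + 1)) ψ + c⁻¹ * (B.dDam a * B.φDam a * accT D P p α a ψ k) := by
    intro a
    rw [accT, exch, ← integral_const_mul, ← integral_const_mul, ← integral_add
      (integrable_exch D P α a (p (k + 1)) ψ)
      (((integrable_accT D P p α a ψ k).const_mul _).const_mul _)]
    refine integral_congr_ae (Eventually.of_forall fun x => ?_)
    simp only [TimeGrid.quot, Nat.add_sub_cancel, Pi.smul_apply, Pi.sub_apply, smul_eq_mul, hc]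
    ring
  have hcc : c * c⁻¹ = 1 := mul_inv_cancel₀ hc0
  rw [flowForm, h1, h2, h3, h3, ← diffF]
  linear_combination (accM D B P Q p u α ψ k + accF D P Q p u α ψ k
        + (B.dDam .plus * B.φDam .plus * accT D P p α .plus ψ k
          + B.dDam .minus * B.φDam .minus * accT D P p α .minus ψ k)) * hcc

end Scheme

end PoroMech

end

/-! ### Discrete chain rules and dissipation -/

noncomputable section

namespace PoroMech

open Filter Topology NNReal

variable {d : ℕ} {G : FractureNetwork d}

theorem pwConst_sub {n : ℕ} {cell : Fin n → Set (Vec d)} (v w : Fin n → ℝ) (x : Vec d) :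
    pwConst cell (v - w) x = pwConst cell v x - pwConst cell w x := by
  unfold pwConst
  rw [← Finset.sum_sub_distrib]
  refine Finset.sum_congr rfl fun i _ => ?_
  by_cases h : x ∈ cell i <;> simp [h]

theorem BiotData.invM_nonneg (B : BiotData) : 0 ≤ B.invM := ENNReal.toReal_nonneg

theorem sq_l2norm_real {α : Type*} [MeasurableSpace α] {μ : Measure α} {f : α → ℝ}
    (hf : MemLp f 2 μ) : l2norm f μ ^ 2 = ∫ x, f x ^ 2 ∂μ := by
  rw [sq_l2norm hf]
  simp only [Real.norm_eq_abs, sq_abs]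

/-- The common shape of the matrix and fracture storage inequalities: increment of energy, coupling
to mechanics, increment of a quadratic term, bounded by the accumulation of the two phases. -/
theorem integral_combination_le {α : Type*} [MeasurableSpace α] {μ : Measure α}
    {f₁ f₀ f₂ f₃ f₄ g₁ g₂ : α → ℝ} {b c : ℝ} (h1 : Integrable f₁ μ) (h0 : Integrable f₀ μ)
    (h2 : Integrable f₂ μ) (h3 : Integrable f₃ μ) (h4 : Integrable f₄ μ) (k1 : Integrable g₁ μ)
    (k2 : Integrable g₂ μ)
    (h : ∀ᵐ x ∂μ, f₁ x - f₀ x + b * f₂ x + c * (f₃ x - f₄ x) ≤ g₁ x + g₂ x) :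
    (∫ x, f₁ x ∂μ) - (∫ x, f₀ x ∂μ) + b * (∫ x, f₂ x ∂μ) + c * ((∫ x, f₃ x ∂μ) - ∫ x, f₄ x ∂μ) ≤
      (∫ x, g₁ x ∂μ) + ∫ x, g₂ x ∂μ := by
  have e1 : ∫ x, (f₁ - f₀ + b • f₂ + c • (f₃ - f₄)) x ∂μ =
      (∫ x, f₁ x ∂μ) - (∫ x, f₀ x ∂μ) + b * (∫ x, f₂ x ∂μ)
        + c * ((∫ x, f₃ x ∂μ) - ∫ x, f₄ x ∂μ) := by
    rw [integral_add' ((h1.sub h0).add (h2.smul b)) ((h3.sub h4).smul c),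
      integral_add' (h1.sub h0) (h2.smul b), integral_sub' h1 h0, ← integral_sub' h3 h4,
      ← smul_eq_mul, ← smul_eq_mul, ← integral_smul, ← integral_smul]
    rfl
  rw [← e1, ← integral_add k1 k2]
  exact integral_mono_ae (((h1.sub h0).add (h2.smul b)).add ((h3.sub h4).smul c)) (k1.add k2) h

section Scheme

variable (D : ModelData G) (B : BiotData) (P : FlowGD G D.d₀) (Q : MechGD G) (τ : TimeGrid D.T)
  (p : ℕ → Phase → P.X) (u : ℕ → Q.X)

/-- Capillary energy in the matrix. -/
def storeM (k : ℕ) : ℝ :=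
  ∫ x, porosity D B P Q p u k x * D.U .mat (P.recM (pcM D P (p k)) x) ∂G.vol

/-- Capillary energy in the fractures. -/
def storeF (q : Phase → P.X) (v : G.Disp) : ℝ :=
  ∫ x, aperture D Q v x * D.U .frac (P.recF (pcF D P q) x) ∂G.surf

/-- Capillary energy in a damaged layer, per unit pore width. -/
def storeT (a : Side) (q : Phase → P.X) : ℝ :=
  ∫ x, D.U (.dam a) (P.recT a (pcM D P q) x) ∂G.surf

theorem integrable_storeM (k : ℕ) : Integrable (fun x => porosity D B P Q p u k x *
    D.U .mat (P.recM (pcM D P (p k)) x)) G.vol :=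
  integrable_mul_of_memLp (memLp_porosity D B P Q p u k) (FlowGD.memLp_comp_recM _ _)

theorem integrable_storeF (q : Phase → P.X) (v : G.Disp) : Integrable (fun x => aperture D Q v x *
    D.U .frac (P.recF (pcF D P q) x)) G.surf :=
  integrable_mul_of_memLp (memLp_aperture D Q v) (FlowGD.memLp_comp_recF _ _)

theorem integrable_storeT (a : Side) (q : Phase → P.X) :
    Integrable (fun x => D.U (.dam a) (P.recT a (pcM D P q) x)) G.surf :=
  memLp_one_iff_integrable.1 (FlowGD.memLp_comp_recT _ _ _)

theorem porosity_sub (k : ℕ) : ∀ᵐ x ∂G.vol,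
    porosity D B P Q p u (k + 1) x - porosity D B P Q p u k x =
      B.b * dvg (u (k + 1) - u k : G.Disp) x
        + B.invM * (P.recM (pEM D P (p (k + 1))) x - P.recM (pEM D P (p k)) x) := by
  filter_upwards [dvg_sub (u (k + 1)).1 (u k).1, dvg_sub (u (k + 1)).1 (u 0).1,
    dvg_sub (u k).1 (u 0).1] with x h1 h2 h3
  simp only [porosity, h1, h2, h3, FlowGD.recM, pwConst_sub]
  ring

/-- `accumulation_lower_bound` at each point, with the porosity increment replaced by its
poromechanical expression. The coupling term p^E div δu is kept with its coefficient b because it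
cancels against the mechanical equation. -/
theorem storeM_step {k : ℕ} (hφ : ∀ᵐ x ∂G.vol, 0 ≤ porosity D B P Q p u k x) :
    storeM D B P Q p u (k + 1) - storeM D B P Q p u k
      + B.b * (∫ x, P.recM (pEM D P (p (k + 1))) x * dvg (u (k + 1) - u k : G.Disp) x ∂G.vol)
      + B.invM / 2 * (l2norm (P.recM (pEM D P (p (k + 1)))) G.vol ^ 2
        - l2norm (P.recM (pEM D P (p k))) G.vol ^ 2) ≤
    accM D B P Q p u .nw (p (k + 1) .nw) k + accM D B P Q p u .w (p (k + 1) .w) k := by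
  have hE : ∀ j, MemLp (P.recM (pEM D P (p j))) 2 G.vol := fun j => FlowGD.memLp_recM _
  have i1 := integrable_storeM D B P Q p u (k + 1)
  have i0 := integrable_storeM D B P Q p u k
  have i2 := integrable_mul_of_memLp (hE (k + 1)) (memLp_dvg (u (k + 1) - u k : G.Disp))
  have i3 := (hE (k + 1)).integrable_sq
  have i4 := (hE k).integrable_sq
  rw [sq_l2norm_real (hE (k + 1)), sq_l2norm_real (hE k)]
  refine integral_combination_le i1 i0 i2 i3 i4 (integrable_accM D B P Q p u .nw _ k)
    (integrable_accM D B P Q p u .w _ k) ?_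
  filter_upwards [hφ, porosity_sub D B P Q p u k] with x h0 h1
  have hM := B.invM_nonneg
  simp only [FlowGD.recM] at h1 ⊢
  rcases pwConst_cases P.cellM_disjoint x with ⟨i, -, hi⟩ | ⟨-, hi⟩
  · simp only [hi] at h1 ⊢
    have := D.accumulation_lower_bound .mat h0 (porosity D B P Q p u (k + 1) x)
      ((p (k + 1) .nw).1 i) ((p (k + 1) .w).1 i) ((p k .nw).1 i) ((p k .w).1 i)
    -- Half of this quantity is the gap between p^E δp^E / M and the increment of |p^E|²/(2M).
    have h2 : 0 ≤ B.invM * (pEM D P (p (k + 1)) i - pEM D P (p k) i) ^ 2 := by positivity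
    have h3 : pEM D P (p (k + 1)) i = (p (k + 1) .nw).1 i * D.sat .nw .mat ((p (k + 1) .nw).1 i - (p (k + 1) .w).1 i)
      + (p (k + 1) .w).1 i * D.sat .w .mat ((p (k + 1) .nw).1 i - (p (k + 1) .w).1 i)
      - D.U .mat ((p (k + 1) .nw).1 i - (p (k + 1) .w).1 i) := rfl
    rw [← h3, h1] at this
    simp only [satM, pcM]
    refine le_trans ?_ this
    nlinarith
  · simp only [hi, D.U_zero]
    simp

/-- The matrix argument with the aperture as extensive factor; its increment is minus that of the
face-averaged normal jump, which is the one appearing in the mechanical equation. -/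
theorem storeF_step {k : ℕ} (hφ : ∀ x, x ∈ G.Γ → 0 ≤ aperture D Q (u k) x) :
    storeF D P Q (p (k + 1)) (u (k + 1)) - storeF D P Q (p k) (u k)
      - (∫ x, P.recF (pEF D P (p (k + 1))) x * Q.jumpNF (u (k + 1) - u k : G.Disp) x ∂G.surf) ≤
    accF D P Q p u .nw (p (k + 1) .nw) k + accF D P Q p u .w (p (k + 1) .w) k := by
  have i1 := integrable_storeF D P Q (p (k + 1)) (u (k + 1))
  have i0 := integrable_storeF D P Q (p k) (u k)
  have i2 : Integrable (fun x => P.recF (pEF D P (p (k + 1))) x *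
      Q.jumpNF (u (k + 1) - u k : G.Disp) x) G.surf :=
    integrable_mul_of_memLp (FlowGD.memLp_recF _) ((Q.memLp_jumpNF _).mono_exponent le_top)
  -- There is no compressibility term in the fractures: c = 0 switches off the quadratic part, whose
  -- integrands are placeholders.
  have key := integral_combination_le (b := -1) (c := 0) i1 i0 i2 i2 i2
    (integrable_accF D P Q p u .nw (p (k + 1) .nw) k) (integrable_accF D P Q p u .w (p (k + 1) .w) k)
  rw [zero_mul, add_zero, neg_one_mul, ← sub_eq_add_neg] at key
  refine key ?_
  filter_upwards [ae_restrict_mem G.measurableSet_Γ] with x hx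
  have h0 := hφ x hx
  have h1 : aperture D Q (u (k + 1)) x - aperture D Q (u k) x =
      -Q.jumpNF (u (k + 1) - u k : G.Disp) x := by
    have hN : Q.jumpN (u (k + 1) - u k : G.Disp) = Q.jumpN (u (k + 1)) - Q.jumpN (u k) :=
      funext fun σ => Q.jumpN_sub _ _ σ
    simp only [aperture, MechGD.jumpNF]
    rw [hN, pwConst_sub]
    ring
  simp only [FlowGD.recF]
  rcases pwConst_cases P.cellF_disjoint x with ⟨i, -, hi⟩ | ⟨-, hi⟩
  · simp only [hi]
    have := D.accumulation_lower_bound .frac h0 (aperture D Q (u (k + 1)) x)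
      ((p (k + 1) .nw).2 i) ((p (k + 1) .w).2 i) ((p k .nw).2 i) ((p k .w).2 i)
    have h3 : pEF D P (p (k + 1)) i = (p (k + 1) .nw).2 i * D.sat .nw .frac ((p (k + 1) .nw).2 i - (p (k + 1) .w).2 i)
      + (p (k + 1) .w).2 i * D.sat .w .frac ((p (k + 1) .nw).2 i - (p (k + 1) .w).2 i)
      - D.U .frac ((p (k + 1) .nw).2 i - (p (k + 1) .w).2 i) := rfl
    rw [← h3, h1] at this
    simp only [satF, pcF]
    linarith
  · simp only [hi, D.U_zero]
    simp

/-- The pore width of a damaged layer is constant, so the chain rule is used with the factor 1 and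
no coupling appears. -/
theorem storeT_step (a : Side) (k : ℕ) :
    storeT D P a (p (k + 1)) - storeT D P a (p k) ≤
    accT D P p .nw a (p (k + 1) .nw) k + accT D P p .w a (p (k + 1) .w) k := by
  have i1 := integrable_storeT D P a (p (k + 1))
  have i0 := integrable_storeT D P a (p k)
  rw [storeT, storeT, accT, accT, ← integral_sub i1 i0,
    ← integral_add (integrable_accT D P p .nw a _ k) (integrable_accT D P p .w a _ k)]
  refine integral_mono (i1.sub i0)
    ((integrable_accT D P p .nw a _ k).add (integrable_accT D P p .w a _ k)) fun x => ?_
  simp only [FlowGD.recT]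
  rcases pwConst_cases (P.cellT_disjoint a) x with ⟨i, -, hi⟩ | ⟨-, hi⟩
  · simp only [hi]
    have := D.accumulation_lower_bound (.dam a) zero_le_one 1
      ((p (k + 1) .nw).1 i) ((p (k + 1) .w).1 i) ((p k .nw).1 i) ((p k .w).1 i)
    simp only [satM, pcM]
    linarith
  · simp only [hi, D.U_zero]
    simp

theorem recM_satM_mem (α : Phase) (rt : Rock) (q : Phase → P.X) (x : Vec d) :
    P.recM (satM D P α rt q) x ∈ Icc (0 : ℝ) 1 := by
  unfold FlowGD.recM
  rcases pwConst_cases P.cellM_disjoint x with ⟨i, -, hi⟩ | ⟨-, hi⟩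
  · rw [hi]; exact D.sat_mem _ _ _
  · rw [hi]; simp

theorem recF_satF_mem (α : Phase) (q : Phase → P.X) (x : Vec d) :
    P.recF (satF D P α q) x ∈ Icc (0 : ℝ) 1 := by
  unfold FlowGD.recF
  rcases pwConst_cases P.cellF_disjoint x with ⟨i, -, hi⟩ | ⟨-, hi⟩
  · rw [hi]; exact D.sat_mem _ _ _
  · rw [hi]; simp

theorem recT_satM_mem (α : Phase) (a : Side) (rt : Rock) (q : Phase → P.X) (x : Vec d) :
    P.recT a (satM D P α rt q) x ∈ Icc (0 : ℝ) 1 := by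
  unfold FlowGD.recT
  rcases pwConst_cases (P.cellT_disjoint a) x with ⟨i, -, hi⟩ | ⟨-, hi⟩
  · rw [hi]; exact D.sat_mem _ _ _
  · rw [hi]; simp

/-- The fracture gradient weighted by the hydraulic conductivity. -/
def wgradF (v : G.Disp) (w : Fin P.nf → ℝ) (x : Vec d) : Vec (d - 1) :=
  aperture D Q v x ^ (3 / 2 : ℝ) • P.gradF w x

theorem norm_wgradF_sq {v : G.Disp} {w : Fin P.nf → ℝ} {x : Vec d} (h : 0 ≤ aperture D Q v x) :
    ‖wgradF D P Q v w x‖ ^ 2 = aperture D Q v x ^ 3 * ‖P.gradF w x‖ ^ 2 := by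
  rw [wgradF, norm_smul, mul_pow, Real.norm_of_nonneg (Real.rpow_nonneg h _),
    ← Real.rpow_natCast (aperture D Q v x ^ (3 / 2 : ℝ)) 2, ← Real.rpow_mul h,
    ← Real.rpow_natCast (aperture D Q v x) 3]
  norm_num

theorem memLp_wgradF {v : G.Disp} (h : ∀ x, x ∈ G.Γ → 0 ≤ aperture D Q v x) (w : Fin P.nf → ℝ) :
    MemLp (wgradF D P Q v w) 2 G.surf := by
  have hg : MemLp (P.gradF w) ⊤ G.surf := Lp.memLp _
  have hm : AEStronglyMeasurable (wgradF D P Q v w) G.surf :=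
    (((memLp_aperture D Q v (r := 2)).1.aemeasurable.pow_const _).aestronglyMeasurable).smul hg.1
  rw [memLp_two_iff_integrable_sq_norm hm]
  have h1 : Integrable (fun x => aperture D Q v x ^ 3 * (‖P.gradF w x‖ * ‖P.gradF w x‖)) G.surf :=
    integrable_mul_of_memLp ((memLp_aperture_pow D Q v).mono_exponent le_top)
      ((memLp_mul hg.norm hg.norm (r := ⊤)).mono_exponent le_top)
  refine h1.congr ?_
  filter_upwards [ae_restrict_mem G.measurableSet_Γ] with x hx
  rw [norm_wgradF_sq D P Q (h x hx), sq ‖P.gradF w x‖]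

/-- Dissipation of one phase. -/
def dissPhase (α : Phase) (q : Phase → P.X) (v : G.Disp) : ℝ :=
  l2norm (P.gradM (q α).1) G.vol ^ 2 + l2norm (wgradF D P Q v (q α).2) G.surf ^ 2
    + (l2norm (P.jump .plus (q α)) G.surf ^ 2 + l2norm (P.jump .minus (q α)) G.surf ^ 2)

/-- Lower bounds for the mobilities, for 𝕂 and for Λ, with 1/12 from the Poiseuille law. In the
exchange term the upwinded flux has the sign of the jump y, whichever mobility is selected: (η₁ y⁺ -
η₂ y⁻) y ≥ m y². The constant is the same for all discretizations. -/
theorem exists_dissPhase_le : ∃ c : ℝ, 0 < c ∧ ∀ (P : FlowGD G D.d₀) (Q : MechGD G) (α : Phase)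
    (q : Phase → P.X) (v : G.Disp), (∀ x, x ∈ G.Γ → 0 ≤ aperture D Q v x) →
    c * dissPhase D P Q α q v ≤ diffM D P α q (q α) + diffF D P Q α q v (q α)
      + (exch D P α .plus q (q α) + exch D P α .minus q (q α)) := by
  obtain ⟨m, hm0, hm⟩ := D.exists_mob_lower
  obtain ⟨cK, hcK0, hcK⟩ := D.K_elliptic
  obtain ⟨cL, hcL0, hcL⟩ := D.Λ_lower
  refine ⟨m * min (min cK (1 / 12)) cL, by positivity, fun P Q α q v hv => ?_⟩
  set κ := min (min cK (1 / 12)) cL with hκ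
  have hκ0 : 0 < κ := by positivity
  have hκ1 : κ ≤ cK := (min_le_left _ _).trans (min_le_left _ _)
  have hκ2 : κ ≤ 1 / 12 := (min_le_left _ _).trans (min_le_right _ _)
  have hκ3 : κ ≤ cL := min_le_right _ _
  have hgM : MemLp (P.gradM (q α).1) 2 G.vol := (Lp.memLp (P.gradM (q α).1)).mono_exponent le_top
  have hgF := memLp_wgradF D P Q hv (q α).2
  have hj : ∀ a, MemLp (P.jump a (q α)) 2 G.surf := fun a =>
    (Lp.memLp (P.jump a (q α))).mono_exponent le_top
  have h1 : m * κ * l2norm (P.gradM (q α).1) G.vol ^ 2 ≤ diffM D P α q (q α) := by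
    rw [sq_l2norm hgM, ← integral_const_mul]
    refine integral_mono_ae ((integrable_norm_sq hgM).const_mul _) (integrable_diffM D P α q (q α)) ?_
    filter_upwards [hcK] with x hx
    have h2 := hm α .mat _ (recM_satM_mem D P α .mat q x)
    have h3 := hx (P.gradM (q α).1 x)
    have h4 : κ * ‖P.gradM (q α).1 x‖ ^ 2 ≤ cK * ‖P.gradM (q α).1 x‖ ^ 2 := by gcongr
    rw [mul_assoc]
    exact mul_le_mul h2 (h4.trans h3) (by positivity) (hm0.le.trans h2)
  have h2 : m * κ * l2norm (wgradF D P Q v (q α).2) G.surf ^ 2 ≤ diffF D P Q α q v (q α) := by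
    rw [sq_l2norm hgF, ← integral_const_mul]
    refine integral_mono_ae ((integrable_norm_sq hgF).const_mul _)
      (integrable_diffF D P Q α q v (q α)) ?_
    filter_upwards [ae_restrict_mem G.measurableSet_Γ] with x hx
    have h2 := hm α .frac _ (recF_satF_mem D P α q x)
    have h3 := hv x hx
    simp only [norm_wgradF_sq D P Q h3]
    rw [real_inner_self_eq_norm_sq]
    have h4 : 0 ≤ aperture D Q v x ^ 3 * ‖P.gradF (q α).2 x‖ ^ 2 := by positivity
    have h5 := mul_le_mul h2 (mul_le_mul_of_nonneg_right hκ2 h4) (by positivity) (hm0.le.trans h2)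
    calc _ = m * (κ * (aperture D Q v x ^ 3 * ‖P.gradF (q α).2 x‖ ^ 2)) := by ring
      _ ≤ _ := h5
      _ = _ := by ring
  have h3 : ∀ a, m * κ * l2norm (P.jump a (q α)) G.surf ^ 2 ≤ exch D P α a q (q α) := by
    intro a
    rw [sq_l2norm_real (hj a), ← integral_const_mul]
    refine integral_mono_ae ((hj a).integrable_sq.const_mul _) (integrable_exch D P α a q (q α)) ?_
    filter_upwards [hcL] with x hx
    have h4 := hm α (.dam a) _ (recT_satM_mem D P α a (.dam a) q x)
    have h5 := hm α .frac _ (recF_satF_mem D P α q x)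
    simp only [mfFlux]
    set y := P.jump a (q α) x
    set η₁ := D.mob α (.dam a) (P.recT a (satM D P α (.dam a) q) x)
    set η₂ := D.mob α .frac (P.recF (satF D P α q) x)
    have h6 : m * y ^ 2 ≤ (η₁ * max 0 y - η₂ * max 0 (-y)) * y := by
      rcases le_total 0 y with hy | hy
      · rw [max_eq_right hy, max_eq_left (neg_nonpos.2 hy)]
        nlinarith [mul_le_mul_of_nonneg_right h4 (sq_nonneg y)]
      · rw [max_eq_left hy, max_eq_right (neg_nonneg.2 hy)]
        nlinarith [mul_le_mul_of_nonneg_right h5 (sq_nonneg y)]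
    have h7 : 0 ≤ m * y ^ 2 := by positivity
    have h8 := mul_le_mul (hκ3.trans hx) h6 h7 (hcL0.le.trans hx)
    calc _ = κ * (m * y ^ 2) := by ring
      _ ≤ _ := h8
      _ = _ := by ring
  have h4 := h3 .plus
  have h5 := h3 .minus
  unfold dissPhase
  linarith

end Scheme

end PoroMech

end

/-! ### Sources and the energy inequality -/

noncomputable section

namespace PoroMech

open Filter Topology NNReal

variable {d : ℕ} {G : FractureNetwork d}

/-- A non-integrable function has integral 0 by convention, so no integrability of the smaller
function is needed; this spares it for the source terms. -/
theorem integral_le_of_ae_le_of_nonneg {α : Type*} [MeasurableSpace α] {μ : Measure α}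
    {f g : α → ℝ} (hg : Integrable g μ) (hg0 : ∀ x, 0 ≤ g x) (h : ∀ᵐ x ∂μ, f x ≤ g x) :
    ∫ x, f x ∂μ ≤ ∫ x, g x ∂μ := by
  by_cases hf : Integrable f μ
  · exact integral_mono_ae hf hg h
  · rw [integral_undef hf]; exact integral_nonneg hg0

/-- Young's inequality for a source term. -/
theorem integral_mul_le_young {α : Type*} [MeasurableSpace α] {μ : Measure α} {h ψ : α → ℝ} {θ : ℝ}
    (hθ : 0 < θ) (hh : Integrable (fun x => h x ^ 2) μ) (hψ : MemLp ψ 2 μ) :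
    ∫ x, h x * ψ x ∂μ ≤ 1 / (2 * θ) * (∫ x, h x ^ 2 ∂μ) + θ / 2 * l2norm ψ μ ^ 2 := by
  rw [sq_l2norm_real hψ, ← integral_const_mul, ← integral_const_mul,
    ← integral_add (hh.const_mul _) (hψ.integrable_sq.const_mul _)]
  refine integral_le_of_ae_le_of_nonneg ((hh.const_mul _).add (hψ.integrable_sq.const_mul _))
    (fun x => by positivity) (Eventually.of_forall fun x => ?_)
  have h1 : 0 ≤ 1 / (2 * θ) * (h x - θ * ψ x) ^ 2 := by positivity
  have h2 : 1 / (2 * θ) * (h x - θ * ψ x) ^ 2 =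
      1 / (2 * θ) * h x ^ 2 + θ / 2 * ψ x ^ 2 - h x * ψ x := by
    field_simp; ring
  linarith

section Source

variable {T : ℝ} {μ : Measure (Vec d)} [SFinite μ] {h : ℝ × Vec d → ℝ}

theorem integrable_integral_sq (hh : MemLp h 2 ((volume.restrict (Ioo 0 T)).prod μ)) :
    Integrable (fun s => ∫ x, h (s, x) ^ 2 ∂μ) (volume.restrict (Ioc 0 T)) := by
  rw [← Measure.restrict_congr_set (Ioo_ae_eq_Ioc (a := (0 : ℝ)) (b := T) (μ := volume))]
  exact hh.integrable_sq.integral_prod_left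

theorem ae_integrable_sq (hh : MemLp h 2 ((volume.restrict (Ioo 0 T)).prod μ)) :
    ∀ᵐ s ∂(volume.restrict (Ioc 0 T)), Integrable (fun x => h (s, x) ^ 2) μ := by
  rw [← Measure.restrict_congr_set (Ioo_ae_eq_Ioc (a := (0 : ℝ)) (b := T) (μ := volume))]
  exact hh.integrable_sq.prod_right_ae

end Source

section Scheme

variable (D : ModelData G) (B : BiotData) (P : FlowGD G D.d₀) (Q : MechGD G) (τ : TimeGrid D.T)
  (p : ℕ → Phase → P.X) (u : ℕ → Q.X) (lam : ℕ → Q.Mult)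

/-- Squared norm in space of the source terms of a phase. -/
def srcSq (α : Phase) (s : ℝ) : ℝ :=
  (∫ x, D.hm α (s, x) ^ 2 ∂G.vol) + ∫ x, D.hf α (s, x) ^ 2 ∂G.surf

theorem integrableOn_srcSq (α : Phase) : IntegrableOn (srcSq D α) (Ioc 0 D.T) :=
  (integrable_integral_sq (D.hm_memLp α)).add (integrable_integral_sq (D.hf_memLp α))

theorem srcSq_nonneg (α : Phase) (s : ℝ) : 0 ≤ srcSq D α s :=
  add_nonneg (integral_nonneg fun _ => sq_nonneg _) (integral_nonneg fun _ => sq_nonneg _)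

/-- Young's inequality at almost every time, then integration over the step; θ is left free so that
the pressures can be absorbed by the dissipation. -/
theorem source_le {k : ℕ} (hk : k < τ.N) (α : Phase) (ψ : P.X) {θ : ℝ} (hθ : 0 < θ) :
    ∫ s in Ioc (τ.t k) (τ.t (k + 1)), ((∫ x, D.hm α (s, x) * P.recM ψ.1 x ∂G.vol)
          + ∫ x, D.hf α (s, x) * P.recF ψ.2 x ∂G.surf) ≤
      1 / (2 * θ) * (∫ s in Ioc (τ.t k) (τ.t (k + 1)), srcSq D α s)
        + (τ.t (k + 1) - τ.t k) * (θ / 2 *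
          (l2norm (P.recM ψ.1) G.vol ^ 2 + l2norm (P.recF ψ.2) G.surf ^ 2)) := by
  have hsub := τ.Ioc_subset hk
  have hi : Integrable (srcSq D α) (volume.restrict (Ioc (τ.t k) (τ.t (k + 1)))) :=
    (integrableOn_srcSq D α).mono_set hsub
  set A := θ / 2 * (l2norm (P.recM ψ.1) G.vol ^ 2 + l2norm (P.recF ψ.2) G.surf ^ 2) with hA
  have hA0 : 0 ≤ A := by positivity
  have e : 1 / (2 * θ) * (∫ s in Ioc (τ.t k) (τ.t (k + 1)), srcSq D α s)
        + (τ.t (k + 1) - τ.t k) * A =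
      ∫ s in Ioc (τ.t k) (τ.t (k + 1)), (1 / (2 * θ) * srcSq D α s + A) := by
    rw [integral_add (hi.const_mul _) (integrable_const _), integral_const_mul, setIntegral_const,
      measureReal_def, Real.volume_Ioc, smul_eq_mul, ENNReal.toReal_ofReal (τ.step_pos hk).le]
  rw [e]
  refine integral_le_of_ae_le_of_nonneg ((hi.const_mul _).add (integrable_const _))
    (fun s => by have := srcSq_nonneg D α s; positivity) ?_
  filter_upwards [ae_mono (Measure.restrict_mono hsub le_rfl) (ae_integrable_sq (D.hm_memLp α)),
    ae_mono (Measure.restrict_mono hsub le_rfl) (ae_integrable_sq (D.hf_memLp α))] with s h1 h2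
  have h3 := integral_mul_le_young hθ h1 (FlowGD.memLp_recM ψ.1 (P := P))
  have h4 := integral_mul_le_young hθ h2 (FlowGD.memLp_recF ψ.2 (P := P))
  rw [srcSq, hA]
  linarith

theorem sum_setIntegral_srcSq_le (α : Phase) {n : ℕ} (hn : n ≤ τ.N) :
    ∑ k ∈ Finset.range n, ∫ s in Ioc (τ.t k) (τ.t (k + 1)), srcSq D α s ≤
      ∫ s in Ioc 0 D.T, srcSq D α s := by
  have h0 : ∀ j ≤ τ.N, 0 ≤ τ.t j ∧ τ.t j ≤ D.T := fun j hj =>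
    ⟨τ.t_zero.symm.le.trans (τ.t_mono (Nat.zero_le j) hj),
      (τ.t_mono hj le_rfl).trans τ.t_last.le⟩
  have h1 : ∑ k ∈ Finset.range n, ∫ s in Ioc (τ.t k) (τ.t (k + 1)), srcSq D α s =
      ∫ s in Ioc 0 (τ.t n), srcSq D α s := by
    rw [← intervalIntegral.integral_of_le (h0 n hn).1, ← τ.t_zero,
      ← intervalIntegral.sum_integral_adjacent_intervals]
    · refine Finset.sum_congr rfl fun k hk => ?_
      rw [intervalIntegral.integral_of_le (τ.t_lt k ((Finset.mem_range.1 hk).trans_le hn)).le]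
    · intro k hk
      rw [intervalIntegrable_iff_integrableOn_Ioc_of_le (τ.t_lt k (hk.trans_le hn)).le]
      exact (integrableOn_srcSq D α).mono_set (τ.Ioc_subset (hk.trans_le hn))
  rw [h1]
  exact setIntegral_mono_set (integrableOn_srcSq D α)
    (Eventually.of_forall fun s => srcSq_nonneg D α s)
    (Ioc_subset_Ioc_right (h0 n hn).2).eventuallyLE

theorem mechForm_eq (q : Phase → P.X) (v : G.Disp) (μ : Q.Mult) (w : G.Disp) :
    mechForm D B P Q q v μ w = D.elastic v w
      - B.b * (∫ x, P.recM (pEM D P q) x * dvg w x ∂G.vol)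
      + (∫ x, ⟪Q.mfun μ x, jmp w x⟫ ∂G.surf)
      + ∫ x, P.recF (pEF D P q) x * Q.jumpNF w x ∂G.surf := by
  have hi := integrable_mul_of_memLp (FlowGD.memLp_recM (P := P) (pEM D P q)) (memLp_dvg w)
  rw [mechForm, ModelData.elastic, ← integral_const_mul,
    ← integral_sub (D.integrable_stress_inner v w) (hi.const_mul _)]
  simp only [mul_assoc]

/-- Work of the body force. -/
def work (v : G.Disp) : ℝ := ∫ x, ⟪D.f x, val v x⟫ ∂G.vol

theorem work_sub (v w : G.Disp) : work D (v - w) = work D v - work D w := by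
  have hf : MemLp D.f 2 G.vol := Lp.memLp _
  rw [work, work, work, ← integral_sub (integrable_inner_of_memLp hf (memLp_val v))
    (integrable_inner_of_memLp hf (memLp_val w))]
  refine integral_congr_ae ?_
  filter_upwards [val_sub v w] with x hx
  rw [hx, inner_sub_right]

/-- The stored energy other than the elastic one. -/
def stored (k : ℕ) : ℝ :=
  storeM D B P Q p u k + B.invM / 2 * l2norm (P.recM (pEM D P (p k))) G.vol ^ 2
    + storeF D P Q (p k) (u k)
    + (B.dDam .plus * B.φDam .plus * storeT D P .plus (p k)
      + B.dDam .minus * B.φDam .minus * storeT D P .minus (p k))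

/-- The total energy. -/
def energy (k : ℕ) : ℝ :=
  stored D B P Q p u k + 1 / 2 * D.elastic (u k) (u k) - work D (u k)

/-- The dissipation. -/
def diss (k : ℕ) : ℝ := dissPhase D P Q .nw (p k) (u k) + dissPhase D P Q .w (p k) (u k)

variable {D B P Q τ p u lam}

theorem dissPhase_nonneg (α : Phase) (q : Phase → P.X) (v : G.Disp) : 0 ≤ dissPhase D P Q α q v := by
  unfold dissPhase; positivity

/-- Coercivity of the flow discretization in terms of the dissipation. -/
theorem sq_rec_le_dissPhase {c : ℝ} (hc : 0 ≤ c) (hP : P.Coercive c) (α : Phase) (q : Phase → P.X)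
    (v : G.Disp) (hv : ∀ x, x ∈ G.Γ → D.d₀ x ≤ aperture D Q v x) :
    l2norm (P.recM (q α).1) G.vol ^ 2 + l2norm (P.recF (q α).2) G.surf ^ 2 ≤
      8 * c ^ 2 * dissPhase D P Q α q v := by
  have h := hP (q α)
  have hv0 : ∀ x, x ∈ G.Γ → 0 ≤ aperture D Q v x := fun x hx => (D.d₀_pos x hx).le.trans (hv x hx)
  have hgM : MemLp (P.gradM (q α).1) 2 G.vol := (Lp.memLp (P.gradM (q α).1)).mono_exponent le_top
  have hgF := memLp_wgradF D P Q hv0 (q α).2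
  have hj : ∀ a, MemLp (P.jump a (q α)) 2 G.surf := fun a =>
    (Lp.memLp (P.jump a (q α))).mono_exponent le_top
  have h1 : eLpNorm (fun x => D.d₀ x ^ (3 / 2 : ℝ) • P.gradF (q α).2 x) 2 G.surf ≤
      eLpNorm (wgradF D P Q v (q α).2) 2 G.surf := by
    refine eLpNorm_mono_ae ?_
    filter_upwards [ae_restrict_mem G.measurableSet_Γ] with x hx
    rw [wgradF, norm_smul, norm_smul]
    have h0 := (D.d₀_pos x hx).le
    refine mul_le_mul_of_nonneg_right ?_ (norm_nonneg _)
    rw [Real.norm_of_nonneg (Real.rpow_nonneg h0 _), Real.norm_of_nonneg (Real.rpow_nonneg (hv0 x hx) _)]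
    exact Real.rpow_le_rpow h0 (hv x hx) (by norm_num)
  set a := l2norm (P.gradM (q α).1) G.vol
  set b := l2norm (wgradF D P Q v (q α).2) G.surf
  set e := l2norm (P.jump .plus (q α)) G.surf
  set f := l2norm (P.jump .minus (q α)) G.surf
  have ha : 0 ≤ a := l2norm_nonneg _ _
  have hb : 0 ≤ b := l2norm_nonneg _ _
  have he : 0 ≤ e := l2norm_nonneg _ _
  have hf : 0 ≤ f := l2norm_nonneg _ _
  have h2 : ENNReal.ofReal c * P.normX (q α) ≤ ENNReal.ofReal (c * (a + b + (e + f))) := by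
    rw [ENNReal.ofReal_mul hc, ENNReal.ofReal_add (by positivity) (by positivity),
      ENNReal.ofReal_add ha hb, ENNReal.ofReal_add he hf, ← eLpNorm_two_eq_ofReal hgM,
      ← eLpNorm_two_eq_ofReal hgF, ← eLpNorm_two_eq_ofReal (hj .plus),
      ← eLpNorm_two_eq_ofReal (hj .minus)]
    exact mul_le_mul_right (add_le_add (add_le_add le_rfl h1) le_rfl) _
  have h3 := h.trans h2
  have h4 : l2norm (P.recM (q α).1) G.vol ≤ c * (a + b + (e + f)) :=
    l2norm_le_of_eLpNorm_le (by positivity) ((le_self_add.trans le_self_add).trans h3)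
  have h5 : l2norm (P.recF (q α).2) G.surf ≤ c * (a + b + (e + f)) :=
    l2norm_le_of_eLpNorm_le (by positivity) ((le_add_self.trans le_self_add).trans h3)
  have h6 := pow_le_pow_left₀ (l2norm_nonneg _ _) h4 2
  have h7 := pow_le_pow_left₀ (l2norm_nonneg _ _) h5 2
  -- Cauchy–Schwarz for four terms; with the two reconstructions this makes the constant 8.
  have h8 : (a + b + (e + f)) ^ 2 ≤ 4 * dissPhase D P Q α q v := by
    unfold dissPhase
    nlinarith [sq_nonneg (a - b), sq_nonneg (a - e), sq_nonneg (a - f), sq_nonneg (b - e),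
      sq_nonneg (b - f), sq_nonneg (e - f)]
  have h9 := mul_le_mul_of_nonneg_left h8 (sq_nonneg c)
  rw [mul_pow] at h6 h7
  linarith

variable (h : IsSolution D B P Q τ p u lam)
include h

theorem IsSolution.aperture_nonneg {k : ℕ} (hk : k ≤ τ.N) (x : Vec d) (hx : x ∈ G.Γ) :
    0 ≤ aperture D Q (u k).1 x := (D.d₀_pos x hx).le.trans (h.d₀_le_aperture hk x)

/-- The energy inequality over one time step. -/
theorem IsSolution.energy_step (hd : d ≤ 3) {c cUp : ℝ} (hc : 0 < c) (hcUp : 0 < cUp)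
    (hdiss : ∀ (α : Phase) (q : Phase → P.X) (v : G.Disp), (∀ x, x ∈ G.Γ → 0 ≤ aperture D Q v x) →
      c * dissPhase D P Q α q v ≤ diffM D P α q (q α) + diffF D P Q α q v (q α)
        + (exch D P α .plus q (q α) + exch D P α .minus q (q α)))
    (hP : P.Coercive cUp) {k : ℕ} (hk : k < τ.N)
    (hφ : ∀ᵐ x ∂G.vol, 0 ≤ porosity D B P Q p u k x) :
    energy D B P Q p u (k + 1)
        + (τ.t (k + 1) - τ.t k) * (c / 2 * diss D P Q p u (k + 1)) ≤
      energy D B P Q p u k + 4 * cUp ^ 2 / c *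
        ((∫ s in Ioc (τ.t k) (τ.t (k + 1)), srcSq D .nw s)
          + ∫ s in Ioc (τ.t k) (τ.t (k + 1)), srcSq D .w s) := by
  set dt := τ.t (k + 1) - τ.t k with hdt
  have hdt0 : 0 < dt := τ.step_pos hk
  have hap1 : ∀ x, x ∈ G.Γ → 0 ≤ aperture D Q (u (k + 1)) x := h.aperture_nonneg hk
  have hap1' : ∀ x, x ∈ G.Γ → D.d₀ x ≤ aperture D Q (u (k + 1)) x := fun x _ =>
    h.d₀_le_aperture hk x
  -- The value for which the pressure part of Young's inequality takes exactly half of the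
  -- dissipation.
  let θ : ℝ := c / (8 * cUp ^ 2)
  have hθ : 0 < θ := by positivity
  have hθ1 : 1 / (2 * θ) = 4 * cUp ^ 2 / c := by simp only [θ]; field_simp; norm_num
  have hflow : ∀ α, accM D B P Q p u α (p (k + 1) α) k + accF D P Q p u α (p (k + 1) α) k
        + (B.dDam .plus * B.φDam .plus * accT D P p α .plus (p (k + 1) α) k
          + B.dDam .minus * B.φDam .minus * accT D P p α .minus (p (k + 1) α) k)
        + dt * (c / 2 * dissPhase D P Q α (p (k + 1)) (u (k + 1))) ≤
      4 * cUp ^ 2 / c * ∫ s in Ioc (τ.t k) (τ.t (k + 1)), srcSq D α s := by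
    intro α
    have e1 := flowForm_eq D B P Q τ p u α (p (k + 1) α) hk
    rw [(h.flow α).step hk] at e1
    have e2 := source_le D P τ hk α (p (k + 1) α) hθ
    have e3 := sq_rec_le_dissPhase hcUp.le hP α (p (k + 1)) (u (k + 1)) hap1'
    have e4 := mul_le_mul_of_nonneg_left (hdiss α (p (k + 1)) (u (k + 1)) hap1) hdt0.le
    have e5 : θ / 2 * (l2norm (P.recM (p (k + 1) α).1) G.vol ^ 2
        + l2norm (P.recF (p (k + 1) α).2) G.surf ^ 2) ≤
        c / 2 * dissPhase D P Q α (p (k + 1)) (u (k + 1)) := by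
      refine (mul_le_mul_of_nonneg_left e3 (by positivity)).trans_eq ?_
      simp only [θ]; field_simp
    have e6 := mul_le_mul_of_nonneg_left e5 hdt0.le
    rw [hθ1] at e2
    linarith
  have hM := storeM_step D B P Q p u hφ
  have hF := storeF_step D P Q p u (h.aperture_nonneg hk.le)
  have hT : ∀ a, B.dDam a * B.φDam a * (storeT D P a (p (k + 1)) - storeT D P a (p k)) ≤
      B.dDam a * B.φDam a * (accT D P p .nw a (p (k + 1) .nw) k + accT D P p .w a (p (k + 1) .w) k) :=
    fun a => mul_le_mul_of_nonneg_left (storeT_step D P p a k)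
      (mul_nonneg (B.dDam_pos a).le (B.φDam_pos a).le)
  -- Tested with the increment itself, not with the difference quotient, so that its coupling terms
  -- are those of `storeM_step` and `storeF_step` with opposite signs.
  have hmech := h.mech.step hk (u (k + 1) - u k)
  have hw : ∫ x, ⟪D.f x, val ((u (k + 1) - u k : Q.X) : G.Disp) x⟫ ∂G.vol =
    work D (u (k + 1)) - work D (u k) := work_sub D _ _
  rw [hw, mechForm_eq] at hmech
  have hcast : ((u (k + 1) - u k : Q.X) : G.Disp) = (u (k + 1) - u k : G.Disp) := rfl
  rw [hcast] at hmech
  have hel := D.elastic_sub_ge hd (u (k + 1)) (u k)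
  have hcon := h.contact_work_nonneg hk
  have h1 := hflow .nw
  have h2 := hflow .w
  have h3 := hT .plus
  have h4 := hT .minus
  unfold energy stored diss
  linarith

/-- The summed energy inequality. -/
theorem IsSolution.energy_le (hd : d ≤ 3) {c cUp : ℝ} (hc : 0 < c) (hcUp : 0 < cUp)
    (hdiss : ∀ (α : Phase) (q : Phase → P.X) (v : G.Disp), (∀ x, x ∈ G.Γ → 0 ≤ aperture D Q v x) →
      c * dissPhase D P Q α q v ≤ diffM D P α q (q α) + diffF D P Q α q v (q α)
        + (exch D P α .plus q (q α) + exch D P α .minus q (q α)))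
    (hP : P.Coercive cUp) (hφ : ∀ k ≤ τ.N, ∀ᵐ x ∂G.vol, 0 ≤ porosity D B P Q p u k x)
    {n : ℕ} (hn : n ≤ τ.N) :
    energy D B P Q p u n
        + c / 2 * ∑ k ∈ Finset.range n, (τ.t (k + 1) - τ.t k) * diss D P Q p u (k + 1) ≤
      energy D B P Q p u 0 + 4 * cUp ^ 2 / c *
        ((∫ s in Ioc 0 D.T, srcSq D .nw s) + ∫ s in Ioc 0 D.T, srcSq D .w s) := by
  have key : ∀ n ≤ τ.N, energy D B P Q p u n
        + c / 2 * ∑ k ∈ Finset.range n, (τ.t (k + 1) - τ.t k) * diss D P Q p u (k + 1) ≤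
      energy D B P Q p u 0 + 4 * cUp ^ 2 / c *
        ((∑ k ∈ Finset.range n, ∫ s in Ioc (τ.t k) (τ.t (k + 1)), srcSq D .nw s)
          + ∑ k ∈ Finset.range n, ∫ s in Ioc (τ.t k) (τ.t (k + 1)), srcSq D .w s) := by
    intro n
    induction n with
    | zero => simp
    | succ n ih =>
      intro hn
      have h1 := ih (by omega)
      have h2 := h.energy_step hd hc hcUp hdiss hP (k := n) (by omega) (hφ n (by omega))
      simp only [Finset.sum_range_succ]
      linarith
  refine (key n hn).trans ?_
  have h1 := sum_setIntegral_srcSq_le D τ .nw hn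
  have h2 := sum_setIntegral_srcSq_le D τ .w hn
  gcongr

end Scheme

end PoroMech

end

/-! ### Norms in time, inf-sup condition and equivalent pressures -/

noncomputable section

namespace PoroMech

open Filter Topology NNReal

variable {d : ℕ} {G : FractureNetwork d}

theorem eLpNorm_one_eq_ofReal_integral {α : Type*} [MeasurableSpace α] {μ : Measure α} {f : α → ℝ}
    (hf : Integrable f μ) (h0 : ∀ᵐ x ∂μ, 0 ≤ f x) : eLpNorm f 1 μ = ENNReal.ofReal (∫ x, f x ∂μ) := by
  rw [eLpNorm_one_eq_lintegral_enorm, ofReal_integral_eq_lintegral_ofReal hf h0]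
  refine lintegral_congr_ae ?_
  filter_upwards [h0] with x hx
  rw [Real.enorm_eq_ofReal hx]

/-- Tonelli's inequality in the direction that needs no joint measurability, followed by summation
over the time steps. -/
theorem eLpNorm_ext_le {T : ℝ} (τ : TimeGrid T) {E : Type*} [NormedAddCommGroup E]
    {μ : Measure (Vec d)} (g : ℕ → Vec d → E)
    (hg : ∀ k < τ.N, MemLp (g (k + 1)) 2 μ) {A : ℝ}
    (hA : ∑ k ∈ Finset.range τ.N, (τ.t (k + 1) - τ.t k) * l2norm (g (k + 1)) μ ^ 2 ≤ A) :
    eLpNorm (fun z : ℝ × Vec d => g (τ.idx z.1) z.2) 2 ((volume.restrict (Ioo 0 T)).prod μ) ≤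
      ENNReal.ofReal (√A) := by
  have hA0 : 0 ≤ A := le_trans (Finset.sum_nonneg fun k hk =>
    mul_nonneg (τ.step_pos (Finset.mem_range.1 hk)).le (sq_nonneg _)) hA
  refine (ENNReal.pow_le_pow_left_iff (n := 2) (by norm_num)).1 ?_
  rw [← ENNReal.ofReal_pow (Real.sqrt_nonneg _), Real.sq_sqrt hA0]
  refine (eLpNorm_natCast_pow _ _ (n := 2) two_ne_zero).trans_le ?_
  refine (lintegral_prod_le _).trans ?_
  rw [setLIntegral_congr Ioo_ae_eq_Ioc, τ.lintegral_idx fun k => ∫⁻ y, ‖g k y‖ₑ ^ 2 ∂μ]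
  refine le_trans (le_of_eq ?_) (ENNReal.ofReal_le_ofReal hA)
  rw [ENNReal.ofReal_sum_of_nonneg fun k hk =>
    mul_nonneg (τ.step_pos (Finset.mem_range.1 hk)).le (sq_nonneg _)]
  refine Finset.sum_congr rfl fun k hk => ?_
  rw [lintegral_enorm_sq_eq_ofReal (hg k (Finset.mem_range.1 hk)),
    ENNReal.ofReal_mul (τ.step_pos (Finset.mem_range.1 hk)).le]

theorem essSup_idx_le {T : ℝ} (τ : TimeGrid T) (Φ : ℕ → ℝ≥0∞) {A : ℝ≥0∞}
    (h : ∀ k, 1 ≤ k → k ≤ τ.N → Φ k ≤ A) :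
    essSup (fun s => Φ (τ.idx s)) (volume.restrict (Ioo 0 T)) ≤ A := by
  refine essSup_le_of_ae_le _ ?_
  filter_upwards [ae_restrict_mem measurableSet_Ioo] with s hs
  have := τ.idx_mem (Ioo_subset_Ioc_self hs)
  exact h _ this.1 this.2

theorem mul_essSup_idx_le {T : ℝ} (τ : TimeGrid T) (Φ : ℕ → ℝ≥0∞) {c A : ℝ≥0∞}
    (h : ∀ k, 1 ≤ k → k ≤ τ.N → c * Φ k ≤ A) :
    c * essSup (fun s => Φ (τ.idx s)) (volume.restrict (Ioo 0 T)) ≤ A := by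
  rw [← ENNReal.essSup_const_mul]
  exact essSup_idx_le τ (fun k => c * Φ k) h

/-- Division by zero yields 0, so a quotient above c/2 forces both factors of the denominator to be
positive. -/
theorem pos_and_le_of_lt_div {c I S n R : ℝ} (hc : 0 < c) (hS : 0 ≤ S) (hn : 0 ≤ n)
    (h : c / 2 < I / (S * n)) (hR : I ≤ R * S) : 0 < n ∧ c / 2 * n ≤ R := by
  have hSn : S * n ≠ 0 := by
    intro h0
    rw [h0, div_zero] at h
    linarith
  have hSpos : 0 < S := lt_of_le_of_ne hS fun h => hSn (by rw [← h, zero_mul])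
  have hnpos : 0 < n := lt_of_le_of_ne hn fun h => hSn (by rw [← h, mul_zero])
  rw [lt_div_iff₀ (mul_pos hSpos hnpos)] at h
  refine ⟨hnpos, le_of_mul_le_mul_right ?_ hSpos⟩
  linarith

/-- The supremum need not be attained; half of the inf-sup constant is given up to obtain an actual
test displacement. -/
theorem MechGD.InfSup.exists_lt {Q : MechGD G} {c : ℝ} (hc : 0 < c) (h : Q.InfSup c) {μ : Q.Mult}
    (hμ : μ ≠ 0) : ∃ v : Q.X, c / 2 < (∫ x, ⟪Q.mfun μ x, jmp (v : G.Disp) x⟫ ∂G.surf) /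
      (l2norm (strain (v : G.Disp)) G.vol * (G.negHalfNorm (Q.mfun μ)).toReal) := by
  have h0 : (c : EReal) ≤ _ := h
  have h1 := lt_of_lt_of_le (EReal.coe_lt_coe_iff.2 (half_lt_self hc))
    (h0.trans (iInf_le _ (⟨μ, hμ⟩ : {μ : Q.Mult // μ ≠ 0})))
  obtain ⟨v, hv⟩ := lt_iSup_iff.1 h1
  exact ⟨v.1, EReal.coe_lt_coe_iff.1 hv⟩

/-- Dual bound for a multiplier from the inf-sup condition. -/
theorem MechGD.InfSup.negHalfNorm_le {Q : MechGD G} {c : ℝ} (hc : 0 < c) (h : Q.InfSup c)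
    (μ : Q.Mult) {R : ℝ}
    (hR : ∀ v : Q.X, ∫ x, ⟪Q.mfun μ x, jmp (v : G.Disp) x⟫ ∂G.surf ≤
      R * l2norm (strain (v : G.Disp)) G.vol) :
    G.negHalfNorm (Q.mfun μ) ≤ ENNReal.ofReal (2 / c * R) := by
  by_cases hμ : μ = 0
  · subst hμ
    unfold negHalfNorm
    refine iSup_le fun v => iSup_le fun _ => iSup_le fun _ => ?_
    simp only [MechGD.mfun_zero, inner_zero_left, integral_zero, ENNReal.ofReal_zero, zero_le]
  obtain ⟨v, hv⟩ := h.exists_lt hc hμ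
  obtain ⟨hn, h2⟩ := pos_and_le_of_lt_div hc (l2norm_nonneg _ _) ENNReal.toReal_nonneg hv (hR v)
  -- The real value of the dual norm is positive, which excludes that the norm is infinite, since
  -- the real value of ∞ is 0.
  rw [← ENNReal.ofReal_toReal (ENNReal.toReal_pos_iff.1 hn).2.ne]
  refine ENNReal.ofReal_le_ofReal ?_
  rw [div_mul_eq_mul_div, le_div_iff₀ hc]
  linarith

section Scheme

variable {D : ModelData G} {B : BiotData} {P : FlowGD G D.d₀} {Q : MechGD G} {τ : TimeGrid D.T}
  {p : ℕ → Phase → P.X} {u : ℕ → Q.X} {lam : ℕ → Q.Mult}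

variable (D P) in
theorem l2norm_recM_pEM_le (q : Phase → P.X) : l2norm (P.recM (pEM D P q)) G.vol ≤
    2 * (l2norm (P.recM (q .nw).1) G.vol + l2norm (P.recM (q .w).1) G.vol) := by
  have h1 : MemLp (P.recM (q .nw).1) 2 G.vol := FlowGD.memLp_recM _
  have h2 : MemLp (P.recM (q .w).1) 2 G.vol := FlowGD.memLp_recM _
  have h3 := l2norm_add_le h1.norm h2.norm
  rw [l2norm_norm, l2norm_norm] at h3
  refine le_trans (l2norm_le_of_ae (h1.norm.add h2.norm) zero_le_two
    (Eventually.of_forall fun x => ?_)) (mul_le_mul_of_nonneg_left h3 zero_le_two)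
  simp only [FlowGD.recM, Pi.add_apply]
  rcases pwConst_cases P.cellM_disjoint x with ⟨i, -, hi⟩ | ⟨-, hi⟩
  · simp only [hi, Real.norm_eq_abs]
    rw [abs_of_nonneg (add_nonneg (abs_nonneg ((q .nw).1 i)) (abs_nonneg ((q .w).1 i)))]
    exact D.abs_equivalent_pressure_le .mat _ _
  · simp [hi]

variable (D P) in
theorem l2norm_recF_pEF_le (q : Phase → P.X) : l2norm (P.recF (pEF D P q)) G.surf ≤
    2 * (l2norm (P.recF (q .nw).2) G.surf + l2norm (P.recF (q .w).2) G.surf) := by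
  have h1 : MemLp (P.recF (q .nw).2) 2 G.surf := FlowGD.memLp_recF _
  have h2 : MemLp (P.recF (q .w).2) 2 G.surf := FlowGD.memLp_recF _
  have h3 := l2norm_add_le h1.norm h2.norm
  rw [l2norm_norm, l2norm_norm] at h3
  refine le_trans (l2norm_le_of_ae (h1.norm.add h2.norm) zero_le_two
    (Eventually.of_forall fun x => ?_)) (mul_le_mul_of_nonneg_left h3 zero_le_two)
  simp only [FlowGD.recF, Pi.add_apply]
  rcases pwConst_cases P.cellF_disjoint x with ⟨i, -, hi⟩ | ⟨-, hi⟩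
  · simp only [hi, Real.norm_eq_abs]
    rw [abs_of_nonneg (add_nonneg (abs_nonneg ((q .nw).2 i)) (abs_nonneg ((q .w).2 i)))]
    exact D.abs_equivalent_pressure_le .frac _ _
  · simp [hi]

variable (D P) in
theorem l2norm_U_recM_le (q : Phase → P.X) :
    l2norm (fun x => D.U .mat (P.recM (pcM D P q) x)) G.vol ≤
    1 * (l2norm (P.recM (q .nw).1) G.vol + l2norm (P.recM (q .w).1) G.vol) := by
  have h1 : MemLp (P.recM (q .nw).1) 2 G.vol := FlowGD.memLp_recM _
  have h2 : MemLp (P.recM (q .w).1) 2 G.vol := FlowGD.memLp_recM _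
  have h3 := l2norm_add_le h1.norm h2.norm
  rw [l2norm_norm, l2norm_norm] at h3
  refine le_trans (l2norm_le_of_ae (h1.norm.add h2.norm) zero_le_one
    (Eventually.of_forall fun x => ?_)) (mul_le_mul_of_nonneg_left h3 zero_le_one)
  simp only [FlowGD.recM, Pi.add_apply]
  rcases pwConst_cases P.cellM_disjoint x with ⟨i, -, hi⟩ | ⟨-, hi⟩
  · simp only [hi, Real.norm_eq_abs, one_mul]
    rw [abs_of_nonneg (add_nonneg (abs_nonneg ((q .nw).1 i)) (abs_nonneg ((q .w).1 i))),
      abs_of_nonneg (D.U_nonneg .mat (pcM D P q i))]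
    exact (D.U_le_abs _ _).trans (abs_sub _ _)
  · simp [hi, D.U_zero]

variable (D P) in
theorem l2norm_U_recF_le (q : Phase → P.X) :
    l2norm (fun x => D.U .frac (P.recF (pcF D P q) x)) G.surf ≤
    1 * (l2norm (P.recF (q .nw).2) G.surf + l2norm (P.recF (q .w).2) G.surf) := by
  have h1 : MemLp (P.recF (q .nw).2) 2 G.surf := FlowGD.memLp_recF _
  have h2 : MemLp (P.recF (q .w).2) 2 G.surf := FlowGD.memLp_recF _
  have h3 := l2norm_add_le h1.norm h2.norm
  rw [l2norm_norm, l2norm_norm] at h3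
  refine le_trans (l2norm_le_of_ae (h1.norm.add h2.norm) zero_le_one
    (Eventually.of_forall fun x => ?_)) (mul_le_mul_of_nonneg_left h3 zero_le_one)
  simp only [FlowGD.recF, Pi.add_apply]
  rcases pwConst_cases P.cellF_disjoint x with ⟨i, -, hi⟩ | ⟨-, hi⟩
  · simp only [hi, Real.norm_eq_abs, one_mul]
    rw [abs_of_nonneg (add_nonneg (abs_nonneg ((q .nw).2 i)) (abs_nonneg ((q .w).2 i))),
      abs_of_nonneg (D.U_nonneg .frac (pcF D P q i))]
    exact (D.U_le_abs _ _).trans (abs_sub _ _)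
  · simp [hi, D.U_zero]

/-- `c` bounds the displacement, its divergence and its jump by the strain. -/
def StrainBound (G : FractureNetwork d) (c : ℝ) : Prop :=
  ∀ v ∈ G.U₀, l2norm (val v) G.vol ≤ c * l2norm (strain v) G.vol ∧
    l2norm (dvg v) G.vol ≤ c * l2norm (strain v) G.vol ∧
    ∀ Q : MechGD G, l2norm (Q.jumpNF v) G.surf ≤ c * l2norm (strain v) G.vol ∧
      eLpNorm (Q.jumpNF v) 4 G.surf ≤ ENNReal.ofReal (c * l2norm (strain v) G.vol)

theorem StrainBound.abs_work_le {c : ℝ} (hc : StrainBound G c) {v : G.Disp} (hv : v ∈ G.U₀) :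
    |work D v| ≤ c * l2norm D.f G.vol * l2norm (strain v) G.vol := by
  refine (abs_integral_inner_le (Lp.memLp D.f) (memLp_val v)).trans ?_
  refine (mul_le_mul_of_nonneg_left (hc v hv).1 (l2norm_nonneg _ _)).trans_eq ?_
  ring

theorem StrainBound.abs_integral_dvg_le {c : ℝ} (hc : StrainBound G c) {v : G.Disp} (hv : v ∈ G.U₀)
    (q : Phase → P.X) : |B.b * ∫ x, P.recM (pEM D P q) x * dvg v x ∂G.vol| ≤
      c * l2norm (P.recM (pEM D P q)) G.vol * l2norm (strain v) G.vol := by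
  have h1 := abs_integral_mul_le (FlowGD.memLp_recM (P := P) (pEM D P q)) (memLp_dvg v)
  have h2 := mul_le_mul_of_nonneg_left (hc v hv).2.1 (l2norm_nonneg (P.recM (pEM D P q)) G.vol)
  rw [abs_mul, abs_of_nonneg B.b_mem.1]
  have h3 := mul_le_of_le_one_left (abs_nonneg (∫ x, P.recM (pEM D P q) x * dvg v x ∂G.vol)) B.b_mem.2
  linarith

theorem StrainBound.abs_integral_jumpNF_le {c : ℝ} (hc : StrainBound G c) {v : G.Disp}
    (hv : v ∈ G.U₀) (q : Phase → P.X) : |∫ x, P.recF (pEF D P q) x * Q.jumpNF v x ∂G.surf| ≤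
      c * l2norm (P.recF (pEF D P q)) G.surf * l2norm (strain v) G.vol := by
  have h1 := abs_integral_mul_le (FlowGD.memLp_recF (P := P) (pEF D P q))
    ((Q.memLp_jumpNF v).mono_exponent (p := 2) le_top)
  have h2 := mul_le_mul_of_nonneg_left ((hc v hv).2.2 Q).1
    (l2norm_nonneg (P.recF (pEF D P q)) G.surf)
  linarith

variable (h : IsSolution D B P Q τ p u lam)
include h

theorem IsSolution.mech_at {k : ℕ} (hk : k ≤ τ.N) (v : Q.X) :
    mechForm D B P Q (p k) (u k).1 (lam k) v = work D (v : G.Disp) := by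
  cases k with
  | zero => exact h.init_mech.1 v
  | succ k => exact h.mech.step hk v

/-- Bound for the multiplier at a given time. -/
theorem IsSolution.negHalfNorm_le {c cE cLow : ℝ} (hc : StrainBound G c)
    (hcE : ∀ u v : G.Disp, |D.elastic u v| ≤ cE * (l2norm (strain u) G.vol * l2norm (strain v) G.vol))
    (hcLow : 0 < cLow) (hQ : Q.InfSup cLow) {k : ℕ} (hk : k ≤ τ.N) :
    G.negHalfNorm (Q.mfun (lam k)) ≤ ENNReal.ofReal (2 / cLow *
      (cE * l2norm (strain (u k : G.Disp)) G.vol + c * (l2norm D.f G.vol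
        + l2norm (P.recM (pEM D P (p k))) G.vol + l2norm (P.recF (pEF D P (p k))) G.surf))) := by
  refine hQ.negHalfNorm_le hcLow (lam k) fun v => ?_
  · have h1 := h.mech_at hk v
    rw [mechForm_eq] at h1
    have hv := Q.X_subset v.2
    have h2 := abs_le.1 (hc.abs_work_le hv (D := D))
    have h3 := abs_le.1 (hc.abs_integral_dvg_le (B := B) hv (p k))
    have h4 := abs_le.1 (hc.abs_integral_jumpNF_le (Q := Q) hv (p k))
    have h5 := abs_le.1 (hcE (u k) v)
    linarith [h2.1, h2.2, h3.1, h3.2, h4.1, h4.2, h5.1, h5.2]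

/-- Bound for the initial displacement. -/
theorem IsSolution.initial_strain_le (hd : d ≤ 3) {c : ℝ} (hc : StrainBound G c) :
    D.elasticLower * l2norm (strain (u 0 : G.Disp)) G.vol ≤ c * (l2norm D.f G.vol
        + l2norm (P.recM (pEM D P (p 0))) G.vol + l2norm (P.recF (pEF D P (p 0))) G.surf)
      ∨ l2norm (strain (u 0 : G.Disp)) G.vol = 0 := by
  -- The estimate is linear in the strain only after division by its norm, hence the two cases.
  by_cases h0 : l2norm (strain (u 0 : G.Disp)) G.vol = 0
  · exact Or.inr h0
  left
  have hpos := lt_of_le_of_ne (l2norm_nonneg (strain (u 0 : G.Disp)) G.vol) (Ne.symm h0)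
  have h1 := h.mech_at (Nat.zero_le _) (u 0)
  rw [mechForm_eq] at h1
  have hv := Q.X_subset (u 0).2
  have h2 := abs_le.1 (hc.abs_work_le hv (D := D))
  have h3 := abs_le.1 (hc.abs_integral_dvg_le (B := B) hv (p 0))
  have h4 := abs_le.1 (hc.abs_integral_jumpNF_le (Q := Q) hv (p 0))
  have h5 := D.elastic_self_ge hd (u 0)
  -- The contact work in the initial equation tested with u⁰ has a favourable sign and is dropped.
  have h6 := h.initial_contact.2
  refine le_of_mul_le_mul_right ?_ hpos
  linarith [h2.1, h2.2, h3.1, h3.2, h4.1, h4.2]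

end Scheme

end PoroMech

end

/-! ### Bound on the energy by the data -/

noncomputable section

namespace PoroMech

open Filter Topology NNReal

variable {d : ℕ} {G : FractureNetwork d}

theorem l2norm_sub_le {α E : Type*} [MeasurableSpace α] {μ : Measure α} [NormedAddCommGroup E]
    {f g : α → E} (hf : MemLp f 2 μ) (hg : MemLp g 2 μ) :
    l2norm (fun x => f x - g x) μ ≤ l2norm f μ + l2norm g μ := by
  unfold l2norm
  rw [← ENNReal.toReal_add hf.2.ne hg.2.ne]
  exact ENNReal.toReal_mono (ENNReal.add_ne_top.2 ⟨hf.2.ne, hg.2.ne⟩)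
    (eLpNorm_sub_le hf.1 hg.1 (by norm_num))

section Scheme

variable {D : ModelData G} {B : BiotData} {P : FlowGD G D.d₀} {Q : MechGD G} {τ : TimeGrid D.T}
  {p : ℕ → Phase → P.X} {u : ℕ → Q.X} {lam : ℕ → Q.Mult}

/-- Real-valued form of the bounds on the initial data, with a nonnegative constant. -/
theorem InitialBound.real {C₀ : ℝ} {q : Phase → P.X} (h : InitialBound D B P C₀ q) :
    l2norm (P.recM (P.interpφ D.φ₀)) G.vol ≤ max C₀ 0 ∧
    (∀ α, l2norm (P.recM (q α).1) G.vol ≤ max C₀ 0) ∧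
    (∀ α, l2norm (P.recF (q α).2) G.surf ≤ max C₀ 0) ∧
    √B.invM * l2norm (P.recM (pEM D P q)) G.vol ≤ max C₀ 0 ∧
    ∀ a, B.dDam a * B.φDam a * storeT D P a q ≤ max C₀ 0 := by
  have hC : ENNReal.ofReal C₀ = ENNReal.ofReal (max C₀ 0) := by
    rcases le_total 0 C₀ with h | h
    · rw [max_eq_left h]
    · rw [max_eq_right h, ENNReal.ofReal_of_nonpos h, ENNReal.ofReal_zero]
  have hc0 : 0 ≤ max C₀ 0 := le_max_right _ _
  obtain ⟨h1, h2, h3, h4, h5⟩ := h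
  rw [hC] at h1 h4
  simp only [hC] at h2 h3 h5
  refine ⟨l2norm_le_of_eLpNorm_le hc0 h1, fun α => l2norm_le_of_eLpNorm_le hc0 (h2 α),
    fun α => l2norm_le_of_eLpNorm_le hc0 (h3 α), ?_, fun a => ?_⟩
  · rw [eLpNorm_two_eq_ofReal (FlowGD.memLp_recM _), ← ENNReal.ofReal_mul (Real.sqrt_nonneg _)] at h4
    exact (ENNReal.ofReal_le_ofReal_iff hc0).1 h4
  · have := h5 a
    rw [eLpNorm_one_eq_ofReal_integral (integrable_storeT D P a q)
      (Eventually.of_forall fun x => D.U_nonneg _ _),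
      ← ENNReal.ofReal_mul (mul_nonneg (B.dDam_pos a).le (B.φDam_pos a).le)] at this
    exact (ENNReal.ofReal_le_ofReal_iff hc0).1 this

theorem porosity_zero : porosity D B P Q p u 0 =ᵐ[G.vol] P.recM (P.interpφ D.φ₀) := by
  filter_upwards [dvg_sub (u 0).1 (u 0).1] with x hx
  simp only [porosity]
  rw [hx, sub_self, sub_self, FlowGD.recM_zero, mul_zero, mul_zero, add_zero, add_zero]

theorem storeM_zero_le {c₀ : ℝ} (hc₀ : 0 ≤ c₀)
    (h1 : l2norm (P.recM (P.interpφ D.φ₀)) G.vol ≤ c₀)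
    (h2 : ∀ α, l2norm (P.recM (p 0 α).1) G.vol ≤ c₀) : storeM D B P Q p u 0 ≤ c₀ * (2 * c₀) := by
  have e : storeM D B P Q p u 0 = ∫ x, P.recM (P.interpφ D.φ₀) x *
      D.U .mat (P.recM (pcM D P (p 0)) x) ∂G.vol := by
    refine integral_congr_ae ?_
    filter_upwards [porosity_zero (D := D) (B := B) (P := P) (Q := Q) (p := p) (u := u)] with x hx
    rw [hx]
  rw [e]
  refine (le_abs_self _).trans ((abs_integral_mul_le (FlowGD.memLp_recM _)
    (FlowGD.memLp_comp_recM _ _)).trans ?_)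
  have h3 := l2norm_U_recM_le D P (p 0)
  have h4 : l2norm (fun x => D.U .mat (P.recM (pcM D P (p 0)) x)) G.vol ≤ 2 * c₀ := by
    linarith [h2 .nw, h2 .w]
  exact mul_le_mul h1 h4 (l2norm_nonneg _ _) hc₀

theorem storeF_zero_le {c₀ A : ℝ} (hA : l2norm (aperture D Q (u 0)) G.surf ≤ A)
    (h3 : ∀ α, l2norm (P.recF (p 0 α).2) G.surf ≤ c₀) :
    storeF D P Q (p 0) (u 0) ≤ A * (2 * c₀) := by
  refine (le_abs_self _).trans ((abs_integral_mul_le (memLp_aperture D Q _)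
    (FlowGD.memLp_comp_recF _ _)).trans ?_)
  have h5 := l2norm_U_recF_le D P (p 0)
  have h4 : l2norm (fun x => D.U .frac (P.recF (pcF D P (p 0)) x)) G.surf ≤ 2 * c₀ := by
    linarith [h3 .nw, h3 .w]
  exact mul_le_mul hA h4 (l2norm_nonneg _ _) ((l2norm_nonneg _ _).trans hA)

variable (D) in
/-- The energy estimate: stored energy, strain and dissipation are bounded by the data. -/
theorem exists_energy_bound (hd : d ≤ 3) {c : ℝ} (hc0 : 0 ≤ c) (hc : StrainBound G c) {cUp : ℝ}
    (hcUp : 0 < cUp) (C₀ : ℝ) : ∃ M κ : ℝ, 0 ≤ M ∧ 0 < κ ∧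
      ∀ (B : BiotData) (P : FlowGD G D.d₀) (Q : MechGD G) (τ : TimeGrid D.T)
        (p : ℕ → Phase → P.X) (u : ℕ → Q.X) (lam : ℕ → Q.Mult), P.Coercive cUp →
        IsSolution D B P Q τ p u lam → InitialBound D B P C₀ (p 0) →
        (∀ k ≤ τ.N, ∀ᵐ x ∂G.vol, 0 ≤ porosity D B P Q p u k x) → ∀ n ≤ τ.N,
        stored D B P Q p u n + κ * l2norm (strain (u n : G.Disp)) G.vol ^ 2
          + κ * ∑ k ∈ Finset.range n, (τ.t (k + 1) - τ.t k) * diss D P Q p u (k + 1) ≤ M := by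
  obtain ⟨cD, hcD, hdiss⟩ := exists_dissPhase_le D
  obtain ⟨cE, hcE0, hcE⟩ := D.exists_elastic_le
  have heL := D.elasticLower_pos
  set eL := D.elasticLower
  set c₀ := max C₀ 0
  have hc₀ : 0 ≤ c₀ := le_max_right _ _
  set F := l2norm D.f G.vol
  have hF : 0 ≤ F := l2norm_nonneg _ _
  -- Bound for the initial strain from `initial_strain_le`; each equivalent pressure is at most 4 c₀
  -- because it is bounded by twice the sum of the two phase pressures.
  let s₀ : ℝ := c * (F + 4 * c₀ + 4 * c₀) / eL
  have hs₀ : 0 ≤ s₀ := by positivity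
  -- Bound for the initial aperture in L²(Γ).
  let A : ℝ := l2norm D.d₀ G.surf + c * s₀
  let H : ℝ := (∫ s in Ioc 0 D.T, srcSq D .nw s) + ∫ s in Ioc 0 D.T, srcSq D .w s
  have hH : 0 ≤ H := add_nonneg (integral_nonneg fun s => srcSq_nonneg D _ s)
    (integral_nonneg fun s => srcSq_nonneg D _ s)
  have hA : 0 ≤ A := add_nonneg (l2norm_nonneg _ _) (by positivity)
  -- Bound for the initial energy. In order: matrix storage, equivalent pressure, fracture storage,
  -- the two damaged layers, elastic energy, work of the body force.
  let E₀ : ℝ := c₀ * (2 * c₀) + 1 / 2 * c₀ ^ 2 + A * (2 * c₀) + (c₀ + c₀) + 1 / 2 * (cE * (s₀ * s₀))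
    + c * F * s₀
  have hE₀ : 0 ≤ E₀ := by positivity
  -- Half of the elastic energy controls eL/2 times the squared strain; the work of the body force
  -- consumes half of that and costs (cF)²/eL, leaving eL/4.
  refine ⟨E₀ + 4 * cUp ^ 2 / cD * H + (c * F) ^ 2 / eL, min (eL / 4) (cD / 2), by positivity,
    by positivity, fun B P Q τ p u lam hP h hI hφ n hn => ?_⟩
  obtain ⟨hi1, hi2, hi3, hi4, hi5⟩ := hI.real
  have hpM : l2norm (P.recM (pEM D P (p 0))) G.vol ≤ 4 * c₀ := by
    linarith [l2norm_recM_pEM_le D P (p 0), hi2 .nw, hi2 .w]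
  have hpF : l2norm (P.recF (pEF D P (p 0))) G.surf ≤ 4 * c₀ := by
    linarith [l2norm_recF_pEF_le D P (p 0), hi3 .nw, hi3 .w]
  have hS0 : l2norm (strain (u 0 : G.Disp)) G.vol ≤ s₀ := by
    rcases h.initial_strain_le hd hc with h1 | h1
    · simp only [s₀]
      rw [le_div_iff₀ heL]
      have : c * (l2norm D.f G.vol + l2norm (P.recM (pEM D P (p 0))) G.vol
          + l2norm (P.recF (pEF D P (p 0))) G.surf) ≤ c * (F + 4 * c₀ + 4 * c₀) :=
        mul_le_mul_of_nonneg_left (by linarith) hc0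
      linarith
    · rw [h1]; exact hs₀
  have hS0n := l2norm_nonneg (strain (u 0 : G.Disp)) G.vol
  have hu : ∀ k, (u k : G.Disp) ∈ G.U₀ := fun k => Q.X_subset (u k).2
  have hA0 : l2norm (aperture D Q (u 0)) G.surf ≤ A := by
    have h1 := l2norm_sub_le (D.memLp_d₀.mono_exponent (p := 2) le_top)
      ((Q.memLp_jumpNF (u 0)).mono_exponent (p := 2) le_top)
    have h2 := ((hc _ (hu 0)).2.2 Q).1
    have h3 := mul_le_mul_of_nonneg_left hS0 hc0
    exact h1.trans (by simp only [A]; linarith)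
  have hE : energy D B P Q p u 0 ≤ E₀ := by
    have e1 := storeM_zero_le (B := B) (Q := Q) (u := u) hc₀ hi1 hi2
    have e2 : B.invM / 2 * l2norm (P.recM (pEM D P (p 0))) G.vol ^ 2 ≤ 1 / 2 * c₀ ^ 2 := by
      have := pow_le_pow_left₀ (by have := l2norm_nonneg (P.recM (pEM D P (p 0))) G.vol; positivity)
        hi4 2
      rw [mul_pow, Real.sq_sqrt B.invM_nonneg] at this
      linarith
    have e3 := storeF_zero_le (P := P) (p := p) hA0 hi3
    have e4 := hi5 .plus
    have e5 := hi5 .minus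
    have e6 : D.elastic (u 0) (u 0) ≤ cE * (s₀ * s₀) :=
      (le_abs_self _).trans ((hcE _ _).trans
        (mul_le_mul_of_nonneg_left (mul_le_mul hS0 hS0 hS0n hs₀) hcE0))
    have e7 := (abs_le.1 (hc.abs_work_le (hu 0) (D := D))).1
    have e8 : c * F * l2norm (strain (u 0 : G.Disp)) G.vol ≤ c * F * s₀ :=
      mul_le_mul_of_nonneg_left hS0 (by positivity)
    simp only [energy, stored, E₀]
    linarith
  have hen := h.energy_le hd hcD hcUp (hdiss P Q) hP hφ hn
  have hel := D.elastic_self_ge hd (u n)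
  have hwork := (abs_le.1 (hc.abs_work_le (hu n) (D := D))).2
  have hSn := l2norm_nonneg (strain (u n : G.Disp)) G.vol
  set S := l2norm (strain (u n : G.Disp)) G.vol
  have hyoung : c * F * S ≤ eL / 4 * S ^ 2 + (c * F) ^ 2 / eL := by
    have h1 : 0 ≤ (eL / 2 * S - c * F) ^ 2 / eL := by positivity
    have h2 : (eL / 2 * S - c * F) ^ 2 / eL = eL / 4 * S ^ 2 - c * F * S + (c * F) ^ 2 / eL := by
      field_simp; ring
    linarith
  have hsum : 0 ≤ ∑ k ∈ Finset.range n, (τ.t (k + 1) - τ.t k) * diss D P Q p u (k + 1) :=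
    Finset.sum_nonneg fun k hk => mul_nonneg
      (τ.step_pos ((Finset.mem_range.1 hk).trans_le hn)).le
      (add_nonneg (dissPhase_nonneg _ _ _) (dissPhase_nonneg _ _ _))
  have k1 := mul_le_mul_of_nonneg_right (min_le_left (eL / 4) (cD / 2)) (sq_nonneg S)
  have k2 := mul_le_mul_of_nonneg_right (min_le_right (eL / 4) (cD / 2)) hsum
  simp only [energy] at hen hE
  simp only [H]
  linarith

variable (D B P Q p u) in
/-- The nonnegative parts of the stored energy. -/
theorem stored_bounds {k : ℕ} {φmin : ℝ} (hφ0 : 0 ≤ φmin)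
    (hφ : ∀ᵐ x ∂G.vol, φmin ≤ porosity D B P Q p u k x)
    (ha : ∀ x, D.d₀ x ≤ aperture D Q (u k) x) :
    0 ≤ stored D B P Q p u k ∧
    φmin * (∫ x, D.U .mat (P.recM (pcM D P (p k)) x) ∂G.vol) ≤ stored D B P Q p u k ∧
    ∫ x, D.d₀ x * D.U .frac (P.recF (pcF D P (p k)) x) ∂G.surf ≤ stored D B P Q p u k ∧
    B.invM / 2 * l2norm (P.recM (pEM D P (p k))) G.vol ^ 2 ≤ stored D B P Q p u k ∧
    ∀ a, B.dDam a * B.φDam a * storeT D P a (p k) ≤ stored D B P Q p u k := by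
  have hUM : Integrable (fun x => D.U .mat (P.recM (pcM D P (p k)) x)) G.vol :=
    memLp_one_iff_integrable.1 (FlowGD.memLp_comp_recM _ _)
  have hdU : Integrable (fun x => D.d₀ x * D.U .frac (P.recF (pcF D P (p k)) x)) G.surf :=
    integrable_mul_of_memLp (D.memLp_d₀.mono_exponent le_top) (FlowGD.memLp_comp_recF _ _)
  have h1 : φmin * (∫ x, D.U .mat (P.recM (pcM D P (p k)) x) ∂G.vol) ≤ storeM D B P Q p u k := by
    rw [← integral_const_mul]
    refine integral_mono_ae (hUM.const_mul _) (integrable_storeM D B P Q p u k) ?_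
    filter_upwards [hφ] with x hx using mul_le_mul_of_nonneg_right hx (D.U_nonneg _ _)
  have h1' : 0 ≤ φmin * (∫ x, D.U .mat (P.recM (pcM D P (p k)) x) ∂G.vol) :=
    mul_nonneg hφ0 (integral_nonneg fun x => D.U_nonneg _ _)
  have h2 : ∫ x, D.d₀ x * D.U .frac (P.recF (pcF D P (p k)) x) ∂G.surf ≤
      storeF D P Q (p k) (u k) :=
    integral_mono hdU (integrable_storeF D P Q (p k) (u k)) fun x =>
      mul_le_mul_of_nonneg_right (ha x) (D.U_nonneg _ _)
  have h2' : 0 ≤ ∫ x, D.d₀ x * D.U .frac (P.recF (pcF D P (p k)) x) ∂G.surf := by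
    refine integral_nonneg_of_ae ?_
    filter_upwards [ae_restrict_mem G.measurableSet_Γ] with x hx
    exact mul_nonneg (D.d₀_pos x hx).le (D.U_nonneg _ _)
  have h3 : 0 ≤ B.invM / 2 * l2norm (P.recM (pEM D P (p k))) G.vol ^ 2 := by
    have := B.invM_nonneg; positivity
  have h4 : ∀ a, 0 ≤ B.dDam a * B.φDam a * storeT D P a (p k) := fun a =>
    mul_nonneg (mul_nonneg (B.dDam_pos a).le (B.φDam_pos a).le)
      (integral_nonneg fun x => D.U_nonneg _ _)
  have h5 := h4 .plus
  have h6 := h4 .minus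
  unfold stored
  refine ⟨by linarith, by linarith, by linarith, by linarith, fun a => ?_⟩
  cases a <;> linarith

end Scheme

end PoroMech

end

/-! ### Bound on the multipliers -/

noncomputable section

namespace PoroMech

open Filter Topology NNReal

variable {d : ℕ} {G : FractureNetwork d}

section Scheme

variable {D : ModelData G} {B : BiotData} {P : FlowGD G D.d₀} {Q : MechGD G} {τ : TimeGrid D.T}
  {p : ℕ → Phase → P.X} {u : ℕ → Q.X} {lam : ℕ → Q.Mult}

theorem dissPhase_le_diss (α : Phase) (k : ℕ) :
    dissPhase D P Q α (p k) (u k) ≤ diss D P Q p u k := by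
  have h1 := dissPhase_nonneg (D := D) (P := P) (Q := Q) .nw (p k) (u k)
  have h2 := dissPhase_nonneg (D := D) (P := P) (Q := Q) .w (p k) (u k)
  unfold diss
  cases α <;> linarith

theorem sum_step_mul_le {f : ℕ → ℝ} {A : ℝ} (hf : ∀ k, f k ≤ diss D P Q p u k)
    (h : ∑ k ∈ Finset.range τ.N, (τ.t (k + 1) - τ.t k) * diss D P Q p u (k + 1) ≤ A) :
    ∑ k ∈ Finset.range τ.N, (τ.t (k + 1) - τ.t k) * f (k + 1) ≤ A :=
  (Finset.sum_le_sum fun k hk =>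
    mul_le_mul_of_nonneg_left (hf (k + 1)) (τ.step_pos (Finset.mem_range.1 hk)).le).trans h

/-- At each step the multiplier is bounded by the strain and the force, which are uniform in time,
plus the equivalent pressures, which are only square summable through the dissipation. This is why λ
is bounded in L² and not in L^∞ in time. -/
theorem IsSolution.lintegral_negHalfNorm_sq_le (h : IsSolution D B P Q τ p u lam)
    {c cE cLow cUp s A : ℝ} (hc0 : 0 ≤ c) (hc : StrainBound G c) (hcE0 : 0 ≤ cE)
    (hcE : ∀ u v : G.Disp, |D.elastic u v| ≤ cE * (l2norm (strain u) G.vol * l2norm (strain v) G.vol))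
    (hcLow : 0 < cLow) (hQ : Q.InfSup cLow) (hcUp : 0 < cUp) (hP : P.Coercive cUp)
    (hs : ∀ k ≤ τ.N, l2norm (strain (u k : G.Disp)) G.vol ≤ s)
    (hA : ∑ k ∈ Finset.range τ.N, (τ.t (k + 1) - τ.t k) * diss D P Q p u (k + 1) ≤ A) :
    ∫⁻ t in Ioo 0 D.T, G.negHalfNorm (Q.mfun (τ.ext lam t)) ^ 2 ≤ ENNReal.ofReal
      (2 * (2 / cLow * (cE * s + c * l2norm D.f G.vol)) ^ 2 * D.T
        + 2 * (2 / cLow * (2 * c)) ^ 2 * (32 * cUp ^ 2) * A) := by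
  set K₁ := 2 / cLow * (cE * s + c * l2norm D.f G.vol)
  set K₂ := 2 / cLow * (2 * c) with hK₂
  have hK₂0 : 0 ≤ K₂ := by positivity
  have hpt : ∀ k < τ.N, G.negHalfNorm (Q.mfun (lam (k + 1))) ^ 2 ≤
      ENNReal.ofReal (2 * K₁ ^ 2 + 2 * K₂ ^ 2 * (32 * cUp ^ 2) * diss D P Q p u (k + 1)) := by
    intro k hk
    have hk1 : k + 1 ≤ τ.N := hk
    have h1 := h.negHalfNorm_le hc hcE hcLow hQ hk1
    have h2 := hs (k + 1) hk1
    have h3 := l2norm_recM_pEM_le D P (p (k + 1))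
    have h4 := l2norm_recF_pEF_le D P (p (k + 1))
    have hap : ∀ x, x ∈ G.Γ → D.d₀ x ≤ aperture D Q (u (k + 1)) x := fun x _ =>
      h.d₀_le_aperture hk1 x
    have h5 := sq_rec_le_dissPhase hcUp.le hP .nw (p (k + 1)) (u (k + 1)) hap
    have h6 := sq_rec_le_dissPhase hcUp.le hP .w (p (k + 1)) (u (k + 1)) hap
    have n1 := l2norm_nonneg (P.recM (p (k + 1) .nw).1) G.vol
    have n2 := l2norm_nonneg (P.recM (p (k + 1) .w).1) G.vol
    have n3 := l2norm_nonneg (P.recF (p (k + 1) .nw).2) G.surf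
    have n4 := l2norm_nonneg (P.recF (p (k + 1) .w).2) G.surf
    have n5 := l2norm_nonneg (P.recM (pEM D P (p (k + 1)))) G.vol
    have n6 := l2norm_nonneg (P.recF (pEF D P (p (k + 1)))) G.surf
    have n7 := l2norm_nonneg (strain (u (k + 1) : G.Disp)) G.vol
    have n8 := l2norm_nonneg D.f G.vol
    set m₁ := l2norm (P.recM (p (k + 1) .nw).1) G.vol
    set m₂ := l2norm (P.recM (p (k + 1) .w).1) G.vol
    set f₁ := l2norm (P.recF (p (k + 1) .nw).2) G.surf
    set f₂ := l2norm (P.recF (p (k + 1) .w).2) G.surf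
    set y := m₁ + m₂ + f₁ + f₂
    -- Cauchy–Schwarz for four terms times the constant 8 of `sq_rec_le_dissPhase`.
    have hy : y ^ 2 ≤ 32 * cUp ^ 2 * diss D P Q p u (k + 1) := by
      unfold diss
      nlinarith [sq_nonneg (m₁ - m₂), sq_nonneg (m₁ - f₁), sq_nonneg (m₁ - f₂), sq_nonneg (m₂ - f₁),
        sq_nonneg (m₂ - f₂), sq_nonneg (f₁ - f₂)]
    have hR : 2 / cLow * (cE * l2norm (strain (u (k + 1) : G.Disp)) G.vol
        + c * (l2norm D.f G.vol + l2norm (P.recM (pEM D P (p (k + 1)))) G.vol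
          + l2norm (P.recF (pEF D P (p (k + 1)))) G.surf)) ≤ K₁ + K₂ * y := by
      have e : K₁ + K₂ * y = 2 / cLow * (cE * s + c * (l2norm D.f G.vol + 2 * y)) := by
        simp only [K₁, K₂]; ring
      rw [e]
      refine mul_le_mul_of_nonneg_left (add_le_add (mul_le_mul_of_nonneg_left h2 hcE0)
        (mul_le_mul_of_nonneg_left ?_ hc0)) (by positivity)
      simp only [y]; linarith
    have hR0 : 0 ≤ K₁ + K₂ * y := le_trans (by positivity) hR
    calc _ ≤ ENNReal.ofReal (K₁ + K₂ * y) ^ 2 :=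
          pow_le_pow_left' (h1.trans (ENNReal.ofReal_le_ofReal hR)) 2
      _ = ENNReal.ofReal ((K₁ + K₂ * y) ^ 2) := (ENNReal.ofReal_pow hR0 2).symm
      _ ≤ _ := by
          refine ENNReal.ofReal_le_ofReal ?_
          have := mul_le_mul_of_nonneg_left hy (by positivity : 0 ≤ 2 * K₂ ^ 2)
          nlinarith [sq_nonneg (K₁ - K₂ * y)]
  have hnn : ∀ k ∈ Finset.range τ.N, 0 ≤ (τ.t (k + 1) - τ.t k) *
      (2 * K₁ ^ 2 + 2 * K₂ ^ 2 * (32 * cUp ^ 2) * diss D P Q p u (k + 1)) := fun k hk => by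
    have h1 := (τ.step_pos (Finset.mem_range.1 hk)).le
    have h2 : 0 ≤ diss D P Q p u (k + 1) :=
      add_nonneg (dissPhase_nonneg _ _ _) (dissPhase_nonneg _ _ _)
    positivity
  have e : ∫⁻ t in Ioo 0 D.T, G.negHalfNorm (Q.mfun (τ.ext lam t)) ^ 2 =
      ∑ k ∈ Finset.range τ.N, ENNReal.ofReal (τ.t (k + 1) - τ.t k) *
        G.negHalfNorm (Q.mfun (lam (k + 1))) ^ 2 := by
    rw [setLIntegral_congr Ioo_ae_eq_Ioc,
      ← τ.lintegral_idx fun k => G.negHalfNorm (Q.mfun (lam k)) ^ 2]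
    rfl
  rw [e]
  calc _ ≤ ∑ k ∈ Finset.range τ.N, ENNReal.ofReal ((τ.t (k + 1) - τ.t k) *
        (2 * K₁ ^ 2 + 2 * K₂ ^ 2 * (32 * cUp ^ 2) * diss D P Q p u (k + 1))) := by
        refine Finset.sum_le_sum fun k hk => ?_
        rw [ENNReal.ofReal_mul (τ.step_pos (Finset.mem_range.1 hk)).le]
        exact mul_le_mul_right (hpt k (Finset.mem_range.1 hk)) _
    _ = ENNReal.ofReal (∑ k ∈ Finset.range τ.N, (τ.t (k + 1) - τ.t k) *
        (2 * K₁ ^ 2 + 2 * K₂ ^ 2 * (32 * cUp ^ 2) * diss D P Q p u (k + 1))) :=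
        (ENNReal.ofReal_sum_of_nonneg hnn).symm
    _ ≤ _ := by
        refine ENNReal.ofReal_le_ofReal ?_
        have e2 : ∑ k ∈ Finset.range τ.N, (τ.t (k + 1) - τ.t k) *
            (2 * K₁ ^ 2 + 2 * K₂ ^ 2 * (32 * cUp ^ 2) * diss D P Q p u (k + 1)) =
            2 * K₁ ^ 2 * ∑ k ∈ Finset.range τ.N, (τ.t (k + 1) - τ.t k) +
            2 * K₂ ^ 2 * (32 * cUp ^ 2) *
              ∑ k ∈ Finset.range τ.N, (τ.t (k + 1) - τ.t k) * diss D P Q p u (k + 1) := by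
          rw [Finset.mul_sum, Finset.mul_sum, ← Finset.sum_add_distrib]
          refine Finset.sum_congr rfl fun k _ => ?_
          ring
        rw [e2, Finset.sum_range_sub, τ.t_zero, τ.t_last, sub_zero]
        have := mul_le_mul_of_nonneg_left hA (by positivity : 0 ≤ 2 * K₂ ^ 2 * (32 * cUp ^ 2))
        linarith

end Scheme

end PoroMech

end

/-! ### The energy estimates -/

theorem theorem1 {d : ℕ} (hd : d = 2 ∨ d = 3) (G : FractureNetwork d) (hKorn : G.Korn)
    (D : ModelData G) (cUp cLow C₀ : ℝ) (hcUp : 0 < cUp) (hcLow : 0 < cLow) :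
    ∃ C : ℝ, 0 ≤ C ∧
      ∀ (B : BiotData) (P : FlowGD G D.d₀) (Q : MechGD G) (τ : TimeGrid D.T)
        (p : ℕ → Phase → P.X) (u : ℕ → Q.X) (lam : ℕ → Q.Mult) (φmin : ℝ),
        P.Coercive cUp → Q.InfSup cLow →
        IsSolution D B P Q τ p u lam →
        InitialBound D B P C₀ (p 0) →
        0 ≤ φmin →
        (∀ k ≤ τ.N, ∀ᵐ x ∂G.vol, φmin ≤ porosity D B P Q p u k x) →
        (∀ α, eLpNorm (fun z : ℝ × Vec d => P.gradM (τ.ext p z.1 α).1 z.2) 2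
            ((volume.restrict (Ioo 0 D.T)).prod G.vol) ≤ ENNReal.ofReal C) ∧
        (∀ α, eLpNorm (fun z : ℝ × Vec d => aperture D Q (τ.ext u z.1).1 z.2 ^ (3 / 2 : ℝ) •
            P.gradF (τ.ext p z.1 α).2 z.2) 2
            ((volume.restrict (Ioo 0 D.T)).prod G.surf) ≤ ENNReal.ofReal C) ∧
        (∀ α a, eLpNorm (fun z : ℝ × Vec d => P.jump a (τ.ext p z.1 α) z.2) 2
            ((volume.restrict (Ioo 0 D.T)).prod G.surf) ≤ ENNReal.ofReal C) ∧
        (∀ a, ENNReal.ofReal (B.dDam a * B.φDam a) *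
            essSup (fun s => eLpNorm (fun x => D.U (.dam a)
              (P.recT a (pcM D P (τ.ext p s)) x)) 1 G.surf) (volume.restrict (Ioo 0 D.T))
            ≤ ENNReal.ofReal C) ∧
        (ENNReal.ofReal φmin *
            essSup (fun s => eLpNorm (fun x => D.U .mat
              (P.recM (pcM D P (τ.ext p s)) x)) 1 G.vol) (volume.restrict (Ioo 0 D.T))
            ≤ ENNReal.ofReal C) ∧
        (essSup (fun s => eLpNorm (fun x => D.d₀ x * D.U .frac
              (P.recF (pcF D P (τ.ext p s)) x)) 1 G.surf) (volume.restrict (Ioo 0 D.T))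
            ≤ ENNReal.ofReal C) ∧
        (ENNReal.ofReal (√B.invM) *
            essSup (fun s => eLpNorm (P.recM (pEM D P (τ.ext p s))) 2 G.vol)
              (volume.restrict (Ioo 0 D.T)) ≤ ENNReal.ofReal C) ∧
        (essSup (fun s => eLpNorm (strain (τ.ext u s).1) 2 G.vol)
            (volume.restrict (Ioo 0 D.T)) ≤ ENNReal.ofReal C) ∧
        (essSup (fun s => eLpNorm (aperture D Q (τ.ext u s).1) 4 G.surf)
            (volume.restrict (Ioo 0 D.T)) ≤ ENNReal.ofReal C) ∧
        (∫⁻ s in Ioo 0 D.T, G.negHalfNorm (Q.mfun (τ.ext lam s)) ^ 2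
            ≤ ENNReal.ofReal C ^ 2) := by
  have hd3 : d ≤ 3 := by omega
  obtain ⟨c, hc0, hc⟩ := Korn.exists_l2norm_bound hd hKorn
  obtain ⟨cE, hcE0, hcE⟩ := D.exists_elastic_le
  obtain ⟨M, κ, hM, hκ, hbound⟩ := exists_energy_bound D hd3 hc0 hc hcUp C₀
  -- Serves twice: as the bound for the strain at each time, and, being the square root of the bound
  -- A on the accumulated dissipation, for the three L² norms in space and time.
  let s : ℝ := √(M / κ)
  let A : ℝ := M / κ
  let d₄ : ℝ := (eLpNorm D.d₀ 4 G.surf).toReal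
  let L : ℝ := 2 * (2 / cLow * (cE * s + c * l2norm D.f G.vol)) ^ 2 * D.T
        + 2 * (2 / cLow * (2 * c)) ^ 2 * (32 * cUp ^ 2) * A
  have hs0 : 0 ≤ s := Real.sqrt_nonneg _
  have hA0 : 0 ≤ A := div_nonneg hM hκ.le
  have hd₄ : 0 ≤ d₄ := ENNReal.toReal_nonneg
  have hT := D.T_pos.le
  have hL0 : 0 ≤ L := by positivity
  have hcs : 0 ≤ c * s := by positivity
  have hM2 : 0 ≤ √(2 * M) := Real.sqrt_nonneg _
  have hL2 : 0 ≤ √L := Real.sqrt_nonneg _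
  have hsA : √A = s := rfl
  -- All summands are nonnegative, so each of the ten bounds keeps the ones it needs: M for the
  -- capillary energies, √(2M) for the equivalent pressure, d₄ + c s for the aperture and √L for the
  -- multiplier.
  refine ⟨s + M + √(2 * M) + d₄ + c * s + √L, by positivity, ?_⟩
  set C := s + M + √(2 * M) + d₄ + c * s + √L with hC
  intro B P Q τ p u lam φmin hP hQ h hI hφ0 hφ
  have hφ' : ∀ k ≤ τ.N, ∀ᵐ x ∂G.vol, 0 ≤ porosity D B P Q p u k x := fun k hk => by
    filter_upwards [hφ k hk] with x hx using hφ0.trans hx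
  have hE := hbound B P Q τ p u lam hP h hI hφ'
  have hst := fun k (hk : k ≤ τ.N) =>
    stored_bounds D B P Q p u hφ0 (hφ k hk) (h.d₀_le_aperture hk)
  have hdiss0 : ∀ k, 0 ≤ diss D P Q p u k := fun k =>
    add_nonneg (dissPhase_nonneg _ _ _) (dissPhase_nonneg _ _ _)
  have hsum0 : ∀ n ≤ τ.N, 0 ≤ κ * ∑ k ∈ Finset.range n,
      (τ.t (k + 1) - τ.t k) * diss D P Q p u (k + 1) := fun n hn =>
    mul_nonneg hκ.le (Finset.sum_nonneg fun k hk => mul_nonneg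
      (τ.step_pos ((Finset.mem_range.1 hk).trans_le hn)).le (hdiss0 _))
  have hstM : ∀ k ≤ τ.N, stored D B P Q p u k ≤ M := fun k hk => by
    have h1 := hE k hk
    have h2 := hsum0 k hk
    have h3 : 0 ≤ κ * l2norm (strain (u k : G.Disp)) G.vol ^ 2 := by positivity
    linarith
  have hS : ∀ k ≤ τ.N, l2norm (strain (u k : G.Disp)) G.vol ≤ s := fun k hk => by
    have h1 := hE k hk
    have h2 := hsum0 k hk
    have h3 := (hst k hk).1
    refine Real.le_sqrt_of_sq_le ?_
    rw [le_div_iff₀ hκ]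
    linarith
  have hsumA : ∑ k ∈ Finset.range τ.N, (τ.t (k + 1) - τ.t k) * diss D P Q p u (k + 1) ≤ A := by
    have h1 := hE τ.N le_rfl
    have h3 := (hst τ.N le_rfl).1
    have h4 : 0 ≤ κ * l2norm (strain (u τ.N : G.Disp)) G.vol ^ 2 := by positivity
    rw [le_div_iff₀ hκ]
    linarith
  have hap : ∀ k ≤ τ.N, ∀ x, x ∈ G.Γ → 0 ≤ aperture D Q (u k).1 x := fun k hk =>
    h.aperture_nonneg hk
  refine ⟨fun α => ?_, fun α => ?_, fun α a => ?_, fun a => ?_, ?_, ?_, ?_, ?_, ?_, ?_⟩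
  · refine (eLpNorm_ext_le τ (fun k x => P.gradM (p k α).1 x)
      (fun k _ => (Lp.memLp (P.gradM (p (k + 1) α).1)).mono_exponent le_top)
      (sum_step_mul_le (f := fun k => l2norm (P.gradM (p k α).1) G.vol ^ 2) (fun k => ?_)
        hsumA)).trans (ENNReal.ofReal_le_ofReal (by rw [hsA]; linarith))
    refine le_trans ?_ (dissPhase_le_diss α k)
    unfold dissPhase
    nlinarith [sq_nonneg (l2norm (wgradF D P Q (u k) (p k α).2) G.surf),
      sq_nonneg (l2norm (P.jump .plus (p k α)) G.surf),
      sq_nonneg (l2norm (P.jump .minus (p k α)) G.surf)]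
  · refine (eLpNorm_ext_le τ (fun k => wgradF D P Q (u k) (p k α).2)
      (fun k hk => memLp_wgradF D P Q (hap (k + 1) hk) _)
      (sum_step_mul_le (f := fun k => l2norm (wgradF D P Q (u k) (p k α).2) G.surf ^ 2)
        (fun k => ?_) hsumA)).trans (ENNReal.ofReal_le_ofReal (by rw [hsA]; linarith))
    refine le_trans ?_ (dissPhase_le_diss α k)
    unfold dissPhase
    nlinarith [sq_nonneg (l2norm (P.gradM (p k α).1) G.vol),
      sq_nonneg (l2norm (P.jump .plus (p k α)) G.surf),
      sq_nonneg (l2norm (P.jump .minus (p k α)) G.surf)]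
  · refine (eLpNorm_ext_le τ (fun k x => P.jump a (p k α) x)
      (fun k _ => (Lp.memLp (P.jump a (p (k + 1) α))).mono_exponent le_top)
      (sum_step_mul_le (f := fun k => l2norm (P.jump a (p k α)) G.surf ^ 2) (fun k => ?_)
        hsumA)).trans (ENNReal.ofReal_le_ofReal (by rw [hsA]; linarith))
    refine le_trans ?_ (dissPhase_le_diss α k)
    unfold dissPhase
    have h1 := sq_nonneg (l2norm (P.gradM (p k α).1) G.vol)
    have h2 := sq_nonneg (l2norm (wgradF D P Q (u k) (p k α).2) G.surf)
    have h3 := sq_nonneg (l2norm (P.jump .plus (p k α)) G.surf)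
    have h4 := sq_nonneg (l2norm (P.jump .minus (p k α)) G.surf)
    cases a <;> linarith
  · refine mul_essSup_idx_le τ (fun k => eLpNorm (fun x => D.U (.dam a)
      (P.recT a (pcM D P (p k)) x)) 1 G.surf) fun k _ hk => ?_
    rw [eLpNorm_one_eq_ofReal_integral (integrable_storeT D P a (p k))
      (Filter.Eventually.of_forall fun x => D.U_nonneg _ _),
      ← ENNReal.ofReal_mul (mul_nonneg (B.dDam_pos a).le (B.φDam_pos a).le)]
    refine ENNReal.ofReal_le_ofReal (((hst k hk).2.2.2.2 a).trans ((hstM k hk).trans ?_))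
    linarith
  · refine mul_essSup_idx_le τ (fun k => eLpNorm (fun x => D.U .mat
      (P.recM (pcM D P (p k)) x)) 1 G.vol) fun k _ hk => ?_
    rw [eLpNorm_one_eq_ofReal_integral
      (memLp_one_iff_integrable.1 (FlowGD.memLp_comp_recM (D.U .mat) (pcM D P (p k))))
      (Filter.Eventually.of_forall fun x => D.U_nonneg _ _), ← ENNReal.ofReal_mul hφ0]
    refine ENNReal.ofReal_le_ofReal ((hst k hk).2.1.trans ((hstM k hk).trans ?_))
    linarith
  · refine essSup_idx_le τ (fun k => eLpNorm (fun x => D.d₀ x * D.U .frac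
      (P.recF (pcF D P (p k)) x)) 1 G.surf) fun k _ hk => ?_
    rw [eLpNorm_one_eq_ofReal_integral (integrable_mul_of_memLp
      (D.memLp_d₀.mono_exponent le_top) (FlowGD.memLp_comp_recF (D.U .frac) (pcF D P (p k))))]
    · refine ENNReal.ofReal_le_ofReal ((hst k hk).2.2.1.trans ((hstM k hk).trans ?_))
      linarith
    · filter_upwards [ae_restrict_mem G.measurableSet_Γ] with x hx
      exact mul_nonneg (D.d₀_pos x hx).le (D.U_nonneg _ _)
  · refine mul_essSup_idx_le τ (fun k => eLpNorm (P.recM (pEM D P (p k))) 2 G.vol) fun k _ hk => ?_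
    rw [eLpNorm_two_eq_ofReal (FlowGD.memLp_recM _), ← ENNReal.ofReal_mul (Real.sqrt_nonneg _)]
    have h1 := (hst k hk).2.2.2.1.trans (hstM k hk)
    have h2 : √B.invM * l2norm (P.recM (pEM D P (p k))) G.vol ≤ √(2 * M) := by
      refine Real.le_sqrt_of_sq_le ?_
      rw [mul_pow, Real.sq_sqrt B.invM_nonneg]
      linarith
    exact ENNReal.ofReal_le_ofReal (h2.trans (by linarith))
  · refine essSup_idx_le τ (fun k => eLpNorm (strain (u k).1) 2 G.vol) fun k _ hk => ?_
    rw [eLpNorm_two_eq_ofReal (memLp_strain _)]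
    exact ENNReal.ofReal_le_ofReal ((hS k hk).trans (by linarith))
  · refine essSup_idx_le τ (fun k => eLpNorm (aperture D Q (u k).1) 4 G.surf) fun k _ hk => ?_
    have hm : MemLp D.d₀ 4 G.surf := D.memLp_d₀.mono_exponent le_top
    have h1 : eLpNorm (aperture D Q (u k).1) 4 G.surf ≤
        eLpNorm D.d₀ 4 G.surf + eLpNorm (Q.jumpNF (u k).1) 4 G.surf :=
      eLpNorm_sub_le hm.1 (Q.memLp_jumpNF _).1 (by norm_num)
    refine h1.trans ((add_le_add (ENNReal.ofReal_toReal hm.2.ne).symm.le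
      ((hc _ (Q.X_subset (u k).2)).2.2 Q).2).trans ?_)
    rw [← ENNReal.ofReal_add ENNReal.toReal_nonneg (mul_nonneg hc0 (l2norm_nonneg _ _))]
    refine ENNReal.ofReal_le_ofReal ?_
    have h2 := mul_le_mul_of_nonneg_left (hS k hk) hc0
    change d₄ + _ ≤ _
    linarith
  · refine (h.lintegral_negHalfNorm_sq_le hc0 hc hcE0 hcE hcLow hQ hcUp hP hS hsumA).trans ?_
    have h1 : √L ≤ C := by linarith
    calc ENNReal.ofReal L = ENNReal.ofReal (√L) ^ 2 := by
          rw [← ENNReal.ofReal_pow hL2, Real.sq_sqrt hL0]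
      _ ≤ _ := pow_le_pow_left' (ENNReal.ofReal_le_ofReal h1) 2
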